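/- **Definitions.** All graphs are finite and simple, and $|G|$ is the number of vertices of $G$. For a graph $G$ with a total ordering $\mathbb G$ of its vertices, $N^-(v)$ is the set of neighbours of $v$ that precede $v$, and $N^-[X]=X\cup\bigcup_{v\in X}N^-(v)$ for a vertex set $X$. The ordering is $d$-degenerate if $|N^-(v)|\le d$ for all $v$; $G$ is $d$-degenerate if it has a $d$-degenerate ordering. A *pattern* is a connected graph $H$ whose vertex set is partitioned into sets $S,T$ such that $T$ is independent, every vertex of $T$ has a neighbour in $S$, and $|S|<|T|$. It is *$(c,d)$-locatable* if in every $d$-degenerate ordering of $H$ there is a vertex set $C$ with $|C|\le c$ and $S\subseteq N^-[C]$. A *strong embedding* of $H$ into $G$ is an injective map $\phi\colon V(H)\to V(G)$ such that for all $u\in S$ and $v\in S\cup T$ we have $uv\in E(H)\iff\phi(u)\phi(v)\in E(G)$ (adjacencies between images of $T$-vertices are arbitrary). Let $\#(H\to G)$ be the number of strong embeddings of $H$ into $G$. **Machine model.** A random access machine whose integer registers, all initially $0$ except for the input, hold natural numbers and allow addition, truncated subtraction, indirect addressing and a test for zero, each at unit cost; arithmetic ($+,-,\times,/$, exact rational)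 on the quantities in which embeddings are counted also has unit cost, and these quantities influence neither tests nor addresses. The graphs $G$ and $H$ are given, through their numbers of vertices and adjacency lists in an arbitrary order, together with the indicator function of $S$. **Theorem.** There exist an algorithm (one program in this model) and absolute constants $K,A$ such that for all integers $c\ge 1$ and $d\ge 2$, every $d$-degenerate graph $G$ and every $(c,d)$-locatable pattern $H$ (with sides $S,T$), the algorithm on input $(G,H)$ halts, outputs $\#(H\to G)$, and takes at most $$K\left((cd)^{A(cd)^d}+(cd)^{2cd+d}\,|G|^c\right)$$ steps; that is, its running time is $O\big((cd)^{O((cd)^d)}+(cd)^{2cd+d}|G|^c\big)$. -/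

import Mathlib

/-! ## Ordered graphs, degeneracy, left covers -/

section Graphs

variable {V : Type*} [Fintype V]

/-- A total ordering of the finite set `V`, given by the bijection that sends every element to its
position. -/
abbrev VertexOrdering (V : Type*) [Fintype V] : Type _ := V ≃ Fin (Fintype.card V)

/-- The left neighbourhood `N⁻(v)`: the neighbours of `v` that precede `v`. -/
def leftNbhd (G : SimpleGraph V) (o : VertexOrdering V) (v : V) : Set V :=
  {u | G.Adj v u ∧ o u < o v}

/-- The closed left neighbourhood `N⁻[X]` of a vertex set `X`. -/
def closedLeftNbhd (G : SimpleGraph V) (o : VertexOrdering V) (X : Set V) : Set V :=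
  X ∪ ⋃ v ∈ X, leftNbhd G o v

/-- The ordering `o` of `G` is `d`-degenerate: every vertex has at most `d` left neighbours. -/
def IsDegenerateOrdering (G : SimpleGraph V) (o : VertexOrdering V) (d : ℕ) : Prop :=
  ∀ v, (leftNbhd G o v).ncard ≤ d

/-- `G` is `d`-degenerate. -/
def IsDegenerate (G : SimpleGraph V) (d : ℕ) : Prop :=
  ∃ o : VertexOrdering V, IsDegenerateOrdering G o d

/-- The left-cover number of `X` in the ordered graph `(G, o)`: the least size of a vertex set `C`
with `X ⊆ N⁻[C]`. (The set of sizes is not empty, as `C = X` is a left cover.) -/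
noncomputable def leftCoverNumber (G : SimpleGraph V) (o : VertexOrdering V) (X : Set V) : ℕ :=
  sInf {k | ∃ C : Finset V, C.card = k ∧ X ⊆ closedLeftNbhd G o (C : Set V)}

end Graphs

/-! ## Patterns and strong embeddings -/

/-- A pattern: a connected graph with a vertex partition into a small side `S` and a large side `T`,
where `T` is independent, every vertex of `T` has a neighbour in `S`, and `|S| < |T|`. -/
structure Pattern (V : Type*) [Fintype V] [DecidableEq V] where
  /-- the underlying graph -/
  graph : SimpleGraph V
  /-- the small side -/
  S : Finset V
  /-- the large side -/
  T : Finset V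
  disjoint : Disjoint S T
  cover : S ∪ T = Finset.univ
  connected : graph.Connected
  indep : ∀ u ∈ T, ∀ v ∈ T, ¬ graph.Adj u v
  dominated : ∀ v ∈ T, ∃ u ∈ S, graph.Adj u v
  card_lt : S.card < T.card

/-- The pattern is `(c, d)`-locatable: in every `d`-degenerate ordering of it, the side `S` has
left-cover number at most `c`. -/
def Pattern.Locatable {V : Type*} [Fintype V] [DecidableEq V] (H : Pattern V) (c d : ℕ) : Prop :=
  ∀ o : VertexOrdering V, IsDegenerateOrdering H.graph o d →
    leftCoverNumber H.graph o (H.S : Set V) ≤ c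

/-- An injection `φ` of `V(H) = S ∪ T` into `V(G)`, that is, a bijection onto the disjoint union of
`φ(S)` and `φ(T)`, is a strong embedding if it preserves adjacency and non-adjacency of all
pairs `u ∈ S`, `v ∈ S ∪ T`. -/
def Pattern.IsStrongEmbedding {V W : Type*} [Fintype V] [DecidableEq V] (H : Pattern V)
    (G : SimpleGraph W) (φ : V ↪ W) : Prop :=
  ∀ u ∈ H.S, ∀ v, H.graph.Adj u v ↔ G.Adj (φ u) (φ v)

/-- The number of strong embeddings of `H` into `G`. -/
noncomputable def Pattern.strongCount {V W : Type*} [Fintype V] [DecidableEq V] (H : Pattern V)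
    (G : SimpleGraph W) : ℕ :=
  Nat.card {φ : V ↪ W // H.IsStrongEmbedding G φ}

/-! ## The machine model

A random access machine with structured control flow. Its integer memory consists of finitely many
(those named in the program) zero-initialised arrays of natural numbers with indirect addressing; the
only operations on these registers are addition and truncated subtraction, and every operation,
memory access, test and assignment costs one step. In addition there are arrays of rational
*counters*, with the field operations at unit cost, in which numbers of embeddings are accumulated.
Nothing flows back from the counters: tests and addresses depend on the integer registers only. -/

/-- Memory of the machine: integer registers `word a i` and rational counters `ctr a i`, where `a` is
the name of an array and `i` the index in that array. -/
structure RamState where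
  /-- integer arrays -/
  word : ℕ → ℕ → ℕ
  /-- counter arrays -/
  ctr : ℕ → ℕ → ℚ

/-- Expressions over the integer registers. -/
inductive WordExpr where
  | const (k : ℕ)
  | get (a : ℕ) (i : WordExpr)
  | add (e f : WordExpr)
  | sub (e f : WordExpr)

/-- The value of an integer expression. -/
def WordExpr.eval (s : RamState) : WordExpr → ℕ
  | .const k => k
  | .get a i => s.word a (i.eval s)
  | .add e f => e.eval s + f.eval s
  | .sub e f => e.eval s - f.eval s

/-- The number of steps taken to evaluate an integer expression. -/
def WordExpr.cost : WordExpr → ℕ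
  | .const _ => 1
  | .get _ i => i.cost + 1
  | .add e f => e.cost + f.cost + 1
  | .sub e f => e.cost + f.cost + 1

/-- Expressions over the counters. -/
inductive CtrExpr where
  | ofWord (e : WordExpr)
  | get (a : ℕ) (i : WordExpr)
  | add (e f : CtrExpr)
  | sub (e f : CtrExpr)
  | mul (e f : CtrExpr)
  | div (e f : CtrExpr)

/-- The value of a counter expression. -/
def CtrExpr.eval (s : RamState) : CtrExpr → ℚ
  | .ofWord e => (e.eval s : ℚ)
  | .get a i => s.ctr a (i.eval s)
  | .add e f => e.eval s + f.eval s
  | .sub e f => e.eval s - f.eval s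
  | .mul e f => e.eval s * f.eval s
  | .div e f => e.eval s / f.eval s

/-- The number of steps taken to evaluate a counter expression. -/
def CtrExpr.cost : CtrExpr → ℕ
  | .ofWord e => e.cost + 1
  | .get _ i => i.cost + 1
  | .add e f => e.cost + f.cost + 1
  | .sub e f => e.cost + f.cost + 1
  | .mul e f => e.cost + f.cost + 1
  | .div e f => e.cost + f.cost + 1

/-- Programs. -/
inductive RamProgram where
  | skip
  /-- `word a i := e` -/
  | setWord (a : ℕ) (i e : WordExpr)
  /-- `ctr a i := e` -/
  | setCtr (a : ℕ) (i : WordExpr) (e : CtrExpr)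
  | seq (p q : RamProgram)
  /-- if `b ≠ 0` then `p` else `q` -/
  | cond (b : WordExpr) (p q : RamProgram)
  /-- while `b ≠ 0` do `p` -/
  | loop (b : WordExpr) (p : RamProgram)

/-- Write `x` into the integer register `word a i`. -/
def RamState.putWord (s : RamState) (a i x : ℕ) : RamState :=
  { s with word := Function.update s.word a (Function.update (s.word a) i x) }

/-- Write `x` into the counter `ctr a i`. -/
def RamState.putCtr (s : RamState) (a i : ℕ) (x : ℚ) : RamState :=
  { s with ctr := Function.update s.ctr a (Function.update (s.ctr a) i x) }

/-- `Exec p s t s'`: started in the memory state `s`, the program `p` halts after exactly `t` steps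
in the memory state `s'`. -/
inductive Exec : RamProgram → RamState → ℕ → RamState → Prop where
  | skip (s : RamState) : Exec .skip s 1 s
  | setWord (a : ℕ) (i e : WordExpr) (s : RamState) :
      Exec (.setWord a i e) s (i.cost + e.cost + 1) (s.putWord a (i.eval s) (e.eval s))
  | setCtr (a : ℕ) (i : WordExpr) (e : CtrExpr) (s : RamState) :
      Exec (.setCtr a i e) s (i.cost + e.cost + 1) (s.putCtr a (i.eval s) (e.eval s))
  | seq {p q : RamProgram} {s s' s'' : RamState} {t t' : ℕ} :
      Exec p s t s' → Exec q s' t' s'' → Exec (.seq p q) s (t + t') s''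
  | condTrue {b : WordExpr} {p q : RamProgram} {s s' : RamState} {t : ℕ} :
      b.eval s ≠ 0 → Exec p s t s' → Exec (.cond b p q) s (b.cost + 1 + t) s'
  | condFalse {b : WordExpr} {p q : RamProgram} {s s' : RamState} {t : ℕ} :
      b.eval s = 0 → Exec q s t s' → Exec (.cond b p q) s (b.cost + 1 + t) s'
  | loopTrue {b : WordExpr} {p : RamProgram} {s s' s'' : RamState} {t t' : ℕ} :
      b.eval s ≠ 0 → Exec p s t s' → Exec (.loop b p) s' t' s'' →
        Exec (.loop b p) s (b.cost + 1 + t + t') s''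
  | loopFalse {b : WordExpr} {p : RamProgram} {s : RamState} :
      b.eval s = 0 → Exec (.loop b p) s (b.cost + 1) s

/-! ## Encoding of the input -/

/-- An adjacency-list representation of a graph with vertex set `{0, …, n - 1}`; the neighbours of a
vertex are listed in an arbitrary order. -/
structure AdjLists {n : ℕ} (G : SimpleGraph (Fin n)) where
  /-- the list of neighbours of each vertex -/
  nbrs : Fin n → List (Fin n)
  nodup : ∀ v, (nbrs v).Nodup
  mem_nbrs : ∀ u v, v ∈ nbrs u ↔ G.Adj u v

/-- The array in which the lists of all vertices are stored one after the other. -/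
def AdjLists.entries {n : ℕ} {G : SimpleGraph (Fin n)} (A : AdjLists G) : List ℕ :=
  (List.ofFn A.nbrs).flatten.map Fin.val

/-- The array of length `n + 1` whose `v`-th cell holds the position at which the list of the vertex
`v` starts; the last cell holds the total length of all lists. -/
def AdjLists.offsets {n : ℕ} {G : SimpleGraph (Fin n)} (A : AdjLists G) : List ℕ :=
  (List.range (n + 1)).map fun v => ((List.ofFn A.nbrs).take v).flatten.length

/-- A zero-initialised array whose first cells are filled with a list. -/
def loadArray (l : List ℕ) : ℕ → ℕ := fun i => l.getD i 0

/-- The initial memory on the host graph `G` and the pattern `H`: array 0 holds `|G|` and `|H|`,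
arrays 1 and 2 hold the adjacency lists of `G`, arrays 3 and 4 those of `H`, and array 5 holds the
indicator function of the side `S` of `H`. All other registers and all counters are 0. -/
def inputState {n m : ℕ} {G : SimpleGraph (Fin n)} (A : AdjLists G) (H : Pattern (Fin m))
    (B : AdjLists H.graph) : RamState where
  word
    | 0 => loadArray [n, m]
    | 1 => loadArray A.offsets
    | 2 => loadArray A.entries
    | 3 => loadArray B.offsets
    | 4 => loadArray B.entries
    | 5 => loadArray (List.ofFn fun v => if v ∈ H.S then 1 else 0)
    | _ => fun _ => 0
  ctr := fun _ _ => 0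

/-! ## A cost-aware program logic -/

namespace RamState

/-! Why few maps of S matter. Fix a `k`-degenerate ordering of G. Since T is independent, a strong
embedding sends edges of H to edges of G, so the ordering of G pulled back along it is a
`k`-degenerate ordering of H. Locatability covers S there by at most `c` closed left neighbourhoods,
and the images of their centres cover the image of S in G (`RankDegenerate.exists_cover`). Each
closed left neighbourhood has at most `k + 1` vertices. Hence `s = |S| ≤ c * (k + 1)`
(`Pattern.Locatable.card_le`), and the restrictions of strong embeddings to S lie among the maps
obtained from `n ^ c` tuples of centres and at most `(c * (k + 1)) ^ s` choices of candidates for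
each tuple.

Why the extensions of a map `ψ` of S are counted without looking at all of G. An extension sends T
injectively to vertices outside the image, each with a prescribed neighbourhood in the image, and
nothing else is required. The number of extensions is therefore a product of falling factorials over
the subsets `X` of S (`Pattern.Induced.card_eq`, `Pattern.strongCount_eq_sum`). A dictionary, filled
once, stores for every partial map of S into a left neighbourhood the number of vertices whose left
neighbourhood contains the image. Looking up all restrictions of `ψ` gives counts of supersets, and
Möbius inversion (`SieveRel.card_succ`) turns them into counts of exact left neighbourhoods in the
image. Exact left neighbourhoods differ from full neighbourhoods only for vertices of the image and
their left neighbours, at most `s * (k + 1)` vertices, which are corrected one at a time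
(`partialCount_eq_freeCount`).

How the algorithm does without `c` and `d`. Repeated deletion of vertices of small degree finds the
degeneracy `k ≤ d` of G. If H is not `k`-degenerate there is no strong embedding; otherwise `s` is
bounded as above. A number `c' ≤ c` that bounds the cover numbers in all `k`-degenerate orderings of
H is found by exhaustion. A vertex of T with all its neighbours on its left may be moved to the end
of the ordering. What remains are at most `(k + 1) * s` essential vertices, and vertices of T with
equal neighbourhoods are interchangeable. So words of length `(k + 1) * s` over `s + 2 ^ s` tokens
describe all orderings that matter, whatever the size of T. Two translations are needed: valid words
come from degenerate orderings (`TokenData.Valid.coverable`), so that `c' ≤ c`, and degenerate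
orderings give valid words (`IsDegenerateOrdering.exists_valid`), so that `c'` suffices for the
enumeration.

The programs are verified with the total-correctness triples `Runs`, which carry a bound on the
steps, together with a syntactic frame condition `SameOutside`. The resulting polynomials and
exponentials are compared with the claimed bound in `coverCost_le`, `patternCost_le`,
`candidates_le` and `two_pow_le`. -/

@[simp] theorem putWord_word_self (s : RamState) (a i x : ℕ) :
    (s.putWord a i x).word a = Function.update (s.word a) i x := by
  simp [putWord]

@[simp] theorem putWord_word_of_ne (s : RamState) {a b : ℕ} (i x : ℕ) (h : b ≠ a) :
    (s.putWord a i x).word b = s.word b := by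
  simp [putWord, h]

@[simp] theorem putWord_ctr (s : RamState) (a i x : ℕ) : (s.putWord a i x).ctr = s.ctr := rfl

@[simp] theorem putCtr_word (s : RamState) (a i : ℕ) (x : ℚ) :
    (s.putCtr a i x).word = s.word := rfl

@[simp] theorem putCtr_ctr_self (s : RamState) (a i : ℕ) (x : ℚ) :
    (s.putCtr a i x).ctr a = Function.update (s.ctr a) i x := by
  simp [putCtr]

@[simp] theorem putCtr_ctr_of_ne (s : RamState) {a b : ℕ} (i : ℕ) (x : ℚ) (h : b ≠ a) :
    (s.putCtr a i x).ctr b = s.ctr b := by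
  simp [putCtr, h]

end RamState

attribute [simp] WordExpr.eval CtrExpr.eval WordExpr.cost CtrExpr.cost

/-- The value of a scalar variable, stored in the first cell of an array. -/
abbrev wv (a : ℕ) : WordExpr := .get a (.const 0)

/-- Assignment to a scalar variable. -/
abbrev setV (a : ℕ) (e : WordExpr) : RamProgram := .setWord a (.const 0) e

instance : Add WordExpr := ⟨.add⟩
instance : Sub WordExpr := ⟨.sub⟩
instance (n : ℕ) : OfNat WordExpr n := ⟨.const n⟩

@[simp] theorem WordExpr.eval_hAdd (s : RamState) (e f : WordExpr) :
    (e + f).eval s = e.eval s + f.eval s := rfl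

@[simp] theorem WordExpr.eval_hSub (s : RamState) (e f : WordExpr) :
    (e - f).eval s = e.eval s - f.eval s := rfl

@[simp] theorem WordExpr.eval_ofNat (s : RamState) (n : ℕ) :
    (OfNat.ofNat n : WordExpr).eval s = n := rfl

@[simp] theorem WordExpr.cost_hAdd (e f : WordExpr) : (e + f).cost = e.cost + f.cost + 1 := rfl

@[simp] theorem WordExpr.cost_hSub (e f : WordExpr) : (e - f).cost = e.cost + f.cost + 1 := rfl

@[simp] theorem WordExpr.cost_ofNat (n : ℕ) : (OfNat.ofNat n : WordExpr).cost = 1 := rfl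

infixr:60 " ;; " => RamProgram.seq

namespace RamProgram

/-- The program has no loops. -/
def straight : RamProgram → Bool
  | skip => true
  | setWord _ _ _ => true
  | setCtr _ _ _ => true
  | seq p q => p.straight && q.straight
  | cond _ p q => p.straight && q.straight
  | loop _ _ => false

/-- The effect of a program without loops. -/
@[simp] def run : RamProgram → RamState → RamState
  | skip, s => s
  | setWord a i e, s => s.putWord a (i.eval s) (e.eval s)
  | setCtr a i e, s => s.putCtr a (i.eval s) (e.eval s)
  | seq p q, s => q.run (p.run s)
  | cond b p q, s => if b.eval s ≠ 0 then p.run s else q.run s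
  | loop _ _, s => s

/-- The largest cost of a program without loops. -/
@[simp] def maxCost : RamProgram → ℕ
  | skip => 1
  | setWord _ i e => i.cost + e.cost + 1
  | setCtr _ i e => i.cost + e.cost + 1
  | seq p q => p.maxCost + q.maxCost
  | cond b p q => b.cost + 1 + max p.maxCost q.maxCost
  | loop _ _ => 0

/-- Does the program contain an assignment to the integer array `a`? -/
@[simp] def writesWord (a : ℕ) : RamProgram → Bool
  | skip => false
  | setWord b _ _ => a == b
  | setCtr _ _ _ => false
  | seq p q => p.writesWord a || q.writesWord a
  | cond _ p q => p.writesWord a || q.writesWord a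
  | loop _ p => p.writesWord a

/-- Does the program contain an assignment to the counter array `a`? -/
@[simp] def writesCtr (a : ℕ) : RamProgram → Bool
  | skip => false
  | setWord _ _ _ => false
  | setCtr b _ _ => a == b
  | seq p q => p.writesCtr a || q.writesCtr a
  | cond _ p q => p.writesCtr a || q.writesCtr a
  | loop _ p => p.writesCtr a

end RamProgram

/-- The states `s` and `s'` agree on all arrays that `P` does not write. -/
structure SameOutside (P : RamProgram) (s s' : RamState) : Prop where
  word : ∀ a, P.writesWord a = false → s'.word a = s.word a
  ctr : ∀ a, P.writesCtr a = false → s'.ctr a = s.ctr a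

theorem SameOutside.refl (P : RamProgram) (s : RamState) : SameOutside P s s :=
  ⟨fun _ _ => rfl, fun _ _ => rfl⟩

theorem SameOutside.trans {P : RamProgram} {s s' s'' : RamState} (h : SameOutside P s s')
    (h' : SameOutside P s' s'') : SameOutside P s s'' :=
  ⟨fun a ha => (h'.word a ha).trans (h.word a ha), fun a ha => (h'.ctr a ha).trans (h.ctr a ha)⟩

theorem SameOutside.mono {P Q : RamProgram} {s s' : RamState} (h : SameOutside P s s')
    (hw : ∀ a, Q.writesWord a = false → P.writesWord a = false)
    (hc : ∀ a, Q.writesCtr a = false → P.writesCtr a = false) : SameOutside Q s s' :=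
  ⟨fun a ha => h.word a (hw a ha), fun a ha => h.ctr a (hc a ha)⟩

/-- This is the frame rule. Array names are literals, so the condition "not written" is decided by
evaluation, and later proofs discharge it with `rfl`. -/
theorem Exec.sameOutside {P : RamProgram} {s s' : RamState} {t : ℕ} (h : Exec P s t s') :
    SameOutside P s s' := by
  induction h with
  | skip s => exact .refl _ _
  | setWord a i e s =>
    refine ⟨fun b hb => ?_, fun b _ => rfl⟩
    simp only [RamProgram.writesWord, beq_eq_false_iff_ne] at hb
    simp [hb]
  | setCtr a i e s =>
    refine ⟨fun b _ => rfl, fun b hb => ?_⟩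
    simp only [RamProgram.writesCtr, beq_eq_false_iff_ne] at hb
    simp [hb]
  | seq _ _ ih1 ih2 =>
    refine (ih1.mono ?_ ?_).trans (ih2.mono ?_ ?_) <;>
      simp +contextual [RamProgram.writesWord, RamProgram.writesCtr]
  | condTrue _ _ ih =>
    refine ih.mono ?_ ?_ <;> simp +contextual [RamProgram.writesWord, RamProgram.writesCtr]
  | condFalse _ _ ih =>
    refine ih.mono ?_ ?_ <;> simp +contextual [RamProgram.writesWord, RamProgram.writesCtr]
  | loopTrue _ _ _ ih1 ih2 =>
    refine (ih1.mono ?_ ?_).trans ih2 <;>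
      simp +contextual [RamProgram.writesWord, RamProgram.writesCtr]
  | loopFalse _ => exact .refl _ _

/-- Started in `s`, the program `P` halts after at most `B` steps in a state that satisfies `Q`. -/
def Runs (P : RamProgram) (s : RamState) (B : ℕ) (Q : RamState → Prop) : Prop :=
  ∃ t s', Exec P s t s' ∧ t ≤ B ∧ Q s'

namespace Runs

variable {P p q : RamProgram} {s : RamState} {B B₁ B₂ : ℕ} {Q R : RamState → Prop}

/-- The weakened postcondition may use the frame information, so `R` need not mention anything about
arrays that `P` does not write. -/
theorem mono (h : Runs P s B₁ R) (hB : B₁ ≤ B)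
    (hQ : ∀ s', SameOutside P s s' → R s' → Q s') : Runs P s B Q := by
  obtain ⟨t, s', he, ht, hr⟩ := h
  exact ⟨t, s', he, ht.trans hB, hQ s' he.sameOutside hr⟩

theorem le (h : Runs P s B₁ Q) (hB : B₁ ≤ B) : Runs P s B Q :=
  h.mono hB fun _ _ h => h

theorem straight (h : P.straight = true) (hB : P.maxCost ≤ B) (hQ : Q (P.run s)) :
    Runs P s B Q := by
  suffices H : ∀ s, ∃ t, Exec P s t (P.run s) ∧ t ≤ P.maxCost by
    obtain ⟨t, he, ht⟩ := H s
    exact ⟨t, _, he, ht.trans hB, hQ⟩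
  clear hQ hB
  induction P with
  | skip => exact fun s => ⟨_, .skip s, le_rfl⟩
  | setWord a i e => exact fun s => ⟨_, .setWord a i e s, le_rfl⟩
  | setCtr a i e => exact fun s => ⟨_, .setCtr a i e s, le_rfl⟩
  | seq p q ihp ihq =>
    intro s
    simp only [RamProgram.straight, Bool.and_eq_true] at h
    obtain ⟨t, he, ht⟩ := ihp h.1 s
    obtain ⟨t', he', ht'⟩ := ihq h.2 (p.run s)
    exact ⟨_, he.seq he', add_le_add ht ht'⟩
  | cond b p q ihp ihq =>
    intro s
    simp only [RamProgram.straight, Bool.and_eq_true] at h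
    by_cases hb : b.eval s = 0
    · obtain ⟨t, he, ht⟩ := ihq h.2 s
      refine ⟨_, .condFalse hb (by simpa [hb] using he), ?_⟩
      simp only [RamProgram.maxCost]; omega
    · obtain ⟨t, he, ht⟩ := ihp h.1 s
      refine ⟨_, .condTrue hb (by simpa [hb] using he), ?_⟩
      simp only [RamProgram.maxCost]; omega
  | loop b p => simp [RamProgram.straight] at h

theorem seq (h₁ : Runs p s B₁ R) (h₂ : ∀ s', SameOutside p s s' → R s' → Runs q s' B₂ Q)
    (hB : B₁ + B₂ ≤ B := by exact Nat.le_refl _) : Runs (p ;; q) s B Q := by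
  obtain ⟨t, s', he, ht, hr⟩ := h₁
  obtain ⟨t', s'', he', ht', hq⟩ := h₂ s' he.sameOutside hr
  exact ⟨_, s'', he.seq he', by omega, hq⟩

/-- Executes a program without loops first. -/
theorem straight_seq (h : p.straight = true) (h₂ : Runs q (p.run s) B₂ Q)
    (hB : p.maxCost + B₂ ≤ B := by exact Nat.le_refl _) : Runs (p ;; q) s B Q :=
  seq (R := fun s' => s' = p.run s) (straight h le_rfl rfl) (fun _ _ hs => hs ▸ h₂) hB

theorem cond {b : WordExpr} (h₁ : b.eval s ≠ 0 → Runs p s B₁ Q)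
    (h₂ : b.eval s = 0 → Runs q s B₁ Q) (hB : b.cost + 1 + B₁ ≤ B := by exact Nat.le_refl _) :
    Runs (.cond b p q) s B Q := by
  by_cases hb : b.eval s = 0
  · obtain ⟨t, s', he, ht, hr⟩ := h₂ hb
    exact ⟨_, s', .condFalse hb he, by omega, hr⟩
  · obtain ⟨t, s', he, ht, hr⟩ := h₁ hb
    exact ⟨_, s', .condTrue hb he, by omega, hr⟩

/-- A loop whose number of rounds is bounded by `M`; the argument `r` of the invariant is the number
of steps that are still available. -/
theorem loop_aux {b : WordExpr} (M : ℕ) (I : ℕ → ℕ → RamState → Prop)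
    (hb : ∀ j r s, I j r s → b.eval s ≠ 0 → j < M ∧
      ∃ B r', B + r' ≤ r ∧ Runs p s B (I (j + 1) r'))
    {j r : ℕ} (h : I j r s) (hj : j ≤ M) :
    Runs (.loop b p) s (r + (M - j) * (b.cost + 1) + b.cost + 1)
      (fun s' => (∃ j r, j ≤ M ∧ I j r s') ∧ b.eval s' = 0) := by
  induction hm : M - j generalizing j r s with
  | zero =>
    have hb0 : b.eval s = 0 := by
      by_contra hne
      have := (hb j r s h hne).1
      omega
    exact ⟨_, s, .loopFalse hb0, by omega, ⟨j, r, hj, h⟩, hb0⟩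
  | succ k ih =>
    by_cases hb0 : b.eval s = 0
    · exact ⟨_, s, .loopFalse hb0, by omega, ⟨j, r, hj, h⟩, hb0⟩
    · obtain ⟨hjM, B, r', hB, t, s', he, ht, hI⟩ := hb j r s h hb0
      obtain ⟨t', s'', he', ht', hQ⟩ := ih hI hjM (by omega)
      refine ⟨_, s'', .loopTrue hb0 he he', ?_, hQ⟩
      have : (k + 1) * (b.cost + 1) = k * (b.cost + 1) + (b.cost + 1) := by ring
      omega

end Runs

/-- `for v < N do p`. -/
def forUpto (v : ℕ) (N : WordExpr) (p : RamProgram) : RamProgram :=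
  setV v 0 ;; .loop (N - wv v) (p ;; setV v (wv v + 1))

namespace Runs

variable {p : RamProgram} {s : RamState} {v : ℕ} {N : WordExpr}

/-- The rule for bounded loops, with a potential `r` for the number of available steps. -/
theorem forUpto_potential (M : ℕ) (r₀ : ℕ) (I : ℕ → ℕ → RamState → Prop)
    (hv : p.writesWord v = false)
    (hN : ∀ s', SameOutside (forUpto v N p) s s' → N.eval s' = M)
    (hI : ∀ j r x s, I j r s → I j r (s.putWord v 0 x))
    (h0 : I 0 r₀ s)
    (hb : ∀ j r s', j < M → SameOutside (forUpto v N p) s s' → s'.word v 0 = j → I j r s' →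
      ∃ B r', B + r' ≤ r ∧ Runs p s' B (I (j + 1) r')) :
    Runs (forUpto v N p) s (r₀ + M * (N.cost + 10) + N.cost + 7)
      (fun s' => ∃ r, I M r s') := by
  have hfr : SameOutside (forUpto v N p) s (s.putWord v 0 0) := by
    refine ⟨fun a ha => ?_, fun _ _ => rfl⟩
    have : a ≠ v := by
      simp [forUpto, RamProgram.writesWord] at ha
      exact ha.1
    simp [this]
  -- The assignment `setV v (wv v + 1)` costs 6 steps and one test of the loop `N.cost + 4`. The
  -- increments are paid by adding 6 units per remaining round to the potential.
  refine straight_seq rfl (B₂ := (r₀ + M * 6) + M * (N.cost + 4) + N.cost + 4)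
    (mono (loop_aux M (fun j r s' => SameOutside (forUpto v N p) s s' ∧ s'.word v 0 = j ∧ j ≤ M ∧
      ∃ r', r = r' + (M - j) * 6 ∧ I j r' s') ?_
      (j := 0) (r := r₀ + M * 6) ⟨hfr, by simp, by omega, r₀, by simp, hI _ _ _ _ h0⟩ (by omega))
      ?_ ?_) ?_
  · rintro j r s' ⟨hs, hj, hjM, r', rfl, hi⟩ hne
    have hlt : j < M := by
      simp [hN s' hs, hj] at hne
      omega
    refine ⟨hlt, ?_⟩
    obtain ⟨B, r'', hB, hr⟩ := hb j r' s' hlt hs hj hi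
    refine ⟨B + 6, r'' + (M - (j + 1)) * 6, ?_, ?_⟩
    · have : (M - j) = (M - (j + 1)) + 1 := by omega
      rw [this]; ring_nf; ring_nf at hB; omega
    · refine seq hr (fun s2 h2 hI2 => ?_) (B₂ := 6) le_rfl
      have hs2v : s2.word v 0 = j := by rw [h2.word v hv, hj]
      refine straight rfl (by rfl) ?_
      have hs2 : SameOutside (forUpto v N p) s s2 := by
        refine hs.trans (h2.mono ?_ ?_) <;>
          simp +contextual [forUpto, RamProgram.writesWord, RamProgram.writesCtr]
      refine ⟨hs2.trans ⟨fun a ha => ?_, fun _ _ => rfl⟩, by simp [hs2v], hlt, r'', rfl,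
        hI _ _ _ _ hI2⟩
      have : a ≠ v := by
        simp [forUpto, RamProgram.writesWord] at ha
        exact ha.1
      simp [this]
  · have : (N - wv v).cost + 1 = N.cost + 4 := by
      change N.cost + 2 + 1 + 1 = _
      ring
    rw [this]
    change _ + N.cost + 2 + 1 + 1 ≤ _
    simp only [Nat.sub_zero]
    omega
  · rintro s' _ ⟨⟨j, r, hj, hs, hjv, -, r', -, hi⟩, h0⟩
    have : j = M := by
      simp [hN s' hs, hjv] at h0
      omega
    exact ⟨r', this ▸ hi⟩
  · change 3 + _ ≤ _
    have : M * (N.cost + 10) = M * 6 + M * (N.cost + 4) := by ring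
    omega

/-- The rule for bounded loops. -/
theorem forUpto (M B : ℕ) (I : ℕ → RamState → Prop)
    (hv : p.writesWord v = false)
    (hN : ∀ s', SameOutside (forUpto v N p) s s' → N.eval s' = M)
    (hI : ∀ j x s, I j s → I j (s.putWord v 0 x))
    (h0 : I 0 s)
    (hb : ∀ j s', j < M → SameOutside (_root_.forUpto v N p) s s' → s'.word v 0 = j → I j s' →
      Runs p s' B (I (j + 1))) :
    Runs (_root_.forUpto v N p) s (M * (B + N.cost + 10) + N.cost + 7) (I M) := by
  refine mono (forUpto_potential M (M * B) (fun j r s' => r = (M - j) * B ∧ I j s') hv hN ?_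
    ⟨by simp, h0⟩ ?_) ?_ ?_
  · exact fun j r x s h => ⟨h.1, hI _ _ _ h.2⟩
  · rintro j r s' hj hs hv ⟨rfl, hi⟩
    refine ⟨B, (M - (j + 1)) * B, ?_, (hb j s' hj hs hv hi).mono le_rfl fun s _ h => ⟨rfl, h⟩⟩
    have : M - j = (M - (j + 1)) + 1 := by omega
    rw [this]; ring_nf; omega
  · have : M * (B + N.cost + 10) = M * B + M * (N.cost + 10) := by ring
    omega
  · rintro s' _ ⟨r, _, h⟩
    exact h

end Runs

/-! ## Enumeration of all digit sequences -/

/-- Runs `p` for all sequences of `k` digits `0, …, N - 1`, which are stored in the array `D`. -/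
def forTuples (D j c : ℕ) (N k : WordExpr) (p : RamProgram) : RamProgram :=
  forUpto j k (.setWord D (wv j) 0) ;;
  setV c 0 ;;
  .loop (1 - wv c) (p ;;
    setV c 1 ;;
    forUpto j k (.cond (wv c)
      (.cond (N - (.get D (wv j) + 1))
        (.setWord D (wv j) (.get D (wv j) + 1) ;; setV c 0)
        (.setWord D (wv j) 0))
      .skip))

theorem digit_succ_of_dvd {b x i : ℕ} (h : b ^ i ∣ x + 1) :
    (x + 1) / b ^ i = x / b ^ i + 1 := by
  rw [Nat.succ_div, if_pos h]

theorem digit_succ_of_not_dvd {b x i : ℕ} (h : ¬ b ^ i ∣ x + 1) :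
    (x + 1) / b ^ i = x / b ^ i := by
  rw [Nat.succ_div, if_neg h, Nat.add_zero]

theorem pow_succ_dvd_iff_of_dvd {b x i : ℕ} (h : b ^ i ∣ x) :
    b ^ (i + 1) ∣ x ↔ b ∣ x / b ^ i := by
  rw [Nat.dvd_div_iff_mul_dvd h, pow_succ]

theorem succ_mod_of_lt {p b : ℕ} (h : p % b + 1 < b) : (p + 1) % b = p % b + 1 := by
  conv_lhs => rw [Nat.add_mod]
  rw [Nat.mod_eq_of_lt (a := 1) (by omega), Nat.mod_eq_of_lt h]

theorem succ_mod_of_eq {p b : ℕ} (h : p % b + 1 = b) : (p + 1) % b = 0 := by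
  rw [← Nat.dvd_iff_mod_eq_zero]
  refine ⟨p / b + 1, ?_⟩
  have := Nat.div_add_mod p b
  rw [mul_add]; omega

namespace Runs

variable {D j c : ℕ} {N k : WordExpr} {p : RamProgram} {s : RamState}

/-- The register `c` is the carry. It reaches digit `i` exactly if all lower digits overflow, that
is, if `b ^ i` divides `x + 1`. A carry that survives all `l` digits signals that the last sequence
has been treated; it doubles as the exit flag of the enumeration. -/
theorem increment (hDj : D ≠ j) (hDc : D ≠ c) (hjc : j ≠ c) (b l x : ℕ) (hb : 0 < b)
    (s₀ : RamState)
    (hN : ∀ s', (∀ a, a ≠ D → a ≠ j → a ≠ c → s'.word a = s₀.word a) → s'.ctr = s₀.ctr → N.eval s' = b)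
    (hk : ∀ s', (∀ a, a ≠ D → a ≠ j → a ≠ c → s'.word a = s₀.word a) → s'.ctr = s₀.ctr → k.eval s' = l)
    (hs : ∀ a, a ≠ D → a ≠ j → a ≠ c → s.word a = s₀.word a) (hsc : s.ctr = s₀.ctr)
    (hx : ∀ i < l, s.word D i = x / b ^ i % b) (hc : s.word c 0 = 1) :
    Runs (_root_.forUpto j k (.cond (wv c)
      (.cond (N - (.get D (wv j) + 1))
        (.setWord D (wv j) (.get D (wv j) + 1) ;; setV c 0)
        (.setWord D (wv j) 0))
      .skip)) s (l * (N.cost + k.cost + 40) + k.cost + 7)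
      (fun s' => s'.word c 0 = (if b ^ l ∣ x + 1 then 1 else 0) ∧
        ∀ i < l, s'.word D i = (x + 1) / b ^ i % b) := by
  have hout : ∀ s', SameOutside (_root_.forUpto j k (.cond (wv c)
      (.cond (N - (.get D (wv j) + 1))
        (.setWord D (wv j) (.get D (wv j) + 1) ;; setV c 0)
        (.setWord D (wv j) 0))
      .skip)) s s' → (∀ a, a ≠ D → a ≠ j → a ≠ c → s'.word a = s₀.word a) ∧
        s'.ctr = s₀.ctr := by
    refine fun s' h => ⟨fun a h1 h2 h3 => ?_, ?_⟩
    swap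
    · rw [← hsc]
      funext a
      exact h.ctr a rfl
    rw [h.word a ?_, hs a h1 h2 h3]
    simp [_root_.forUpto, RamProgram.writesWord, h1, h2, h3]
  refine mono (forUpto l (N.cost + 21) (fun i s' => s'.word c 0 = (if b ^ i ∣ x + 1 then 1 else 0) ∧
    ∀ i' < l, s'.word D i' = if i' < i then (x + 1) / b ^ i' % b else x / b ^ i' % b)
    ?_ ?_ ?_ ?_ ?_) ?_ ?_
  · simp [RamProgram.writesWord, hjc, hDj.symm]
  · exact fun s' h => hk s' (hout s' h).1 (hout s' h).2
  · rintro i y s' ⟨h1, h2⟩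
    refine ⟨by simpa [hjc.symm] using h1, fun i' hi' => by simpa [hDj] using h2 i' hi'⟩
  · simpa [hc] using hx
  · rintro i s' hi hs' hji ⟨h1, h2⟩
    refine straight rfl ?_ ?_
    · change 2 + 1 + max (N.cost + (2 + 1 + 1 + 1) + 1 + 1 + max (2 + (2 + 1 + 1 + 1) + 1 + (1 + 1 + 1))
        (2 + 1 + 1)) 1 ≤ _
      omega
    have hDi := h2 i hi
    rw [if_neg (lt_irrefl i)] at hDi
    have hlt : x / b ^ i % b < b := Nat.mod_lt _ hb
    have hNs : N.eval s' = b := hN s' (hout s' hs').1 (hout s' hs').2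
    by_cases hd : b ^ i ∣ x + 1
    · rw [if_pos hd] at h1
      have h3 := digit_succ_of_dvd hd
      by_cases hlt2 : x / b ^ i % b + 1 < b
      · have hne : b - (x / b ^ i % b + 1) ≠ 0 := by omega
        have hnd : ¬ b ^ (i + 1) ∣ x + 1 := by
          rw [pow_succ_dvd_iff_of_dvd hd, h3, Nat.dvd_iff_mod_eq_zero, succ_mod_of_lt hlt2]
          omega
        simp [h1, hji, hDi, hNs, hne, hDc, hnd]
        intro i' hi'
        rw [Function.update_apply]
        by_cases he : i' = i
        · subst he; simp [h3, succ_mod_of_lt hlt2]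
        · have : i' ≤ i ↔ i' < i := by omega
          simp [he, h2 i' hi', this]
      · have he : b - (x / b ^ i % b + 1) = 0 := by omega
        have he' : x / b ^ i % b + 1 = b := by omega
        have hdd : b ^ (i + 1) ∣ x + 1 := by
          rw [pow_succ_dvd_iff_of_dvd hd, h3, Nat.dvd_iff_mod_eq_zero, succ_mod_of_eq he']
        simp [h1, hji, hDi, hNs, he, hDc.symm, hdd]
        intro i' hi'
        rw [Function.update_apply]
        by_cases he : i' = i
        · subst he; simp [h3, succ_mod_of_eq he']
        · have : i' ≤ i ↔ i' < i := by omega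
          simp [he, h2 i' hi', this]
    · rw [if_neg hd] at h1
      have hnd : ¬ b ^ (i + 1) ∣ x + 1 := fun h => hd (dvd_trans (pow_dvd_pow b (by omega)) h)
      simp [h1, hnd]
      intro i' hi'
      rw [h2 i' hi']
      by_cases he : i' = i
      · subst he; simp [digit_succ_of_not_dvd hd]
      · have : i' ≤ i ↔ i' < i := by omega
        simp [this]
  · have : l * (N.cost + 21 + k.cost + 10) ≤ l * (N.cost + k.cost + 40) :=
      Nat.mul_le_mul le_rfl (by omega)
    omega
  · rintro s' _ ⟨h1, h2⟩
    exact ⟨h1, fun i hi => by simpa [hi] using h2 i hi⟩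

/-- The rule for the enumeration of all digit sequences. -/
theorem forTuples (b l B : ℕ) (I : ℕ → RamState → Prop)
    (hDj : D ≠ j) (hDc : D ≠ c) (hjc : j ≠ c) (hb : 0 < b) (hD : p.writesWord D = false)
    (hN : ∀ s', SameOutside (forTuples D j c N k p) s s' → N.eval s' = b)
    (hk : ∀ s', SameOutside (_root_.forTuples D j c N k p) s s' → k.eval s' = l)
    (hI : ∀ x s s', (∀ a, a ≠ D → a ≠ j → a ≠ c → s'.word a = s.word a) → s'.ctr = s.ctr →
      I x s → I x s')
    (h0 : I 0 s)
    (hp : ∀ x s', x < b ^ l → SameOutside (_root_.forTuples D j c N k p) s s' →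
      (∀ i < l, s'.word D i = x / b ^ i % b) → I x s' → Runs p s' B (I (x + 1))) :
    Runs (_root_.forTuples D j c N k p) s
      (b ^ l * (B + l * (N.cost + k.cost + 40) + k.cost + 15) + l * (k.cost + 15) + k.cost + 15)
      (I (b ^ l)) := by
  have hw : ∀ a, (_root_.forTuples D j c N k p).writesWord a = false ↔
      a ≠ D ∧ a ≠ j ∧ a ≠ c ∧ p.writesWord a = false := by
    intro a
    simp [_root_.forTuples, _root_.forUpto, RamProgram.writesWord]
    tauto
  have hcw : ∀ a, (_root_.forTuples D j c N k p).writesCtr a = false ↔ p.writesCtr a = false := by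
    intro a
    simp [_root_.forTuples, _root_.forUpto, RamProgram.writesCtr]
  have hpos : 0 < b ^ l := Nat.pow_pos hb
  have houter : ∀ s₁ s', SameOutside (_root_.forTuples D j c N k p) s s₁ →
      (∀ a, a ≠ D → a ≠ j → a ≠ c → s'.word a = s₁.word a) → s'.ctr = s₁.ctr →
      SameOutside (_root_.forTuples D j c N k p) s s' := by
    intro s₁ s' h1 h2 h3
    refine h1.trans ⟨fun a ha => ?_, fun a ha => by rw [h3]⟩
    rw [hw] at ha
    exact h2 a ha.1 ha.2.1 ha.2.2.1
  have hloop : ∀ s', SameOutside (_root_.forTuples D j c N k p) s s' → s'.word c 0 = 0 →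
      (∀ i < l, s'.word D i = 0) → I 0 s' →
      Runs (.loop (1 - wv c) (p ;; setV c 1 ;; _root_.forUpto j k (.cond (wv c)
        (.cond (N - (.get D (wv j) + 1))
          (.setWord D (wv j) (.get D (wv j) + 1) ;; setV c 0)
          (.setWord D (wv j) 0))
        .skip))) s' (b ^ l * (B + l * (N.cost + k.cost + 40) + k.cost + 10) + (b ^ l - 0) * 5 + 4 + 1)
        (I (b ^ l)) := by
    intro s₁ hs₁ hc hd hI0
    refine mono (loop_aux (b ^ l) (fun x r s' => x ≤ b ^ l ∧
      SameOutside (_root_.forTuples D j c N k p) s s' ∧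
      s'.word c 0 = (if x = b ^ l then 1 else 0) ∧
      (x < b ^ l → ∀ i < l, s'.word D i = x / b ^ i % b) ∧ I x s' ∧
      r = (b ^ l - x) * (B + l * (N.cost + k.cost + 40) + k.cost + 10)) ?_
      (j := 0) (r := b ^ l * (B + l * (N.cost + k.cost + 40) + k.cost + 10))
      ⟨by omega, hs₁, by rw [hc, if_neg hpos.ne], ?_, hI0, by simp⟩ (by omega)) le_rfl ?_
    · rintro x r s₂ ⟨hx, hs₂, hc₂, hd₂, hI₂, rfl⟩ hne
      have hxlt : x < b ^ l := by
        refine lt_of_le_of_ne hx fun he => ?_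
        simp [hc₂, he] at hne
      refine ⟨hxlt, B + l * (N.cost + k.cost + 40) + k.cost + 10,
        (b ^ l - (x + 1)) * (B + l * (N.cost + k.cost + 40) + k.cost + 10), ?_, ?_⟩
      · have : b ^ l - x = b ^ l - (x + 1) + 1 := by omega
        rw [this, add_mul (b ^ l - (x + 1)), one_mul, add_comm]
      refine seq (hp x s₂ hxlt hs₂ (hd₂ hxlt) hI₂) (fun s₃ h₃ hI₃ => ?_)
        (B₂ := l * (N.cost + k.cost + 40) + k.cost + 10) (by omega)
      have hs₃ : SameOutside (_root_.forTuples D j c N k p) s s₃ :=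
        hs₂.trans (h₃.mono (fun a ha => ((hw a).1 ha).2.2.2) fun a ha => (hcw a).1 ha)
      refine straight_seq rfl ?_ (B₂ := l * (N.cost + k.cost + 40) + k.cost + 7) ?_
      · have hagree : ∀ a, a ≠ D → a ≠ j → a ≠ c → (s₃.putWord c 0 1).word a = s₃.word a :=
          fun a _ _ h => by simp [h]
        refine mono (increment hDj hDc hjc b l x hb s₃
          (fun s' h h' => hN s' (houter s₃ s' hs₃ h h')) (fun s' h h' => hk s' (houter s₃ s' hs₃ h h'))
          hagree rfl ?_ (by simp)) le_rfl ?_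
        · intro i hi
          change (s₃.putWord c 0 1).word D i = _
          rw [RamState.putWord_word_of_ne _ _ _ hDc, h₃.word D hD]
          exact hd₂ hxlt i hi
        · rintro s₄ h₄ ⟨hc₄, hd₄⟩
          have hw₄ : ∀ a, a ≠ D → a ≠ j → a ≠ c → s₄.word a = s₃.word a := by
            intro a h1 h2 h3
            rw [h₄.word a ?_]
            · exact hagree a h1 h2 h3
            · simp [_root_.forUpto, RamProgram.writesWord, h1, h2, h3]
          have hc₄' : s₄.ctr = s₃.ctr := funext fun a => h₄.ctr a rfl
          refine ⟨hxlt, houter s₃ s₄ hs₃ hw₄ hc₄', ?_, fun _ => hd₄, hI _ _ _ hw₄ hc₄' hI₃, rfl⟩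
          rw [hc₄]
          by_cases he : x + 1 = b ^ l
          · simp [he]
          · rw [if_neg he, if_neg fun h => ?_]
            have := Nat.le_of_dvd (by omega) h
            omega
      · change 3 + _ ≤ _
        omega
    · intro _ i hi
      rw [hd i hi, Nat.zero_div, Nat.zero_mod]
    · rintro s' _ ⟨⟨x, r, hx, -, -, hc', -, hI', -⟩, h0'⟩
      have : x = b ^ l := by
        by_contra hne
        simp [hc', hne] at h0'
      exact this ▸ hI'
  refine seq (forUpto l 4 (fun i s' => I 0 s' ∧ ∀ i' < i, s'.word D i' = 0) ?_ ?_ ?_ ?_ ?_)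
    (fun s₁ h₁ hi₁ => ?_) (B₁ := l * (4 + k.cost + 10) + k.cost + 7)
    (B₂ := b ^ l * (B + l * (N.cost + k.cost + 40) + k.cost + 10) + (b ^ l - 0) * 5 + 4 + 1 + 3) ?_
  · simp [RamProgram.writesWord, hDj.symm]
  · refine fun s' h => hk s' (h.mono (fun a ha => ?_) fun _ _ => rfl)
    rw [hw] at ha
    simp [_root_.forUpto, RamProgram.writesWord, ha.1, ha.2.1]
  · rintro i x s' ⟨h1, h2⟩
    exact ⟨hI _ s' _ (fun a _ h _ => by simp [h]) rfl h1, fun i' hi' => by simpa [hDj] using h2 i' hi'⟩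
  · exact ⟨h0, by simp⟩
  · rintro i s' hi hs' hji ⟨h1, h2⟩
    refine straight rfl le_rfl ⟨hI _ s' _ (fun a h _ _ => by simp [h]) rfl h1, fun i' hi' => ?_⟩
    simp only [RamProgram.run, WordExpr.eval, hji, RamState.putWord_word_self,
      Function.update_apply]
    split_ifs with he
    · rfl
    · exact h2 i' (by omega)
  · refine straight_seq rfl (B₂ := b ^ l * (B + l * (N.cost + k.cost + 40) + k.cost + 10) +
      (b ^ l - 0) * 5 + 4 + 1) (hloop _ ?_ (by simp) ?_ ?_) ?_
    · refine (h₁.mono (fun a ha => ?_) fun _ _ => rfl).trans ⟨fun a ha => ?_, fun _ _ => rfl⟩ <;>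
        rw [hw] at ha
      · simp [_root_.forUpto, RamProgram.writesWord, ha.1, ha.2.1]
      · simp [ha.2.2.1]
    · intro i hi
      simpa [hDc] using hi₁.2 i hi
    · exact hI _ s₁ _ (fun a _ _ h => by simp [h]) rfl hi₁.1
    · change 3 + _ ≤ _
      omega
  · simp only [Nat.sub_zero]
    have h1 : b ^ l * (B + l * (N.cost + k.cost + 40) + k.cost + 15) =
      b ^ l * (B + l * (N.cost + k.cost + 40) + k.cost + 10) + b ^ l * 5 := by ring
    have h2 : l * (4 + k.cost + 10) ≤ l * (k.cost + 15) := Nat.mul_le_mul le_rfl (by omega)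
    omega

end Runs

/-! ## Adjacency lists in memory -/

namespace AdjLists

variable {n : ℕ} {G : SimpleGraph (Fin n)} (A : AdjLists G)

/-- The position at which the list of `v` starts. -/
def start (v : ℕ) : ℕ := ((List.ofFn A.nbrs).take v).flatten.length

theorem loadArray_offsets {v : ℕ} (hv : v ≤ n) : loadArray A.offsets v = A.start v := by
  have : v < n + 1 := by omega
  simp [loadArray, offsets, start, List.getD_eq_getElem?_getD, this]

theorem start_succ (v : Fin n) : A.start (v + 1) = A.start v + (A.nbrs v).length := by
  unfold start
  rw [List.take_add_one]
  simp

theorem loadArray_entries (v : Fin n) {i : ℕ} (hi : i < (A.nbrs v).length) :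
    loadArray A.entries (A.start v + i) = ((A.nbrs v)[i] : Fin n) := by
  have h : (List.ofFn A.nbrs).flatten =
      ((List.ofFn A.nbrs).take v).flatten ++ (A.nbrs v ++ ((List.ofFn A.nbrs).drop (v + 1)).flatten) := by
    conv_lhs => rw [← List.take_append_drop v (List.ofFn A.nbrs), List.flatten_append]
    congr 1
    rw [List.drop_eq_getElem_cons (by simp)]
    simp
  simp only [loadArray, entries, List.getD_eq_getElem?_getD, List.getElem?_map, h, start]
  rw [List.getElem?_append_right (by omega)]
  simp [List.getElem?_append_left hi, hi]

theorem start_eq_sum {v : ℕ} (hv : v ≤ n) :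
    A.start v = ∑ u : Fin n with u.val < v, (A.nbrs u).length := by
  induction v with
  | zero => simp [start]
  | succ v ih =>
    rw [A.start_succ ⟨v, hv⟩, ih (by omega)]
    have : (Finset.univ.filter fun u : Fin n => u.val < v + 1) =
        insert ⟨v, hv⟩ (Finset.univ.filter fun u : Fin n => u.val < v) := by
      ext u
      simp [Fin.ext_iff]
      omega
    rw [this, Finset.sum_insert (by simp), add_comm]

theorem start_last : A.start n = ∑ u : Fin n, (A.nbrs u).length := by
  rw [A.start_eq_sum le_rfl]
  congr 1
  ext u
  simp

theorem length_nbrs [DecidableRel G.Adj] (v : Fin n) :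
    (A.nbrs v).length = (Finset.univ.filter (G.Adj v)).card := by
  rw [← List.toFinset_card_of_nodup (A.nodup v)]
  congr 1
  ext u
  simp [A.mem_nbrs]

end AdjLists

/-- For every entry `u` of the list of the vertex in the register `x`, run `p`. The lists are given
by the arrays `o` of offsets and `e` of entries; `i` is an auxiliary register. -/
def forNbrs (o e x i u : ℕ) (p : RamProgram) : RamProgram :=
  forUpto i (.get o (wv x + 1) - .get o (wv x)) (setV u (.get e (.get o (wv x) + wv i)) ;; p)

theorem Runs.forNbrs {n : ℕ} {G : SimpleGraph (Fin n)} (A : AdjLists G) (v : Fin n)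
    {o e x i u : ℕ} {p : RamProgram} {s : RamState} (B : ℕ) (I : ℕ → RamState → Prop)
    (hi : p.writesWord i = false) (hoi : o ≠ i) (hei : e ≠ i) (hxi : x ≠ i) (hou : o ≠ u)
    (heu : e ≠ u) (hxu : x ≠ u) (hiu : i ≠ u)
    (hop : p.writesWord o = false) (hep : p.writesWord e = false) (hxp : p.writesWord x = false)
    (ho : s.word o = loadArray A.offsets) (he : s.word e = loadArray A.entries)
    (hx : s.word x 0 = v)
    (hI : ∀ j y s, I j s → I j (s.putWord i 0 y)) (hI' : ∀ j y s, I j s → I j (s.putWord u 0 y))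
    (h0 : I 0 s)
    (hp : ∀ j s' (hj : j < (A.nbrs v).length), SameOutside (forNbrs o e x i u p) s s' →
      s'.word u 0 = ((A.nbrs v)[j] : Fin n) → I j s' → Runs p s' B (I (j + 1))) :
    Runs (_root_.forNbrs o e x i u p) s ((A.nbrs v).length * (B + 28) + 16)
      (I (A.nbrs v).length) := by
  have hwo : (_root_.forNbrs o e x i u p).writesWord o = false := by
    simp [_root_.forNbrs, _root_.forUpto, RamProgram.writesWord, hoi, hou, hop]
  have hwe : (_root_.forNbrs o e x i u p).writesWord e = false := by
    simp [_root_.forNbrs, _root_.forUpto, RamProgram.writesWord, hei, heu, hep]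
  have hwx : (_root_.forNbrs o e x i u p).writesWord x = false := by
    simp [_root_.forNbrs, _root_.forUpto, RamProgram.writesWord, hxi, hxu, hxp]
  have hs : ∀ s', SameOutside (_root_.forNbrs o e x i u p) s s' → s'.word o = loadArray A.offsets ∧
      s'.word e = loadArray A.entries ∧ s'.word x 0 = v :=
    fun s' h => ⟨by rw [h.word o hwo, ho], by rw [h.word e hwe, he], by rw [h.word x hwx, hx]⟩
  refine (Runs.forUpto (A.nbrs v).length (9 + B) I ?_ ?_ hI h0 ?_).le ?_
  · simp [RamProgram.writesWord, hiu, hi]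
  · intro s' h
    obtain ⟨h1, h2, h3⟩ := hs s' h
    simp [h1, h3, A.loadArray_offsets (Nat.succ_le_of_lt v.2), A.loadArray_offsets v.2.le,
      A.start_succ v]
  · intro j s' hj h hji hIj
    obtain ⟨h1, h2, h3⟩ := hs s' h
    refine straight_seq rfl (hp j _ hj (h.trans ⟨fun a ha => ?_, fun _ _ => rfl⟩) ?_
      (hI' _ _ _ hIj)) (by rfl)
    · have : a ≠ u := by
        simp [_root_.forUpto, RamProgram.writesWord] at ha
        exact ha.2.1.1
      simp [this]
    · simp [h1, h2, h3, hji, A.loadArray_offsets v.2.le, A.loadArray_entries v hj]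
  · change _ * (9 + B + 9 + 10) + 9 + 7 ≤ _
    have : 9 + B + 9 + 10 = B + 28 := by ring
    rw [this]

/-- `|e - f|` -/
abbrev distExpr (e f : WordExpr) : WordExpr := (e - f) + (f - e)

/-! ## Elimination of vertices of small degree -/

notation "rK" => 10
notation "rTail" => 11
notation "rDeg" => 12
notation "rQueue" => 13
notation "rPos" => 14
notation "rI" => 15
notation "rX" => 16
notation "rJ" => 17
notation "rU" => 18

/-- Append the vertex in the register `x` to the queue. -/
def pushVertex (x : ℕ) : RamProgram :=
  .setWord rQueue (wv rTail) (wv x) ;; .setWord rPos (wv x) (wv rTail) ;; setV rTail (wv rTail + 1)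

/-- Repeatedly put vertices with at most `K` remaining neighbours into a queue. -/
def eliminateInit (o : ℕ) (N : WordExpr) : RamProgram :=
  setV rTail 0 ;;
  forUpto rI N
    (.setWord rDeg (wv rI) (.get o (wv rI + 1) - .get o (wv rI)) ;;
      .cond (.get rDeg (wv rI) - wv rK) .skip (pushVertex rI))

/-- Remove the vertex in the register `rX`. -/
def removeVertex (o e : ℕ) : RamProgram :=
  forNbrs o e rX rJ rU
    (.setWord rDeg (wv rU) (.get rDeg (wv rU) - 1) ;;
      .cond (distExpr (.get rDeg (wv rU)) (wv rK)) .skip (pushVertex rU))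

/-- Repeatedly put vertices with at most `K` remaining neighbours into a queue. -/
def eliminate (o e : ℕ) (N : WordExpr) : RamProgram :=
  eliminateInit o N ;;
  forUpto rI N
    (.cond (wv rTail - wv rI) (setV rX (.get rQueue (wv rI)) ;; removeVertex o e) .skip)

section Queue

variable {n : ℕ} {G : SimpleGraph (Fin n)}

/-- The queue contains the vertices of the list `l`, whose elements are distinct. -/
structure QueueHolds (l : List (Fin n)) (s : RamState) : Prop where
  nodup : l.Nodup
  tail : s.word rTail 0 = l.length
  queue : ∀ i (h : i < l.length), s.word rQueue i = (l[i] : Fin n)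
  pos : ∀ i (h : i < l.length), s.word rPos (l[i] : Fin n) = i

theorem QueueHolds.push {l : List (Fin n)} {s : RamState} (h : QueueHolds l s) {x : ℕ} {v : Fin n}
    (hx : s.word x 0 = v) (hv : v ∉ l) (hxq : x ≠ rQueue) :
    QueueHolds (l ++ [v]) ((pushVertex x).run s) := by
  refine ⟨?_, ?_, ?_, ?_⟩
  · rw [List.nodup_append]
    refine ⟨h.nodup, by simp, ?_⟩
    rintro a ha b hb rfl
    simp at hb
    exact hv (hb ▸ ha)
  · simp [pushVertex, h.tail]
  · intro i hi
    simp at hi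
    simp only [pushVertex, RamProgram.run, WordExpr.eval]
    simp [h.tail, hx, Function.update_apply]
    rcases lt_or_eq_of_le hi with h1 | rfl
    · simp [h1, h1.ne, h.queue i h1]
    · simp
  · intro i hi
    simp at hi
    simp only [pushVertex, RamProgram.run, WordExpr.eval]
    simp [h.tail, hx, hxq, Function.update_apply]
    rcases lt_or_eq_of_le hi with h1 | rfl
    · have : l[i] ≠ v := fun he => hv (he ▸ List.getElem_mem h1)
      simp [h1, h.pos i h1, Fin.val_inj, this]
    · simp

theorem QueueHolds.congr {l : List (Fin n)} {s s' : RamState} (h : QueueHolds l s)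
    (h1 : s'.word rTail = s.word rTail) (h2 : s'.word rQueue = s.word rQueue)
    (h3 : s'.word rPos = s.word rPos) : QueueHolds l s' :=
  ⟨h.nodup, by rw [h1, h.tail], fun i hi => by rw [h2, h.queue i hi],
    fun i hi => by rw [h3, h.pos i hi]⟩

theorem runs_eliminateInit (A : AdjLists G) {o k : ℕ} (ho : o < 10) {N : WordExpr} {s : RamState}
    (hoff : s.word o = loadArray A.offsets) (hN : ∀ s', s'.word 0 = s.word 0 → N.eval s' = n)
    (hNc : N.cost = 2) (hk : s.word rK 0 = k) :
    Runs (eliminateInit o N) s (n * 70 + 30) (fun s' => ∃ l : List (Fin n), QueueHolds l s' ∧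
      (∀ v : Fin n, s'.word rDeg v = (A.nbrs v).length) ∧
      (∀ v : Fin n, v ∈ l ↔ (A.nbrs v).length ≤ k)) := by
  have ho' : ∀ a, 10 ≤ a → o ≠ a := fun a h => by omega
  refine Runs.le (Runs.straight_seq rfl ((Runs.forUpto n 45 (fun j s' =>
      ∃ l : List (Fin n), QueueHolds l s' ∧
      (∀ v : Fin n, v.val < j → s'.word rDeg v = (A.nbrs v).length) ∧
      (∀ v : Fin n, v ∈ l ↔ v.val < j ∧ (A.nbrs v).length ≤ k)) rfl ?_ ?_ ?_ ?_).mono le_rfl ?_)) ?_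
  · intro s' h
    apply hN
    rw [h.word 0 rfl]
    simp
  · rintro j x s ⟨l, h1, h2, h3⟩
    exact ⟨l, h1.congr (by simp) (by simp) (by simp), by simpa using h2, h3⟩
  · refine ⟨[], ⟨by simp, by simp, by simp, by simp⟩, by simp, by simp⟩
  · rintro j s' hj hs hjj ⟨l, h1, h2, h3⟩
    have hoff' : s'.word o = loadArray A.offsets := by
      rw [hs.word o (by simp [forUpto, pushVertex, ho']), ← hoff]
      simp [ho']
    have hk' : s'.word rK 0 = k := by rw [hs.word rK rfl]; simpa using hk
    have hdeg : loadArray A.offsets (j + 1) - loadArray A.offsets j = (A.nbrs ⟨j, hj⟩).length := by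
      rw [A.loadArray_offsets (show j + 1 ≤ n from hj), A.loadArray_offsets hj.le]
      have := A.start_succ ⟨j, hj⟩
      simp only at this
      omega
    have hdeg2 : ∀ v : Fin n, v.val < j + 1 → Function.update (s'.word rDeg) j
        (A.nbrs ⟨j, hj⟩).length v = (A.nbrs v).length := by
      intro v hv
      rcases eq_or_ne v.val j with he | he
      · have : v = ⟨j, hj⟩ := Fin.ext he
        subst this
        simp
      · rw [Function.update_of_ne he, h2 v (by omega)]
    refine Runs.le (Runs.straight_seq rfl (Runs.cond (B₁ := 20) (fun hc => ?_) (fun hc => ?_)))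
      (by simp)
    · refine Runs.straight rfl (by simp) ⟨l, h1.congr (by simp) (by simp) (by simp),
        ?_, fun v => ?_⟩
      · simpa [hjj, hoff', hdeg] using hdeg2
      · simp [hjj, hoff', hdeg, hk'] at hc
        rw [h3]
        refine ⟨fun h => ⟨by omega, h.2⟩, fun h => ⟨?_, h.2⟩⟩
        refine lt_of_le_of_ne (by omega) fun he => ?_
        have : v = ⟨j, hj⟩ := Fin.ext he
        subst this
        omega
    · refine Runs.straight rfl (by simp [pushVertex]) ⟨l ++ [⟨j, hj⟩],
        QueueHolds.push (h1.congr (by simp) (by simp) (by simp)) ?_ ?_ ?_, ?_, fun v => ?_⟩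
      · simpa using hjj
      · simp [h3]
      · simp
      · simpa [pushVertex, hjj, hoff', hdeg] using hdeg2
      · simp [hjj, hoff', hdeg, hk', Nat.sub_eq_zero_iff_le] at hc
        rw [List.mem_append, h3, List.mem_singleton]
        constructor
        · rintro (h | rfl)
          · exact ⟨by omega, h.2⟩
          · exact ⟨by simp, hc⟩
        · rintro ⟨h, h'⟩
          rcases lt_or_eq_of_le (Nat.lt_succ_iff.1 h) with h4 | h4
          · exact Or.inl ⟨h4, h'⟩
          · exact Or.inr (Fin.ext h4)
  · rintro s' - ⟨l, h1, h2, h3⟩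
    exact ⟨l, h1, fun v => h2 v v.2, fun v => by simp [h3]⟩
  · simp [hNc]
    omega

/-- Degrees drop by one at a time, so a vertex enters the set of values at most `k` precisely when
its value becomes equal to `k`. Testing for equality thus pushes every vertex once. The hypothesis
`hpos` ensures that the truncated decrement really decreases; for `k = 0` a value stuck at 0 would
be pushed again. -/
theorem runs_removeVertex (A : AdjLists G) {o e k : ℕ} (ho : o < 10) (he : e < 10) {s : RamState}
    (hoff : s.word o = loadArray A.offsets) (hent : s.word e = loadArray A.entries)
    (hk : s.word rK 0 = k) {x : Fin n} (hx : s.word rX 0 = x) {l : List (Fin n)}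
    (hl : QueueHolds l s) {D : Fin n → ℕ} (hD : ∀ v : Fin n, s.word rDeg v = D v)
    (hlD : ∀ v : Fin n, v ∈ l ↔ D v ≤ k) (hpos : ∀ v ∈ A.nbrs x, 0 < D v) :
    Runs (removeVertex o e) s ((A.nbrs x).length * 80 + 16) (fun s' => ∃ l' : List (Fin n),
      QueueHolds (l ++ l') s' ∧
      (∀ v : Fin n, s'.word rDeg v = D v - if v ∈ A.nbrs x then 1 else 0) ∧
      (∀ v : Fin n, v ∈ l ++ l' ↔ D v - (if v ∈ A.nbrs x then 1 else 0) ≤ k)) := by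
  have ho' : ∀ a, 10 ≤ a → o ≠ a := fun a h => by omega
  have he' : ∀ a, 10 ≤ a → e ≠ a := fun a h => by omega
  refine (Runs.forNbrs A x 52 (fun t s' => ∃ l' : List (Fin n), QueueHolds (l ++ l') s' ∧
      (∀ v : Fin n, s'.word rDeg v = D v - if v ∈ (A.nbrs x).take t then 1 else 0) ∧
      (∀ v : Fin n, v ∈ l ++ l' ↔ D v - (if v ∈ (A.nbrs x).take t then 1 else 0) ≤ k))
    rfl (by simp [ho']) (by simp [he']) (by simp) (by simp [ho']) (by simp [he']) (by simp)
    (by simp) (by simp [ho', pushVertex]) (by simp [he', pushVertex]) rfl hoff hent hx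
    ?_ ?_ ?_ ?_).mono le_rfl ?_
  · rintro j y s ⟨l', h1, h2, h3⟩
    exact ⟨l', h1.congr (by simp) (by simp) (by simp), by simpa using h2, h3⟩
  · rintro j y s ⟨l', h1, h2, h3⟩
    exact ⟨l', h1.congr (by simp) (by simp) (by simp), by simpa using h2, h3⟩
  · exact ⟨[], by simpa using hl, by simpa using hD, by simpa using hlD⟩
  · rintro j s' hj hs hu ⟨l', h1, h2, h3⟩
    set u : Fin n := (A.nbrs x)[j] with hu_def
    have hk' : s'.word rK 0 = k := by rw [hs.word rK rfl, hk]
    have hut : u ∉ (A.nbrs x).take j := by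
      have := A.nodup x
      rw [← List.take_append_drop j (A.nbrs x), List.nodup_append] at this
      intro hmem
      refine this.2.2 u hmem u ?_ rfl
      rw [List.drop_eq_getElem_cons hj]
      exact List.mem_cons_self
    have huD : s'.word rDeg u = D u := by rw [h2, if_neg hut, Nat.sub_zero]
    have hupos := hpos u (List.getElem_mem hj)
    have htake : ∀ v, v ∈ (A.nbrs x).take (j + 1) ↔ v ∈ (A.nbrs x).take j ∨ v = u := by
      intro v
      rw [List.take_add_one, List.mem_append]
      simp [hj, hu_def]
    have hdeg : ∀ v : Fin n, Function.update (s'.word rDeg) u (D u - 1) v =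
        D v - if v ∈ (A.nbrs x).take (j + 1) then 1 else 0 := by
      intro v
      rcases eq_or_ne v u with rfl | hne
      · simp [htake]
      · have : v.val ≠ u := fun h => hne (Fin.ext h)
        rw [Function.update_of_ne this, h2]
        simp [htake, hne]
    refine Runs.le (Runs.straight_seq rfl (Runs.cond (B₁ := 20) (fun hc => ?_) (fun hc => ?_)))
      (by simp)
    · refine Runs.straight rfl (by simp) ⟨l', h1.congr (by simp) (by simp) (by simp),
        ?_, fun v => ?_⟩
      · simpa [hu, huD] using hdeg
      · simp [hu, huD, hk'] at hc
        rw [h3]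
        rcases eq_or_ne v u with rfl | hne
        · simp [htake, hut]; omega
        · simp [htake, hne]
    · simp [hu, huD, hk'] at hc
      refine Runs.straight rfl (by simp [pushVertex]) ⟨l' ++ [u], ?_, ?_, fun v => ?_⟩
      · rw [← List.append_assoc]
        refine QueueHolds.push (h1.congr (by simp) (by simp) (by simp)) ?_ ?_ ?_
        · simpa using hu
        · rw [h3]; simp [hut]; omega
        · simp
      · simpa [pushVertex, hu, huD] using hdeg
      · rw [← List.append_assoc, List.mem_append, h3, List.mem_singleton]
        rcases eq_or_ne v u with rfl | hne
        · simp [htake]; omega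
        · simp [htake, hne]
  · simp

open scoped Classical in
/-- The number of neighbours of `v` outside the list `l`. -/
noncomputable def remainingDegree (G : SimpleGraph (Fin n)) (l : List (Fin n)) (v : Fin n) : ℕ :=
  (Finset.univ.filter fun w => G.Adj v w ∧ w ∉ l).card

theorem remainingDegree_nil (A : AdjLists G) (v : Fin n) :
    remainingDegree G [] v = (A.nbrs v).length := by
  classical
  rw [A.length_nbrs]
  simp [remainingDegree]

theorem remainingDegree_append_singleton {l : List (Fin n)} {x : Fin n} (hx : x ∉ l) (A : AdjLists G)
    (v : Fin n) : remainingDegree G (l ++ [x]) v =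
      remainingDegree G l v - if v ∈ A.nbrs x then 1 else 0 := by
  classical
  have h : (Finset.univ.filter fun w => G.Adj v w ∧ w ∉ l ++ [x]) =
      (Finset.univ.filter fun w => G.Adj v w ∧ w ∉ l).erase x := by
    ext w
    simp
    tauto
  simp only [remainingDegree, h, Finset.card_erase_eq_ite, A.mem_nbrs]
  simp [hx, G.adj_comm x v]
  split_ifs <;> simp

theorem remainingDegree_pos {l : List (Fin n)} {x v : Fin n} (hx : x ∉ l) (A : AdjLists G)
    (hv : v ∈ A.nbrs x) : 0 < remainingDegree G l v := by
  refine Finset.card_pos.2 ⟨x, ?_⟩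
  simpa [hx] using ((A.mem_nbrs _ _).1 hv).symm

open scoped Classical in
-- After `j` rounds, the array `rDeg` holds the degrees after deletion of the first `j` queue
-- entries, and the queue holds exactly the vertices whose value is at most `k`. Deleting `x` costs
-- the length of its list; the potential is the sum of the lengths over the vertices not yet
-- deleted, so that the total is the number of list entries. When the queue runs dry, the vertices
-- left over induce a subgraph of minimum degree above `k`.
theorem runs_eliminate (A : AdjLists G) {o e k : ℕ} (ho : o < 10) (he : e < 10) {N : WordExpr}
    {s : RamState} (hoff : s.word o = loadArray A.offsets) (hent : s.word e = loadArray A.entries)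
    (hN : ∀ s', s'.word 0 = s.word 0 → N.eval s' = n) (hNc : N.cost = 2) (hk : s.word rK 0 = k) :
    Runs (eliminate o e N) s (n * 150 + A.start n * 80 + 60) (fun s' => ∃ l : List (Fin n),
      QueueHolds l s' ∧
      (∀ i (h : i < l.length), remainingDegree G (l.take i) l[i] ≤ k) ∧
      (∀ v ∉ l, k < remainingDegree G l v)) := by
  have ho' : ∀ a, 10 ≤ a → o ≠ a := fun a h => by omega
  have he' : ∀ a, 10 ≤ a → e ≠ a := fun a h => by omega
  refine Runs.le (Runs.seq (runs_eliminateInit A ho hoff hN hNc hk) (fun s₁ hs₁ hi => ?_)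
    (B₂ := (n * 40 + A.start n * 80) + n * (N.cost + 10) + N.cost + 7)) (by rw [hNc]; omega)
  obtain ⟨l₀, h1, h2, h3⟩ := hi
  have hoff₁ : s₁.word o = loadArray A.offsets := by
    rw [hs₁.word o (by simp [eliminateInit, forUpto, pushVertex, ho']), hoff]
  have hent₁ : s₁.word e = loadArray A.entries := by
    rw [hs₁.word e (by simp [eliminateInit, forUpto, pushVertex, he']), hent]
  refine (Runs.forUpto_potential n (n * 40 + A.start n * 80) (fun j r s' =>
    ∃ l : List (Fin n), QueueHolds l s' ∧
      (∀ v : Fin n, s'.word rDeg v = remainingDegree G (l.take j) v) ∧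
      (∀ v : Fin n, v ∈ l ↔ remainingDegree G (l.take j) v ≤ k) ∧
      (∀ i < j, ∀ h : i < l.length, remainingDegree G (l.take i) l[i] ≤ k) ∧
      r = (n - j) * 40 + (∑ v with v ∉ l.take j, (A.nbrs v).length) * 80) rfl ?_ ?_ ?_ ?_).mono
      le_rfl ?_
  · intro s' h
    apply hN
    rw [h.word 0 rfl, hs₁.word 0 rfl]
  · rintro j r x s' ⟨l, h1, h2, h3, h4, h5⟩
    exact ⟨l, h1.congr (by simp) (by simp) (by simp), by simpa using h2, h3, h4, h5⟩
  · refine ⟨l₀, h1, ?_, ?_, by simp, ?_⟩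
    · simpa [remainingDegree_nil A] using h2
    · simpa [remainingDegree_nil A] using h3
    · simp [A.start_last]
  · rintro j r s' hj hs hjj ⟨l, h1, h2, h3, h4, rfl⟩
    have hk' : s'.word rK 0 = k := by rw [hs.word rK rfl, hs₁.word rK rfl, hk]
    have hoff' : s'.word o = loadArray A.offsets := by
      rw [hs.word o (by simp [forUpto, forNbrs, removeVertex, pushVertex, ho']), hoff₁]
    have hent' : s'.word e = loadArray A.entries := by
      rw [hs.word e (by simp [forUpto, forNbrs, removeVertex, pushVertex, he']), hent₁]
    have hsub : n - j = n - (j + 1) + 1 := by omega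
    by_cases hjl : j < l.length
    · set x := l[j] with hx_def
      have hx : x ∉ l.take j := by
        have := h1.nodup
        rw [← List.take_append_drop j l, List.nodup_append] at this
        intro hmem
        refine this.2.2 x hmem x ?_ rfl
        rw [List.drop_eq_getElem_cons hjl]
        exact List.mem_cons_self
      have htake : ∀ l', (l ++ l').take (j + 1) = l.take j ++ [x] := by
        intro l'
        rw [List.take_append_of_le_length (by omega), List.take_add_one]
        simp [hjl, hx_def]
      refine ⟨(A.nbrs x).length * 80 + 40, (n - (j + 1)) * 40 +
        (∑ v with v ∉ l.take j ++ [x], (A.nbrs v).length) * 80, ?_, ?_⟩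
      · have : (Finset.univ.filter fun v => v ∉ l.take j) =
            insert x (Finset.univ.filter fun v => v ∉ l.take j ++ [x]) := by
          ext v
          rcases eq_or_ne v x with rfl | hne
          · simp [hx]
          · simp [hne]
        rw [this, Finset.sum_insert (by simp), hsub]
        ring_nf
        omega
      refine Runs.le (Runs.cond (B₁ := (A.nbrs x).length * 80 + 30) (fun hc => ?_) (fun hc => ?_))
        (by simp; omega)
      · refine Runs.le (Runs.straight_seq rfl ((runs_removeVertex A ho he (k := k) (x := x) (l := l)
          (D := remainingDegree G (l.take j)) ?_ ?_ ?_ ?_ ?_ ?_ ?_ ?_).mono le_rfl ?_)) ?_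
        · simpa [ho'] using hoff'
        · simpa [he'] using hent'
        · simpa using hk'
        · simp [hjj, h1.queue j hjl, hx_def]
        · exact h1.congr (by simp) (by simp) (by simp)
        · simpa using h2
        · exact h3
        · exact fun v hv => remainingDegree_pos hx A hv
        · rintro s₂ - ⟨l', h1', h2', h3'⟩
          refine ⟨l ++ l', h1', ?_, ?_, ?_, ?_⟩
          · intro v
            rw [h2', htake, remainingDegree_append_singleton hx A]
          · intro v
            rw [h3', htake, remainingDegree_append_singleton hx A]
          · intro i hi hil
            have hil' : i < l.length := by omega
            rw [List.getElem_append_left hil', List.take_append_of_le_length hil'.le]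
            rcases lt_or_eq_of_le (Nat.lt_succ_iff.1 hi) with h | rfl
            · exact h4 i h hil'
            · exact (h3 _).1 (List.getElem_mem hil')
          · rw [htake]
        · simp
          omega
      · simp [hjj, h1.tail] at hc
        omega
    -- The loop always makes `n` rounds; once the queue is exhausted, the remaining rounds are idle.
    · have htake : l.take (j + 1) = l.take j := by
        rw [List.take_of_length_le (by omega), List.take_of_length_le (by omega)]
      refine ⟨40, (n - (j + 1)) * 40 + (∑ v with v ∉ l.take (j + 1), (A.nbrs v).length) * 80, ?_, ?_⟩
      rotate_left
      · refine Runs.le (Runs.cond (B₁ := 20) (fun hc => ?_) (fun hc => ?_)) (by simp)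
        · simp [hjj, h1.tail] at hc
          omega
        · refine Runs.straight rfl (by simp) ⟨l, h1, ?_, ?_, ?_, rfl⟩
          · simpa [htake] using h2
          · simpa [htake] using h3
          · exact fun i hi hil => h4 i (by omega) hil
      · rw [hsub, htake]
        ring_nf
        omega
  · rintro s' - ⟨r, l, h1, h2, h3, h4, -⟩
    have hlen : l.length ≤ n := by
      simpa using h1.nodup.length_le_card
    rw [List.take_of_length_le hlen] at h2 h3
    refine ⟨l, h1, fun i hi => h4 i (by omega) hi, fun v hv => ?_⟩
    rw [h3] at hv
    omega

end Queue

/-! ## Degeneracy -/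

theorem exists_vertexOrdering {V α : Type*} [Fintype V] [LinearOrder α] (f : V → α)
    (hf : Function.Injective f) : ∃ o : VertexOrdering V, ∀ u v, o u < o v ↔ f u < f v := by
  let _ : LinearOrder V := LinearOrder.lift' f hf
  let e : Fin (Fintype.card V) ≃o V := monoEquivOfFin V rfl
  exact ⟨e.symm.toEquiv, fun u v => e.symm.lt_iff_lt⟩

theorem IsDegenerateOrdering.mono {V : Type*} [Fintype V] {G : SimpleGraph V}
    {o : VertexOrdering V} {d d' : ℕ} (h : IsDegenerateOrdering G o d) (hd : d ≤ d') :
    IsDegenerateOrdering G o d' := fun v => (h v).trans hd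

open scoped Classical in
-- Every edge leads to the left from exactly one of its ends, so the lengths of the lists add up to
-- twice the number of left edges.
theorem IsDegenerate.sum_degree_le {n : ℕ} {G : SimpleGraph (Fin n)} {d : ℕ}
    (h : IsDegenerate G d) (A : AdjLists G) : A.start n ≤ 2 * (d * n) := by
  obtain ⟨o, ho⟩ := h
  have h1 : ∀ v, (Finset.univ.filter fun u => G.Adj v u ∧ o u < o v).card ≤ d := by
    intro v
    have := ho v
    rwa [leftNbhd, Set.ncard_eq_toFinset_card', Set.toFinset_ofPred] at this
  have h2 : ∑ v, (Finset.univ.filter fun u => G.Adj v u ∧ o v < o u).card =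
      ∑ v, (Finset.univ.filter fun u => G.Adj v u ∧ o u < o v).card := by
    simp only [Finset.card_filter]
    rw [Finset.sum_comm]
    simp only [G.adj_comm]
  have h3 : ∀ v, (A.nbrs v).length =
      (Finset.univ.filter fun u => G.Adj v u ∧ o v < o u).card +
      (Finset.univ.filter fun u => G.Adj v u ∧ o u < o v).card := by
    intro v
    rw [A.length_nbrs, ← Finset.card_union_of_disjoint]
    · congr 1
      ext u
      simp only [Finset.mem_filter, Finset.mem_univ, true_and, Finset.mem_union]
      constructor
      · intro h
        have : o v ≠ o u := fun he => G.ne_of_adj h (o.injective he)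
        rcases lt_or_gt_of_ne this with h' | h'
        · exact Or.inl ⟨h, h'⟩
        · exact Or.inr ⟨h, h'⟩
      · rintro (h | h) <;> exact h.1
    · rw [Finset.disjoint_filter]
      rintro u - ⟨-, h⟩ ⟨-, h'⟩
      exact lt_asymm h h'
  rw [A.start_last, Finset.sum_congr rfl fun v _ => h3 v, Finset.sum_add_distrib, h2, ← two_mul]
  refine Nat.mul_le_mul_left 2 ((Finset.sum_le_sum fun v _ => h1 v).trans ?_)
  simp [mul_comm]

/-! ### Elimination orders and degenerate orderings. -/

section Queue

variable {n : ℕ} {G : SimpleGraph (Fin n)}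

/-- If vertices were left over, consider the last of them in a `k`-degenerate ordering. All its
remaining neighbours precede it, so there are at most `k` of them, contrary to `hrem`. -/
theorem IsDegenerate.length_eq {k : ℕ} (h : IsDegenerate G k) {l : List (Fin n)} (hl : l.Nodup)
    (hrem : ∀ v ∉ l, k < remainingDegree G l v) : l.length = n := by
  classical
  obtain ⟨o, ho⟩ := h
  have hall : ∀ v, v ∈ l := by
    by_contra! hne
    obtain ⟨v, hv⟩ := hne
    obtain ⟨w, hw, hmax⟩ := Finset.exists_max_image (Finset.univ.filter fun w => w ∉ l) o
      ⟨v, by simpa using hv⟩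
    simp only [Finset.mem_filter, Finset.mem_univ, true_and] at hw hmax
    refine absurd (hrem w hw) (not_lt.2 (le_trans ?_ (ho w)))
    rw [leftNbhd, Set.ncard_eq_toFinset_card', Set.toFinset_ofPred]
    refine Finset.card_le_card fun u => ?_
    simp only [Finset.mem_filter, Finset.mem_univ, true_and]
    rintro ⟨h1, h2⟩
    exact ⟨h1, lt_of_le_of_ne (hmax u h2) fun he => G.ne_of_adj h1 (o.injective he).symm⟩
  have : l.toFinset = Finset.univ := by ext v; simp [hall v]
  rw [← List.toFinset_card_of_nodup hl, this]
  simp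

open scoped Classical in
/-- Every vertex has at most `k` neighbours in a later position. -/
structure RankDegenerate (G : SimpleGraph (Fin n)) (pos : Fin n → ℕ) (k : ℕ) : Prop where
  injective : Function.Injective pos
  card_le : ∀ v, (Finset.univ.filter fun u => G.Adj v u ∧ pos v < pos u).card ≤ k

/-- A vertex leaves the graph with at most `k` neighbours still present, and these are at later
queue positions. Being to the left therefore means having a larger `pos`, whence the order dual.
This convention is used throughout for the host graph. -/
theorem RankDegenerate.isDegenerate {pos : Fin n → ℕ} {k : ℕ} (h : RankDegenerate G pos k) :
    ∃ o : VertexOrdering (Fin n), (∀ u v, o u < o v ↔ pos v < pos u) ∧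
      IsDegenerateOrdering G o k := by
  classical
  obtain ⟨o, ho⟩ := exists_vertexOrdering (fun v => OrderDual.toDual (pos v)) h.injective
  refine ⟨o, fun u v => by rw [ho]; exact OrderDual.toDual_lt_toDual, fun v => ?_⟩
  rw [leftNbhd, Set.ncard_eq_toFinset_card', Set.toFinset_ofPred]
  convert h.card_le v using 4
  rw [ho, OrderDual.toDual_lt_toDual]

theorem QueueHolds.rankDegenerate {l : List (Fin n)} {s : RamState} (h : QueueHolds l s) {k : ℕ}
    (hlen : l.length = n) (hrem : ∀ i (h : i < l.length), remainingDegree G (l.take i) l[i] ≤ k) :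
    RankDegenerate G (fun v => s.word rPos v) k := by
  have hall : ∀ v, v ∈ l := by
    intro v
    have : l.toFinset = Finset.univ := by
      rw [← Finset.card_eq_iff_eq_univ, List.toFinset_card_of_nodup h.nodup, hlen]
      simp
    rw [← List.mem_toFinset, this]
    simp
  have hget : ∀ v, ∃ i, ∃ hi : i < l.length, l[i] = v := fun v => List.getElem_of_mem (hall v)
  constructor
  · intro u v huv
    obtain ⟨i, hi, rfl⟩ := hget u
    obtain ⟨j, hj, rfl⟩ := hget v
    simp only [h.pos] at huv
    subst huv
    rfl
  · intro v
    obtain ⟨i, hi, rfl⟩ := hget v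
    refine le_trans (Finset.card_le_card fun u => ?_) (hrem i hi)
    simp only [Finset.mem_filter, Finset.mem_univ, true_and, h.pos]
    obtain ⟨j, hj, rfl⟩ := hget u
    rw [h.pos]
    rintro ⟨h1, h2⟩
    refine ⟨h1, fun hmem => ?_⟩
    obtain ⟨j', hj', he⟩ := List.getElem_of_mem hmem
    rw [List.getElem_take, h.nodup.getElem_inj_iff] at he
    simp at hj'
    omega

end Queue

/-- Compute the degeneracy of the graph in the arrays 1 and 2. -/
def computeDegeneracy : RamProgram :=
  setV rK 0 ;;
  eliminate 1 2 (.get 0 (.const 0)) ;;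
  .loop (.get 0 (.const 0) - wv rTail)
    (setV rK (wv rK + 1) ;; eliminate 1 2 (.get 0 (.const 0)))

/-- The threshold is raised until the queue swallows the whole graph. By `IsDegenerate.length_eq`
this happens at `d` at the latest, so `k ≤ d` holds although `d` is not part of the input. -/
theorem runs_computeDegeneracy {n d : ℕ} {G : SimpleGraph (Fin n)} (A : AdjLists G)
    (hG : IsDegenerate G d) {s : RamState} (hoff : s.word 1 = loadArray A.offsets)
    (hent : s.word 2 = loadArray A.entries) (hn : s.word 0 0 = n) :
    Runs computeDegeneracy s ((d + 1) * (n * 150 + A.start n * 80 + 80))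
      (fun s' => ∃ k ≤ d, s'.word rK 0 = k ∧ RankDegenerate G (fun v => s'.word rPos v) k) := by
  set E := n * 150 + A.start n * 80 + 60 with hE
  have helim : ∀ k s', s'.word 1 = loadArray A.offsets → s'.word 2 = loadArray A.entries →
      s'.word 0 0 = n → s'.word rK 0 = k →
      Runs (eliminate 1 2 (.get 0 (.const 0))) s' E (fun s' =>
        (∃ l : List (Fin n), QueueHolds l s' ∧
        (∀ i (h : i < l.length), remainingDegree G (l.take i) l[i] ≤ k) ∧
        (∀ v ∉ l, k < remainingDegree G l v)) ∧ s'.word 1 = loadArray A.offsets ∧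
        s'.word 2 = loadArray A.entries ∧ s'.word 0 0 = n ∧ s'.word rK 0 = k) := by
    intro k s' h1 h2 h0 hk
    refine (runs_eliminate A (by norm_num) (by norm_num) h1 h2 (fun s'' h => ?_) rfl hk).mono
      le_rfl ?_
    · simp [h, h0]
    · intro s'' hs h
      exact ⟨h, by rw [hs.word 1 rfl, h1], by rw [hs.word 2 rfl, h2], by rw [hs.word 0 rfl, h0],
        by rw [hs.word rK rfl, hk]⟩
  refine Runs.le (Runs.straight_seq rfl (Runs.seq (helim 0 _ (by simpa using hoff)
    (by simpa using hent) (by simpa using hn) (by simp)) (fun s₁ _ h₁ => ?_)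
    (B₂ := d * (E + 6) + (d - 0) * 6 + 5 + 1))) ?_
  · refine (Runs.loop_aux d (fun k r s' => ((∃ l : List (Fin n), QueueHolds l s' ∧
        (∀ i (h : i < l.length), remainingDegree G (l.take i) l[i] ≤ k) ∧
        (∀ v ∉ l, k < remainingDegree G l v)) ∧ s'.word 1 = loadArray A.offsets ∧
        s'.word 2 = loadArray A.entries ∧ s'.word 0 0 = n ∧ s'.word rK 0 = k) ∧
        r = (d - k) * (E + 6)) ?_ (j := 0) (r := d * (E + 6)) ⟨h₁, by simp⟩ (by omega)).mono ?_ ?_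
    · rintro k r s' ⟨⟨⟨l, h1, h2, h3⟩, h4, h5, h6, h7⟩, rfl⟩ hc
      have hkd : k < d := by
        by_contra hge
        obtain ⟨o, ho⟩ := hG
        have := IsDegenerate.length_eq ⟨o, ho.mono (not_lt.1 hge)⟩ h1.nodup h3
        simp [h6, h1.tail, this] at hc
      refine ⟨hkd, E + 6, (d - (k + 1)) * (E + 6), ?_, ?_⟩
      · have : d - k = (d - (k + 1)) + 1 := by omega
        rw [this, add_mul _ 1, one_mul, add_comm]
      · refine Runs.le (Runs.straight_seq rfl ((helim (k + 1) _ (by simpa using h4)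
          (by simpa using h5) (by simpa using h6) (by simpa using h7)).mono le_rfl
          fun s'' _ h => ⟨h, rfl⟩)) (by simp; omega)
    · simp
    · rintro s' - ⟨⟨k, r, hk, ⟨⟨l, h1, h2, h3⟩, h4, h5, h6, h7⟩, -⟩, h0⟩
      refine ⟨k, hk, h7, h1.rankDegenerate ?_ h2⟩
      have hlen : l.length ≤ n := by simpa using h1.nodup.length_le_card
      simp [h6, h1.tail] at h0
      omega
  · simp
    have : (d + 1) * (n * 150 + A.start n * 80 + 80) = (d + 1) * E + (d + 1) * 20 := by
      rw [hE]; ring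
    rw [this]
    ring_nf
    omega

/-! ## Tables for the host graph -/

notation "rBase" => 20
notation "rAdj" => 21
notation "rLeft" => 22
notation "rLNbr" => 23
notation "rLCnt" => 24
notation "rRow" => 25

/-- The list of the neighbours of `v` in a later position. -/
def AdjLists.leftList {n : ℕ} {G : SimpleGraph (Fin n)} (A : AdjLists G) (pos : Fin n → ℕ)
    (v : Fin n) : List (Fin n) := (A.nbrs v).filter fun u => pos v < pos u

theorem AdjLists.length_leftList_le {n k : ℕ} {G : SimpleGraph (Fin n)} (A : AdjLists G)
    {pos : Fin n → ℕ} (h : RankDegenerate G pos k) (v : Fin n) :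
    (A.leftList pos v).length ≤ k := by
  classical
  rw [AdjLists.leftList, ← List.toFinset_card_of_nodup ((A.nodup v).filter _)]
  refine le_trans (Finset.card_le_card fun u => ?_) (h.card_le v)
  simp [A.mem_nbrs]

theorem AdjLists.length_nbrs_lt {n : ℕ} {G : SimpleGraph (Fin n)} (A : AdjLists G) (v : Fin n) :
    (A.nbrs v).length < n := by
  classical
  have : (v :: A.nbrs v).Nodup := List.nodup_cons.2 ⟨by simp [A.mem_nbrs], A.nodup v⟩
  simpa using this.length_le_card

theorem AdjLists.length_leftList_lt {n : ℕ} {G : SimpleGraph (Fin n)} (A : AdjLists G)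
    (pos : Fin n → ℕ) (v : Fin n) : (A.leftList pos v).length < n :=
  (List.length_filter_le _ _).trans_lt (A.length_nbrs_lt v)

open scoped Classical in
/-- The memory contains the adjacency matrix of the host graph, the matrix of the relation `u ∈ N⁻(v)`,
and the lists of left neighbours (with all vertices increased by one). -/
structure HostTables {n : ℕ} {G : SimpleGraph (Fin n)} (A : AdjLists G) (pos : Fin n → ℕ)
    (s : RamState) : Prop where
  size : s.word 0 0 = n
  base : ∀ v : Fin n, s.word rBase v = v * n
  adj : ∀ u v : Fin n, s.word rAdj (u * n + v) = if G.Adj u v then 1 else 0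
  left : ∀ u v : Fin n, s.word rLeft (u * n + v) = if G.Adj u v ∧ pos u < pos v then 1 else 0
  lcnt : ∀ v : Fin n, s.word rLCnt v = (A.leftList pos v).length
  lzero : ∀ v : Fin n, s.word rLNbr (v * n) = 0
  lnbr : ∀ (v : Fin n) i (h : i < (A.leftList pos v).length),
    s.word rLNbr (v * n + (i + 1)) = (A.leftList pos v)[i] + 1

theorem HostTables.congr {n : ℕ} {G : SimpleGraph (Fin n)} {A : AdjLists G} {pos : Fin n → ℕ}
    {s s' : RamState} (h : HostTables A pos s)
    (h' : ∀ a ∈ [0, rBase, rAdj, rLeft, rLNbr, rLCnt], s'.word a = s.word a) :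
    HostTables A pos s' := by
  simp only [List.mem_cons, List.not_mem_nil, or_false, forall_eq_or_imp, forall_eq] at h'
  obtain ⟨h0, h1, h2, h3, h4, h5⟩ := h'
  exact ⟨by rw [h0, h.size], fun v => by rw [h1, h.base], fun u v => by rw [h2, h.adj],
    fun u v => by rw [h3, h.left], fun v => by rw [h5, h.lcnt], fun v => by rw [h4, h.lzero],
    fun v i hi => by rw [h4, h.lnbr v i hi]⟩

/-- Fill in the row of the vertex in the register `rX`. -/
def hostRow : RamProgram :=
  forNbrs 1 2 rX rJ rU
    (.setWord rAdj (wv rRow + wv rU) 1 ;;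
      .cond (.get rPos (wv rU) - .get rPos (wv rX))
        (.setWord rLeft (wv rRow + wv rU) 1 ;;
          .setWord rLCnt (wv rX) (.get rLCnt (wv rX) + 1) ;;
          .setWord rLNbr (wv rRow + .get rLCnt (wv rX)) (wv rU + 1))
        .skip)

/-- Compute the tables of the host graph. -/
def hostTables : RamProgram :=
  setV rRow 0 ;;
  forUpto rI (.get 0 (.const 0))
    (.setWord rBase (wv rI) (wv rRow) ;;
      setV rX (wv rI) ;;
      hostRow ;;
      setV rRow (wv rRow + .get 0 (.const 0)))

theorem mul_add_inj {n a b : ℕ} (u v : Fin n) :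
    a * n + u = b * n + v ↔ a = b ∧ u = v := by
  constructor
  · intro h
    have hn : 0 < n := u.pos
    have h1 := congrArg (· % n) h
    have h2 := congrArg (· / n) h
    simp [Nat.mul_add_mod_self_right, Nat.mod_eq_of_lt, Fin.val_inj] at h1
    simp [Nat.add_div_of_dvd_right (Dvd.intro_left _ rfl), Nat.mul_div_cancel _ hn, Nat.div_eq_of_lt] at h2
    exact ⟨h2, h1⟩
  · rintro ⟨rfl, rfl⟩
    rfl

section

variable {n : ℕ} {G : SimpleGraph (Fin n)} (A : AdjLists G) (pos : Fin n → ℕ)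

open scoped Classical in
theorem runs_hostRow {s : RamState} (x : Fin n) (hx : s.word rX 0 = x) (hrow : s.word rRow 0 = x * n)
    (hoff : s.word 1 = loadArray A.offsets) (hent : s.word 2 = loadArray A.entries)
    (hpos : ∀ v : Fin n, s.word rPos v = pos v) (hcnt : s.word rLCnt x = 0) :
    Runs hostRow s ((A.nbrs x).length * 80 + 16) (fun s' =>
      (∀ z, s'.word rAdj z = if ∃ u ∈ A.nbrs x, z = x * n + u then 1 else s.word rAdj z) ∧
      (∀ z, s'.word rLeft z =
        if ∃ u ∈ A.leftList pos x, z = x * n + u then 1 else s.word rLeft z) ∧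
      s'.word rLCnt = Function.update (s.word rLCnt) x (A.leftList pos x).length ∧
      (∀ z, z ≤ x * n ∨ x * n + (A.leftList pos x).length < z →
        s'.word rLNbr z = s.word rLNbr z) ∧
      (∀ i (h : i < (A.leftList pos x).length),
        s'.word rLNbr (x * n + (i + 1)) = (A.leftList pos x)[i] + 1)) := by
  set L : ℕ → List (Fin n) := fun t => ((A.nbrs x).take t).filter fun u => pos x < pos u with hL
  have hLlen : L (A.nbrs x).length = A.leftList pos x := by
    simp [hL, AdjLists.leftList]
  refine (Runs.forNbrs A x 52 (fun t s' =>
      (∀ z, s'.word rAdj z = if ∃ u ∈ (A.nbrs x).take t, z = x * n + u then 1 else s.word rAdj z) ∧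
      (∀ z, s'.word rLeft z =
        if ∃ u ∈ L t, z = x * n + u then 1 else s.word rLeft z) ∧
      s'.word rLCnt = Function.update (s.word rLCnt) x (L t).length ∧
      (∀ z, z ≤ x * n ∨ x * n + (L t).length < z → s'.word rLNbr z = s.word rLNbr z) ∧
      (∀ i (h : i < (L t).length), s'.word rLNbr (x * n + (i + 1)) = (L t)[i] + 1))
    rfl (by simp) (by simp) (by simp) (by simp) (by simp) (by simp)
    (by simp) rfl rfl rfl hoff hent hx ?_ ?_ ?_ ?_).mono le_rfl ?_
  · intro j y s h
    simpa using h
  · intro j y s h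
    simpa using h
  · have : L 0 = [] := by simp [hL]
    simp [this, hcnt]
  · rintro j s' hj hs hu ⟨h1, h2, h3, h4, h5⟩
    set u : Fin n := (A.nbrs x)[j] with hu_def
    have hx' : s'.word rX 0 = x := by rw [hs.word rX rfl, hx]
    have hrow' : s'.word rRow 0 = x * n := by rw [hs.word rRow rfl, hrow]
    have hpos' : ∀ v : Fin n, s'.word rPos v = pos v := fun v => by rw [hs.word rPos rfl, hpos]
    have htake : (A.nbrs x).take (j + 1) = (A.nbrs x).take j ++ [u] := by
      rw [List.take_add_one]
      simp [hj, hu_def]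
    have hadj : ∀ z, Function.update (s'.word rAdj) (x * n + u) 1 z =
        if ∃ v ∈ (A.nbrs x).take (j + 1), z = x * n + v then 1 else s.word rAdj z := by
      intro z
      rw [Function.update_apply, h1]
      by_cases hz : z = x * n + u
      · rw [if_pos hz, if_pos ⟨u, by simp [htake], hz⟩]
      · simp only [htake, List.mem_append, List.mem_singleton, or_and_right, exists_or,
          exists_eq_left, hz, or_false, if_false]
    refine Runs.le (Runs.straight_seq rfl (Runs.cond (B₁ := 30) (fun hc => ?_) (fun hc => ?_)))
      (by simp)
    · simp [hu, hx', hpos'] at hc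
      have hLs : L (j + 1) = L j ++ [u] := by
        have : pos x < pos u := by omega
        simp [hL, htake, List.filter_append, this]
      refine Runs.straight rfl (by simp) ⟨?_, ?_, ?_, ?_, ?_⟩
      · simpa [hu, hrow'] using hadj
      · intro z
        simp [hu, hrow', h3, Function.update_apply]
        rw [h2]
        by_cases hz : z = x * n + u
        · rw [if_pos hz, if_pos ⟨u, by simp [hLs], hz⟩]
        · simp only [hLs, List.mem_append, List.mem_singleton, or_and_right, exists_or,
            exists_eq_left, hz, or_false, if_false]
      · simp [hx', h3, hLs]
      · intro z hz
        rw [hLs] at hz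
        simp at hz
        have hne : z ≠ x * n + ((L j).length + 1) := by omega
        simp [hu, hrow', hx', h3, hne]
        exact h4 z (by omega)
      · intro i hi
        simp [hu, hrow', hx', h3, Function.update_apply]
        simp only [hLs]
        simp [hLs] at hi
        rcases lt_or_eq_of_le hi with h | rfl
        · rw [List.getElem_append_left h, if_neg h.ne, h5 i h]
        · simp
    · simp [hu, hx', hpos', Nat.sub_eq_zero_iff_le] at hc
      have hLs : L (j + 1) = L j := by
        simp [hL, htake, List.filter_append, hc]
      rw [hLs]
      refine Runs.straight rfl (by simp) ⟨?_, ?_, ?_, ?_, ?_⟩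
      · simpa [hu, hrow'] using hadj
      · simpa using h2
      · simpa using h3
      · simpa using h4
      · simpa using h5
  · rintro s' - ⟨h1, h2, h3, h4, h5⟩
    rw [List.take_length] at h1
    simp only [hLlen] at h2 h3 h4 h5
    exact ⟨h1, h2, h3, h4, h5⟩

theorem _root_.AdjLists.start_mono {j k : ℕ} (hjk : j ≤ k) (hk : k ≤ n) :
    A.start j ≤ A.start k := by
  rw [A.start_eq_sum (hjk.trans hk), A.start_eq_sum hk]
  refine Finset.sum_le_sum_of_subset fun u => ?_
  simp
  omega

/-- The matrices have `n ^ 2` cells, but as the memory is zero-initialised only the cells of edges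
are written, and the cost is linear in `n` and the number of list entries. A left list has fewer
than `n` entries, so it fits into the row of its vertex after the cell `v * n`, which stays 0 and
later encodes "undefined". -/
theorem runs_hostTables {s : RamState} (hn : s.word 0 0 = n)
    (hoff : s.word 1 = loadArray A.offsets) (hent : s.word 2 = loadArray A.entries)
    (hpos : ∀ v : Fin n, s.word rPos v = pos v)
    (hz : ∀ a ∈ [rAdj, rLeft, rLNbr, rLCnt], ∀ z, s.word a z = 0) :
    Runs hostTables s (n * 80 + A.start n * 80 + 30) (HostTables A pos) := by
  classical
  refine Runs.le (Runs.straight_seq rfl ((Runs.forUpto_potential n (n * 60 + A.start n * 80)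
    (fun j r s' => s'.word rRow 0 = j * n ∧
      (∀ v : Fin n, v.val < j → s'.word rBase v = v * n) ∧
      ((∀ u v : Fin n, u.val < j → s'.word rAdj (u * n + v) = if G.Adj u v then 1 else 0) ∧
        ∀ z, j * n ≤ z → s'.word rAdj z = 0) ∧
      ((∀ u v : Fin n, u.val < j → s'.word rLeft (u * n + v) =
        if G.Adj u v ∧ pos u < pos v then 1 else 0) ∧ ∀ z, j * n ≤ z → s'.word rLeft z = 0) ∧
      ((∀ v : Fin n, v.val < j → s'.word rLCnt v = (A.leftList pos v).length) ∧
        ∀ v, j ≤ v → s'.word rLCnt v = 0) ∧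
      ((∀ v, s'.word rLNbr (v * n) = 0) ∧ (∀ (v : Fin n) i (h : i < (A.leftList pos v).length),
        v.val < j → s'.word rLNbr (v * n + (i + 1)) = (A.leftList pos v)[i] + 1) ∧
        ∀ z, j * n ≤ z → s'.word rLNbr z = 0) ∧
      r = (n - j) * 60 + (A.start n - A.start j) * 80) rfl ?_ ?_ ?_ ?_).mono le_rfl ?_)) ?_
  · intro s' h
    rw [WordExpr.eval, WordExpr.eval, h.word 0 rfl]
    simpa using hn
  · intro j r y s h
    simpa using h
  · simp only [List.mem_cons, List.not_mem_nil, or_false, forall_eq_or_imp, forall_eq] at hz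
    obtain ⟨h1, h2, h3, h4⟩ := hz
    simp [h1, h2, h3, h4, AdjLists.start]
  · rintro j r s' hj hs hjj ⟨h1, h2, ⟨h3, h3'⟩, ⟨h4, h4'⟩, ⟨h5, h5'⟩, ⟨h6, h6', h6''⟩, rfl⟩
    have hst := A.start_succ ⟨j, hj⟩
    have hst' := A.start_mono (show j + 1 ≤ n from hj) le_rfl
    simp only at hst
    set x : Fin n := ⟨j, hj⟩ with hx
    have hxj : (x : ℕ) = j := rfl
    have hn' : s'.word 0 0 = n := by rw [hs.word 0 rfl]; simpa using hn
    have hcase : ∀ v : Fin n, v.val < j + 1 → v.val < j ∨ v = x := by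
      intro v hv
      rcases lt_or_eq_of_le (Nat.lt_succ_iff.1 hv) with h | h
      · exact Or.inl h
      · exact Or.inr (Fin.ext h)
    have hnot : ∀ z (l : List (Fin n)), (j + 1) * n ≤ z → ¬ ∃ u ∈ l, z = x * n + u := by
      rintro z l hz' ⟨u, -, rfl⟩
      have := u.2
      simp only [hx, add_mul, one_mul] at hz'
      omega
    refine ⟨(A.nbrs x).length * 80 + 60, (n - (j + 1)) * 60 + (A.start n - A.start (j + 1)) * 80,
      ?_, ?_⟩
    · have : n - j = n - (j + 1) + 1 := by omega
      have h' : A.start n - A.start j = A.start n - A.start (j + 1) + (A.nbrs x).length := by omega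
      rw [this, h']
      ring_nf
      omega
    refine Runs.le (Runs.straight_seq rfl (Runs.straight_seq rfl (Runs.seq
      (runs_hostRow A pos x (s := _) ?_ ?_ ?_ ?_ ?_ ?_) (fun s₂ hs₂ h => Runs.straight rfl le_rfl
        ?_)))) ?_
    · simpa using hjj
    · simpa using h1
    · simp only [RamProgram.run, WordExpr.eval]
      simpa [hs.word 1 rfl] using hoff
    · simpa [hs.word 2 rfl] using hent
    · simpa [hs.word rPos rfl] using hpos
    · simpa using h5' j le_rfl
    · obtain ⟨g1, g2, g3, g4, g5⟩ := h
      have e1 : s₂.word rRow 0 = j * n := by rw [hs₂.word rRow rfl]; simpa using h1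
      have e0 : s₂.word 0 0 = n := by rw [hs₂.word 0 rfl]; simpa using hn'
      have e2 : s₂.word rBase = Function.update (s'.word rBase) j (j * n) := by
        rw [hs₂.word rBase rfl]
        simp [hjj, h1]
      have hlen := A.length_leftList_lt pos x
      simp [hjj] at g1 g2 g3 g4 g5
      refine ⟨?_, ?_, ⟨?_, ?_⟩, ⟨?_, ?_⟩, ⟨?_, ?_⟩, ⟨?_, ?_, ?_⟩, rfl⟩
      · simp [e0, e1]; ring
      · intro v hv
        simp [e2]
        rcases hcase v hv with h | rfl
        · rw [Function.update_of_ne h.ne, h2 v h]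
        · simp [hx]
      · intro u v hu
        simp [g1]
        rcases hcase u hu with h | rfl
        · rw [if_neg, h3 u v h]
          rintro ⟨w, -, he⟩
          rw [mul_add_inj, hxj] at he
          omega
        · rw [h3' _ (by simp [hx])]
          simp [A.mem_nbrs, Fin.val_inj]
      · intro z hz'
        simp [g1]
        rw [if_neg (hnot z _ hz'), h3']
        rw [add_mul] at hz'
        omega
      · intro u v hu
        simp [g2]
        rcases hcase u hu with h | rfl
        · rw [if_neg, h4 u v h]
          rintro ⟨w, -, he⟩
          rw [mul_add_inj, hxj] at he
          omega
        · rw [h4' _ (by simp [hx])]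
          simp [AdjLists.leftList, A.mem_nbrs, Fin.val_inj]
      · intro z hz'
        simp [g2]
        rw [if_neg (hnot z _ hz'), h4']
        rw [add_mul] at hz'
        omega
      · intro v hv
        simp [g3]
        rcases hcase v hv with h | rfl
        · rw [Function.update_of_ne h.ne, h5 v h]
        · simp [hx]
      · intro v hv
        simp [g3]
        rw [Function.update_of_ne (by simp [hx]; omega), h5' v (by omega)]
      · intro v
        simp
        rw [g4, h6]
        rcases le_or_gt v j with h | h
        · exact Or.inl (Nat.mul_le_mul_right n h)
        · right
          have : (j + 1) * n ≤ v * n := Nat.mul_le_mul_right n h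
          simp only [hxj, add_mul, one_mul] at this ⊢
          omega
      · intro v i hi hv
        simp
        rcases hcase v hv with h | rfl
        · rw [g4, h6' v i hi h]
          left
          have : (v + 1) * n ≤ j * n := Nat.mul_le_mul_right n h
          have := A.length_leftList_lt pos v
          simp only [hx, add_mul, one_mul] at *
          omega
        · exact g5 i hi
      · intro z hz'
        simp
        rw [add_mul, one_mul] at hz'
        rw [g4, h6'']
        · omega
        · right
          rw [hxj]
          omega
    · simp
      omega
  · rintro s' hs ⟨r, h1, h2, ⟨h3, h3'⟩, ⟨h4, h4'⟩, ⟨h5, h5'⟩, ⟨h6, h6', h6''⟩, -⟩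
    refine ⟨?_, fun v => h2 v v.2, fun u v => h3 u v u.2, fun u v => h4 u v u.2, fun v => h5 v v.2,
      fun v => h6 v, fun v i hi => h6' v i hi v.2⟩
    rw [hs.word 0 rfl]
    simpa using hn
  · simp
    omega

end

/-! ## Sums of powers of two -/

open scoped Classical in
/-- The number whose `i`-th binary digit, for `i < s`, is given by `p`. -/
noncomputable def bitSum (s : ℕ) (p : ℕ → Prop) : ℕ := ∑ i ∈ Finset.range s, if p i then 2 ^ i else 0

open scoped Classical in
theorem bitSum_succ (s : ℕ) (p : ℕ → Prop) :
    bitSum (s + 1) p = bitSum s p + if p s then 2 ^ s else 0 := by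
  simp [bitSum, Finset.sum_range_succ]

@[simp] theorem bitSum_zero (p : ℕ → Prop) : bitSum 0 p = 0 := by simp [bitSum]

theorem bitSum_lt (s : ℕ) (p : ℕ → Prop) : bitSum s p < 2 ^ s := by
  induction s with
  | zero => simp
  | succ s ih =>
    rw [bitSum_succ, pow_succ]
    split_ifs <;> omega

theorem testBit_bitSum (s : ℕ) (p : ℕ → Prop) (i : ℕ) :
    (bitSum s p).testBit i = true ↔ i < s ∧ p i := by
  induction s with
  | zero => simp
  | succ s ih =>
    rw [bitSum_succ]
    split_ifs with hp
    · rw [add_comm]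
      rcases lt_trichotomy i s with h | rfl | h
      · rw [Nat.testBit_two_pow_add_gt h, ih]
        simp [h, h.le]
      · rw [Nat.testBit_two_pow_add_eq, Nat.testBit_lt_two_pow (bitSum_lt _ _)]
        simp [hp]
      · rw [Nat.testBit_lt_two_pow]
        · simp; omega
        · calc 2 ^ s + bitSum s p < 2 ^ s + 2 ^ s := by have := bitSum_lt s p; omega
            _ = 2 ^ (s + 1) := by ring
            _ ≤ 2 ^ i := Nat.pow_le_pow_right (by norm_num) h
    · rw [add_zero, ih]
      constructor
      · exact fun h => ⟨by omega, h.2⟩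
      · refine fun h => ⟨lt_of_le_of_ne (by omega) ?_, h.2⟩
        rintro rfl
        exact hp h.2

theorem bitSum_congr {s : ℕ} {p q : ℕ → Prop} (h : ∀ i < s, p i ↔ q i) : bitSum s p = bitSum s q := by
  apply Nat.eq_of_testBit_eq
  intro i
  rw [Bool.eq_iff_iff, testBit_bitSum, testBit_bitSum]
  constructor
  · exact fun hi => ⟨hi.1, (h i hi.1).1 hi.2⟩
  · exact fun hi => ⟨hi.1, (h i hi.1).2 hi.2⟩

theorem bitSum_inj {s : ℕ} {p q : ℕ → Prop} : bitSum s p = bitSum s q ↔ ∀ i < s, p i ↔ q i := by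
  refine ⟨fun h i hi => ?_, bitSum_congr⟩
  have := congrArg (fun x => x.testBit i = true) h
  simpa [testBit_bitSum, hi] using this

theorem bitSum_testBit {s X : ℕ} (hX : X < 2 ^ s) : bitSum s (fun i => X.testBit i = true) = X := by
  apply Nat.eq_of_testBit_eq
  intro i
  rw [Bool.eq_iff_iff, testBit_bitSum]
  refine ⟨fun h => h.2, fun h => ⟨?_, h⟩⟩
  by_contra hi
  rw [Nat.testBit_lt_two_pow (hX.trans_le (Nat.pow_le_pow_right (by norm_num) (not_lt.1 hi)))] at h
  simp at h

theorem digit_two (X i : ℕ) : X / 2 ^ i % 2 = if X.testBit i = true then 1 else 0 := by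
  rw [Nat.testBit_eq_decide_div_mod_eq]
  have := Nat.mod_two_eq_zero_or_one (X / 2 ^ i)
  rcases this with h | h <;> simp [h]

/-! ## Tables for the pattern -/

notation "rS" => 26
notation "rSide" => 27
notation "rPow" => 28
notation "rMask" => 29
notation "rCap" => 30
notation "rBit" => 31
notation "rAcc" => 32
notation "rBitRow" => 36
notation "rCount" => 37
notation "rTok" => 38

/-- The vertices of the small side, listed by `σ`, that are adjacent to `v`, as a binary number. -/
noncomputable def Pattern.mask {m s : ℕ} (H : Pattern (Fin m)) (σ : Fin s → Fin m) (v : Fin m) : ℕ :=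
  bitSum s fun i => ∃ h : i < s, H.graph.Adj (σ ⟨i, h⟩) v

theorem Pattern.testBit_mask {m s : ℕ} (H : Pattern (Fin m)) (σ : Fin s → Fin m) (v : Fin m)
    (i : Fin s) : (H.mask σ v).testBit i = true ↔ H.graph.Adj (σ i) v := by
  simp [Pattern.mask, testBit_bitSum]

theorem Pattern.mask_lt {m s : ℕ} (H : Pattern (Fin m)) (σ : Fin s → Fin m) (v : Fin m) :
    H.mask σ v < 2 ^ s := bitSum_lt _ _

open scoped Classical in
/-- The number of vertices of the large side with a given set of neighbours. -/
noncomputable def Pattern.cap {m s : ℕ} (H : Pattern (Fin m)) (σ : Fin s → Fin m) (X : ℕ) : ℕ :=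
  (Finset.univ.filter fun t => t ∉ H.S ∧ H.mask σ t = X).card

/-- The map `σ` lists the vertices of the small side of `H`. -/
structure Pattern.Lists {m s : ℕ} (H : Pattern (Fin m)) (σ : Fin s → Fin m) : Prop where
  injective : Function.Injective σ
  mem : ∀ v, v ∈ H.S ↔ ∃ i, σ i = v

/-- The memory contains the small side `σ` and the masks of its vertices, the number of vertices of the
large side for every mask, the powers and binary digits of all numbers below `2 ^ s`. -/
structure PatternTables {m s : ℕ} (H : Pattern (Fin m)) (σ : Fin s → Fin m) (st : RamState) :
    Prop where
  size : st.word 0 1 = m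
  side : st.word rS 0 = s
  pow : ∀ i ≤ s, st.word rPow i = 2 ^ i
  cap : ∀ X, st.word rCap X = H.cap σ X
  row : ∀ X < 2 ^ s, st.word rBitRow X = X * s
  bit : ∀ X < 2 ^ s, ∀ i < s, st.word rBit (X * s + i) = if X.testBit i = true then 1 else 0
  tok : ∀ i : Fin s, st.word rTok i = H.mask σ (σ i)
  tok' : ∀ X < 2 ^ s, st.word rTok (s + X) = X

theorem PatternTables.congr {m s : ℕ} {H : Pattern (Fin m)} {σ : Fin s → Fin m}
    {st st' : RamState} (h : PatternTables H σ st)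
    (h' : ∀ a ∈ [0, rS, rPow, rCap, rBitRow, rBit, rTok], st'.word a = st.word a) :
    PatternTables H σ st' := by
  simp only [List.mem_cons, List.not_mem_nil, or_false, forall_eq_or_imp, forall_eq] at h'
  obtain ⟨h0, h1, h2, h3, h4, h5, h6⟩ := h'
  exact ⟨by rw [h0, h.size], by rw [h1, h.side], fun i hi => by rw [h2, h.pow i hi],
    fun X => by rw [h3, h.cap], fun X hX => by rw [h4, h.row X hX],
    fun X hX i hi => by rw [h5, h.bit X hX i hi], fun i => by rw [h6, h.tok],
    fun X hX => by rw [h6, h.tok' X hX]⟩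

/-- List the vertices of the small side. -/
def collectSide : RamProgram :=
  setV rS 0 ;;
  forUpto rI (.get 0 (.const 1))
    (.cond (.get 5 (wv rI)) (.setWord rSide (wv rS) (wv rI) ;; setV rS (wv rS + 1)) .skip)

/-- Compute powers of two. -/
def computePowers : RamProgram :=
  .setWord rPow 0 1 ;;
  forUpto rI (wv rS) (.setWord rPow (wv rI + 1) (.get rPow (wv rI) + .get rPow (wv rI)))

/-- Compute the masks of all vertices. -/
def computeMasks : RamProgram :=
  forUpto rI (wv rS)
    (setV rX (.get rSide (wv rI)) ;;
      forNbrs 3 4 rX rJ rU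
        (.setWord rMask (wv rU) (.get rMask (wv rU) + .get rPow (wv rI))))

/-- Count the vertices of the large side with every mask. -/
def computeCaps : RamProgram :=
  forUpto rI (.get 0 (.const 1))
    (.cond (.get 5 (wv rI)) .skip
      (.setWord rCap (.get rMask (wv rI)) (.get rCap (.get rMask (wv rI)) + 1)))

/-- Compute the binary digits. -/
def computeBits : RamProgram :=
  setV rAcc 0 ;;
  setV rCount 0 ;;
  forTuples 33 34 35 2 (wv rS)
    (forUpto rI (wv rS) (.setWord rBit (wv rAcc + wv rI) (.get 33 (wv rI))) ;;
      .setWord rBitRow (wv rCount) (wv rAcc) ;;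
      setV rCount (wv rCount + 1) ;;
      setV rAcc (wv rAcc + wv rS))

/-- Compute the masks of all tokens. -/
def computeTokens : RamProgram :=
  forUpto rI (wv rS) (.setWord rTok (wv rI) (.get rMask (.get rSide (wv rI)))) ;;
  forUpto rI (.get rPow (wv rS)) (.setWord rTok (wv rS + wv rI) (wv rI))

section

variable {m : ℕ} (H : Pattern (Fin m))

theorem runs_collectSide {st : RamState} (hm : st.word 0 1 = m)
    (hS : ∀ v : Fin m, st.word 5 v = if v ∈ H.S then 1 else 0) :
    Runs collectSide st (m * 40 + 20) (fun st' => ∃ (s : ℕ) (σ : Fin s → Fin m), H.Lists σ ∧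
      st'.word rS 0 = s ∧ ∀ i : Fin s, st'.word rSide i = σ i) := by
  refine Runs.le (Runs.straight_seq rfl ((Runs.forUpto m 25 (fun j st' => ∃ l : List (Fin m),
    l.Nodup ∧ (∀ v, v ∈ l ↔ v ∈ H.S ∧ v.val < j) ∧ st'.word rS 0 = l.length ∧
    ∀ i (h : i < l.length), st'.word rSide i = (l[i] : Fin m)) rfl ?_ ?_ ?_ ?_).mono le_rfl ?_)) ?_
  · intro s' h
    rw [WordExpr.eval, WordExpr.eval, h.word 0 rfl]
    simpa using hm
  · intro j x s h
    simpa using h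
  · exact ⟨[], by simp⟩
  · rintro j s' hj hs hjj ⟨l, h1, h2, h3, h4⟩
    have hS' : s'.word 5 j = if (⟨j, hj⟩ : Fin m) ∈ H.S then 1 else 0 := by
      rw [hs.word 5 rfl]; simpa using hS ⟨j, hj⟩
    have hlt : ∀ v : Fin m, v.val < j + 1 ↔ v.val < j ∨ v = ⟨j, hj⟩ := by
      intro v
      rw [Fin.ext_iff]
      simp only
      omega
    refine Runs.le (Runs.cond (B₁ := 15) (fun hc => ?_) (fun hc => ?_)) (by simp)
    · simp [hjj, hS'] at hc
      have hnot : (⟨j, hj⟩ : Fin m) ∉ l := by simp [h2]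
      refine Runs.straight rfl (by simp) ⟨l ++ [⟨j, hj⟩], ?_, ?_, ?_, ?_⟩
      · rw [List.nodup_append]
        refine ⟨h1, by simp, ?_⟩
        rintro a ha b hb rfl
        simp at hb
        exact hnot (hb ▸ ha)
      · intro v
        rw [List.mem_append, h2, hlt, List.mem_singleton]
        constructor
        · rintro (h | rfl)
          · exact ⟨h.1, Or.inl h.2⟩
          · exact ⟨hc, Or.inr rfl⟩
        · rintro ⟨h, h' | h'⟩
          · exact Or.inl ⟨h, h'⟩
          · exact Or.inr h'
      · simp [h3]
      · intro i hi
        simp at hi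
        simp [h3, hjj, Function.update_apply]
        rcases lt_or_eq_of_le hi with h | rfl
        · simp [h, h.ne, h4 i h]
        · simp
    · simp [hjj, hS'] at hc
      refine Runs.straight rfl (by simp) ⟨l, h1, ?_, h3, h4⟩
      intro v
      rw [h2, hlt]
      constructor
      · exact fun h => ⟨h.1, Or.inl h.2⟩
      · rintro ⟨h, h' | rfl⟩
        · exact ⟨h, h'⟩
        · exact absurd h hc
  · rintro s' - ⟨l, h1, h2, h3, h4⟩
    refine ⟨l.length, fun i => l[i], ⟨fun i j hij => ?_, fun v => ?_⟩, h3, fun i => h4 i i.2⟩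
    · exact Fin.ext ((h1.getElem_inj_iff).1 hij)
    · have : v ∈ H.S ↔ v ∈ l := by simp [h2]
      rw [this, List.mem_iff_getElem]
      exact ⟨fun ⟨i, hi, he⟩ => ⟨⟨i, hi⟩, he⟩, fun ⟨i, he⟩ => ⟨i, i.2, he⟩⟩
  · simp
    omega

theorem runs_computePowers {s : ℕ} {st : RamState} (hs : st.word rS 0 = s) :
    Runs computePowers st (s * 40 + 20) (fun st' => ∀ i ≤ s, st'.word rPow i = 2 ^ i) := by
  refine Runs.le (Runs.straight_seq rfl (Runs.forUpto s 20
    (fun j st' => ∀ i ≤ j, st'.word rPow i = 2 ^ i) rfl ?_ ?_ ?_ ?_)) ?_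
  · intro s' h
    rw [WordExpr.eval, WordExpr.eval, h.word rS rfl]
    simpa using hs
  · intro j x s h
    simpa using h
  · simp
  · rintro j s' hj hs hjj h
    refine Runs.straight rfl (by simp) fun i hi => ?_
    simp [hjj, Function.update_apply]
    split_ifs with he
    · rw [h j le_rfl, he]; ring
    · exact h i (by omega)
  · simp
    omega

open scoped Classical in
-- Round `j` adds `2 ^ j` to the neighbours of `σ j`. The lists have no repetitions, so no binary
-- digit is added twice.
theorem runs_computeMasks {s : ℕ} {σ : Fin s → Fin m} {st : RamState} (B : AdjLists H.graph)
    (hs : st.word rS 0 = s) (hoff : st.word 3 = loadArray B.offsets)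
    (hent : st.word 4 = loadArray B.entries) (hσ : ∀ i : Fin s, st.word rSide i = σ i)
    (hpow : ∀ i ≤ s, st.word rPow i = 2 ^ i) (hz : ∀ z, st.word rMask z = 0) :
    Runs computeMasks st (s * (m * 50 + 50) + 20) (fun st' => ∀ v : Fin m,
      st'.word rMask v = H.mask σ v) := by
  refine Runs.le ((Runs.forUpto s (m * 50 + 25) (fun j st' => ∀ v : Fin m, st'.word rMask v =
    bitSum j fun i => ∃ h : i < s, H.graph.Adj (σ ⟨i, h⟩) v) rfl ?_ ?_ ?_ ?_).mono le_rfl ?_) ?_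
  rotate_left 3
  · rintro j s' hj hs' hjj h
    set x := σ ⟨j, hj⟩ with hx
    refine Runs.le (Runs.straight_seq rfl ((Runs.forNbrs B x 20 (fun t s₂ => ∀ v : Fin m,
      s₂.word rMask v = s'.word rMask v + if v ∈ (B.nbrs x).take t then 2 ^ j else 0)
      rfl (by simp) (by simp) (by simp) (by simp) (by simp) (by simp)
      (by simp) rfl rfl rfl ?_ ?_ ?_ ?_ ?_ ?_ ?_).mono le_rfl ?_)) ?_
    · simp [hs'.word 3 rfl, hoff]
    · simp [hs'.word 4 rfl, hent]
    · simp [hjj, hs'.word rSide rfl, hx, ← hσ]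
    · intro t y s h
      simpa using h
    · intro t y s h
      simpa using h
    · simp
    · intro t s₂ ht hs₂ hu h2
      set u : Fin m := (B.nbrs x)[t] with hu_def
      have hj2 : s₂.word rI 0 = j := by rw [hs₂.word rI rfl]; simpa using hjj
      have hp2 : s₂.word rPow j = 2 ^ j := by
        rw [hs₂.word rPow rfl]; simp [hs'.word rPow rfl, hpow j hj.le]
      have hut : u ∉ (B.nbrs x).take t := by
        have := B.nodup x
        rw [← List.take_append_drop t (B.nbrs x), List.nodup_append] at this
        intro hmem
        refine this.2.2 u hmem u ?_ rfl
        rw [List.drop_eq_getElem_cons ht]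
        exact List.mem_cons_self
      have htake : ∀ v, v ∈ (B.nbrs x).take (t + 1) ↔ v ∈ (B.nbrs x).take t ∨ v = u := by
        intro v
        rw [List.take_add_one, List.mem_append]
        simp [ht, hu_def]
      refine Runs.straight rfl (by simp) fun v => ?_
      simp [hu, hj2, hp2, Function.update_apply, Fin.val_inj]
      rcases eq_or_ne v u with rfl | hne
      · simp [htake, h2, hut]
      · simp [htake, h2, hne]
    · rintro s₂ - h2 v
      rw [h2, h, bitSum_succ, List.take_length]
      simp [B.mem_nbrs, hj, hx]
    · have := B.length_nbrs_lt x
      simp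
      omega
  · exact fun _ _ h => h
  · simp
    ring_nf
    omega
  · intro s' h
    rw [WordExpr.eval, WordExpr.eval, h.word rS rfl, hs]
  · intro j x s h
    simpa using h
  · simpa using fun v : Fin m => hz v

theorem runs_computeCaps {s : ℕ} {σ : Fin s → Fin m} {st : RamState} (hm : st.word 0 1 = m)
    (hS : ∀ v : Fin m, st.word 5 v = if v ∈ H.S then 1 else 0)
    (hmask : ∀ v : Fin m, st.word rMask v = H.mask σ v) (hz : ∀ z, st.word rCap z = 0) :
    Runs computeCaps st (m * 40 + 20) (fun st' => ∀ X, st'.word rCap X = H.cap σ X) := by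
  classical
  refine Runs.le ((Runs.forUpto m 25 (fun j st' => ∀ X, st'.word rCap X =
    (Finset.univ.filter fun t : Fin m => (t ∉ H.S ∧ H.mask σ t = X) ∧ t.val < j).card)
    rfl ?_ ?_ ?_ ?_).mono le_rfl ?_) ?_
  · intro s' h
    rw [WordExpr.eval, WordExpr.eval, h.word 0 rfl]
    simpa using hm
  · intro j x s h
    simpa using h
  · simpa using hz
  · rintro j s' hj hs hjj h
    have hS' : s'.word 5 j = if (⟨j, hj⟩ : Fin m) ∈ H.S then 1 else 0 := by
      rw [hs.word 5 rfl]; simpa using hS ⟨j, hj⟩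
    have hmask' : s'.word rMask j = H.mask σ ⟨j, hj⟩ := by
      rw [hs.word rMask rfl]; simpa using hmask ⟨j, hj⟩
    have hlt : ∀ v : Fin m, v.val < j + 1 ↔ v.val < j ∨ v = ⟨j, hj⟩ := by
      intro v
      rw [Fin.ext_iff]
      simp only
      omega
    refine Runs.le (Runs.cond (B₁ := 15) (fun hc => ?_) (fun hc => ?_)) (by simp)
    · simp [hjj, hS'] at hc
      refine Runs.straight rfl (by simp) fun X => ?_
      simp only [RamProgram.run, h X]
      congr 1
      ext t
      simp only [Finset.mem_filter, Finset.mem_univ, true_and, hlt]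
      refine ⟨fun h => ⟨h.1, Or.inl h.2⟩, ?_⟩
      rintro ⟨h, h' | rfl⟩
      · exact ⟨h, h'⟩
      · exact absurd hc h.1
    · simp [hjj, hS'] at hc
      refine Runs.straight rfl (by simp) fun X => ?_
      simp [hjj, hmask', Function.update_apply, h, -Order.lt_add_one_iff]
      split_ifs with he
      · subst he
        have : (Finset.univ.filter fun t : Fin m => (t ∉ H.S ∧ H.mask σ t = H.mask σ ⟨j, hj⟩) ∧
            t.val < j + 1) = insert ⟨j, hj⟩ (Finset.univ.filter fun t : Fin m =>
              (t ∉ H.S ∧ H.mask σ t = H.mask σ ⟨j, hj⟩) ∧ t.val < j) := by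
          ext t
          simp only [Finset.mem_filter, Finset.mem_univ, true_and, hlt, Finset.mem_insert]
          constructor
          · rintro ⟨h, h' | h'⟩
            · exact Or.inr ⟨h, h'⟩
            · exact Or.inl h'
          · rintro (rfl | h)
            · exact ⟨⟨hc, rfl⟩, Or.inr rfl⟩
            · exact ⟨h.1, Or.inl h.2⟩
        rw [this, Finset.card_insert_of_notMem (by simp)]
      · congr 1
        ext t
        simp only [Finset.mem_filter, Finset.mem_univ, true_and, hlt]
        refine ⟨fun h => ⟨h.1, Or.inl h.2⟩, ?_⟩
        rintro ⟨h, h' | rfl⟩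
        · exact ⟨h, h'⟩
        · exact absurd h.2.symm he
  · rintro s' - h X
    rw [h]
    simp [Pattern.cap]
  · simp
    omega

/-- Integer registers allow neither division nor multiplication. The digits of all `X < 2 ^ s` are
obtained by enumerating the digit sequences in numerical order, while `rCount` follows `X` and
`rAcc` follows `X * s` by additions. -/
theorem runs_computeBits {s : ℕ} {st : RamState} (hs : st.word rS 0 = s) :
    Runs computeBits st (2 ^ s * (s * 100 + 70) + s * 20 + 30) (fun st' =>
      (∀ X < 2 ^ s, st'.word rBitRow X = X * s) ∧ ∀ X < 2 ^ s, ∀ i < s,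
        st'.word rBit (X * s + i) = if X.testBit i = true then 1 else 0) := by
  refine Runs.le (Runs.straight_seq rfl (Runs.straight_seq rfl ((Runs.forTuples 2 s (s * 30 + 40)
    (fun X st' => st'.word rAcc 0 = X * s ∧ st'.word rCount 0 = X ∧
      (∀ Y < X, st'.word rBitRow Y = Y * s) ∧ ∀ Y < X, ∀ i < s,
        st'.word rBit (Y * s + i) = if Y.testBit i = true then 1 else 0)
    (by simp) (by simp) (by simp) (by norm_num) rfl ?_ ?_ ?_ ?_ ?_).mono le_rfl ?_))) ?_
  · intro s' h
    rfl
  · intro s' h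
    rw [WordExpr.eval, WordExpr.eval, h.word rS rfl]
    simpa using hs
  · intro x s₁ s₂ h _ h'
    simpa [h rAcc, h rCount, h rBitRow, h rBit] using h'
  · simp
  · rintro X s' hX hs' hd ⟨h1, h2, h3, h4⟩
    have hS : s'.word rS 0 = s := by rw [hs'.word rS rfl]; simpa using hs
    refine Runs.le (Runs.seq (Runs.forUpto s 11 (fun i st' =>
      (∀ z < X * s, st'.word rBit z = s'.word rBit z) ∧ ∀ i' < i,
        st'.word rBit (X * s + i') = if X.testBit i' = true then 1 else 0) rfl ?_ ?_ ?_ ?_)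
      (fun s₂ hs₂ h => Runs.straight rfl le_rfl ?_)) ?_
    · intro s₂ h
      rw [WordExpr.eval, WordExpr.eval, h.word rS rfl, hS]
    · intro j x s h
      simpa using h
    · simp
    · rintro i s₂ hi hs₂ hii ⟨g1, g2⟩
      have hacc : s₂.word rAcc 0 = X * s := by rw [hs₂.word rAcc rfl, h1]
      have hdig : s₂.word 33 i = if X.testBit i = true then 1 else 0 := by
        rw [hs₂.word 33 rfl, hd i hi, digit_two]
      refine Runs.straight rfl (by simp) ⟨fun z hz => ?_, fun i' hi' => ?_⟩
      · have : z ≠ X * s + i := by omega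
        simp [hacc, hii, this, g1 z hz]
      · simp [hacc, hii, hdig, Function.update_apply]
        split_ifs with h5 h6 h6
        · rfl
        · rw [h5] at *; contradiction
        · rw [h5] at *; contradiction
        · rfl
        all_goals rw [g2 i' (by omega)]; simp [*]
    · obtain ⟨g1, g2⟩ := h
      have e1 : s₂.word rAcc 0 = X * s := by rw [hs₂.word rAcc rfl, h1]
      have e2 : s₂.word rCount 0 = X := by rw [hs₂.word rCount rfl, h2]
      have e3 : s₂.word rBitRow = s'.word rBitRow := hs₂.word rBitRow rfl
      have e4 : s₂.word rS 0 = s := by rw [hs₂.word rS rfl, hS]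
      refine ⟨by simp [e1, e4]; ring, by simp [e2], fun Y hY => ?_, fun Y hY i hi => ?_⟩
      · simp [e1, e2, e3, Function.update_apply]
        split_ifs with he
        · rw [he]
        · exact h3 Y (by omega)
      · simp
        rcases lt_or_eq_of_le (Nat.lt_succ_iff.1 hY) with h | rfl
        · rw [g1, h4 Y h i hi]
          calc Y * s + i < (Y + 1) * s := by rw [add_mul]; omega
            _ ≤ X * s := Nat.mul_le_mul_right s h
        · exact g2 i hi
    · simp
      omega
  · rintro s' - ⟨-, -, h3, h4⟩
    exact ⟨h3, h4⟩
  · simp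
    have : 2 ^ s * (s * 30 + 40 + s * 43 + 2 + 15) ≤ 2 ^ s * (s * 100 + 70) :=
      Nat.mul_le_mul le_rfl (by omega)
    omega

theorem runs_computeTokens {s : ℕ} {σ : Fin s → Fin m} {st : RamState}
    (hs : st.word rS 0 = s) (hσ : ∀ i : Fin s, st.word rSide i = σ i)
    (hmask : ∀ v : Fin m, st.word rMask v = H.mask σ v) (hpow : st.word rPow s = 2 ^ s) :
    Runs computeTokens st (2 ^ s * 40 + s * 40 + 30) (fun st' =>
      (∀ i : Fin s, st'.word rTok i = H.mask σ (σ i)) ∧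
      ∀ X < 2 ^ s, st'.word rTok (s + X) = X) := by
  refine Runs.le (Runs.seq (Runs.forUpto s 20 (fun j st' => ∀ i : Fin s, i.val < j →
    st'.word rTok i = H.mask σ (σ i)) rfl ?_ ?_ ?_ ?_) (fun s₁ hs₁ h1 => (Runs.forUpto (2 ^ s) 20
      (fun j st' => (∀ i : Fin s, st'.word rTok i = H.mask σ (σ i)) ∧
        ∀ X < j, st'.word rTok (s + X) = X) rfl ?_ ?_ ?_ ?_))) ?_
  · intro s' h
    rw [WordExpr.eval, WordExpr.eval, h.word rS rfl, hs]
  · intro j x s h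
    simpa using h
  · simp
  · rintro j s' hj hs' hjj h
    have hσ' : s'.word rSide j = σ ⟨j, hj⟩ := by rw [hs'.word rSide rfl]; simpa using hσ ⟨j, hj⟩
    have hm' : s'.word rMask (σ ⟨j, hj⟩) = H.mask σ (σ ⟨j, hj⟩) := by rw [hs'.word rMask rfl, hmask]
    refine Runs.straight rfl (by simp) fun i hi => ?_
    simp [hjj, hσ', hm', Function.update_apply]
    split_ifs with he
    · subst he; rfl
    · exact h i (by omega)
  · intro s' h
    rw [WordExpr.eval, WordExpr.eval, WordExpr.eval, h.word rPow rfl, h.word rS rfl,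
      hs₁.word rPow rfl, hs₁.word rS rfl, hs, hpow]
  · intro j x s h
    simpa using h
  · exact ⟨fun i => h1 i i.2, by simp⟩
  · rintro j s' hj hs' hjj ⟨g1, g2⟩
    have hS : s'.word rS 0 = s := by rw [hs'.word rS rfl, hs₁.word rS rfl, hs]
    refine Runs.straight rfl (by simp) ⟨fun i => ?_, fun X hX => ?_⟩
    · have : (i : ℕ) ≠ s + j := by omega
      simp [hjj, hS, this, g1]
    · simp [hjj, hS, Function.update_apply]
      split_ifs with he
      · exact he.symm
      · exact g2 X (by omega)
  · simp
    omega

end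

/-- Compute the tables of the pattern. -/
def patternTables : RamProgram :=
  collectSide ;; computePowers ;; computeMasks ;; computeCaps ;; computeBits ;; computeTokens

theorem runs_patternTables {m : ℕ} (H : Pattern (Fin m)) (B : AdjLists H.graph) {st : RamState}
    (hm : st.word 0 1 = m) (hoff : st.word 3 = loadArray B.offsets)
    (hent : st.word 4 = loadArray B.entries)
    (hS : ∀ v : Fin m, st.word 5 v = if v ∈ H.S then 1 else 0)
    (hz : ∀ a ∈ [rMask, rCap], ∀ z, st.word a z = 0) :
    Runs patternTables st ((m + 1) * (H.S.card + 1) * 1000 + 2 ^ H.S.card * (H.S.card + 1) * 150)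
      (fun st' => ∃ (s : ℕ) (σ : Fin s → Fin m), H.Lists σ ∧ PatternTables H σ st') := by
  simp only [List.mem_cons, List.not_mem_nil, or_false, forall_eq_or_imp, forall_eq] at hz
  obtain ⟨hz1, hz2⟩ := hz
  have hcard : ∀ {s : ℕ} {σ : Fin s → Fin m}, H.Lists σ → s = H.S.card := by
    intro s σ h
    have : H.S = Finset.univ.map ⟨σ, h.injective⟩ := by
      ext v
      simp [h.mem]
    rw [this]
    simp
  set s := H.S.card with hs_def
  refine Runs.le (Runs.seq (runs_collectSide H hm hS) (fun s₁ h₁ hq => ?_)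
    (B₂ := (s * 40 + 20) + ((s * (m * 50 + 50) + 20) + ((m * 40 + 20) +
      ((2 ^ s * (s * 100 + 70) + s * 20 + 30) + (2 ^ s * 40 + s * 40 + 30)))))) ?_
  · obtain ⟨s', σ, hl, hS₁, hσ₁⟩ := hq
    have hs' := hcard hl
    rw [← hs']
    refine Runs.seq (runs_computePowers hS₁) (fun s₂ h₂ hpow₂ => ?_)
    have hS₂ : s₂.word rS 0 = s' := by rw [h₂.word rS rfl, hS₁]
    have hσ₂ : ∀ i : Fin s', s₂.word rSide i = σ i := fun i => by rw [h₂.word rSide rfl, hσ₁]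
    refine Runs.seq (runs_computeMasks H B hS₂ (by rw [h₂.word 3 rfl, h₁.word 3 rfl, hoff])
      (by rw [h₂.word 4 rfl, h₁.word 4 rfl, hent]) hσ₂ hpow₂
      (fun z => by rw [h₂.word rMask rfl, h₁.word rMask rfl, hz1])) (fun s₃ h₃ hmask₃ => ?_)
    refine Runs.seq (runs_computeCaps H (σ := σ)
      (by rw [h₃.word 0 rfl, h₂.word 0 rfl, h₁.word 0 rfl, hm])
      (fun v => by rw [h₃.word 5 rfl, h₂.word 5 rfl, h₁.word 5 rfl, hS]) hmask₃
      (fun z => by rw [h₃.word rCap rfl, h₂.word rCap rfl, h₁.word rCap rfl, hz2]))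
      (fun s₄ h₄ hcap₄ => ?_)
    refine Runs.seq (runs_computeBits (s := s') (by rw [h₄.word rS rfl, h₃.word rS rfl, hS₂]))
      (fun s₅ h₅ hbit₅ => ?_)
    have hS₅ : s₅.word rS 0 = s' := by
      rw [h₅.word rS rfl, h₄.word rS rfl, h₃.word rS rfl, hS₂]
    have hpow₅ : ∀ i ≤ s', s₅.word rPow i = 2 ^ i := fun i hi => by
      rw [h₅.word rPow rfl, h₄.word rPow rfl, h₃.word rPow rfl, hpow₂ i hi]
    refine (runs_computeTokens H (σ := σ) hS₅
      (fun i => by rw [h₅.word rSide rfl, h₄.word rSide rfl, h₃.word rSide rfl, hσ₂])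
      (fun v => by rw [h₅.word rMask rfl, h₄.word rMask rfl, hmask₃]) (hpow₅ s' le_rfl)).mono
      le_rfl fun s₆ h₆ htok₆ => ⟨s', σ, hl, ⟨?_, ?_, ?_, ?_, ?_, ?_, htok₆.1, htok₆.2⟩⟩
    · rw [h₆.word 0 rfl, h₅.word 0 rfl, h₄.word 0 rfl, h₃.word 0 rfl, h₂.word 0 rfl,
        h₁.word 0 rfl, hm]
    · rw [h₆.word rS rfl, hS₅]
    · exact fun i hi => by rw [h₆.word rPow rfl, hpow₅ i hi]
    · exact fun X => by rw [h₆.word rCap rfl, h₅.word rCap rfl, hcap₄]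
    · exact fun X hX => by rw [h₆.word rBitRow rfl, hbit₅.1 X hX]
    · exact fun X hX i hi => by rw [h₆.word rBit rfl, hbit₅.2 X hX i hi]
  · have : 0 < 2 ^ s := by positivity
    generalize 2 ^ s = p at *
    nlinarith [Nat.zero_le (p * s), Nat.zero_le (m * s)]

/-! ## Words of tokens

A word of tokens describes the initial part of an ordering of a pattern, up to exchanging vertices of
the large side that have the same neighbours: the token `i < s` stands for the `i`-th vertex of the
small side, and the token `s + X` for a vertex of the large side with the set `X` of neighbours. The
remaining vertices of the large side are placed at the end: they are represented by the tokens
`s, …, s + 2 ^ s - 1`, some of which may be absent. -/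

/-- The data of a pattern that are needed to interpret words of tokens. -/
structure TokenData where
  /-- the size of the small side -/
  s : ℕ
  /-- the bound for the numbers of left neighbours -/
  k : ℕ
  /-- the length of words -/
  L : ℕ
  /-- the neighbours of a token in the small side -/
  nb : ℕ → ℕ
  /-- the multiplicities of the tokens of the large side -/
  cap : ℕ → ℕ

namespace TokenData

variable (D : TokenData)

/-- The number of tokens. -/
def base : ℕ := D.s + 2 ^ D.s

/-- The number of positions. -/
def len : ℕ := D.L + 2 ^ D.s

/-- Adjacency of tokens. -/
def Adj (y z : ℕ) : Prop :=
  if z < D.s then (D.nb y).testBit z = true else y < D.s ∧ (D.nb z).testBit y = true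

/-- Append the tokens of the large side to a word. -/
def extend (w : ℕ → ℕ) (p : ℕ) : ℕ := if p < D.L then w p else D.s + (p - D.L)

/-- The number of occurrences of a token. -/
def occ (u : ℕ → ℕ) (y : ℕ) : ℕ := ((Finset.range D.L).filter fun p => u p = y).card

/-- The position `p` is occupied by a vertex. -/
def Present (u : ℕ → ℕ) (p : ℕ) : Prop :=
  p < D.L ∨ D.occ u (D.s + (p - D.L)) < D.cap (p - D.L)

open scoped Classical in
/-- The number of left neighbours of a position. -/
noncomputable def leftDeg (u : ℕ → ℕ) (p : ℕ) : ℕ :=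
  ((Finset.range p).filter fun q => D.Adj (u q) (u p)).card

/-- The word describes a degenerate ordering. -/
structure Valid (u : ℕ → ℕ) : Prop where
  occ_eq_one : ∀ i < D.s, D.occ u i = 1
  occ_le_cap : ∀ X < 2 ^ D.s, X ≠ 0 → D.occ u (D.s + X) ≤ D.cap X
  leftDeg_le : ∀ p < D.len, D.Present u p → D.leftDeg u p ≤ D.k

/-- The vertex `i` of the small side is in the closed left neighbourhood of the position `p`. -/
def Cov (u : ℕ → ℕ) (p i : ℕ) : Prop :=
  D.Present u p ∧ (u p = i ∨ ∃ q < p, u q = i ∧ D.Adj (u q) (u p))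

/-- The small side is covered by `k` closed left neighbourhoods. -/
def Coverable (u : ℕ → ℕ) (k : ℕ) : Prop :=
  ∃ C : ℕ → ℕ, (∀ j < k, C j < D.len) ∧ ∀ i < D.s, ∃ j < k, D.Cov u (C j) i

end TokenData

/-! ## Computation of the cover number -/

notation "rL" => 41
notation "rLL" => 42
notation "rC" => 43
notation "rWord" => 44
notation "rOcc" => 48
notation "rBad" => 49
notation "rPres" => 50
notation "rF" => 51
notation "rFRow" => 52
notation "rLd" => 53
notation "rA" => 54
notation "rFlag" => 55
notation "rMiss" => 59
notation "rHit" => 60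
notation "rFound" => 61
notation "rY" => 62

/-- The binary digit `i` of the neighbourhood of the token `y`. -/
abbrev tokenBit (y i : WordExpr) : WordExpr := .get rBit (.get rBitRow (.get rTok y) + i)

/-- Are the tokens in `rU` and `rX` adjacent? -/
def tokenAdj : RamProgram :=
  .cond (wv rS - wv rX) (setV rA (tokenBit (wv rU) (wv rX)))
    (.cond (wv rS - wv rU) (setV rA (tokenBit (wv rX) (wv rU))) (setV rA 0))

/-- The body of the loop over the earlier positions in `leftSet`. -/
def leftSetStep : RamProgram :=
  setV rU (.get rWord (wv rJ)) ;;
  tokenAdj ;;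
  .cond (wv rA)
    (setV rLd (wv rLd + 1) ;;
      .cond (wv rS - wv rU) (.setWord rF (.get rFRow (wv rI) + wv rU) 1) .skip)
    .skip

/-- Compute the closed left neighbourhood of the position in `rI`. -/
def leftSet : RamProgram :=
  setV rX (.get rWord (wv rI)) ;;
  forUpto rJ (wv rS) (.setWord rF (.get rFRow (wv rI) + wv rJ) 0) ;;
  .cond (.get rPres (wv rI))
    (setV rLd 0 ;;
      .cond (wv rS - wv rX) (.setWord rF (.get rFRow (wv rI) + wv rX) 1) .skip ;;
      forUpto rJ (wv rI) leftSetStep ;;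
      setV rBad (wv rBad + (wv rLd - wv rK)))
    .skip

/-- Search for a cover. -/
def searchCover : RamProgram :=
  setV rFlag 1 ;;
  .loop (wv rFlag)
    (setV rFound 0 ;;
      forTuples 56 57 58 (wv rLL) (wv rC)
        (setV rMiss 0 ;;
          forUpto rI (wv rS)
            (setV rHit 0 ;;
              forUpto rJ (wv rC)
                (setV rHit (wv rHit + .get rF (.get rFRow (.get 56 (wv rJ)) + wv rI))) ;;
              .cond (wv rHit) .skip (setV rMiss 1)) ;;
          .cond (wv rMiss) .skip (setV rFound 1)) ;;
      .cond (wv rFound) (setV rFlag 0) (setV rC (wv rC + 1)))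

/-- Count the occurrences of all tokens. -/
def countTokens : RamProgram :=
  forUpto rI (wv rL) (.setWord rWord (wv rI) (.get 45 (wv rI))) ;;
  forUpto rI (wv rY) (.setWord rOcc (wv rI) 0) ;;
  forUpto rI (wv rL) (.setWord rOcc (.get rWord (wv rI)) (.get rOcc (.get rWord (wv rI)) + 1))

/-- Compare the numbers of occurrences with the multiplicities. -/
def checkCounts : RamProgram :=
  setV rBad 0 ;;
  forUpto rI (wv rS) (setV rBad (wv rBad + distExpr (.get rOcc (wv rI)) 1)) ;;
  forUpto rI (.get rPow (wv rS))
    (.cond (wv rI)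
        (setV rBad (wv rBad + (.get rOcc (wv rS + wv rI) - .get rCap (wv rI)))) .skip ;;
      .setWord rPres (wv rL + wv rI) (.get rCap (wv rI) - .get rOcc (wv rS + wv rI)))

/-- Process one word. -/
def checkWord : RamProgram :=
  countTokens ;; checkCounts ;; forUpto rI (wv rLL) leftSet ;; .cond (wv rBad) .skip searchCover

/-- Prepare the enumeration of all words. -/
def prepareWords : RamProgram :=
  setV rL 0 ;;
  forUpto rI (wv rK + 1) (setV rL (wv rL + wv rS)) ;;
  setV rLL (wv rL + .get rPow (wv rS)) ;;
  setV rY (wv rS + .get rPow (wv rS)) ;;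
  setV rC 1 ;;
  forUpto rI (.get rPow (wv rS)) (.setWord rWord (wv rL + wv rI) (wv rS + wv rI)) ;;
  setV rAcc 0 ;;
  forUpto rI (wv rLL) (.setWord rFRow (wv rI) (wv rAcc) ;; setV rAcc (wv rAcc + wv rS)) ;;
  forUpto rI (wv rL) (.setWord rPres (wv rI) 1)

/-- Compute a number `c` such that in all degenerate orderings of the pattern, the small side is
covered by `c` closed left neighbourhoods. -/
def coverBound : RamProgram :=
  prepareWords ;; forTuples 45 46 47 (wv rY) (wv rL) checkWord

/-- The memory contains the data `D`. -/
structure CoverEnv (D : TokenData) (st : RamState) : Prop where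
  side : st.word rS 0 = D.s
  bound : st.word rK 0 = D.k
  pow : st.word rPow D.s = 2 ^ D.s
  cap : ∀ X, st.word rCap X = D.cap X
  row : ∀ X < 2 ^ D.s, st.word rBitRow X = X * D.s
  bit : ∀ X < 2 ^ D.s, ∀ i < D.s,
    st.word rBit (X * D.s + i) = if X.testBit i = true then 1 else 0
  tok : ∀ y < D.base, st.word rTok y = D.nb y
  tok_lt : ∀ y < D.base, D.nb y < 2 ^ D.s
  length : st.word rL 0 = D.L
  length' : st.word rLL 0 = D.len
  tokens : st.word rY 0 = D.base
  frow : ∀ p < D.len, st.word rFRow p = p * D.s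

theorem CoverEnv.congr {D : TokenData} {st st' : RamState} (h : CoverEnv D st)
    (h' : ∀ a ∈ [rS, rK, rPow, rCap, rBitRow, rBit, rTok, rL, rLL, rY, rFRow],
      st'.word a = st.word a) : CoverEnv D st' := by
  simp only [List.mem_cons, List.not_mem_nil, or_false, forall_eq_or_imp, forall_eq] at h'
  obtain ⟨h1, h2, h3, h4, h5, h6, h7, h8, h9, h10, h11⟩ := h'
  exact ⟨by rw [h1, h.side], by rw [h2, h.bound], by rw [h3, h.pow], fun X => by rw [h4, h.cap],
    fun X hX => by rw [h5, h.row X hX], fun X hX i hi => by rw [h6, h.bit X hX i hi],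
    fun y hy => by rw [h7, h.tok y hy], h.tok_lt, by rw [h8, h.length], by rw [h9, h.length'],
    by rw [h10, h.tokens], fun p hp => by rw [h11, h.frow p hp]⟩

/-- A program that does not write the tables preserves them. -/
theorem CoverEnv.of_sameOutside {D : TokenData} {st st' : RamState} {P : RamProgram}
    (h : CoverEnv D st) (hs : SameOutside P st st')
    (hP : ([rS, rK, rPow, rCap, rBitRow, rBit, rTok, rL, rLL, rY, rFRow].all
      fun a => !P.writesWord a) = true) : CoverEnv D st' := by
  refine h.congr fun a ha => hs.word a ?_
  simpa using List.all_eq_true.1 hP a ha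

section

variable {D : TokenData}

open scoped Classical in
theorem runs_tokenAdj {st : RamState} (h : CoverEnv D st) {y z : ℕ} (hy : y < D.base)
    (hz : z < D.base) (hU : st.word rU 0 = y) (hX : st.word rX 0 = z) :
    Runs tokenAdj st 40 (fun st' => st'.word rA 0 = if D.Adj y z then 1 else 0) := by
  have h1 := h.tok_lt y hy
  have h2 := h.tok_lt z hz
  refine Runs.le (Runs.cond (B₁ := 30) (fun hc => ?_) (fun hc => ?_)) (by simp)
  · simp [h.side, hX] at hc
    have hzs : z < D.s := by omega
    refine Runs.straight rfl (by simp) ?_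
    simp [hU, hX, h.tok y hy, h.row _ h1, h.bit _ h1 z hzs, TokenData.Adj, hzs]
  · simp [h.side, hX, Nat.sub_eq_zero_iff_le] at hc
    refine Runs.le (Runs.cond (B₁ := 20) (fun hc' => ?_) (fun hc' => ?_)) (by simp)
    · simp [h.side, hU] at hc'
      have hys : y < D.s := by omega
      refine Runs.straight rfl (by simp) ?_
      simp [hU, hX, h.tok z hz, h.row _ h2, h.bit _ h2 y hys, TokenData.Adj, hys, not_lt.2 hc]
    · simp [h.side, hU, Nat.sub_eq_zero_iff_le] at hc'
      refine Runs.straight rfl (by simp) ?_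
      simp [TokenData.Adj, not_lt.2 hc, not_lt.2 hc']

open scoped Classical in
-- A present position adds the truncated difference between its left degree and `k` to `rBad`, so
-- `rBad` stays 0 exactly as long as no violation is met. In the row of `p` in `rF` only tokens of
-- the small side are recorded, since only these have to be covered.
theorem runs_leftSet {st : RamState} (h : CoverEnv D st) {u : ℕ → ℕ}
    (hu : ∀ q < D.len, st.word rWord q = u q) (hu' : ∀ q < D.len, u q < D.base)
    {p : ℕ} (hp : p < D.len) (hI : st.word rI 0 = p)
    (hpres : st.word rPres p ≠ 0 ↔ D.Present u p) :
    Runs leftSet st (D.len * 150 + D.s * 40 + 150) (fun st' =>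
      (st'.word rBad 0 = 0 ↔ st.word rBad 0 = 0 ∧ (D.Present u p → D.leftDeg u p ≤ D.k)) ∧
      (∀ z < p * D.s, st'.word rF z = st.word rF z) ∧
      ∀ i < D.s, st'.word rF (p * D.s + i) ≠ 0 ↔ D.Cov u p i) := by
  have hz := hu' p hp
  refine Runs.le (Runs.straight_seq rfl (Runs.seq (Runs.forUpto D.s 12 (fun i st' =>
    (∀ z < p * D.s, st'.word rF z = st.word rF z) ∧ ∀ i' < i, st'.word rF (p * D.s + i') = 0)
    rfl ?_ ?_ ?_ ?_) (fun s₁ hs₁ hF₁ => Runs.cond (B₁ := D.len * 150 + 100)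
      (fun hc => ?_) (fun hc => ?_)))) ?_
  · intro s' hs
    rw [WordExpr.eval, WordExpr.eval, hs.word rS rfl]
    simpa using h.side
  · intro j x s h
    simpa using h
  · simp
  · rintro i s' hi hs hii ⟨g1, g2⟩
    have hrow : s'.word rFRow p = p * D.s := by
      rw [hs.word rFRow rfl]; simpa using h.frow p hp
    have hI' : s'.word rI 0 = p := by rw [hs.word rI rfl]; simpa using hI
    refine Runs.straight rfl (by simp) ⟨fun z hz => ?_, fun i' hi' => ?_⟩
    · have : z ≠ p * D.s + i := by omega
      simp [hI', hrow, hii, this, g1 z hz]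
    · simp [hI', hrow, hii, Function.update_apply]
      exact fun hne => g2 i' (by omega)
  · obtain ⟨g1, g2⟩ := hF₁
    have hI₁ : s₁.word rI 0 = p := by rw [hs₁.word rI rfl]; simpa using hI
    have hX₁ : s₁.word rX 0 = u p := by rw [hs₁.word rX rfl]; simp [hI, hu p hp]
    have hP : D.Present u p := by
      rw [← hpres]
      simpa [hI₁, hs₁.word rPres rfl] using hc
    have hE₁ : CoverEnv D s₁ := (h.congr (st' := (setV rX (.get rWord (wv rI))).run st)
      (by simp)).of_sameOutside hs₁ rfl
    have hB₁ : s₁.word rBad = st.word rBad := by rw [hs₁.word rBad rfl]; simp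
    have hW₁ : ∀ q < D.len, s₁.word rWord q = u q := by
      rw [hs₁.word rWord rfl]; simpa using hu
    refine Runs.le (Runs.straight_seq rfl (Runs.seq (R := fun s' =>
        (∀ z < p * D.s, s'.word rF z = st.word rF z) ∧ s'.word rLd 0 = 0 ∧ ∀ i < D.s,
          s'.word rF (p * D.s + i) ≠ 0 ↔ u p = i) (B₁ := 20) ?_ (fun s₂ hs₂ hF₂ =>
        Runs.seq (Runs.forUpto p 120 (fun t s' =>
          s'.word rLd 0 = ((Finset.range t).filter fun q => D.Adj (u q) (u p)).card ∧
          (∀ z < p * D.s, s'.word rF z = st.word rF z) ∧ ∀ i < D.s,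
          s'.word rF (p * D.s + i) ≠ 0 ↔ u p = i ∨ ∃ q < t, u q = i ∧ D.Adj (u q) (u p))
          rfl ?_ ?_ ?_ ?_) (fun s₃ hs₃ h₃ => Runs.straight rfl le_rfl ?_))))
        ?_
    · refine Runs.le (Runs.cond (B₁ := 12) (fun hc => ?_) (fun hc => ?_)) (by simp)
      · simp [hE₁.side, hX₁] at hc
        refine Runs.straight rfl (by simp) ⟨fun z hz => ?_, by simp, fun i hi => ?_⟩
        · have : z ≠ p * D.s + u p := by omega
          simp [hI₁, hE₁.frow p hp, hX₁, this, g1 z hz]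
        · simp [hI₁, hE₁.frow p hp, hX₁, Function.update_apply, g2 i hi, eq_comm]
      · simp [hE₁.side, hX₁, Nat.sub_eq_zero_iff_le] at hc
        refine Runs.straight rfl (by simp) ⟨by simpa using g1, by simp, fun i hi => ?_⟩
        simp [g2 i hi]
        omega
    · intro s' hs
      rw [WordExpr.eval, WordExpr.eval, hs.word rI rfl, hs₂.word rI rfl]
      simpa using hI₁
    · intro j x s h
      simpa using h
    · exact ⟨by simp [hF₂.2.1], hF₂.1, by simpa using hF₂.2.2⟩
    · rintro q s' hq hs hqq ⟨k1, k2, k3⟩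
      have hql : q < D.len := hq.trans hp
      have hE₂ : CoverEnv D s₂ := (hE₁.congr (st' := (setV rLd 0).run s₁)
        (by simp)).of_sameOutside hs₂ rfl
      have hE : CoverEnv D s' := hE₂.of_sameOutside hs rfl
      have hW : ∀ q < D.len, s'.word rWord q = u q := by
        rw [hs.word rWord rfl, hs₂.word rWord rfl]; simpa using hW₁
      have hI' : s'.word rI 0 = p := by
        rw [hs.word rI rfl, hs₂.word rI rfl]; simpa using hI₁
      have hX' : s'.word rX 0 = u p := by
        rw [hs.word rX rfl, hs₂.word rX rfl]; simpa using hX₁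
      refine Runs.le (Runs.straight_seq rfl (Runs.seq (runs_tokenAdj (y := u q) (z := u p)
        (hE.congr (by simp)) (hu' q hql) hz (by simp [hqq, hW q hql]) (by simpa using hX'))
        (fun s₃ hs₃ hA => Runs.cond (B₁ := 35) (fun hc => ?_) (fun hc => ?_)))) (by simp)
      · have hadj : D.Adj (u q) (u p) := by
          by_contra hne
          simp [hA, hne] at hc
        have hE3 : CoverEnv D s₃ := (hE.congr (st' := (setV rU (.get rWord (wv rJ))).run s')
          (by simp)).of_sameOutside hs₃ rfl
        have hU3 : s₃.word rU 0 = u q := by rw [hs₃.word rU rfl]; simp [hqq, hW q hql]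
        have hI3 : s₃.word rI 0 = p := by rw [hs₃.word rI rfl]; simpa using hI'
        have hF3 : s₃.word rF = s'.word rF := by rw [hs₃.word rF rfl]; simp
        have hL3 : s₃.word rLd = s'.word rLd := by rw [hs₃.word rLd rfl]; simp
        have hcard : s'.word rLd 0 + 1 =
            ((Finset.range (q + 1)).filter fun q => D.Adj (u q) (u p)).card := by
          rw [Finset.range_add_one, Finset.filter_insert, if_pos hadj,
            Finset.card_insert_of_notMem (by simp), k1]
        refine Runs.le (Runs.straight_seq rfl (Runs.cond (B₁ := 15) (fun hc => ?_) (fun hc => ?_)))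
          (by simp)
        · simp [hE3.side, hU3] at hc
          refine Runs.straight rfl (by simp) ⟨?_, fun z hz => ?_, fun i hi => ?_⟩
          · simpa [hL3] using hcard
          · have : z ≠ p * D.s + u q := by omega
            simp [hI3, hE3.frow p hp, hU3, this, hF3, k2 z hz]
          · by_cases he : i = u q
            · simp [hI3, hE3.frow p hp, hU3, hF3, he, -Order.lt_add_one_iff]
              exact Or.inr ⟨q, by omega, rfl, hadj⟩
            · simp [hI3, hE3.frow p hp, hU3, hF3, he, -Order.lt_add_one_iff]
              rw [← ne_eq, k3 i hi]
              refine or_congr_right ⟨fun ⟨q', h4, h5⟩ => ⟨q', by omega, h5⟩, fun ⟨q', h4, h5⟩ =>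
                ⟨q', lt_of_le_of_ne (by omega) ?_, h5⟩⟩
              rintro rfl
              exact he h5.1.symm
        · simp [hE3.side, hU3, Nat.sub_eq_zero_iff_le] at hc
          refine Runs.straight rfl (by simp) ⟨?_, fun z hz => ?_, fun i hi => ?_⟩
          · simpa [hL3] using hcard
          · simp [hF3, k2 z hz]
          · simp [hF3, -Order.lt_add_one_iff]
            rw [← ne_eq, k3 i hi]
            refine or_congr_right ⟨fun ⟨q', h4, h5⟩ => ⟨q', by omega, h5⟩, fun ⟨q', h4, h5⟩ =>
              ⟨q', lt_of_le_of_ne (by omega) ?_, h5⟩⟩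
            rintro rfl
            omega
      · have hadj : ¬ D.Adj (u q) (u p) := by
          intro hne
          simp [hA, hne] at hc
        have hF3 : s₃.word rF = s'.word rF := by rw [hs₃.word rF rfl]; simp
        have hL3 : s₃.word rLd = s'.word rLd := by rw [hs₃.word rLd rfl]; simp
        refine Runs.straight rfl (by simp) ⟨?_, fun z hz => ?_, fun i hi => ?_⟩
        · rw [Finset.range_add_one, Finset.filter_insert, if_neg hadj, ← k1]
          simp [hL3]
        · simp [hF3, k2 z hz]
        · simp only [RamProgram.run, hF3]
          rw [k3 i hi]
          refine or_congr_right ⟨fun ⟨q', h4, h5⟩ => ⟨q', by omega, h5⟩, fun ⟨q', h4, h5⟩ =>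
            ⟨q', lt_of_le_of_ne (by omega) ?_, h5⟩⟩
          rintro rfl
          exact hadj h5.2
    · obtain ⟨k1, k2, k3⟩ := h₃
      have hB3 : s₃.word rBad 0 = st.word rBad 0 := by
        rw [hs₃.word rBad rfl, hs₂.word rBad rfl]; simp [hB₁]
      have hK3 : s₃.word rK 0 = D.k := by
        rw [hs₃.word rK rfl, hs₂.word rK rfl]; simp [hE₁.bound]
      refine ⟨?_, by simpa using k2, fun i hi => ?_⟩
      · have : s₃.word rLd 0 = D.leftDeg u p := k1
        simp [hB3, this, hK3, hP, Nat.sub_eq_zero_iff_le]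
      · simp only [TokenData.Cov, hP, true_and]
        simpa using k3 i hi
    · simp
      omega
  · obtain ⟨g1, g2⟩ := hF₁
    have hI₁ : s₁.word rI 0 = p := by rw [hs₁.word rI rfl]; simpa using hI
    have hP : ¬ D.Present u p := by
      rw [← hpres]
      simpa [hI₁, hs₁.word rPres rfl] using hc
    refine Runs.straight rfl (by simp) ⟨?_, g1, fun i hi => ?_⟩
    · simp [hs₁.word rBad rfl, hP]
    · simp [g2 i hi, TokenData.Cov, hP]
  · simp
    omega

end

theorem exists_digits {b : ℕ} (l : ℕ) (f : ℕ → ℕ) (hf : ∀ p < l, f p < b) :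
    ∃ x < b ^ l, ∀ p < l, x / b ^ p % b = f p := by
  induction l generalizing f with
  | zero => exact ⟨0, by simp, by simp⟩
  | succ l ih =>
    obtain ⟨x, hx, h⟩ := ih (fun p => f (p + 1)) fun p hp => hf (p + 1) (by omega)
    have h0 := hf 0 (by omega)
    refine ⟨f 0 + b * x, ?_, fun p hp => ?_⟩
    · calc f 0 + b * x < b * (x + 1) := by rw [mul_add]; omega
        _ ≤ b * b ^ l := Nat.mul_le_mul_left b hx
        _ = b ^ (l + 1) := by ring
    · cases p with
      | zero => simp [Nat.mod_eq_of_lt h0]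
      | succ p =>
        rw [pow_succ', ← Nat.div_div_eq_div_mul, Nat.add_mul_div_left _ _ (by omega),
          Nat.div_eq_of_lt h0, zero_add, h p (by omega)]

namespace TokenData

variable {D : TokenData}

theorem extend_congr {w w' : ℕ → ℕ} (h : ∀ p < D.L, w p = w' p) : D.extend w = D.extend w' := by
  funext p
  by_cases hp : p < D.L
  · simp [extend, hp, h p hp]
  · simp [extend, hp]

theorem extend_lt {w : ℕ → ℕ} (h : ∀ p < D.L, w p < D.base) {p : ℕ} (hp : p < D.len) :
    D.extend w p < D.base := by
  unfold extend
  split_ifs with hpL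
  · exact h p hpL
  · simp only [base, len] at *
    omega

theorem Coverable.mono {u : ℕ → ℕ} {k k' : ℕ} (h : D.Coverable u k) (hk : k ≤ k') :
    D.Coverable u k' := by
  obtain ⟨C, h1, h2⟩ := h
  -- The superfluous centres are placed at position 0, which exists because `len` is at least `2 ^
  -- s`, hence positive.
  refine ⟨fun j => if j < k then C j else 0, fun j _ => ?_, fun i hi => ?_⟩
  · dsimp only
    split_ifs with hj
    · exact h1 j hj
    · have : 0 < 2 ^ D.s := by positivity
      simp only [len]
      omega
  · obtain ⟨j, hj, hc⟩ := h2 i hi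
    exact ⟨j, hj.trans_le hk, by simpa [hj] using hc⟩

/-- The centres are read as the digits of one number in base `len`; this is the form in which
`searchCover` runs through them. -/
theorem coverable_iff_exists_digits {u : ℕ → ℕ} {k : ℕ} : D.Coverable u k ↔
    ∃ x < D.len ^ k, ∀ i < D.s, ∃ j < k, D.Cov u (x / D.len ^ j % D.len) i := by
  have : 0 < 2 ^ D.s := by positivity
  have hlen : 0 < D.len := by simp only [len]; omega
  constructor
  · rintro ⟨C, h1, h2⟩
    obtain ⟨x, hx, hd⟩ := exists_digits k C h1
    refine ⟨x, hx, fun i hi => ?_⟩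
    obtain ⟨j, hj, hc⟩ := h2 i hi
    exact ⟨j, hj, by rwa [hd j hj]⟩
  · rintro ⟨x, hx, h⟩
    exact ⟨fun j => x / D.len ^ j % D.len, fun j _ => Nat.mod_lt _ hlen, h⟩

end TokenData

/-! ### Correctness of the search for the cover number of one word. -/

section

variable {D : TokenData}

theorem runs_countTokens {st : RamState} (h : CoverEnv D st) {w : ℕ → ℕ}
    (hw : ∀ p < D.L, st.word 45 p = w p) (hw' : ∀ p < D.L, w p < D.base)
    (htail : ∀ X < 2 ^ D.s, st.word rWord (D.L + X) = D.s + X) :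
    Runs countTokens st (D.len * 100 + D.base * 20 + 50) (fun st' =>
      (∀ q < D.len, st'.word rWord q = D.extend w q) ∧
      ∀ y < D.base, st'.word rOcc y = D.occ (D.extend w) y) := by
  have hLlen : D.L ≤ D.len := by simp [TokenData.len]
  refine Runs.le (Runs.seq (Runs.forUpto D.L 20 (fun j st' => (∀ p < j, st'.word rWord p = w p) ∧
    ∀ X < 2 ^ D.s, st'.word rWord (D.L + X) = D.s + X) rfl ?_ ?_ ?_ ?_) (fun s₁ hs₁ h₁ =>
    Runs.seq (Runs.forUpto D.base 6 (fun j st' => ∀ y < j, st'.word rOcc y = 0) rfl ?_ ?_ ?_ ?_)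
    (fun s₂ hs₂ h₂ => (Runs.forUpto D.L 20 (fun j st' => ∀ y < D.base, st'.word rOcc y =
      ((Finset.range j).filter fun p => D.extend w p = y).card) rfl ?_ ?_ ?_ ?_).mono
      le_rfl ?_))) ?_
  · intro s' hs
    rw [WordExpr.eval, WordExpr.eval, hs.word rL rfl, h.length]
  · intro j x s h
    simpa using h
  · exact ⟨by simp, htail⟩
  · rintro j s' hj hs hjj ⟨g1, g2⟩
    have hw2 : s'.word 45 j = w j := by rw [hs.word 45 rfl, hw j hj]
    refine Runs.straight rfl (by simp) ⟨fun p hp => ?_, fun X hX => ?_⟩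
    · simp [hjj, hw2, Function.update_apply]
      split_ifs with he
      · rw [he]
      · exact g1 p (by omega)
    · have : D.L + X ≠ j := by omega
      simp [hjj, this, g2 X hX]
  · intro s' hs
    rw [WordExpr.eval, WordExpr.eval, hs.word rY rfl, hs₁.word rY rfl, h.tokens]
  · intro j x s h
    simpa using h
  · simp
  · rintro j s' hj hs hjj g
    refine Runs.straight rfl (by simp) fun y hy => ?_
    simp [hjj, Function.update_apply]
    exact fun hne => g y (by omega)
  · intro s' hs
    rw [WordExpr.eval, WordExpr.eval, hs.word rL rfl, hs₂.word rL rfl, hs₁.word rL rfl, h.length]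
  · intro j x s h
    simpa using h
  · simpa using h₂
  · rintro j s' hj hs hjj g
    have hw2 : s'.word rWord j = w j := by
      rw [hs.word rWord rfl, hs₂.word rWord rfl, h₁.1 j hj]
    have he : D.extend w j = w j := by simp [TokenData.extend, hj]
    refine Runs.straight rfl (by simp) fun y hy => ?_
    rw [Finset.range_add_one, Finset.filter_insert, he]
    simp [hjj, hw2, Function.update_apply, g _ (hw' j hj), eq_comm (a := w j)]
    split_ifs with h3
    · subst h3
      rw [Finset.card_insert_of_notMem (by simp)]
    · exact g y hy
  · intro s₃ hs₃ h₃
    refine ⟨fun q hq => ?_, fun y hy => by rw [h₃ y hy, TokenData.occ]⟩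
    rw [hs₃.word rWord rfl, hs₂.word rWord rfl]
    unfold TokenData.extend
    split_ifs with hqL
    · exact h₁.1 q hqL
    · rw [← h₁.2 (q - D.L) (by simp only [TokenData.len] at hq; omega)]
      congr 1
      omega
  · simp
    omega

/-- The number `X = 0` is exempt from the comparison with the multiplicities: no vertex of the large
side has an empty neighbourhood, so the token `s` is free to serve as padding. The tail position of
`X` gets the truncated difference of multiplicity and number of occurrences, which is nonzero
exactly if some vertex of that class does not occur in the word. -/
theorem runs_checkCounts {st : RamState} (h : CoverEnv D st) {u : ℕ → ℕ}
    (hocc : ∀ y < D.base, st.word rOcc y = D.occ u y) (hpres : ∀ p < D.L, st.word rPres p = 1) :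
    Runs checkCounts st (D.base * 100 + 50) (fun st' =>
      (st'.word rBad 0 = 0 ↔ (∀ i < D.s, D.occ u i = 1) ∧
        ∀ X < 2 ^ D.s, X ≠ 0 → D.occ u (D.s + X) ≤ D.cap X) ∧
      (∀ p < D.L, st'.word rPres p = 1) ∧
      ∀ p < D.len, st'.word rPres p ≠ 0 ↔ D.Present u p) := by
  refine Runs.le (Runs.straight_seq rfl (Runs.seq (Runs.forUpto D.s 40 (fun j st' =>
    (st'.word rBad 0 = 0 ↔ ∀ i < j, D.occ u i = 1)) rfl ?_ ?_ ?_ ?_) (fun s₁ hs₁ h₁ =>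
    (Runs.forUpto (2 ^ D.s) 50 (fun j st' =>
      (st'.word rBad 0 = 0 ↔ (∀ i < D.s, D.occ u i = 1) ∧
        ∀ X < j, X ≠ 0 → D.occ u (D.s + X) ≤ D.cap X) ∧
      (∀ p < D.L, st'.word rPres p = 1) ∧
      ∀ X < j, st'.word rPres (D.L + X) = D.cap X - D.occ u (D.s + X)) rfl ?_ ?_ ?_ ?_).mono
      le_rfl ?_))) ?_
  · intro s' hs
    rw [WordExpr.eval, WordExpr.eval, hs.word rS rfl]
    simpa using h.side
  · intro j x s h
    simpa using h
  · simp
  · rintro j s' hj hs hjj g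
    have hjb : j < D.base := Nat.lt_of_lt_of_le hj (Nat.le_add_right _ _)
    have ho : s'.word rOcc j = D.occ u j := by
      rw [hs.word rOcc rfl]; simpa using hocc j hjb
    refine Runs.straight rfl (by simp) ?_
    simp [hjj, ho, g, -Order.lt_add_one_iff]
    constructor
    · rintro ⟨h1, h2, h3⟩ i hi
      rcases lt_or_eq_of_le (Nat.lt_succ_iff.1 hi) with h4 | rfl
      · exact h1 i h4
      · omega
    · intro h1
      have := h1 j (by omega)
      exact ⟨fun i hi => h1 i (by omega), by omega, by omega⟩
  · intro s' hs
    rw [WordExpr.eval, WordExpr.eval, WordExpr.eval, hs.word rPow rfl, hs.word rS rfl,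
      hs₁.word rPow rfl, hs₁.word rS rfl]
    simp [h.side, h.pow]
  · intro j x s h
    simpa using h
  · refine ⟨by simp [h₁], fun p hp => ?_, by simp⟩
    rw [hs₁.word rPres rfl]
    simpa using hpres p hp
  · rintro j s' hj hs hjj ⟨g1, g2, g3⟩
    have hjb : D.s + j < D.base := by simp only [TokenData.base]; omega
    have ho : s'.word rOcc (D.s + j) = D.occ u (D.s + j) := by
      rw [hs.word rOcc rfl, hs₁.word rOcc rfl]; simpa using hocc _ hjb
    have hS : s'.word rS 0 = D.s := by
      rw [hs.word rS rfl, hs₁.word rS rfl]; simpa using h.side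
    have hL : s'.word rL 0 = D.L := by
      rw [hs.word rL rfl, hs₁.word rL rfl]; simpa using h.length
    have hC : s'.word rCap j = D.cap j := by
      rw [hs.word rCap rfl, hs₁.word rCap rfl]; simpa using h.cap j
    refine Runs.le (Runs.seq (R := fun s₂ => (s₂.word rBad 0 = 0 ↔ (∀ i < D.s, D.occ u i = 1) ∧
        ∀ X < j + 1, X ≠ 0 → D.occ u (D.s + X) ≤ D.cap X)) (B₁ := 25) ?_ (fun s₂ hs₂ h₂ =>
        Runs.straight rfl le_rfl ⟨?_, fun p hp => ?_, fun X hX => ?_⟩)) ?_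
    · refine Runs.le (Runs.cond (B₁ := 20) (fun hc => ?_) (fun hc => ?_)) (by simp)
      · simp [hjj] at hc
        refine Runs.straight rfl (by simp) ?_
        simp [hjj, ho, hS, hC, g1, Nat.sub_eq_zero_iff_le, -Order.lt_add_one_iff, and_assoc]
        intro _
        constructor
        · rintro ⟨h1, h2⟩ X hX hX0
          rcases lt_or_eq_of_le (Nat.lt_succ_iff.1 hX) with h4 | rfl
          · exact h1 X h4 hX0
          · exact h2
        · intro h1
          exact ⟨fun X hX => h1 X (by omega), h1 j (by omega) hc⟩
      · simp [hjj] at hc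
        refine Runs.straight rfl (by simp) ?_
        rw [RamProgram.run, g1, hc]
        refine and_congr_right fun _ => ⟨fun _ X hX hX0 => by omega, fun _ X hX => by omega⟩
    · simpa using h₂
    · have : p ≠ D.L + j := by omega
      simp [hs₂.word rPres rfl, hs₂.word rL rfl, hL, hs₂.word rI rfl, hjj, this, g2 p hp]
    · simp [hs₂.word rPres rfl, hs₂.word rL rfl, hL, hs₂.word rI rfl, hjj, hs₂.word rCap rfl, hC,
        hs₂.word rOcc rfl, hs₂.word rS rfl, hS, ho, Function.update_apply]
      split_ifs with he
      · rw [he]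
      · exact g3 X (by omega)
    · simp
  · rintro s' - ⟨g1, g2, g3⟩
    refine ⟨g1, g2, fun p hp => ?_⟩
    by_cases hpL : p < D.L
    · simp [g2 p hpL, TokenData.Present, hpL]
    · have := g3 (p - D.L) (by simp only [TokenData.len] at hp; omega)
      rw [show D.L + (p - D.L) = p by omega] at this
      rw [this]
      simp only [TokenData.Present, hpL, false_or]
      omega
  · simp [TokenData.base]
    omega

/-- The search starts from the current value of `rC` instead of 0 and increments it until a cover
exists. The hypothesis that `c` centres suffice bounds both the final value and the number of
rounds. -/
theorem runs_searchCover {st : RamState} (h : CoverEnv D st) {u : ℕ → ℕ} {k c : ℕ}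
    (hF : ∀ p < D.len, ∀ i < D.s, st.word rF (p * D.s + i) ≠ 0 ↔ D.Cov u p i)
    (hk : st.word rC 0 = k) (hkc : k ≤ c) (hc : D.Coverable u c) :
    Runs searchCover st ((c + 1) * (D.len ^ c * (D.s * (c * 40 + 60) + c * 60 + 60) + c * 30 + 60))
      (fun st' => ∃ k', k ≤ k' ∧ k' ≤ c ∧ st'.word rC 0 = k' ∧ D.Coverable u k') := by
  have h2pos : 0 < 2 ^ D.s := by positivity
  have hlen : 0 < D.len := by simp only [TokenData.len]; omega
  set T := D.len ^ c * (D.s * (c * 40 + 60) + c * 60 + 60) + c * 30 + 40 with hT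
  have key : ∀ k' s', k' ≤ c → CoverEnv D s' → s'.word rF = st.word rF → s'.word rC 0 = k' →
      Runs (setV rFound 0 ;;
      forTuples 56 57 58 (wv rLL) (wv rC)
        (setV rMiss 0 ;;
          forUpto rI (wv rS)
            (setV rHit 0 ;;
              forUpto rJ (wv rC)
                (setV rHit (wv rHit + .get rF (.get rFRow (.get 56 (wv rJ)) + wv rI))) ;;
              .cond (wv rHit) .skip (setV rMiss 1)) ;;
          .cond (wv rMiss) .skip (setV rFound 1)) ;;
      .cond (wv rFound) (setV rFlag 0) (setV rC (wv rC + 1))) s' T (fun s'' =>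
        (D.Coverable u k' ∧ s''.word rFlag 0 = 0 ∧ s''.word rC 0 = k') ∨
        (¬ D.Coverable u k' ∧ s''.word rFlag 0 = s'.word rFlag 0 ∧ s''.word rC 0 = k' + 1)) := by
    intro k' s' hk' hE hF' hC
    refine Runs.le (Runs.straight_seq rfl (Runs.seq (Runs.forTuples D.len k'
      (D.s * (k' * 40 + 50) + 40) (fun x s₁ => s₁.word rFound 0 ≠ 0 ↔ ∃ x' < x, ∀ i < D.s,
        ∃ j < k', D.Cov u (x' / D.len ^ j % D.len) i) (by simp) (by simp) (by simp) hlen rfl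
      ?_ ?_ ?_ ?_ ?_) (fun s₁ hs₁ h₁ => Runs.cond (B₁ := 6) (fun hc => ?_) (fun hc => ?_)))) ?_
    · intro s₁ hs
      rw [WordExpr.eval, WordExpr.eval, hs.word rLL rfl]
      simpa using hE.length'
    · intro s₁ hs
      rw [WordExpr.eval, WordExpr.eval, hs.word rC rfl]
      simpa using hC
    · intro x s₁ s₂ h _ h'
      simpa [h rFound] using h'
    · simp
    · intro x s₁ hx hs₁ hd h₁
      have hE₁ : CoverEnv D s₁ := (hE.congr (st' := (setV rFound 0).run s')
        (by simp)).of_sameOutside hs₁ rfl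
      have hC₁ : s₁.word rC 0 = k' := by rw [hs₁.word rC rfl]; simpa using hC
      have hF₁ : s₁.word rF = st.word rF := by rw [hs₁.word rF rfl]; simpa using hF'
      refine Runs.le (Runs.straight_seq rfl (Runs.seq (Runs.forUpto D.s (k' * 30 + 30)
        (fun i s₂ => s₂.word rMiss 0 = 0 ↔ ∀ i' < i, ∃ j < k', D.Cov u (x / D.len ^ j % D.len) i')
        rfl ?_ ?_ ?_ ?_) (fun s₂ hs₂ h₂ => Runs.cond (B₁ := 4) (fun hc => ?_) (fun hc => ?_)))) ?_
      · intro s₂ hs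
        rw [WordExpr.eval, WordExpr.eval, hs.word rS rfl]
        simpa using hE₁.side
      · intro j x s h
        simpa using h
      · simp
      · intro i s₂ hi hs₂ hii h₂
        have hE₂ : CoverEnv D s₂ := (hE₁.congr (st' := (setV rMiss 0).run s₁)
          (by simp)).of_sameOutside hs₂ rfl
        have hC₂ : s₂.word rC 0 = k' := by rw [hs₂.word rC rfl]; simpa using hC₁
        have hF₂ : s₂.word rF = st.word rF := by rw [hs₂.word rF rfl]; simpa using hF₁
        have hd₂ : ∀ j < k', s₂.word 56 j = x / D.len ^ j % D.len := by
          rw [hs₂.word 56 rfl]; simpa using hd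
        refine Runs.le (Runs.straight_seq rfl (Runs.seq (Runs.forUpto k' 18
          (fun j s₃ => s₃.word rHit 0 ≠ 0 ↔ ∃ j' < j, D.Cov u (x / D.len ^ j' % D.len) i)
          rfl ?_ ?_ ?_ ?_) (fun s₃ hs₃ h₃ => Runs.cond (B₁ := 4) (fun hc => ?_) (fun hc => ?_)))) ?_
        · intro s₃ hs
          rw [WordExpr.eval, WordExpr.eval, hs.word rC rfl]
          simpa using hC₂
        · intro j x s h
          simpa using h
        · simp
        · intro j s₃ hj hs₃ hjj h₃
          have hE₃ : CoverEnv D s₃ := (hE₂.congr (st' := (setV rHit 0).run s₂)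
            (by simp)).of_sameOutside hs₃ rfl
          have hp : x / D.len ^ j % D.len < D.len := Nat.mod_lt _ hlen
          have hFx := hF _ hp i hi
          have hF₃ : s₃.word rF = st.word rF := by rw [hs₃.word rF rfl]; simpa using hF₂
          have hd₃ : s₃.word 56 j = x / D.len ^ j % D.len := by
            rw [hs₃.word 56 rfl]; simpa using hd₂ j hj
          have hI₃ : s₃.word rI 0 = i := by rw [hs₃.word rI rfl]; simpa using hii
          have hsum : ∀ a b : ℕ, a + b ≠ 0 ↔ a ≠ 0 ∨ b ≠ 0 := by omega
          refine Runs.straight rfl (by simp) ?_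
          simp only [RamProgram.run, WordExpr.eval,
            RamState.putWord_word_self, Function.update_self, hjj, hd₃, hE₃.frow _ hp, hI₃, hF₃]
          rw [hsum, h₃, hFx]
          constructor
          · rintro (⟨j', h4, h5⟩ | h4)
            · exact ⟨j', by omega, h5⟩
            · exact ⟨j, by omega, h4⟩
          · rintro ⟨j', h4, h5⟩
            rcases lt_or_eq_of_le (Nat.lt_succ_iff.1 h4) with h6 | rfl
            · exact Or.inl ⟨j', h6, h5⟩
            · exact Or.inr h5
        · have hM : s₃.word rMiss 0 = s₂.word rMiss 0 := by rw [hs₃.word rMiss rfl]; simp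
          refine Runs.straight rfl (by simp) ?_
          simp only [RamProgram.run, hM, h₂]
          refine ⟨fun h4 i' hi' => ?_, fun h4 i' hi' => h4 i' (by omega)⟩
          rcases lt_or_eq_of_le (Nat.lt_succ_iff.1 hi') with h6 | rfl
          · exact h4 i' h6
          · exact h₃.1 hc
        · refine Runs.straight rfl (by simp) ?_
          simp
          refine ⟨i, le_rfl, fun j hj hcov => ?_⟩
          exact (h₃.2 ⟨j, hj, hcov⟩) hc
        · simp
          omega
      · have hM : s₂.word rFound 0 = s₁.word rFound 0 := by rw [hs₂.word rFound rfl]; simp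
        refine Runs.straight rfl (by simp) ?_
        simp only [RamProgram.run, hM, h₁]
        refine ⟨fun ⟨x', h4, h5⟩ => ⟨x', by omega, h5⟩, fun ⟨x', h4, h5⟩ =>
          ⟨x', lt_of_le_of_ne (by omega) ?_, h5⟩⟩
        rintro rfl
        exact hc (h₂.2 h5)
      · refine Runs.straight rfl (by simp) ?_
        simp
        exact ⟨x, le_rfl, h₂.1 hc⟩
      · simp
        ring_nf
        omega
    · have hcov : D.Coverable u k' := TokenData.coverable_iff_exists_digits.2 (h₁.1 hc)
      refine Runs.straight rfl (by simp) (Or.inl ⟨hcov, by simp, ?_⟩)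
      simp [hs₁.word rC rfl, hC]
    · have hcov : ¬ D.Coverable u k' := fun hcov =>
        (h₁.2 (TokenData.coverable_iff_exists_digits.1 hcov)) hc
      refine Runs.straight rfl (by simp) (Or.inr ⟨hcov, ?_, ?_⟩)
      · simp [hs₁.word rFlag rfl]
      · simp [hs₁.word rC rfl, hC]
    · have h1 : D.len ^ k' ≤ D.len ^ c := Nat.pow_le_pow_right hlen hk'
      have h3 : D.s * (k' * 40 + 50) ≤ D.s * (c * 40 + 60) := Nat.mul_le_mul_left _ (by omega)
      have h2 : D.len ^ k' * (D.s * (k' * 40 + 50) + 40 + k' * 44 + 2 + 15) ≤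
          D.len ^ c * (D.s * (c * 40 + 60) + c * 60 + 60) := Nat.mul_le_mul h1 (by omega)
      simp
      omega
  refine Runs.le (Runs.straight_seq rfl ((Runs.loop_aux (c + 1) (fun j r s' => CoverEnv D s' ∧
    s'.word rF = st.word rF ∧ r = (c + 1 - j) * T ∧
    ((s'.word rFlag 0 = 1 ∧ k + j ≤ c ∧ s'.word rC 0 = k + j) ∨
      (s'.word rFlag 0 = 0 ∧ ∃ k', k ≤ k' ∧ k' ≤ c ∧ s'.word rC 0 = k' ∧ D.Coverable u k'))) ?_
    (j := 0) (r := (c + 1) * T)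
    ⟨h.congr (by simp), by simp, by simp, Or.inl ⟨by simp, hkc, by simpa using hk⟩⟩
    (by omega)).mono le_rfl ?_)) ?_
  · rintro j r s' ⟨hE, hF', rfl, ⟨hfl, hj, hC⟩ | ⟨hfl, -⟩⟩ hne
    · refine ⟨by omega, T, (c + 1 - (j + 1)) * T, ?_, (key (k + j) s' hj hE hF' hC).mono le_rfl ?_⟩
      · have : c + 1 - j = (c + 1 - (j + 1)) + 1 := by omega
        rw [this, add_mul _ 1, one_mul, add_comm]
      · intro s'' hs hq
        refine ⟨hE.of_sameOutside hs rfl, by rw [hs.word rF rfl, hF'], rfl, ?_⟩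
        rcases hq with ⟨h1, h2, h3⟩ | ⟨h1, h2, h3⟩
        · exact Or.inr ⟨h2, k + j, by omega, hj, h3, h1⟩
        · refine Or.inl ⟨by rw [h2, hfl], ?_, by rw [h3]; ring⟩
          by_contra hgt
          have : k + j = c := by omega
          exact h1 (this ▸ hc)
    · simp [hfl] at hne
  · rintro s' - ⟨⟨j, r, -, -, -, -, ⟨hfl, -⟩ | ⟨-, hq⟩⟩, h0⟩
    · simp [hfl] at h0
    · exact hq
  · simp
    have h1 : (c + 1) * T + (c + 1) * 20 =
        (c + 1) * (D.len ^ c * (D.s * (c * 40 + 60) + c * 60 + 60) + c * 30 + 60) := by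
      rw [hT]; ring
    rw [← h1]
    omega

end

section

variable {D : TokenData}

/-- A bound for the cost of `checkWord`. -/
def TokenData.wordCost (D : TokenData) (c : ℕ) : ℕ :=
  D.len * (D.len * 150 + D.s * 40 + 300) + D.base * 120 + 150 +
    (c + 1) * (D.len ^ c * (D.s * (c * 40 + 60) + c * 60 + 60) + c * 30 + 60)

/-- An invalid word leaves `rC` alone, and a valid one can only increase it. Hence the bound `c` has
to be justified for valid words only. The tail of `rWord` and the entries of `rPres` below `L` are
returned intact for the next word. -/
theorem runs_checkWord {st : RamState} (h : CoverEnv D st) {w : ℕ → ℕ} {k c : ℕ}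
    (hw : ∀ p < D.L, st.word 45 p = w p) (hw' : ∀ p < D.L, w p < D.base)
    (htail : ∀ X < 2 ^ D.s, st.word rWord (D.L + X) = D.s + X)
    (hpres : ∀ p < D.L, st.word rPres p = 1) (hk : st.word rC 0 = k) (hkc : k ≤ c)
    (hc : D.Valid (D.extend w) → D.Coverable (D.extend w) c) :
    Runs checkWord st (D.wordCost c) (fun st' =>
      (∀ X < 2 ^ D.s, st'.word rWord (D.L + X) = D.s + X) ∧ (∀ p < D.L, st'.word rPres p = 1) ∧
      ∃ k', k ≤ k' ∧ k' ≤ c ∧ st'.word rC 0 = k' ∧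
        (D.Valid (D.extend w) → D.Coverable (D.extend w) k')) := by
  set u := D.extend w with hu
  have hu' : ∀ q < D.len, u q < D.base := fun q hq => TokenData.extend_lt hw' hq
  refine Runs.le (Runs.seq (runs_countTokens h hw hw' htail) (fun s₁ hs₁ h₁ => ?_)
    (B₂ := (D.base * 100 + 50) + ((D.len * ((D.len * 150 + D.s * 40 + 150) + 2 + 10) + 2 + 7) +
      (3 + (c + 1) * (D.len ^ c * (D.s * (c * 40 + 60) + c * 60 + 60) + c * 30 + 60))))) ?_
  · obtain ⟨hW₁, hO₁⟩ := h₁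
    have hE₁ := h.of_sameOutside hs₁ rfl
    refine Runs.seq (runs_checkCounts hE₁ hO₁ (fun p hp => by rw [hs₁.word rPres rfl, hpres p hp]))
      (fun s₂ hs₂ h₂ => ?_)
    obtain ⟨hB₂, hP₂, hP₂'⟩ := h₂
    have hE₂ := hE₁.of_sameOutside hs₂ rfl
    have hW₂ : ∀ q < D.len, s₂.word rWord q = u q := by rw [hs₂.word rWord rfl]; exact hW₁
    refine Runs.seq (Runs.forUpto D.len (D.len * 150 + D.s * 40 + 150) (fun p s' =>
      (s'.word rBad 0 = 0 ↔ s₂.word rBad 0 = 0 ∧ ∀ q < p, D.Present u q → D.leftDeg u q ≤ D.k) ∧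
      ∀ q < p, ∀ i < D.s, s'.word rF (q * D.s + i) ≠ 0 ↔ D.Cov u q i) rfl ?_ ?_ ?_ ?_)
      (fun s₃ hs₃ h₃ => ?_)
    · intro s' hs
      rw [WordExpr.eval, WordExpr.eval, hs.word rLL rfl, hE₂.length']
    · intro j x s h
      simpa using h
    · simp
    · rintro p s' hp hs hpp ⟨g1, g2⟩
      have hE := hE₂.of_sameOutside hs rfl
      refine (runs_leftSet hE (by rw [hs.word rWord rfl]; exact hW₂) hu' hp hpp
        (by rw [hs.word rPres rfl]; exact hP₂' p hp)).mono le_rfl ?_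
      rintro s'' - ⟨k1, k2, k3⟩
      refine ⟨?_, fun q hq i hi => ?_⟩
      · rw [k1, g1, and_assoc]
        refine and_congr_right fun _ => ⟨fun ⟨h1, h2⟩ q hq => ?_, fun h1 =>
          ⟨fun q hq => h1 q (by omega), h1 p (by omega)⟩⟩
        rcases lt_or_eq_of_le (Nat.lt_succ_iff.1 hq) with h3 | rfl
        · exact h1 q h3
        · exact h2
      · rcases lt_or_eq_of_le (Nat.lt_succ_iff.1 hq) with h3 | rfl
        · rw [k2, g2 q h3 i hi]
          calc q * D.s + i < (q + 1) * D.s := by rw [add_mul]; omega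
            _ ≤ p * D.s := Nat.mul_le_mul_right _ h3
        · exact k3 i hi
    · obtain ⟨g1, g2⟩ := h₃
      have hE₃ := hE₂.of_sameOutside hs₃ rfl
      have hvalid : s₃.word rBad 0 = 0 ↔ D.Valid u := by
        rw [g1, hB₂]
        exact ⟨fun h => ⟨h.1.1, h.1.2, h.2⟩, fun h => ⟨⟨h.1, h.2⟩, h.3⟩⟩
      have hC₃ : s₃.word rC 0 = k := by
        rw [hs₃.word rC rfl, hs₂.word rC rfl, hs₁.word rC rfl, hk]
      have htail₃ : ∀ X < 2 ^ D.s, s₃.word rWord (D.L + X) = D.s + X := by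
        intro X hX
        rw [hs₃.word rWord rfl, hW₂ _ (by simp only [TokenData.len]; omega), hu]
        simp [TokenData.extend]
      have hpres₃ : ∀ p < D.L, s₃.word rPres p = 1 := by rw [hs₃.word rPres rfl]; exact hP₂
      refine Runs.cond (fun hb => ?_) (fun hb => ?_)
      · refine Runs.straight rfl ?_ ⟨htail₃, hpres₃, k, le_rfl, hkc, hC₃, fun hv => absurd (hvalid.2 hv) hb⟩
        simp only [RamProgram.maxCost]
        exact Nat.succ_le_of_lt (by positivity)
      · have hv := hvalid.1 hb
        refine (runs_searchCover hE₃ g2 hC₃ hkc (hc hv)).mono le_rfl ?_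
        rintro s₄ hs₄ ⟨k', h1, h2, h3, h4⟩
        exact ⟨by rw [hs₄.word rWord rfl]; exact htail₃, by rw [hs₄.word rPres rfl]; exact hpres₃,
          k', h1, h2, h3, fun _ => h4⟩
  · unfold TokenData.wordCost
    have h1 : D.len * (D.len * 150 + D.s * 40 + 300) =
      D.len * (D.len * 150 + D.s * 40 + 150 + 2 + 10) + D.len * 138 := by ring
    omega

end

/-- The data of a pattern. -/
noncomputable def Pattern.tokenData {m s : ℕ} (H : Pattern (Fin m)) (σ : Fin s → Fin m) (k : ℕ) :
    TokenData where
  s := s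
  k := k
  L := (k + 1) * s
  nb y := if h : y < s then H.mask σ (σ ⟨y, h⟩) else y - s
  cap := H.cap σ

theorem runs_prepareWords {m s k : ℕ} {H : Pattern (Fin m)} {σ : Fin s → Fin m} {st : RamState}
    (h : PatternTables H σ st) (hk : st.word rK 0 = k) :
    Runs prepareWords st ((H.tokenData σ k).len * 250 + k * 30 + 250) (fun st' =>
      CoverEnv (H.tokenData σ k) st' ∧ st'.word rC 0 = 1 ∧
      (∀ X < 2 ^ s, st'.word rWord ((k + 1) * s + X) = s + X) ∧
      ∀ p < (k + 1) * s, st'.word rPres p = 1) := by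
  have hsle : s ≤ (k + 1) * s := Nat.le_mul_of_pos_left s (by omega)
  refine Runs.le (Runs.straight_seq rfl (Runs.seq (Runs.forUpto (k + 1) 10 (fun j st' =>
    st'.word rL 0 = j * s) rfl ?_ ?_ ?_ ?_) (fun s₁ hs₁ h₁ => ?_)
    (B₂ := 10 + (10 + (5 + ((2 ^ s * 60 + 20) + (5 + ((((k + 1) * s + 2 ^ s) * 60 + 20) +
      ((k + 1) * s * 60 + 20)))))))))
    ?_
  · intro s' hs
    simp only [WordExpr.eval, hs.word rK rfl]
    simpa using hk
  · intro j x s h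
    simpa using h
  · simp
  · rintro j s' hj hs hjj g
    have hS : s'.word rS 0 = s := by rw [hs.word rS rfl]; simpa using h.side
    refine Runs.straight rfl (by simp) ?_
    simp [g, hS]
    ring
  · have hS₁ : s₁.word rS 0 = s := by rw [hs₁.word rS rfl]; simpa using h.side
    have hP₁ : s₁.word rPow s = 2 ^ s := by rw [hs₁.word rPow rfl]; simpa using h.pow s le_rfl
    set s₂ := (setV rC 1).run ((setV rY (wv rS + .get rPow (wv rS))).run
      ((setV rLL (wv rL + .get rPow (wv rS))).run s₁)) with hs₂
    have hL₂ : s₂.word rL 0 = (k + 1) * s := by simp [hs₂, h₁]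
    have hLL₂ : s₂.word rLL 0 = (k + 1) * s + 2 ^ s := by simp [hs₂, h₁, hS₁, hP₁]
    have hY₂ : s₂.word rY 0 = s + 2 ^ s := by simp [hs₂, hS₁, hP₁]
    have hC₂ : s₂.word rC 0 = 1 := by simp [hs₂]
    have hS₂ : s₂.word rS 0 = s := by simp [hs₂, hS₁]
    have hP₂ : s₂.word rPow s = 2 ^ s := by simp [hs₂, hP₁]
    have hout : ∀ a, a ≠ rL → a ≠ rI → a ≠ rLL → a ≠ rY → a ≠ rC → s₂.word a = st.word a := by
      intro a a1 a2 a3 a4 a5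
      simp only [hs₂, RamProgram.run]
      rw [RamState.putWord_word_of_ne _ _ _ a5, RamState.putWord_word_of_ne _ _ _ a4,
        RamState.putWord_word_of_ne _ _ _ a3, hs₁.word a (by simp [forUpto, a1, a2])]
      simp [a1]
    set B₅ := ((k + 1) * s + 2 ^ s) * 60 + 20 + ((k + 1) * s * 60 + 20) with hB₅
    refine Runs.straight_seq rfl (B₂ := 10 + (5 + ((2 ^ s * 60 + 20) + (5 + B₅))))
      (Runs.straight_seq rfl (B₂ := 5 + ((2 ^ s * 60 + 20) + (5 + B₅)))
      (Runs.straight_seq rfl (B₂ := (2 ^ s * 60 + 20) + (5 + B₅))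
      (Runs.seq (B₂ := 5 + B₅) (Runs.forUpto (2 ^ s) 20 (fun j st' => ∀ X < j,
        st'.word rWord ((k + 1) * s + X) = s + X) rfl ?_ ?_ ?_ ?_)
      (fun s₃ hs₃ h₃ => ?_) ?_) (by simp)) (by simp)) (by simp)
    · intro s' hs
      change s'.word rPow (s'.word rS 0) = _
      rw [hs.word rPow rfl, hs.word rS rfl]
      exact hS₂.symm ▸ hP₂
    · intro j x s h
      simpa using h
    · simp
    · rintro j s' hj hs hjj g
      have hL : s'.word rL 0 = (k + 1) * s := by rw [hs.word rL rfl]; exact hL₂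
      have hS : s'.word rS 0 = s := by rw [hs.word rS rfl]; exact hS₂
      refine Runs.straight rfl (by simp) fun X hX => ?_
      simp [hjj, hL, hS, Function.update_apply]
      split_ifs with he
      · rw [he]
      · exact g X (by omega)
    · refine Runs.straight_seq rfl (B₂ := B₅) (Runs.le (Runs.seq (Runs.forUpto ((k + 1) * s + 2 ^ s) 20
        (fun j st' => st'.word rAcc 0 = j * s ∧ ∀ p < j, st'.word rFRow p = p * s) rfl ?_ ?_ ?_ ?_)
        (fun s₄ hs₄ h₄ => ((Runs.forUpto ((k + 1) * s) 20 (fun j st' => ∀ p < j,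
          st'.word rPres p = 1) rfl ?_ ?_ ?_ ?_).mono le_rfl ?_))) ?_) (by simp)
      · intro s' hs
        rw [WordExpr.eval, WordExpr.eval, hs.word rLL rfl]
        simp [hs₃.word rLL rfl, h₁, hS₁, hP₁]
      · intro j x s h
        simpa using h
      · simp
      · rintro j s' hj hs hjj ⟨g1, g2⟩
        have hS : s'.word rS 0 = s := by
          rw [hs.word rS rfl]; simp [hs₃.word rS rfl, hS₁]
        refine Runs.straight rfl (by simp) ⟨?_, fun p hp => ?_⟩
        · simp [g1, hS]
          ring
        · simp [hjj, g1, Function.update_apply]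
          split_ifs with he
          · rw [he]
          · exact g2 p (by omega)
      · intro s' hs
        rw [WordExpr.eval, WordExpr.eval, hs.word rL rfl, hs₄.word rL rfl]
        simp [hs₃.word rL rfl, h₁]
      · intro j x s h
        simpa using h
      · simp
      · rintro j s' hj hs hjj g
        refine Runs.straight rfl (by simp) fun p hp => ?_
        simp [hjj, Function.update_apply]
        exact fun hne => g p (by omega)
      · intro s₅ hs₅ h₅
        have hout₅ : ∀ a, a ≠ rL → a ≠ rI → a ≠ rLL → a ≠ rY → a ≠ rC → a ≠ rWord → a ≠ rAcc →
            a ≠ rFRow → a ≠ rPres → s₅.word a = st.word a := by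
          intro a a1 a2 a3 a4 a5 a6 a7 a8 a9
          rw [hs₅.word a (by simp [forUpto, a2, a9]), hs₄.word a (by simp [forUpto, a2, a7, a8])]
          simp only [RamProgram.run]
          rw [RamState.putWord_word_of_ne _ _ _ a7, hs₃.word a (by simp [forUpto, a2, a6])]
          exact hout a a1 a2 a3 a4 a5
        have hout₅' : ∀ a, a ≠ rI → a ≠ rWord → a ≠ rAcc → a ≠ rFRow → a ≠ rPres →
            s₅.word a = s₂.word a := by
          intro a a2 a6 a7 a8 a9
          rw [hs₅.word a (by simp [forUpto, a2, a9]), hs₄.word a (by simp [forUpto, a2, a7, a8])]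
          simp only [RamProgram.run]
          rw [RamState.putWord_word_of_ne _ _ _ a7, hs₃.word a (by simp [forUpto, a2, a6])]
        refine ⟨⟨?_, ?_, ?_, ?_, ?_, ?_, ?_, ?_, ?_, ?_, ?_, ?_⟩, ?_, ?_, h₅⟩
        · rw [hout₅ rS (by simp) (by simp) (by simp) (by simp) (by simp) (by simp) (by simp)
            (by simp) (by simp)]
          exact h.side
        · rw [hout₅ rK (by simp) (by simp) (by simp) (by simp) (by simp) (by simp) (by simp)
            (by simp) (by simp)]
          exact hk
        · rw [hout₅ rPow (by simp) (by simp) (by simp) (by simp) (by simp) (by simp) (by simp)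
            (by simp) (by simp)]
          exact h.pow s le_rfl
        · rw [hout₅ rCap (by simp) (by simp) (by simp) (by simp) (by simp) (by simp) (by simp)
            (by simp) (by simp)]
          exact h.cap
        · rw [hout₅ rBitRow (by simp) (by simp) (by simp) (by simp) (by simp) (by simp) (by simp)
            (by simp) (by simp)]
          exact h.row
        · rw [hout₅ rBit (by simp) (by simp) (by simp) (by simp) (by simp) (by simp) (by simp)
            (by simp) (by simp)]
          exact h.bit
        · rw [hout₅ rTok (by simp) (by simp) (by simp) (by simp) (by simp) (by simp) (by simp)
            (by simp) (by simp)]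
          intro y hy
          simp only [Pattern.tokenData, TokenData.base] at hy ⊢
          split_ifs with hys
          · exact h.tok ⟨y, hys⟩
          · rw [← h.tok' (y - s) (by omega)]
            congr 1
            omega
        · intro y hy
          simp only [Pattern.tokenData, TokenData.base] at hy ⊢
          split_ifs with hys
          · exact H.mask_lt _ _
          · omega
        · rw [hout₅' rL (by simp) (by simp) (by simp) (by simp) (by simp)]
          exact hL₂
        · rw [hout₅' rLL (by simp) (by simp) (by simp) (by simp) (by simp)]
          exact hLL₂
        · rw [hout₅' rY (by simp) (by simp) (by simp) (by simp) (by simp)]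
          exact hY₂
        · rw [hs₅.word rFRow rfl]
          exact h₄.2
        · rw [hout₅' rC (by simp) (by simp) (by simp) (by simp) (by simp)]
          exact hC₂
        · rw [hs₅.word rWord rfl, hs₄.word rWord rfl]
          simpa using h₃
      · rw [hB₅]
        simp
        ring_nf
        omega
    · simp
      ring_nf
      omega
  · simp only [Pattern.tokenData, TokenData.len]
    simp
    ring_nf
    omega

/-- `rC` is a running maximum: by `TokenData.Coverable.mono`, words treated earlier stay coverable
when it grows. Every word over the tokens occurs in the enumeration by `exists_digits`, because
`TokenData.extend` depends only on the first `L` letters. -/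
theorem runs_coverBound {m s k c : ℕ} {H : Pattern (Fin m)} {σ : Fin s → Fin m} {st : RamState}
    (h : PatternTables H σ st) (hk : st.word rK 0 = k) (hc1 : 1 ≤ c)
    (hc : ∀ w : ℕ → ℕ, (H.tokenData σ k).Valid ((H.tokenData σ k).extend w) →
      (H.tokenData σ k).Coverable ((H.tokenData σ k).extend w) c) :
    Runs coverBound st ((H.tokenData σ k).len * 250 + k * 30 + 300 +
      (H.tokenData σ k).base ^ (H.tokenData σ k).L * ((H.tokenData σ k).wordCost c +
        (H.tokenData σ k).L * 50 + 50) + (H.tokenData σ k).L * 20) (fun st' =>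
      ∃ c', 1 ≤ c' ∧ c' ≤ c ∧ st'.word rC 0 = c' ∧ ∀ w : ℕ → ℕ,
        (∀ p < (H.tokenData σ k).L, w p < (H.tokenData σ k).base) →
        (H.tokenData σ k).Valid ((H.tokenData σ k).extend w) →
        (H.tokenData σ k).Coverable ((H.tokenData σ k).extend w) c') := by
  have hp := runs_prepareWords h hk
  set D := H.tokenData σ k with hD
  have hbase : 0 < D.base := by
    have : 0 < 2 ^ D.s := by positivity
    simp only [TokenData.base]
    omega
  refine Runs.le (Runs.seq hp (fun s₁ hs₁ h₁ => (Runs.forTuples D.base D.L (D.wordCost c)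
    (fun x s' => (∀ X < 2 ^ D.s, s'.word rWord (D.L + X) = D.s + X) ∧
      (∀ p < D.L, s'.word rPres p = 1) ∧ ∃ c', 1 ≤ c' ∧ c' ≤ c ∧ s'.word rC 0 = c' ∧ ∀ x' < x,
        D.Valid (D.extend fun p => x' / D.base ^ p % D.base) →
        D.Coverable (D.extend fun p => x' / D.base ^ p % D.base) c') (by simp) (by simp) (by simp)
    hbase rfl ?_ ?_ ?_ ?_ ?_).mono le_rfl ?_)) ?_
  · intro s' hs
    rw [WordExpr.eval, WordExpr.eval, hs.word rY rfl, h₁.1.tokens]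
  · intro s' hs
    rw [WordExpr.eval, WordExpr.eval, hs.word rL rfl, h₁.1.length]
  · intro x s s' h _ h'
    simpa [h rWord, h rPres, h rC] using h'
  · exact ⟨h₁.2.2.1, h₁.2.2.2, 1, le_rfl, hc1, h₁.2.1, by simp⟩
  · rintro x s' hx hs hd ⟨g1, g2, c', g3, g4, g5, g6⟩
    refine (runs_checkWord (h₁.1.of_sameOutside hs rfl) hd (fun p _ => Nat.mod_lt _ hbase) g1 g2 g5
      g4 (hc _)).mono le_rfl ?_
    rintro s'' - ⟨k1, k2, c'', k3, k4, k5, k6⟩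
    refine ⟨k1, k2, c'', by omega, k4, k5, fun x' hx' hv => ?_⟩
    rcases lt_or_eq_of_le (Nat.lt_succ_iff.1 hx') with h3 | rfl
    · exact (g6 x' h3 hv).mono k3
    · exact k6 hv
  · rintro s' - ⟨-, -, c', g3, g4, g5, g6⟩
    refine ⟨c', g3, g4, g5, fun w hw hv => ?_⟩
    obtain ⟨x, hx, hd⟩ := exists_digits D.L w hw
    rw [← TokenData.extend_congr hd] at hv ⊢
    exact g6 x hx hv
  · simp
    have : D.base ^ D.L * (D.wordCost c + D.L * 44 + 2 + 15) ≤
        D.base ^ D.L * (D.wordCost c + D.L * 50 + 50) := Nat.mul_le_mul le_rfl (by omega)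
    omega

/-! ### Valid words describe degenerate orderings of the pattern. -/

section

variable {m s k : ℕ} {H : Pattern (Fin m)} {σ : Fin s → Fin m}

theorem Pattern.mem_T_of_not_mem_S {v : Fin m} (hv : v ∉ H.S) : v ∈ H.T := by
  have := H.cover ▸ Finset.mem_univ v
  rw [Finset.mem_union] at this
  exact this.resolve_left hv

theorem Pattern.not_adj_of_not_mem_S {u v : Fin m} (hu : u ∉ H.S) (hv : v ∉ H.S) :
    ¬ H.graph.Adj u v :=
  H.indep u (Pattern.mem_T_of_not_mem_S hu) v (Pattern.mem_T_of_not_mem_S hv)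

namespace Pattern.Lists

theorem apply_mem (hσ : H.Lists σ) (i : Fin s) : σ i ∈ H.S := (hσ.mem _).2 ⟨i, rfl⟩

/-- Domination of the large side by the small side is used here; it is what makes the token `s`
(empty neighbourhood) available as padding. -/
theorem mask_ne_zero (hσ : H.Lists σ) {v : Fin m} (hv : v ∉ H.S) : H.mask σ v ≠ 0 := by
  obtain ⟨u, hu, huv⟩ := H.dominated v (Pattern.mem_T_of_not_mem_S hv)
  obtain ⟨i, rfl⟩ := (hσ.mem u).1 hu
  intro h0
  have := (H.testBit_mask σ v i).2 huv
  simp [h0] at this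

end Pattern.Lists

open scoped Classical in
/-- The token of a vertex of the pattern. -/
noncomputable def Pattern.token (H : Pattern (Fin m)) (σ : Fin s → Fin m) (v : Fin m) : ℕ :=
  if h : ∃ i, σ i = v then h.choose else s + H.mask σ v

namespace Pattern.Lists

theorem token_apply (hσ : H.Lists σ) (i : Fin s) : H.token σ (σ i) = i := by
  have h : ∃ j, σ j = σ i := ⟨i, rfl⟩
  rw [Pattern.token, dif_pos h, hσ.injective h.choose_spec]

theorem token_of_not_mem (hσ : H.Lists σ) {v : Fin m} (hv : v ∉ H.S) :
    H.token σ v = s + H.mask σ v := by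
  rw [Pattern.token, dif_neg]
  rwa [← hσ.mem]

theorem token_eq_val_iff (hσ : H.Lists σ) {v : Fin m} {i : Fin s} :
    H.token σ v = i ↔ v = σ i := by
  by_cases hv : v ∈ H.S
  · obtain ⟨j, rfl⟩ := (hσ.mem v).1 hv
    rw [hσ.token_apply, hσ.injective.eq_iff, Fin.val_inj]
  · rw [hσ.token_of_not_mem hv]
    refine ⟨fun h => by omega, fun h => absurd (hσ.apply_mem i) (h ▸ hv)⟩

theorem token_eq_add_iff (hσ : H.Lists σ) {v : Fin m} {X : ℕ} :
    H.token σ v = s + X ↔ v ∉ H.S ∧ H.mask σ v = X := by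
  by_cases hv : v ∈ H.S
  · obtain ⟨j, rfl⟩ := (hσ.mem v).1 hv
    rw [hσ.token_apply]
    simp only [hv, not_true_eq_false, false_and, iff_false]
    omega
  · rw [hσ.token_of_not_mem hv]
    simp [hv]

theorem token_lt (hσ : H.Lists σ) (v : Fin m) : H.token σ v < s + 2 ^ s := by
  by_cases hv : v ∈ H.S
  · obtain ⟨j, rfl⟩ := (hσ.mem v).1 hv
    rw [hσ.token_apply]
    exact j.2.trans_le (Nat.le_add_right _ _)
  · rw [hσ.token_of_not_mem hv]
    have := H.mask_lt σ v
    omega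

theorem adj_add_iff {y X : ℕ} :
    (H.tokenData σ k).Adj y (s + X) ↔ y < s ∧ X.testBit y = true := by
  simp [TokenData.Adj, Pattern.tokenData]

theorem token_adj_iff (hσ : H.Lists σ) {u v : Fin m} :
    (H.tokenData σ k).Adj (H.token σ u) (H.token σ v) ↔ H.graph.Adj u v := by
  by_cases hv : v ∈ H.S
  · obtain ⟨j, rfl⟩ := (hσ.mem v).1 hv
    have hj : H.token σ (σ j) < (H.tokenData σ k).s := by
      rw [hσ.token_apply]; exact j.2
    rw [TokenData.Adj, if_pos hj, hσ.token_apply]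
    have : (H.tokenData σ k).nb (H.token σ u) = H.mask σ u := by
      by_cases hu : u ∈ H.S
      · obtain ⟨i, rfl⟩ := (hσ.mem u).1 hu
        rw [hσ.token_apply]
        simp [Pattern.tokenData]
      · rw [hσ.token_of_not_mem hu]
        simp [Pattern.tokenData]
    rw [this, H.testBit_mask, H.graph.adj_comm]
  · rw [hσ.token_of_not_mem hv, adj_add_iff]
    by_cases hu : u ∈ H.S
    · obtain ⟨i, rfl⟩ := (hσ.mem u).1 hu
      rw [hσ.token_apply, H.testBit_mask]
      simp
    · rw [hσ.token_of_not_mem hu]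
      simp [Pattern.not_adj_of_not_mem_S hu hv]

end Pattern.Lists

theorem exists_injOn_of_card_le {α β : Type*} [Nonempty β] {P : Finset α} {T : Finset β}
    (h : P.card ≤ T.card) : ∃ f : α → β, (∀ p ∈ P, f p ∈ T) ∧ Set.InjOn f P := by
  obtain ⟨f, hf, hi⟩ := (P.finite_toSet).exists_injOn_of_encard_le (t := (T : Set β))
    (by simpa using h)
  exact ⟨f, fun p hp => by simpa using hf (by simpa using hp), hi⟩

theorem leftCoverNumber_le_iff {V : Type*} [Fintype V] {G : SimpleGraph V} {o : VertexOrdering V}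
    {X : Set V} {c : ℕ} : leftCoverNumber G o X ≤ c ↔
      ∃ C : Finset V, C.card ≤ c ∧ X ⊆ closedLeftNbhd G o (C : Set V) := by
  constructor
  · intro h
    have hne : Set.Nonempty {k | ∃ C : Finset V, C.card = k ∧
        X ⊆ closedLeftNbhd G o (C : Set V)} :=
      ⟨Finset.univ.card, Finset.univ, rfl, fun v _ => Or.inl (by simp)⟩
    obtain ⟨C, h1, h2⟩ : ∃ C : Finset V, C.card = leftCoverNumber G o X ∧
      X ⊆ closedLeftNbhd G o (C : Set V) := Nat.sInf_mem hne
    exact ⟨C, h1.trans_le h, h2⟩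
  · rintro ⟨C, h1, h2⟩
    have h3 : leftCoverNumber G o X ≤ C.card := Nat.sInf_le ⟨C, rfl, h2⟩
    exact h3.trans h1

theorem mem_closedLeftNbhd {V : Type*} [Fintype V] {G : SimpleGraph V} {o : VertexOrdering V}
    {X : Set V} {v : V} :
    v ∈ closedLeftNbhd G o X ↔ ∃ x ∈ X, v = x ∨ G.Adj x v ∧ o v < o x := by
  simp only [closedLeftNbhd, Set.mem_union, Set.mem_iUnion, leftNbhd, Set.mem_ofPred_eq]
  constructor
  · rintro (h | ⟨x, hx, h⟩)
    · exact ⟨v, h, Or.inl rfl⟩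
    · exact ⟨x, hx, Or.inr h⟩
  · rintro ⟨x, hx, rfl | h⟩
    · exact Or.inl hx
    · exact Or.inr ⟨x, hx, h⟩

open scoped Classical in
/-- The vertices of a pattern can be placed at the positions of a valid word. -/
theorem TokenData.Valid.exists_place (hσ : H.Lists σ) {w : ℕ → ℕ}
    (h : (H.tokenData σ k).Valid ((H.tokenData σ k).extend w)) :
    ∃ place : Fin m → ℕ, ∀ v,
      place v < (H.tokenData σ k).len ∧
      (H.tokenData σ k).Present ((H.tokenData σ k).extend w) (place v) ∧
      (H.tokenData σ k).extend w (place v) = H.token σ v ∧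
      ((H.tokenData σ k).L ≤ place v → v ∉ H.S) ∧
      ∀ v', place v < (H.tokenData σ k).L → place v = place v' → v = v' := by
  set D := H.tokenData σ k with hD
  set u := D.extend w with hu
  have : Nonempty (Fin m) := H.connected.nonempty
  have hs : D.s = s := rfl
  have hcap : ∀ X, D.cap X = (Finset.univ.filter fun t => t ∉ H.S ∧ H.mask σ t = X).card :=
    fun _ => rfl
  -- For each token `y` other than the padding, `e` assigns different vertices with token `y` to its
  -- occurrences. A token of the small side occurs once, and a class of the large side has enough
  -- vertices by `occ_le_cap`.
  have hex : ∀ y, ∃ e : ℕ → Fin m, y < D.base → y ≠ s →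
      (∀ p < D.L, u p = y → H.token σ (e p) = y) ∧
      ∀ p < D.L, ∀ q < D.L, u p = y → u q = y → e p = e q → p = q := by
    intro y
    by_cases hys : y < s
    · refine ⟨fun _ => σ ⟨y, hys⟩, fun _ _ => ⟨fun p _ _ => hσ.token_apply _,
        fun p hp q hq h1 h2 _ => ?_⟩⟩
      obtain ⟨a, ha⟩ := Finset.card_eq_one.1 (h.occ_eq_one y hys)
      have h3 : p ∈ (Finset.range D.L).filter fun p => u p = y := by simp [hp, h1]
      have h4 : q ∈ (Finset.range D.L).filter fun p => u p = y := by simp [hq, h2]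
      rw [ha, Finset.mem_singleton] at h3 h4
      rw [h3, h4]
    · by_cases hy : y < D.base ∧ y ≠ s
      · obtain ⟨X, rfl⟩ := Nat.exists_eq_add_of_le (not_lt.1 hys)
        have hX : X < 2 ^ s := by
          have := hy.1
          simp only [TokenData.base, hs] at this
          omega
        have hc := h.occ_le_cap X hX (by omega)
        rw [hcap] at hc
        obtain ⟨e, he, hi⟩ := exists_injOn_of_card_le hc
        refine ⟨e, fun _ _ => ⟨fun p hp hpy => ?_, fun p hp q hq h1 h2 he => ?_⟩⟩
        · rw [hσ.token_eq_add_iff]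
          simpa using he p (by simp [hp, hpy, hs])
        · exact hi (by simp [hp, h1, hs]) (by simp [hq, h2, hs]) he
      · exact ⟨fun _ => Classical.arbitrary _, fun h1 h2 => absurd ⟨h1, h2⟩ hy⟩
  choose e he using hex
  -- No vertex has the padding token, as its mask would be empty.
  have hgood : ∀ v p, H.token σ v = u p → u p < D.base ∧ u p ≠ s := by
    intro v p hv
    refine ⟨hv ▸ hσ.token_lt v, fun hps => ?_⟩
    have h1 := (hσ.token_eq_add_iff (X := 0)).1 (hv.trans hps)
    exact hσ.mask_ne_zero h1.1 h1.2
  -- `P v p` says that the occurrence `p` is assigned to `v`. A vertex without an assigned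
  -- occurrence goes to the tail position of its class, which it may share with others.
  set P : Fin m → ℕ → Prop := fun v p => p < D.L ∧ u p = H.token σ v ∧ e (u p) p = v with hP
  refine ⟨fun v => if hv : ∃ p, P v p then hv.choose else D.L + H.mask σ v, fun v => ?_⟩
  have hpos : ∀ v, (hv : ∃ p, P v p) → P v hv.choose := fun v hv => hv.choose_spec
  have hno : ∀ v, (¬ ∃ p, P v p) → v ∉ H.S := by
    intro v hv hvS
    obtain ⟨i, rfl⟩ := (hσ.mem v).1 hvS
    obtain ⟨a, ha⟩ := Finset.card_eq_one.1 (h.occ_eq_one i i.2)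
    have h3 : a ∈ (Finset.range D.L).filter fun p => u p = i := by simp [ha]
    rw [Finset.mem_filter, Finset.mem_range] at h3
    have h4 := hgood (σ i) a (by rw [hσ.token_apply, h3.2])
    refine hv ⟨a, h3.1, by rw [h3.2, hσ.token_apply], ?_⟩
    exact hσ.token_eq_val_iff.1 (((he (u a) h4.1 h4.2).1 a h3.1 rfl).trans h3.2)
  by_cases hv : ∃ p, P v p
  · simp only [dif_pos hv]
    obtain ⟨h1, h2, h3⟩ := hpos v hv
    refine ⟨h1.trans_le (Nat.le_add_right _ _), Or.inl h1, h2, fun h4 => by omega,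
      fun v' _ h4 => ?_⟩
    by_cases hv' : ∃ p, P v' p
    · rw [dif_pos hv'] at h4
      have h5 := (hpos v' hv').2.2
      rw [← h4, h3] at h5
      exact h5
    · rw [dif_neg hv'] at h4
      omega
  · simp only [dif_neg hv]
    have hvS := hno v hv
    have hmask := H.mask_lt σ v
    have htok := hσ.token_of_not_mem hvS
    refine ⟨by simp only [TokenData.len, hs]; omega, Or.inr ?_, ?_, fun _ => hvS,
      fun v' h4 => by omega⟩
    · rw [hcap, TokenData.occ, Nat.add_sub_cancel_left]
      have hg : s + H.mask σ v < D.base := by simp only [TokenData.base, hs]; omega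
      have hg' : s + H.mask σ v ≠ s := by have := hσ.mask_ne_zero hvS; omega
      obtain ⟨h5, h6⟩ := he _ hg hg'
      -- The occurrences of the token inject into the class without `v`, so they are fewer than the
      -- multiplicity: the tail position is present because of `v` itself.
      refine (Finset.card_le_card_of_injOn (e (s + H.mask σ v)) ?_ ?_).trans_lt
        (Finset.card_lt_card (Finset.erase_ssubset (a := v) (by simp [hvS])))
      · intro p hp
        simp only [Finset.coe_filter, Finset.mem_range, Set.mem_ofPred_eq] at hp
        have h7 := hσ.token_eq_add_iff.1 (h5 p hp.1 hp.2)
        simp only [Finset.coe_erase, Finset.coe_filter, Finset.mem_univ, true_and, Set.mem_sdiff,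
          Set.mem_ofPred_eq, Set.mem_singleton_iff]
        refine ⟨h7, fun h8 => hv ⟨p, hp.1, by rw [htok]; exact hp.2, ?_⟩⟩
        have : u p = s + H.mask σ v := hp.2
        rw [this]
        exact h8
      · intro p hp q hq h7
        simp only [Finset.coe_filter, Finset.mem_range, Set.mem_ofPred_eq] at hp hq
        exact h6 p hp.1 q hq.1 hp.2 hq.2 h7
    · rw [htok, hu, TokenData.extend, if_neg (by omega), Nat.add_sub_cancel_left, hs]

open scoped Classical in
/-- Every valid word describes a degenerate ordering of the pattern. -/
theorem TokenData.Valid.coverable (hσ : H.Lists σ) {c d : ℕ} (hH : H.Locatable c d) (hk : k ≤ d)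
    {w : ℕ → ℕ} (h : (H.tokenData σ k).Valid ((H.tokenData σ k).extend w)) :
    (H.tokenData σ k).Coverable ((H.tokenData σ k).extend w) c := by
  obtain ⟨place, hplace⟩ := h.exists_place hσ
  set D := H.tokenData σ k with hD
  set u := D.extend w with hu
  -- Vertices are ordered by position. The summand `v < m` only breaks ties between vertices that
  -- share a tail position.
  obtain ⟨o, ho⟩ := exists_vertexOrdering (fun v => place v * m + v) fun v v' hv =>
    ((mul_add_inj v v').1 hv).2
  -- The tail contains only vertices of the independent large side. So the left end of an edge lies
  -- at a position below `L`, where `place` takes no value twice, and its position is strictly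
  -- smaller than that of the right end.
  have hlt : ∀ v v', H.graph.Adj v v' → o v' < o v → place v' < place v ∧ place v' < D.L := by
    intro v v' hadj hov
    rw [ho] at hov
    have hle : place v' ≤ place v := by
      by_contra hlt
      have : (place v + 1) * m ≤ place v' * m := Nat.mul_le_mul_right _ (by omega)
      have := v.2
      rw [add_mul] at *
      omega
    have hL : place v' < D.L := by
      by_contra hL
      exact Pattern.not_adj_of_not_mem_S ((hplace v).2.2.2.1 (by omega))
        ((hplace v').2.2.2.1 (by omega)) hadj
    refine ⟨lt_of_le_of_ne hle fun he => hadj.ne ?_, hL⟩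
    exact ((hplace v').2.2.2.2 v hL he).symm
  have hdeg : IsDegenerateOrdering H.graph o d := by
    intro v
    refine le_trans ?_ ((h.leftDeg_le (place v) (hplace v).1 (hplace v).2.1).trans hk)
    rw [Set.ncard_eq_toFinset_card']
    refine Finset.card_le_card_of_injOn place ?_ ?_
    · intro v' hv'
      rw [Set.coe_toFinset] at hv'
      simp only [Finset.coe_filter, Finset.mem_range, Set.mem_ofPred_eq]
      refine ⟨(hlt v v' hv'.1 hv'.2).1, ?_⟩
      rw [(hplace v').2.2.1, (hplace v).2.2.1, hσ.token_adj_iff]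
      exact hv'.1.symm
    · intro v' hv' v'' hv'' he
      rw [Set.coe_toFinset] at hv' hv''
      exact (hplace v').2.2.2.2 v'' (hlt v v' hv'.1 hv'.2).2 he
  obtain ⟨C, hC, hcov⟩ := leftCoverNumber_le_iff.1 (hH o hdeg)
  have hlen : 0 < D.len := by
    have : 0 < 2 ^ D.s := by positivity
    simp only [TokenData.len]
    omega
  refine ⟨fun j => if hj : j < C.toList.length then place (C.toList[j]) else 0, fun j _ => ?_,
    fun i hi => ?_⟩
  · dsimp only
    split_ifs
    · exact (hplace _).1
    · exact hlen
  · obtain ⟨x, hx, hxi⟩ := mem_closedLeftNbhd.1 (hcov (hσ.apply_mem ⟨i, hi⟩))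
    obtain ⟨j, hj, rfl⟩ := List.mem_iff_getElem.1 (Finset.mem_toList.2 hx)
    have hjc : j < c := by
      rw [Finset.length_toList] at hj
      omega
    refine ⟨j, hjc, ?_⟩
    simp only [dif_pos hj]
    refine ⟨(hplace _).2.1, ?_⟩
    rcases hxi with hxi | ⟨h1, h2⟩
    · left
      rw [(hplace _).2.2.1, ← hxi, hσ.token_apply]
    · right
      refine ⟨place (σ ⟨i, hi⟩), (hlt _ _ h1 h2).1, ?_, ?_⟩
      · rw [(hplace _).2.2.1, hσ.token_apply]
      · rw [(hplace _).2.2.1, (hplace _).2.2.1, hσ.token_adj_iff]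
        exact h1.symm

end

/-! ### Degenerate orderings of the pattern are described by valid words. -/

section

variable {m s k : ℕ} {H : Pattern (Fin m)} {σ : Fin s → Fin m}

theorem Pattern.Lists.card_eq (hσ : H.Lists σ) : H.S.card = s := by
  have : H.S = Finset.univ.image σ := by
    ext v
    simp [hσ.mem]
  rw [this, Finset.card_image_of_injective _ hσ.injective, Finset.card_univ, Fintype.card_fin]

/-- The small side of a locatable pattern is not much larger than the covers. -/
theorem Pattern.Locatable.card_le {c d : ℕ} (hH : H.Locatable c d) {o : VertexOrdering (Fin m)}
    (ho : IsDegenerateOrdering H.graph o k) (hk : k ≤ d) : H.S.card ≤ c * (k + 1) := by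
  classical
  obtain ⟨C, hC, hcov⟩ := leftCoverNumber_le_iff.1 (hH o (ho.mono hk))
  have hsub : H.S ⊆ C.biUnion fun v => insert v (leftNbhd H.graph o v).toFinset := by
    intro u hu
    obtain ⟨x, hx, h⟩ := mem_closedLeftNbhd.1 (hcov hu)
    simp only [Finset.mem_biUnion, Finset.mem_insert, Set.mem_toFinset]
    exact ⟨x, hx, h⟩
  calc H.S.card ≤ C.card * (k + 1) := (Finset.card_le_card hsub).trans
        (Finset.card_biUnion_le_card_mul _ _ _ fun v _ => (Finset.card_insert_le _ _).trans
          (Nat.succ_le_succ (by rw [← Set.ncard_eq_toFinset_card']; exact ho v)))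
    _ ≤ c * (k + 1) := Nat.mul_le_mul_right _ hC

theorem mem_leftNbhd {V : Type*} [Fintype V] {G : SimpleGraph V} {o : VertexOrdering V} {u v : V} :
    u ∈ leftNbhd G o v ↔ G.Adj v u ∧ o u < o v := Iff.rfl

open scoped Classical in
/-- The vertices of the pattern that are essential for the cover number: the small side and all
vertices that have a neighbour in the small side to their right. -/
noncomputable def Pattern.essential (H : Pattern (Fin m)) (o : VertexOrdering (Fin m)) :
    Finset (Fin m) :=
  H.S.biUnion fun u => insert u (leftNbhd H.graph o u).toFinset

theorem Pattern.mem_essential {o : VertexOrdering (Fin m)} {v : Fin m} :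
    v ∈ H.essential o ↔ v ∈ H.S ∨ ∃ u ∈ H.S, H.graph.Adj u v ∧ o v < o u := by
  simp only [Pattern.essential, Finset.mem_biUnion, Finset.mem_insert, Set.mem_toFinset,
    mem_leftNbhd]
  constructor
  · rintro ⟨u, hu, rfl | h⟩
    · exact Or.inl hu
    · exact Or.inr ⟨u, hu, h⟩
  · rintro (h | ⟨u, hu, h⟩)
    · exact ⟨v, h, Or.inl rfl⟩
    · exact ⟨u, hu, Or.inr h⟩

/-- Each vertex of the small side contributes itself and at most `k` left neighbours. This explains
the word length `(k + 1) * s` in `Pattern.tokenData`. -/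
theorem Pattern.card_essential_le (hσ : H.Lists σ) {o : VertexOrdering (Fin m)}
    (ho : IsDegenerateOrdering H.graph o k) : (H.essential o).card ≤ (k + 1) * s := by
  classical
  rw [Pattern.essential, ← hσ.card_eq, mul_comm]
  exact Finset.card_biUnion_le_card_mul _ _ _ fun v _ => (Finset.card_insert_le _ _).trans
    (Nat.succ_le_succ (by rw [← Set.ncard_eq_toFinset_card']; exact ho v))

/-- The essential vertices in their order. -/
theorem Pattern.exists_enumeration (H : Pattern (Fin m)) (o : VertexOrdering (Fin m)) :
    ∃ x : ℕ → Fin m, (∀ p < (H.essential o).card, x p ∈ H.essential o) ∧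
      (∀ v ∈ H.essential o, ∃ p < (H.essential o).card, x p = v) ∧
      ∀ p < (H.essential o).card, ∀ q < (H.essential o).card, o (x p) < o (x q) ↔ p < q := by
  have : Nonempty (Fin m) := H.connected.nonempty
  set E := (H.essential o).map o.toEmbedding with hE
  have hcard : E.card = (H.essential o).card := Finset.card_map _
  let f := E.orderIsoOfFin hcard
  refine ⟨fun p => if hp : p < (H.essential o).card then o.symm (f ⟨p, hp⟩) else
    Classical.arbitrary _, fun p hp => ?_, fun v hv => ?_, fun p hp q hq => ?_⟩
  · simp only [dif_pos hp]
    have := (f ⟨p, hp⟩).2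
    obtain ⟨v, hv, h⟩ := Finset.mem_map.1 this
    rw [← h]
    simpa using hv
  · have hv' : o v ∈ E := by simpa [hE] using hv
    refine ⟨f.symm ⟨o v, hv'⟩, (f.symm ⟨o v, hv'⟩).2, ?_⟩
    simp
  · simp only [dif_pos hp, dif_pos hq, Equiv.apply_symm_apply, Subtype.coe_lt_coe, f.lt_iff_lt,
      Fin.mk_lt_mk]

open scoped Classical in
/-- Every degenerate ordering of the pattern is described by a valid word. -/
theorem IsDegenerateOrdering.exists_valid (hσ : H.Lists σ) {o : VertexOrdering (Fin m)}
    (ho : IsDegenerateOrdering H.graph o k) :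
    ∃ w : ℕ → ℕ, (∀ p < (H.tokenData σ k).L, w p < (H.tokenData σ k).base) ∧
      (H.tokenData σ k).Valid ((H.tokenData σ k).extend w) ∧
      ∀ c, (H.tokenData σ k).Coverable ((H.tokenData σ k).extend w) c →
        leftCoverNumber H.graph o H.S ≤ c := by
  have hNL := Pattern.card_essential_le hσ ho
  obtain ⟨x, hxE, hxs, hxo⟩ := H.exists_enumeration o
  set N := (H.essential o).card with hN
  have hxi : ∀ p < N, ∀ q < N, x p = x q → p = q := by
    intro p hp q hq h
    have h1 := hxo p hp q hq
    have h2 := hxo q hq p hp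
    rw [h] at h1 h2
    simp only [lt_irrefl, false_iff, not_lt] at h1 h2
    omega
  set D := H.tokenData σ k with hD
  have hs : D.s = s := rfl
  have hL : D.L = (k + 1) * s := rfl
  have hcap : ∀ X, D.cap X = (Finset.univ.filter fun t => t ∉ H.S ∧ H.mask σ t = X).card :=
    fun _ => rfl
  -- The word lists the tokens of the essential vertices in their order, followed by the padding
  -- token `s`, which is adjacent to nothing and may be repeated freely.
  set w : ℕ → ℕ := fun p => if p < N then H.token σ (x p) else s with hw
  set u := D.extend w with hu
  have hu1 : ∀ p < N, u p = H.token σ (x p) := by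
    intro p hp
    rw [hu, TokenData.extend, if_pos (by omega), hw]
    simp only [if_pos hp]
  have hu2 : ∀ p, N ≤ p → p < D.L → u p = s := by
    intro p hp hpL
    rw [hu, TokenData.extend, if_pos hpL, hw]
    simp only [if_neg (not_lt.2 hp)]
  have hu3 : ∀ X, u (D.L + X) = s + X := by
    intro X
    rw [hu, TokenData.extend, if_neg (by omega), Nat.add_sub_cancel_left, hs]
  have hsmall : ∀ p, ∀ i : Fin s, u p = i → p < N ∧ x p = σ i := by
    intro p i hp
    rcases lt_or_ge p N with h1 | h1
    · exact ⟨h1, hσ.token_eq_val_iff.1 ((hu1 p h1).symm.trans hp)⟩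
    · have := i.2
      rcases lt_or_ge p D.L with h2 | h2
      · rw [hu2 p h1 h2] at hp
        omega
      · obtain ⟨X, rfl⟩ := Nat.exists_eq_add_of_le h2
        rw [hu3] at hp
        omega
  have hnadj : ∀ y, ¬ D.Adj y s := fun y h => by
    have := (Pattern.Lists.adj_add_iff (X := 0)).1 h
    simp at this
  -- If all vertices of the class of `X` were essential, they would all occur in the word and
  -- exhaust the multiplicity, so the tail position would be absent.
  have htail : ∀ X, D.Present u (D.L + X) → ∃ t, t ∉ H.S ∧ H.mask σ t = X ∧
      t ∉ H.essential o := by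
    intro X hP
    by_contra! hne
    have hlt := hP.resolve_left (by omega)
    rw [Nat.add_sub_cancel_left] at hlt
    refine absurd hlt (not_lt.2 ?_)
    rw [hcap, TokenData.occ]
    refine le_trans (Finset.card_le_card (t := Finset.image x _) fun t ht => ?_)
      Finset.card_image_le
    simp only [Finset.mem_filter, Finset.mem_univ, true_and] at ht
    obtain ⟨p, hp, rfl⟩ := hxs t (hne t ht.1 ht.2)
    refine Finset.mem_image.2 ⟨p, ?_, rfl⟩
    rw [Finset.mem_filter, Finset.mem_range, hu1 p hp, hs]
    exact ⟨by omega, hσ.token_eq_add_iff.2 ht⟩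
  -- All neighbours of an inessential vertex are to its left; therefore moving it to the end changes
  -- no left neighbourhood.
  have hleft : ∀ t, t ∉ H.S → t ∉ H.essential o → ∀ i, H.graph.Adj (σ i) t → o (σ i) < o t := by
    intro t htS ht i hi
    by_contra! hle
    refine ht (Pattern.mem_essential.2 (Or.inr ⟨σ i, hσ.apply_mem i, hi,
      lt_of_le_of_ne hle fun he => ?_⟩))
    exact hi.ne (o.injective he).symm
  refine ⟨w, fun p hp => ?_, (⟨fun i hi => ?_, fun X hX hX0 => ?_, fun p hp hP => ?_⟩ : D.Valid u),
    fun c ⟨C, hC, hcov⟩ => ?_⟩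
  · rw [hw]
    dsimp only
    split_ifs
    · exact hσ.token_lt _
    · have : 0 < 2 ^ s := by positivity
      change s < s + 2 ^ s
      omega
  · obtain ⟨p, hp, hpx⟩ := hxs (σ ⟨i, hi⟩) (Pattern.mem_essential.2 (Or.inl (hσ.apply_mem _)))
    refine Finset.card_eq_one.2 ⟨p, ?_⟩
    ext q
    rw [Finset.mem_filter, Finset.mem_range, Finset.mem_singleton]
    constructor
    · rintro ⟨hq, hqi⟩
      obtain ⟨h1, h2⟩ := hsmall q ⟨i, hi⟩ hqi
      exact hxi q h1 p hp (h2.trans hpx.symm)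
    · rintro rfl
      exact ⟨by omega, by rw [hu1 q hp, hpx, hσ.token_apply]⟩
  · rw [hcap]
    refine Finset.card_le_card_of_injOn x ?_ ?_
    · intro p hp
      simp only [Finset.coe_filter, Finset.mem_range, Set.mem_ofPred_eq] at hp
      have hpN : p < N := by
        by_contra hpN
        rw [hu2 p (by omega) hp.1] at hp
        omega
      rw [hu1 p hpN, hs] at hp
      simpa using hσ.token_eq_add_iff.1 hp.2
    · intro p hp q hq h
      simp only [Finset.coe_filter, Finset.mem_range, Set.mem_ofPred_eq] at hp hq
      refine hxi p ?_ q ?_ h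
      · by_contra hpN
        rw [hu2 p (by omega) hp.1] at hp
        omega
      · by_contra hpN
        rw [hu2 q (by omega) hq.1] at hq
        omega
  · rcases lt_or_ge p N with h1 | h1
    · refine le_trans ?_ (ho (x p))
      rw [Set.ncard_eq_toFinset_card']
      refine Finset.card_le_card_of_injOn x ?_ ?_
      · intro q hq
        simp only [Finset.coe_filter, Finset.mem_range, Set.mem_ofPred_eq] at hq
        rw [hu1 p h1, hu1 q (by omega), hσ.token_adj_iff] at hq
        rw [Set.coe_toFinset]
        exact ⟨hq.2.symm, (hxo q (by omega) p h1).2 hq.1⟩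
      · intro q hq r hr h
        simp only [Finset.coe_filter, Finset.mem_range, Set.mem_ofPred_eq] at hq hr
        exact hxi q (by omega) r (by omega) h
    · rcases lt_or_ge p D.L with h2 | h2
      · refine le_of_eq_of_le (Finset.card_eq_zero.2 ?_) (Nat.zero_le _)
        refine Finset.filter_eq_empty_iff.2 fun q _ => ?_
        rw [hu2 p h1 h2]
        exact hnadj _
      · obtain ⟨X, rfl⟩ := Nat.exists_eq_add_of_le h2
        obtain ⟨t, htS, htX, htE⟩ := htail X hP
        -- Only tokens of the small side are adjacent to a tail token, and the vertices they stand
        -- for are left neighbours of the inessential vertex `t`. So the left degree of the tail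
        -- position is at most that of `t`.
        have key : ∀ q, D.Adj (u q) (u (D.L + X)) → q < N ∧ ∃ i, x q = σ i ∧
            H.graph.Adj (σ i) t := by
          intro q hq
          rw [hu3, Pattern.Lists.adj_add_iff] at hq
          obtain ⟨h3, h4⟩ := hsmall q ⟨u q, hq.1⟩ rfl
          refine ⟨h3, ⟨u q, hq.1⟩, h4, ?_⟩
          rw [← H.testBit_mask, htX]
          exact hq.2
        refine le_trans ?_ (ho t)
        rw [Set.ncard_eq_toFinset_card']
        refine Finset.card_le_card_of_injOn x ?_ ?_
        · intro q hq
          simp only [Finset.coe_filter, Finset.mem_range, Set.mem_ofPred_eq] at hq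
          obtain ⟨-, i, h4, h5⟩ := key q hq.2
          rw [Set.coe_toFinset, h4]
          exact ⟨h5.symm, hleft t htS htE i h5⟩
        · intro q hq r hr h
          simp only [Finset.coe_filter, Finset.mem_range, Set.mem_ofPred_eq] at hq hr
          exact hxi q (key q hq.2).1 r (key r hr.2).1 h
  -- Every position is replaced by a vertex whose closed left neighbourhood contains all it covers:
  -- a letter by its essential vertex, a present tail position by an inessential vertex of the
  -- class. Padding and absent positions cover nothing, so for them `x 0` is an arbitrary choice.
  · have hrep : ∀ p, ∃ v, ∀ i : Fin s, D.Cov u p i → σ i = v ∨ H.graph.Adj v (σ i) ∧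
        o (σ i) < o v := by
      intro p
      rcases lt_or_ge p N with h1 | h1
      · refine ⟨x p, fun i ⟨_, hi⟩ => ?_⟩
        rcases hi with hi | ⟨q, hq, hqi, hadj⟩
        · exact Or.inl (hsmall p i hi).2.symm
        · have h2 := (hsmall q i hqi).2
          rw [hu1 p h1, hu1 q (by omega), hσ.token_adj_iff, h2] at hadj
          refine Or.inr ⟨hadj.symm, ?_⟩
          rw [← h2]
          exact (hxo q (by omega) p h1).2 hq
      · by_cases hP : D.L ≤ p ∧ D.Present u p
        · obtain ⟨X, rfl⟩ := Nat.exists_eq_add_of_le hP.1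
          obtain ⟨t, htS, htX, htE⟩ := htail X hP.2
          refine ⟨t, fun i ⟨_, hi⟩ => ?_⟩
          rcases hi with hi | ⟨q, hq, hqi, hadj⟩
          · rw [hu3] at hi
            omega
          · rw [hu3, Pattern.Lists.adj_add_iff, hqi, ← htX, H.testBit_mask] at hadj
            exact Or.inr ⟨hadj.2.symm, hleft t htS htE i hadj.2⟩
        · refine ⟨x 0, fun i ⟨h2, hi⟩ => ?_⟩
          have h3 : p < D.L := by
            by_contra h3
            exact hP ⟨not_lt.1 h3, h2⟩
          rw [hu2 p h1 h3] at hi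
          rcases hi with hi | ⟨q, hq, hqi, hadj⟩
          · omega
          · exact absurd hadj (hnadj _)
    choose rep hrep using hrep
    refine leftCoverNumber_le_iff.2 ⟨(Finset.range c).image fun j => rep (C j),
      Finset.card_image_le.trans (Finset.card_range c).le, fun v hv => ?_⟩
    obtain ⟨i, rfl⟩ := (hσ.mem v).1 hv
    obtain ⟨j, hj, hc⟩ := hcov i i.2
    exact mem_closedLeftNbhd.2 ⟨rep (C j), by simpa using ⟨j, hj, rfl⟩, hrep _ i hc⟩

end

/-! ## Counting strong embeddings -/

/-- The number of embeddings that preserve a colouring. -/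
theorem card_colored_embeddings {α β κ : Type*} [Fintype α] [Fintype β] [Fintype κ]
    [DecidableEq κ] (f : α → κ) (g : β → κ) :
    Nat.card {τ : α ↪ β // ∀ a, g (τ a) = f a} =
      ∏ x : κ, (Fintype.card {b // g b = x}).descFactorial (Fintype.card {a // f a = x}) := by
  classical
  let e : {τ : α ↪ β // ∀ a, g (τ a) = f a} ≃ ∀ x : κ, {a // f a = x} ↪ {b // g b = x} :=
    { toFun := fun τ x => ⟨fun a => ⟨τ.1 a.1, (τ.2 a.1).trans a.2⟩, fun a b h =>
        Subtype.ext (τ.1.injective (congrArg Subtype.val h))⟩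
      invFun := fun h => ⟨⟨fun a => (h (f a) ⟨a, rfl⟩).1, fun a b hab => by
        have hf : f a = f b := by
          rw [← (h (f a) ⟨a, rfl⟩).2, ← (h (f b) ⟨b, rfl⟩).2]
          exact congrArg g hab
        have key : ∀ x (ha : f a = x) (hb : f b = x),
            (h x ⟨a, ha⟩).1 = (h x ⟨b, hb⟩).1 → a = b := fun x ha hb h' =>
          congrArg Subtype.val ((h x).injective (Subtype.ext h'))
        refine key (f a) rfl hf.symm (hab.trans ?_)
        have : ∀ x (hx : f b = x), (h (f b) ⟨b, rfl⟩).1 = (h x ⟨b, hx⟩).1 := by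
          rintro x rfl
          rfl
        exact this _ _⟩, fun a => (h (f a) ⟨a, rfl⟩).2⟩
      left_inv := fun τ => by
        ext a
        rfl
      right_inv := fun h => by
        funext x
        ext ⟨a, rfl⟩
        rfl }
  rw [Nat.card_congr e, Nat.card_eq_fintype_card, Fintype.card_pi]
  simp [Fintype.card_embedding_eq]

section

variable {m s k n : ℕ} {H : Pattern (Fin m)} {σ : Fin s → Fin m} {G : SimpleGraph (Fin n)}

/-- The vertices among the `ψ i` that are adjacent to `v`, as a binary number. -/
noncomputable def hostMask (G : SimpleGraph (Fin n)) (ψ : Fin s → Fin n) (v : Fin n) : ℕ :=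
  bitSum s fun i => ∃ h : i < s, G.Adj (ψ ⟨i, h⟩) v

theorem hostMask_lt {ψ : Fin s → Fin n} {v : Fin n} : hostMask G ψ v < 2 ^ s := bitSum_lt _ _

theorem Pattern.mask_eq_hostMask_iff {ψ : Fin s → Fin n} {v : Fin n} {t : Fin m} :
    hostMask G ψ v = H.mask σ t ↔ ∀ i, H.graph.Adj (σ i) t ↔ G.Adj (ψ i) v := by
  rw [hostMask, Pattern.mask, bitSum_inj]
  constructor
  · intro h i
    simpa using (h i i.2).symm
  · intro h i hi
    simpa [hi] using (h ⟨i, hi⟩).symm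

open scoped Classical in
/-- The number of vertices outside the image of `ψ` with a given set of neighbours. -/
noncomputable def freeCount (G : SimpleGraph (Fin n)) (ψ : Fin s → Fin n) (X : ℕ) : ℕ :=
  (Finset.univ.filter fun v => (∀ i, ψ i ≠ v) ∧ hostMask G ψ v = X).card

/-- The map `ψ` is an embedding of the small side as an induced subgraph. -/
structure Pattern.Induced (H : Pattern (Fin m)) (σ : Fin s → Fin m) (G : SimpleGraph (Fin n))
    (ψ : Fin s → Fin n) : Prop where
  injective : Function.Injective ψ
  adj_iff : ∀ i j, H.graph.Adj (σ i) (σ j) ↔ G.Adj (ψ i) (ψ j)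

/-- The number of extensions of an embedding of the small side to strong embeddings. -/
noncomputable def Pattern.extensions (H : Pattern (Fin m)) (σ : Fin s → Fin m)
    (G : SimpleGraph (Fin n)) (ψ : Fin s → Fin n) : ℕ :=
  ∏ X ∈ Finset.range (2 ^ s), (freeCount G ψ X).descFactorial (H.cap σ X)

/-- Glue an embedding of the small side and an embedding of the large side. -/
noncomputable def Pattern.Lists.glue (hσ : H.Lists σ) {ψ : Fin s → Fin n} (hψ : Function.Injective ψ)
    (τ : {t : Fin m // t ∉ H.S} ↪ {v : Fin n // ∀ i, ψ i ≠ v}) : Fin m ↪ Fin n where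
  toFun v := if hv : v ∈ H.S then ψ ((hσ.mem v).1 hv).choose else (τ ⟨v, hv⟩).1
  inj' u v h := by
    dsimp only at h
    split_ifs at h with hu hv hv
    · have h1 := ((hσ.mem u).1 hu).choose_spec
      have h2 := ((hσ.mem v).1 hv).choose_spec
      rw [← h1, ← h2, hψ h]
    · exact absurd h ((τ ⟨v, hv⟩).2 _)
    · exact absurd h.symm ((τ ⟨u, hu⟩).2 _)
    · exact congrArg Subtype.val (τ.injective (Subtype.ext h))

theorem Pattern.Lists.glue_apply (hσ : H.Lists σ) {ψ : Fin s → Fin n} (hψ : Function.Injective ψ)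
    (τ : {t : Fin m // t ∉ H.S} ↪ {v : Fin n // ∀ i, ψ i ≠ v}) (i : Fin s) :
    hσ.glue hψ τ (σ i) = ψ i := by
  have h : σ i ∈ H.S := hσ.apply_mem i
  have h1 := ((hσ.mem _).1 h).choose_spec
  change (if hv : σ i ∈ H.S then ψ ((hσ.mem _).1 hv).choose else _) = ψ i
  rw [dif_pos h, hσ.injective h1]

theorem Pattern.Lists.glue_of_not_mem (hσ : H.Lists σ) {ψ : Fin s → Fin n}
    (hψ : Function.Injective ψ)
    (τ : {t : Fin m // t ∉ H.S} ↪ {v : Fin n // ∀ i, ψ i ≠ v}) {v : Fin m} (hv : v ∉ H.S) :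
    hσ.glue hψ τ v = (τ ⟨v, hv⟩).1 := by
  exact dif_neg hv

theorem Pattern.IsStrongEmbedding.induced (hσ : H.Lists σ) {φ : Fin m ↪ Fin n}
    (h : H.IsStrongEmbedding G φ) : H.Induced σ G (φ ∘ σ) :=
  ⟨φ.injective.comp hσ.injective, fun i _ => h _ (hσ.apply_mem i) _⟩

/-- The strong embeddings that extend `ψ` correspond to embeddings of the large side. -/
noncomputable def Pattern.Induced.equiv (hσ : H.Lists σ) {ψ : Fin s → Fin n}
    (hψ : H.Induced σ G ψ) :
    {φ : Fin m ↪ Fin n // H.IsStrongEmbedding G φ ∧ φ ∘ σ = ψ} ≃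
      {τ : {t : Fin m // t ∉ H.S} ↪ {v : Fin n // ∀ i, ψ i ≠ v} //
        ∀ t, hostMask G ψ (τ t).1 = H.mask σ t.1} where
  toFun φ := ⟨⟨fun t => ⟨φ.1 t.1, fun i hi => by
      have h1 : φ.1 (σ i) = φ.1 t.1 := (congrFun φ.2.2 i).trans hi
      exact t.2 (φ.1.injective h1 ▸ hσ.apply_mem i)⟩, fun a b h =>
        Subtype.ext (φ.1.injective (congrArg Subtype.val h))⟩, fun t => by
      refine Pattern.mask_eq_hostMask_iff.2 fun i => ?_
      rw [φ.2.1 _ (hσ.apply_mem i)]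
      have := congrFun φ.2.2 i
      rw [Function.comp_apply] at this
      rw [this]
      rfl⟩
  invFun τ := ⟨hσ.glue hψ.injective τ.1, by
    refine ⟨fun u hu v => ?_, funext fun i => hσ.glue_apply hψ.injective τ.1 i⟩
    obtain ⟨i, rfl⟩ := (hσ.mem u).1 hu
    rw [hσ.glue_apply]
    by_cases hv : v ∈ H.S
    · obtain ⟨j, rfl⟩ := (hσ.mem v).1 hv
      rw [hσ.glue_apply, hψ.adj_iff]
    · rw [hσ.glue_of_not_mem _ _ hv]
      exact Pattern.mask_eq_hostMask_iff.1 (τ.2 ⟨v, hv⟩) i⟩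
  left_inv φ := by
    obtain ⟨φ, h, rfl⟩ := φ
    refine Subtype.ext (DFunLike.ext _ _ fun v => ?_)
    dsimp only
    by_cases hv : v ∈ H.S
    · obtain ⟨j, rfl⟩ := (hσ.mem v).1 hv
      rw [hσ.glue_apply]
      rfl
    · rw [hσ.glue_of_not_mem _ _ hv]
      rfl
  right_inv τ := by
    refine Subtype.ext (DFunLike.ext _ _ fun t => Subtype.ext ?_)
    exact hσ.glue_of_not_mem hψ.injective τ.1 t.2

/-- Colour the vertices of the large side by their masks and the vertices outside the image of `ψ`
by their host masks. Adjacency between images of the large side is unconstrained, so extensions are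
exactly the colour-preserving injections, counted by `card_colored_embeddings`. -/
theorem Pattern.Induced.card_eq (hσ : H.Lists σ) {ψ : Fin s → Fin n} (hψ : H.Induced σ G ψ) :
    Nat.card {φ : Fin m ↪ Fin n // H.IsStrongEmbedding G φ ∧ φ ∘ σ = ψ} = H.extensions σ G ψ := by
  classical
  let f : {t : Fin m // t ∉ H.S} → Fin (2 ^ s) := fun t => ⟨H.mask σ t.1, H.mask_lt _ _⟩
  let g : {v : Fin n // ∀ i, ψ i ≠ v} → Fin (2 ^ s) := fun v => ⟨hostMask G ψ v.1, hostMask_lt⟩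
  have h := card_colored_embeddings f g
  rw [Nat.card_congr (hψ.equiv hσ), Pattern.extensions, Finset.prod_range]
  have h2 : ∀ (τ : {t : Fin m // t ∉ H.S} ↪ {v : Fin n // ∀ i, ψ i ≠ v}),
      (∀ t, g (τ t) = f t) ↔ ∀ t, hostMask G ψ (τ t).1 = H.mask σ t.1 := fun τ =>
    forall_congr' fun t => Fin.ext_iff
  rw [Nat.card_congr (Equiv.subtypeEquivRight h2)] at h
  rw [h]
  refine Finset.prod_congr rfl fun X _ => ?_
  congr 1
  · rw [freeCount, Fintype.card_subtype, ← Finset.card_map (Function.Embedding.subtype _)]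
    congr 1
    ext v
    have hg : ∀ b, g b = X ↔ hostMask G ψ b.1 = X := fun b => Fin.ext_iff
    simp [hg, and_comm]
  · rw [Pattern.cap, Fintype.card_subtype, ← Finset.card_map (Function.Embedding.subtype _)]
    congr 1
    ext v
    have hf : ∀ b, f b = X ↔ H.mask σ b.1 = X := fun b => Fin.ext_iff
    simp [hf, and_comm]

open scoped Classical in
-- Strong embeddings are grouped by their restriction to the small side, which is always an induced
-- embedding.
theorem Pattern.strongCount_eq_sum (hσ : H.Lists σ) :
    H.strongCount G = ∑ ψ ∈ Finset.univ.filter (H.Induced σ G), H.extensions σ G ψ := by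
  rw [Pattern.strongCount, Nat.card_eq_fintype_card, Fintype.card_subtype,
    Finset.card_eq_sum_card_fiberwise (f := fun φ : Fin m ↪ Fin n => φ ∘ σ)
      (t := Finset.univ.filter (H.Induced σ G))]
  · refine Finset.sum_congr rfl fun ψ hψ => ?_
    rw [← Pattern.Induced.card_eq hσ (Finset.mem_filter.1 hψ).2, Nat.card_eq_fintype_card,
      Fintype.card_subtype, Finset.filter_filter]
  · intro φ hφ
    simp only [Finset.coe_filter, Finset.mem_univ, true_and, Set.mem_ofPred_eq] at hφ ⊢
    exact hφ.induced hσ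

/-- The image of the small side under a strong embedding is covered. -/
theorem RankDegenerate.exists_cover (hσ : H.Lists σ) {pos : Fin n → ℕ}
    (hpos : RankDegenerate G pos k) {c : ℕ}
    (hc : ∀ w : ℕ → ℕ, (∀ p < (H.tokenData σ k).L, w p < (H.tokenData σ k).base) →
      (H.tokenData σ k).Valid ((H.tokenData σ k).extend w) →
      (H.tokenData σ k).Coverable ((H.tokenData σ k).extend w) c)
    {ψ : Fin s → Fin n} (hψ : H.Induced σ G ψ) (hne : H.extensions σ G ψ ≠ 0) :
    ∃ C : ℕ → Fin n, ∀ i, ∃ j < c, ψ i = C j ∨ G.Adj (C j) (ψ i) ∧ pos (C j) < pos (ψ i) := by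
  classical
  rw [← hψ.card_eq hσ] at hne
  obtain ⟨⟨φ, hφ, rfl⟩⟩ := (Nat.card_ne_zero.1 hne).1
  -- The pattern inherits the ordering of the host graph along `φ`. Edges go to edges, because none
  -- joins two vertices of the large side, so left degrees do not exceed those in the host graph.
  obtain ⟨o, ho⟩ := exists_vertexOrdering (fun v => OrderDual.toDual (pos (φ v)))
    (hpos.injective.comp φ.injective)
  simp only [OrderDual.toDual_lt_toDual] at ho
  have hmono : ∀ u v, H.graph.Adj u v → G.Adj (φ u) (φ v) := by
    intro u v huv
    by_cases hu : u ∈ H.S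
    · exact (hφ u hu v).1 huv
    · by_cases hv : v ∈ H.S
      · exact ((hφ v hv u).1 huv.symm).symm
      · exact absurd huv (Pattern.not_adj_of_not_mem_S hu hv)
  have hdeg : IsDegenerateOrdering H.graph o k := by
    intro v
    refine le_trans ?_ (hpos.card_le (φ v))
    rw [Set.ncard_eq_toFinset_card']
    refine Finset.card_le_card_of_injOn φ ?_ φ.injective.injOn
    intro u hu
    rw [Set.coe_toFinset] at hu
    simp only [Finset.coe_filter, Finset.mem_univ, true_and, Set.mem_ofPred_eq]
    exact ⟨hmono _ _ hu.1, (ho _ _).1 hu.2⟩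
  obtain ⟨w, hw, hv, hcov⟩ := hdeg.exists_valid hσ
  obtain ⟨C, hC, hS⟩ := leftCoverNumber_le_iff.1 (hcov c (hc w hw hv))
  have : Nonempty (Fin m) := H.connected.nonempty
  refine ⟨fun j => if h : j < C.toList.length then φ C.toList[j] else
    φ (Classical.arbitrary _), fun i => ?_⟩
  obtain ⟨x, hx, hxi⟩ := mem_closedLeftNbhd.1 (hS (hσ.apply_mem i))
  obtain ⟨j, hj, rfl⟩ := List.mem_iff_getElem.1 (Finset.mem_toList.2 hx)
  refine ⟨j, by rw [Finset.length_toList] at hj; omega, ?_⟩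
  simp only [dif_pos hj]
  rcases hxi with h | ⟨h1, h2⟩
  · exact Or.inl (congrArg φ h)
  · exact Or.inr ⟨hmono _ _ h1, (ho _ _).1 h2⟩

end

/-! ## Numbers with given digits -/

/-- The number with the digits `y` in base `b`. -/
def digitSum (b s : ℕ) (y : ℕ → ℕ) : ℕ := ∑ i ∈ Finset.range s, y i * b ^ i

theorem digitSum_succ (b s : ℕ) (y : ℕ → ℕ) :
    digitSum b (s + 1) y = digitSum b s y + y s * b ^ s := Finset.sum_range_succ _ _

theorem digitSum_congr {b s : ℕ} {y y' : ℕ → ℕ} (h : ∀ i < s, y i = y' i) :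
    digitSum b s y = digitSum b s y' :=
  Finset.sum_congr rfl fun i hi => by rw [h i (Finset.mem_range.1 hi)]

theorem digitSum_lt {b s : ℕ} {y : ℕ → ℕ} (h : ∀ i < s, y i < b) : digitSum b s y < b ^ s := by
  induction s with
  | zero => simp [digitSum]
  | succ s ih =>
    rw [digitSum_succ]
    have h1 := ih fun i hi => h i (by omega)
    have h2 : (y s + 1) * b ^ s ≤ b * b ^ s := Nat.mul_le_mul_right _ (h s (by omega))
    rw [pow_succ']
    rw [add_mul] at h2
    omega

theorem digitSum_inj {b s : ℕ} {y y' : ℕ → ℕ} (h : ∀ i < s, y i < b) (h' : ∀ i < s, y' i < b) :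
    digitSum b s y = digitSum b s y' ↔ ∀ i < s, y i = y' i := by
  refine ⟨fun he => ?_, digitSum_congr⟩
  induction s with
  | zero => simp
  | succ s ih =>
    have h1 := digitSum_lt fun i hi => h i (Nat.lt_succ_of_lt hi)
    have h2 := digitSum_lt fun i hi => h' i (Nat.lt_succ_of_lt hi)
    rw [digitSum_succ, digitSum_succ, add_comm, add_comm (digitSum b s y')] at he
    have h3 := (mul_add_inj ⟨_, h1⟩ ⟨_, h2⟩).1 he
    have h4 := ih (fun i hi => h i (by omega)) (fun i hi => h' i (by omega))
      (congrArg Fin.val h3.2)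
    intro i hi
    rcases lt_or_eq_of_le (Nat.lt_succ_iff.1 hi) with h5 | rfl
    · exact h4 i h5
    · exact h3.1

theorem digitSum_digits {b s x : ℕ} (hx : x < b ^ s) :
    digitSum b s (fun i => x / b ^ i % b) = x := by
  have key : ∀ s, digitSum b s (fun i => x / b ^ i % b) = x % b ^ s := by
    intro s
    induction s with
    | zero => simp [digitSum, Nat.mod_one]
    | succ s ih => rw [digitSum_succ, ih, pow_succ, Nat.mod_mul, mul_comm (b ^ s)]
  rw [key, Nat.mod_eq_of_lt hx]

/-! ## Tables for the enumeration -/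

notation "rMul" => 63
notation "rMulRow" => 64
notation "rPw" => 65
notation "rCode" => 66
notation "rDict" => 67
notation "rVert" => 71

/-- Compute the multiples `y * (n + 1) ^ i` for all `i < s` and `y ≤ n`. -/
def mulTable : RamProgram :=
  setV rPw 1 ;;
  setV rAcc 0 ;;
  forUpto rI (wv rS)
    (.setWord rMulRow (wv rI) (wv rAcc) ;;
      .setWord rMul (wv rAcc) 0 ;;
      forUpto rJ (wv 0)
        (.setWord rMul (wv rAcc + (wv rJ + 1)) (.get rMul (wv rAcc + wv rJ) + wv rPw)) ;;
      setV rPw (.get rMul (wv rAcc + wv 0) + wv rPw) ;;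
      setV rAcc (wv rAcc + (wv 0 + 1)))

/-- Compute the factorials of all `i ≤ n`. -/
def factTable : RamProgram :=
  .setCtr 1 (.const 0) (.ofWord 1) ;;
  forUpto rI (wv 0)
    (.setCtr 1 (wv rI + 1) (.mul (.get 1 (wv rI)) (.ofWord (wv rI + 1))))

/-- Count, for all partial maps from the small side to the host graph, the vertices whose left
neighbourhood contains the image. -/
def dictionary : RamProgram :=
  forUpto rVert (wv 0)
    (forTuples 68 69 70 (.get rLCnt (wv rVert) + 1) (wv rS)
      (setV rCode 0 ;;
        forUpto rI (wv rS)
          (setV rCode (wv rCode + .get rMul (.get rMulRow (wv rI) +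
            .get rLNbr (.get rBase (wv rVert) + .get 68 (wv rI))))) ;;
        .setWord rDict (wv rCode) (.get rDict (wv rCode) + 1)))

/-- The multiples of `(n + 1) ^ i` are obtained by repeated addition, and one more addition gives
the next power. The base is `n + 1` because the digit 0 is reserved for "undefined". -/
theorem runs_mulTable {st : RamState} {n s : ℕ} (hn : st.word 0 0 = n) (hs : st.word rS 0 = s) :
    Runs mulTable st (s * (n * 40 + 80) + 30) (fun st' => ∀ i < s,
      st'.word rMulRow i = i * (n + 1) ∧
      ∀ y ≤ n, st'.word rMul (i * (n + 1) + y) = y * (n + 1) ^ i) := by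
  refine Runs.straight_seq rfl (B₂ := s * (n * 40 + 80) + 20) (Runs.straight_seq rfl
    (B₂ := s * (n * 40 + 80) + 10) (Runs.le ((Runs.forUpto s (n * 35 + 60) (fun i st' => st'.word rPw 0 = (n + 1) ^ i ∧
      st'.word rAcc 0 = i * (n + 1) ∧ ∀ i' < i, st'.word rMulRow i' = i' * (n + 1) ∧
      ∀ y ≤ n, st'.word rMul (i' * (n + 1) + y) = y * (n + 1) ^ i') rfl ?_ ?_ ?_ ?_).mono le_rfl
      (fun s' _ h => h.2.2)) ?_)
    (by simp; omega)) (by simp; omega)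
  · intro s' h
    rw [WordExpr.eval, WordExpr.eval, h.word rS rfl]
    simpa using hs
  · intro j x s h
    simpa using h
  · simp
  · rintro i s' hi hss hii ⟨g1, g2, g3⟩
    have hn' : s'.word 0 0 = n := by rw [hss.word 0 rfl]; simpa using hn
    refine Runs.le (Runs.straight_seq rfl (Runs.straight_seq rfl (Runs.seq
      (Runs.forUpto n 20 (fun j st' => (∀ z < i * (n + 1), st'.word rMul z = s'.word rMul z) ∧
        ∀ y ≤ j, st'.word rMul (i * (n + 1) + y) = y * (n + 1) ^ i) rfl ?_ ?_ ?_ ?_)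
      (fun s₁ hs₁ h₁ => Runs.straight (P := setV rPw (.get rMul (wv rAcc + wv 0) + wv rPw) ;;
        setV rAcc (wv rAcc + (wv 0 + 1))) rfl le_rfl ?_)))) ?_
    · intro s'' h
      rw [WordExpr.eval, WordExpr.eval, h.word 0 rfl]
      simpa using hn'
    · intro j x s h
      simpa using h
    · refine ⟨fun z hz => ?_, fun y hy => ?_⟩
      · have : z ≠ i * (n + 1) := by omega
        simp [g2, this]
      · obtain rfl : y = 0 := by omega
        simp [g2]
    · rintro j s'' hj h hjj ⟨k1, k2⟩
      have hA : s''.word rAcc 0 = i * (n + 1) := by rw [h.word rAcc rfl]; simpa using g2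
      have hP : s''.word rPw 0 = (n + 1) ^ i := by rw [h.word rPw rfl]; simpa using g1
      refine Runs.straight rfl (by simp) ⟨fun z hz => ?_, fun y hy => ?_⟩
      · have : z ≠ i * (n + 1) + (j + 1) := by omega
        simp [hA, hjj, this, k1 z hz]
      · by_cases he : y = j + 1
        · subst he
          simp [hA, hjj, hP, k2 j le_rfl]
          ring
        · have : i * (n + 1) + y ≠ i * (n + 1) + (j + 1) := by omega
          simp [hA, hjj, he, k2 y (by omega)]
    · obtain ⟨k1, k2⟩ := h₁
      have hA : s₁.word rAcc 0 = i * (n + 1) := by rw [hs₁.word rAcc rfl]; simpa using g2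
      have hP : s₁.word rPw 0 = (n + 1) ^ i := by rw [hs₁.word rPw rfl]; simpa using g1
      have hN : s₁.word 0 0 = n := by rw [hs₁.word 0 rfl]; simpa using hn'
      have hR : s₁.word rMulRow = Function.update (s'.word rMulRow) i (i * (n + 1)) := by
        rw [hs₁.word rMulRow rfl]; simp [hii, g2]
      refine ⟨?_, ?_, fun i' hi' => ⟨?_, fun y hy => ?_⟩⟩
      · simp [hA, hP, hN, k2 n le_rfl]
        ring
      · simp [hA, hN]
        ring
      · simp only [RamProgram.run]
        rw [RamState.putWord_word_of_ne _ _ _ (by simp),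
          RamState.putWord_word_of_ne _ _ _ (by simp), hR, Function.update_apply]
        split_ifs with he
        · rw [he]
        · exact (g3 i' (by omega)).1
      · simp only [RamProgram.run]
        rw [RamState.putWord_word_of_ne _ _ _ (by simp),
          RamState.putWord_word_of_ne _ _ _ (by simp)]
        by_cases he : i' = i
        · rw [he]; exact k2 y hy
        · rw [k1, (g3 i' (by omega)).2 y hy]
          have : (i' + 1) * (n + 1) ≤ i * (n + 1) := Nat.mul_le_mul_right _ (by omega)
          rw [add_mul] at this
          omega
    · simp
      omega
  · simp
    have : s * (n * 40 + 80) = s * (n * 35 + 60 + 2 + 10) + s * (n * 5 + 8) := by ring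
    omega

theorem runs_factTable {st : RamState} {n : ℕ} (hn : st.word 0 0 = n) :
    Runs factTable st (n * 40 + 20) (fun st' => ∀ i ≤ n, st'.ctr 1 i = (i.factorial : ℚ)) := by
  refine Runs.straight_seq rfl (B₂ := n * 40 + 10) (Runs.le ((Runs.forUpto n 20 (fun i st' => ∀ i' ≤ i,
    st'.ctr 1 i' = (i'.factorial : ℚ)) rfl ?_ ?_ ?_ ?_)) ?_) (by simp; omega)
  · intro s' h
    rw [WordExpr.eval, WordExpr.eval, h.word 0 rfl]
    simpa using hn
  · intro j x s h
    simpa using h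
  · simp
  · rintro i s' hi hss hii g
    refine Runs.straight rfl (by simp) fun i' hi' => ?_
    by_cases he : i' = i + 1
    · subst he
      simp [hii, g i le_rfl, Nat.factorial_succ]
      ring
    · simp [hii, he, g i' (by omega)]
  · simp
    omega

section

variable {n k s : ℕ} {G : SimpleGraph (Fin n)}

/-- The left neighbour of `v` number `r`, increased by one; `0` for `r = 0`. -/
def AdjLists.leftEntry (A : AdjLists G) (pos : Fin n → ℕ) (v : Fin n) : ℕ → ℕ
  | 0 => 0
  | r + 1 => if h : r < (A.leftList pos v).length then (A.leftList pos v)[r] + 1 else 0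

theorem AdjLists.leftEntry_le (A : AdjLists G) (pos : Fin n → ℕ) (v : Fin n) (r : ℕ) :
    A.leftEntry pos v r ≤ n := by
  cases r with
  | zero => simp [leftEntry]
  | succ r =>
    simp only [leftEntry]
    split_ifs
    · exact ((A.leftList pos v)[r]).2
    · omega

theorem AdjLists.leftEntry_inj (A : AdjLists G) (pos : Fin n → ℕ) (v : Fin n) {r r' : ℕ}
    (hr : r < (A.leftList pos v).length + 1) (hr' : r' < (A.leftList pos v).length + 1)
    (h : A.leftEntry pos v r = A.leftEntry pos v r') : r = r' := by
  cases r with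
  | zero =>
    cases r' with
    | zero => rfl
    | succ r' =>
      rw [leftEntry, leftEntry, dif_pos (by omega)] at h
      omega
  | succ r =>
    cases r' with
    | zero =>
      rw [leftEntry, leftEntry, dif_pos (by omega)] at h
      omega
    | succ r' =>
      rw [leftEntry, leftEntry, dif_pos (by omega), dif_pos (by omega)] at h
      have := (((A.nodup v).filter _).getElem_inj_iff).1 (Fin.ext (Nat.succ.inj h))
      omega

theorem AdjLists.mem_leftList (A : AdjLists G) {pos : Fin n → ℕ} {u v : Fin n} :
    u ∈ A.leftList pos v ↔ G.Adj v u ∧ pos v < pos u := by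
  simp [leftList, A.mem_nbrs]

/-- The partial map with the values `y i - 1` is a map to the left neighbourhood of `v`. -/
def LeftMap (G : SimpleGraph (Fin n)) (pos : Fin n → ℕ) (s : ℕ) (y : ℕ → ℕ) (v : Fin n) : Prop :=
  ∀ i < s, ∀ u : Fin n, y i = u + 1 → G.Adj v u ∧ pos v < pos u

theorem AdjLists.exists_leftEntry (A : AdjLists G) {pos : Fin n → ℕ} {y : ℕ → ℕ} {v : Fin n}
    (h : LeftMap G pos s y v) (hy : ∀ i < s, y i ≤ n) {i : ℕ} (hi : i < s) :
    ∃ r < (A.leftList pos v).length + 1, A.leftEntry pos v r = y i := by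
  cases hyi : y i with
  | zero => exact ⟨0, by omega, rfl⟩
  | succ u =>
    have hu : u < n := by have := hy i hi; omega
    obtain ⟨r, hr, he⟩ := List.mem_iff_getElem.1 (A.mem_leftList.2 (h i hi ⟨u, hu⟩ hyi))
    refine ⟨r + 1, by omega, ?_⟩
    rw [leftEntry, dif_pos hr, he]

theorem AdjLists.leftMap_of_leftEntry (A : AdjLists G) {pos : Fin n → ℕ} {y r : ℕ → ℕ} {v : Fin n}
    (h : ∀ i < s, A.leftEntry pos v (r i) = y i) : LeftMap G pos s y v := by
  intro i hi u hu
  have h1 := (h i hi).trans hu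
  cases hr : r i with
  | zero => simp [hr, leftEntry] at h1
  | succ r' =>
    rw [hr, leftEntry] at h1
    split_ifs at h1 with h2
    have h3 : (A.leftList pos v)[r'] = u := Fin.ext (Nat.succ.inj h1)
    rw [← A.mem_leftList, ← h3]
    exact List.getElem_mem h2

/-- The code of a partial map to the left neighbourhood of `v`. -/
def AdjLists.leftCode (A : AdjLists G) (pos : Fin n → ℕ) (s : ℕ) (v : Fin n) (x : ℕ) : ℕ :=
  digitSum (n + 1) s fun i => A.leftEntry pos v
    (x / ((A.leftList pos v).length + 1) ^ i % ((A.leftList pos v).length + 1))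

open scoped Classical in
-- The entries of the left list are distinct and nonzero, so every partial map into the left
-- neighbourhood of `v` arises from exactly one sequence of indices. Thus `v` contributes at most
-- one to each cell of the dictionary.
theorem AdjLists.card_leftCode (A : AdjLists G) (pos : Fin n → ℕ) (v : Fin n) {y : ℕ → ℕ}
    (hy : ∀ i < s, y i ≤ n) :
    ((Finset.range (((A.leftList pos v).length + 1) ^ s)).filter fun x =>
      A.leftCode pos s v x = digitSum (n + 1) s y).card = if LeftMap G pos s y v then 1 else 0 := by
  set b := (A.leftList pos v).length + 1 with hb
  have hiff : ∀ x, A.leftCode pos s v x = digitSum (n + 1) s y ↔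
      ∀ i < s, A.leftEntry pos v (x / b ^ i % b) = y i := fun x =>
    digitSum_inj (fun i _ => Nat.lt_succ_of_le (A.leftEntry_le _ _ _))
      fun i hi => Nat.lt_succ_of_le (hy i hi)
  have hmod : ∀ x i, x / b ^ i % b < b := fun x i => Nat.mod_lt _ (by omega)
  split_ifs with h
  · have hex : ∀ i, ∃ r, i < s → r < b ∧ A.leftEntry pos v r = y i := by
      intro i
      by_cases hi : i < s
      · obtain ⟨r, h1, h2⟩ := A.exists_leftEntry h hy hi
        exact ⟨r, fun _ => ⟨h1, h2⟩⟩
      · exact ⟨0, fun h => absurd h hi⟩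
    choose r hr using hex
    obtain ⟨x, hx, hd⟩ := exists_digits s r fun i hi => (hr i hi).1
    refine Finset.card_eq_one.2 ⟨x, ?_⟩
    ext x'
    rw [Finset.mem_filter, Finset.mem_range, Finset.mem_singleton, hiff]
    constructor
    · rintro ⟨hx', h'⟩
      rw [← digitSum_digits hx', ← digitSum_digits hx]
      refine digitSum_congr fun i hi => ?_
      rw [hd i hi]
      exact A.leftEntry_inj pos v (hmod _ _) (hr i hi).1 ((h' i hi).trans (hr i hi).2.symm)
    · rintro rfl
      exact ⟨hx, fun i hi => by rw [hd i hi]; exact (hr i hi).2⟩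
  · refine Finset.card_eq_zero.2 (Finset.filter_eq_empty_iff.2 fun x _ hx => h ?_)
    exact A.leftMap_of_leftEntry ((hiff x).1 hx)

open scoped Classical in
-- A cell sums the 0/1 contributions of `AdjLists.card_leftCode` over all vertices. Only partial
-- maps into left neighbourhoods are touched, at most `(k + 1) ^ s` for each vertex; all other cells
-- keep their initial 0.
theorem runs_dictionary (A : AdjLists G) {pos : Fin n → ℕ} {st : RamState}
    (hT : HostTables A pos st) (hpos : RankDegenerate G pos k) (hs : st.word rS 0 = s)
    (hmul : ∀ i < s, st.word rMulRow i = i * (n + 1) ∧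
      ∀ y ≤ n, st.word rMul (i * (n + 1) + y) = y * (n + 1) ^ i)
    (hz : ∀ z, st.word rDict z = 0) :
    Runs dictionary st (n * ((k + 1) ^ s * (s * 90 + 60) + s * 30 + 50) + 20) (fun st' =>
      ∀ y : ℕ → ℕ, (∀ i < s, y i ≤ n) → st'.word rDict (digitSum (n + 1) s y) =
        (Finset.univ.filter (LeftMap G pos s y)).card) := by
  set cnt : ℕ → ℕ → ℕ := fun v z => if h : v < n then
    ((Finset.range (((A.leftList pos ⟨v, h⟩).length + 1) ^ s)).filter fun x =>
      A.leftCode pos s ⟨v, h⟩ x = z).card else 0 with hcnt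
  refine Runs.le ((Runs.forUpto n ((k + 1) ^ s * (s * 90 + 60) + s * 30 + 30) (fun v st' =>
    ∀ z, st'.word rDict z = ∑ v' ∈ Finset.range v, cnt v' z) rfl ?_ ?_ ?_ ?_).mono le_rfl ?_) ?_
  · intro s' h
    rw [WordExpr.eval, WordExpr.eval, h.word 0 rfl]
    exact hT.size
  · intro j x s h
    simpa using h
  · simpa using hz
  · rintro v s' hv hss hvv g
    have hT' : HostTables A pos s' := hT.congr (by
      intro a ha
      refine hss.word a ?_
      simp at ha
      rcases ha with rfl | rfl | rfl | rfl | rfl | rfl <;> rfl)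
    set b := (A.leftList pos ⟨v, hv⟩).length + 1 with hb
    have hbk : b ≤ k + 1 := Nat.succ_le_succ (A.length_leftList_le hpos _)
    refine Runs.le ((Runs.forTuples b s (s * 40 + 25) (fun x st' => ∀ z, st'.word rDict z =
      s'.word rDict z + ((Finset.range x).filter fun x => A.leftCode pos s ⟨v, hv⟩ x = z).card)
      (by simp) (by simp) (by simp) (by omega) rfl ?_ ?_ ?_ ?_ ?_).mono le_rfl ?_) ?_
    · intro s'' h
      rw [WordExpr.eval_hAdd, WordExpr.eval, WordExpr.eval, WordExpr.eval, h.word rLCnt rfl,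
        h.word rVert rfl, hvv]
      simpa [hb] using hT'.lcnt ⟨v, hv⟩
    · intro s'' h
      rw [WordExpr.eval, WordExpr.eval, h.word rS rfl, hss.word rS rfl, hs]
    · intro x s₁ s₂ h _ h'
      simpa [h rDict] using h'
    · simp
    · rintro x s₁ hx hs₁ hd g₁
      have hT₁ : HostTables A pos s₁ := hT'.congr (by
        intro a ha
        refine hs₁.word a ?_
        simp at ha
        rcases ha with rfl | rfl | rfl | rfl | rfl | rfl <;> rfl)
      have hbase : s₁.word rBase v = v * n := hT₁.base ⟨v, hv⟩
      have hvv₁ : s₁.word rVert 0 = v := by rw [hs₁.word rVert rfl, hvv]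
      refine Runs.le (Runs.straight_seq rfl (Runs.seq (Runs.forUpto s 25 (fun i st' =>
        st'.word rCode 0 = digitSum (n + 1) i fun i => A.leftEntry pos ⟨v, hv⟩ (x / b ^ i % b))
        rfl ?_ ?_ ?_ ?_) (fun s₂ hs₂ h₂ => Runs.straight rfl le_rfl ?_))) ?_
      · intro s'' h
        rw [WordExpr.eval, WordExpr.eval, h.word rS rfl]
        simp [hs₁.word rS rfl, hss.word rS rfl, hs]
      · intro j x s h
        simpa using h
      · simp [digitSum]
      · rintro i s₂ hi hs₂ hii g₂
        have hr : s₂.word rMulRow = st.word rMulRow := by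
          rw [hs₂.word rMulRow rfl]; simp [hs₁.word rMulRow rfl, hss.word rMulRow rfl]
        have hm : s₂.word rMul = st.word rMul := by
          rw [hs₂.word rMul rfl]; simp [hs₁.word rMul rfl, hss.word rMul rfl]
        have hB : s₂.word rBase v = v * n := by rw [hs₂.word rBase rfl]; simpa using hbase
        have hV : s₂.word rVert 0 = v := by rw [hs₂.word rVert rfl]; simpa using hvv₁
        have hD : s₂.word 68 i = x / b ^ i % b := by
          rw [hs₂.word 68 rfl]; simpa using hd i hi
        have hL : s₂.word rLNbr (v * n + x / b ^ i % b) =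
            A.leftEntry pos ⟨v, hv⟩ (x / b ^ i % b) := by
          have h1 : s₂.word rLNbr = s₁.word rLNbr := by rw [hs₂.word rLNbr rfl]; simp
          rw [h1]
          have hlt : x / b ^ i % b < b := Nat.mod_lt _ (by omega)
          cases hr' : x / b ^ i % b with
          | zero => exact hT₁.lzero ⟨v, hv⟩
          | succ r =>
            have hrl : r < (A.leftList pos ⟨v, hv⟩).length := by omega
            rw [AdjLists.leftEntry, dif_pos hrl]
            exact hT₁.lnbr ⟨v, hv⟩ r hrl
        refine Runs.straight rfl (by simp) ?_
        have := (hmul i hi).2 _ (A.leftEntry_le pos ⟨v, hv⟩ (x / b ^ i % b))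
        simp only [RamProgram.run]
        rw [RamState.putWord_word_self, digitSum_succ]
        simp [hii, hr, hm, hV, hB, hD, hL, (hmul i hi).1, this, g₂]
      · intro z
        have hDict : s₂.word rDict z = s₁.word rDict z := by rw [hs₂.word rDict rfl]; simp
        have hDict' : s₂.word rDict (s₂.word rCode 0) = s₁.word rDict (s₂.word rCode 0) := by
          rw [hs₂.word rDict rfl]; simp
        have hcode : A.leftCode pos s ⟨v, hv⟩ x = s₂.word rCode 0 := h₂.symm
        simp only [RamProgram.run]
        rw [RamState.putWord_word_self, Finset.range_add_one, Finset.filter_insert]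
        simp only [WordExpr.eval, Function.update_apply]
        split_ifs with h1 h2 h2
        · rw [Finset.card_insert_of_notMem (by simp), h1, hDict', g₁, add_assoc]
        · exact absurd (hcode.trans h1.symm) h2
        · exact absurd (h2.symm.trans hcode) h1
        · rw [hDict, g₁]
      · simp
        omega
    · intro s'' _ h z
      rw [h, g, Finset.sum_range_succ]
      simp [hcnt, hv, hb]
    · simp
      have h1 : b ^ s * (s * 40 + 25 + s * 47 + 2 + 15) ≤
          (k + 1) ^ s * (s * 90 + 60) :=
        Nat.mul_le_mul (Nat.pow_le_pow_left hbk _) (by omega)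
      omega
  · intro s' _ h y hy
    rw [h, Finset.sum_range, Finset.card_filter]
    refine Finset.sum_congr rfl fun v _ => ?_
    rw [← A.card_leftCode pos v hy]
    simp [hcnt]
  · simp
    have : n * ((k + 1) ^ s * (s * 90 + 60) + s * 30 + 50) =
      n * ((k + 1) ^ s * (s * 90 + 60) + s * 30 + 30 + 2 + 10) + n * 8 := by ring
    omega

end

/-! ## The number of extensions of a map of the small side -/

notation "rPhi" => 80
notation "rVis" => 81
notation "rCodes" => 82
notation "rE" => 83
notation "rMark" => 84
notation "rStamp" => 85
notation "rXl" => 86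
notation "rXf" => 87
notation "rInS" => 88

/-- For every set `X` of vertices of the small side, count the vertices whose left neighbourhood
contains the image of `X`. -/
def lookupCounts : RamProgram :=
  .setWord rCodes 0 0 ;;
  forUpto rI (wv rS)
    (forUpto rJ (.get rPow (wv rI))
      (.setWord rCodes (.get rPow (wv rI) + wv rJ) (.get rCodes (wv rJ) +
        .get rMul (.get rMulRow (wv rI) + (.get rPhi (wv rI) + 1))))) ;;
  forUpto rJ (.get rPow (wv rS)) (.setWord rE (wv rJ) (.get rDict (.get rCodes (wv rJ))))

/-- Möbius inversion. -/
def sieve : RamProgram :=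
  forUpto rI (wv rS)
    (forUpto rJ (.get rPow (wv rS))
      (.cond (.get rBit (.get rBitRow (wv rJ) + wv rI)) .skip
        (.setWord rE (wv rJ) (.get rE (wv rJ) - .get rE (wv rJ + .get rPow (wv rI))))))

/-- Compute the left neighbours and the neighbours of the vertex in `rVert` in the image of the small
side. -/
def vertexMasks : RamProgram :=
  setV rXl 0 ;; setV rXf 0 ;; setV rInS 0 ;;
  forUpto rU (wv rS)
    (.cond (.get rLeft (.get rBase (wv rVert) + .get rPhi (wv rU)))
        (setV rXl (wv rXl + .get rPow (wv rU))) .skip ;;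
      .cond (.get rAdj (.get rBase (wv rVert) + .get rPhi (wv rU)))
        (setV rXf (wv rXf + .get rPow (wv rU))) .skip ;;
      .cond (distExpr (wv rVert) (.get rPhi (wv rU))) .skip (setV rInS 1))

/-- Count the vertex in `rVert` at its set of neighbours, instead of its set of left neighbours. -/
def correctVertex : RamProgram :=
  .cond (distExpr (.get rMark (wv rVert)) (wv rStamp))
    (.setWord rMark (wv rVert) (wv rStamp) ;;
      vertexMasks ;;
      .setWord rE (wv rXl) (.get rE (wv rXl) - 1) ;;
      .cond (wv rInS) .skip (.setWord rE (wv rXf) (.get rE (wv rXf) + 1)))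
    .skip

/-- Correct the counts for the image of the small side and its left neighbours. -/
def correctCounts : RamProgram :=
  setV rStamp (wv rStamp + 1) ;;
  forUpto rI (wv rS)
    (setV rX (.get rPhi (wv rI)) ;;
      forUpto rJ (.get rLCnt (wv rX) + 1)
        (.cond (wv rJ) (setV rVert (.get rLNbr (.get rBase (wv rX) + wv rJ) - 1))
            (setV rVert (wv rX)) ;;
          correctVertex))

/-- Multiply the falling factorials and add the product to the result. -/
def addProduct : RamProgram :=
  .setCtr 2 0 (.ofWord 1) ;;
  forUpto rI (.get rPow (wv rS))
    (.cond (.get rCap (wv rI) - .get rE (wv rI)) (.setCtr 2 0 (.ofWord 0))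
      (.setCtr 2 0 (.mul (.get 2 0) (.div (.get 1 (.get rE (wv rI)))
        (.get 1 (.get rE (wv rI) - .get rCap (wv rI))))))) ;;
  .setCtr 0 0 (.add (.get 0 0) (.get 2 0))

/-- Add the number of extensions to the result. -/
def countExtensions : RamProgram := lookupCounts ;; sieve ;; correctCounts ;; addProduct

theorem bitSum_or_eq {s i : ℕ} {p : ℕ → Prop} (hi : i < s) (hp : ¬ p i) :
    bitSum s (fun j => j = i ∨ p j) = bitSum s p + 2 ^ i := by
  classical
  calc bitSum s (fun j => j = i ∨ p j)
      = ∑ j ∈ Finset.range s, ((if p j then 2 ^ j else 0) + if j = i then 2 ^ j else 0) := by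
        refine Finset.sum_congr rfl fun j _ => ?_
        by_cases hj : j = i
        · subst hj
          simp [hp]
        · simp [hj]
    _ = bitSum s p + 2 ^ i := by
        rw [Finset.sum_add_distrib, Finset.sum_ite_eq' (Finset.range s) i]
        simp [hi, bitSum]

theorem testBit_add_two_pow {X i s : ℕ} (hX : X < 2 ^ s) (hi : i < s) (h : X.testBit i = false) :
    X + 2 ^ i < 2 ^ s ∧ ∀ j, (X + 2 ^ i).testBit j = true ↔ j = i ∨ X.testBit j = true := by
  have h1 := bitSum_or_eq (p := fun j => X.testBit j = true) hi (by simp [h])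
  rw [bitSum_testBit hX] at h1
  rw [← h1]
  refine ⟨bitSum_lt _ _, fun j => ?_⟩
  rw [testBit_bitSum]
  refine ⟨fun h => h.2, fun h' => ⟨?_, h'⟩⟩
  rcases h' with rfl | h'
  · exact hi
  · by_contra hj
    rw [Nat.testBit_lt_two_pow (hX.trans_le (Nat.pow_le_pow_right (by norm_num) (not_lt.1 hj)))] at h'
    simp at h'

/-- The numbers that arise in the Möbius inversion: vertices `v` such that `f v` agrees with `X` in
the first `i` digits and contains `X`. -/
def SieveRel (i X Y : ℕ) : Prop :=
  (∀ j < i, Y.testBit j = true → X.testBit j = true) ∧ ∀ j, X.testBit j = true → Y.testBit j = true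

theorem SieveRel.succ_iff_of_testBit {i X Y : ℕ} (h : X.testBit i = true) :
    SieveRel (i + 1) X Y ↔ SieveRel i X Y := by
  refine and_congr_left fun _ => ⟨fun h' j hj => h' j (by omega), fun h' j hj => ?_⟩
  rcases lt_or_eq_of_le (Nat.lt_succ_iff.1 hj) with h1 | rfl
  · exact h' j h1
  · exact fun _ => h

open scoped Classical in
-- Split according to the digit `i` of `f a`. If it is 0, then `f a` agrees with `X` in one more
-- digit; if it is 1, then `f a` contains `X + 2 ^ i`, and the condition on the lower digits is
-- unchanged.
theorem SieveRel.card_succ {α : Type*} [Fintype α] (f : α → ℕ) {i s X : ℕ} (hX : X < 2 ^ s)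
    (hi : i < s) (h : X.testBit i = false) :
    (Finset.univ.filter fun a => SieveRel i X (f a)).card =
      (Finset.univ.filter fun a => SieveRel (i + 1) X (f a)).card +
      (Finset.univ.filter fun a => SieveRel i (X + 2 ^ i) (f a)).card := by
  obtain ⟨-, h2⟩ := testBit_add_two_pow hX hi h
  rw [← Finset.card_filter_add_card_filter_not (fun a => (f a).testBit i = false),
    Finset.filter_filter, Finset.filter_filter]
  congr 2
  · ext a
    simp only [Finset.mem_filter, Finset.mem_univ, true_and]
    constructor
    · rintro ⟨⟨h3, h4⟩, h5⟩
      refine ⟨fun j hj hj' => ?_, h4⟩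
      rcases lt_or_eq_of_le (Nat.lt_succ_iff.1 hj) with h6 | rfl
      · exact h3 j h6 hj'
      · simp [h5] at hj'
    · rintro ⟨h3, h4⟩
      refine ⟨⟨fun j hj => h3 j (by omega), h4⟩, ?_⟩
      by_contra h5
      have := h3 i (by omega) (by simpa using h5)
      simp [h] at this
  · ext a
    simp only [Finset.mem_filter, Finset.mem_univ, true_and, Bool.not_eq_false]
    constructor
    · rintro ⟨⟨h3, h4⟩, h5⟩
      refine ⟨fun j hj hj' => (h2 j).2 (Or.inr (h3 j hj hj')), fun j hj => ?_⟩
      rcases (h2 j).1 hj with rfl | h6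
      · exact h5
      · exact h4 j h6
    · rintro ⟨h3, h4⟩
      refine ⟨⟨fun j hj hj' => ?_, fun j hj => h4 j ((h2 j).2 (Or.inr hj))⟩,
        h4 i ((h2 i).2 (Or.inl rfl))⟩
      rcases (h2 j).1 (h3 j hj hj') with rfl | h6
      · omega
      · exact h6

theorem SieveRel.iff_eq {s X Y : ℕ} (hY : Y < 2 ^ s) : SieveRel s X Y ↔ Y = X := by
  constructor
  · rintro ⟨h1, h2⟩
    apply Nat.eq_of_testBit_eq
    intro j
    rw [Bool.eq_iff_iff]
    refine ⟨fun h => h1 j ?_ h, h2 j⟩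
    by_contra hj
    rw [Nat.testBit_lt_two_pow (hY.trans_le (Nat.pow_le_pow_right (by norm_num) (not_lt.1 hj)))] at h
    simp at h
  · rintro rfl
    exact ⟨fun _ _ h => h, fun _ h => h⟩

/-! ### Counts of left neighbourhoods that contain a given subset of the image. -/

section

variable {m s k n : ℕ} {H : Pattern (Fin m)} {σ : Fin s → Fin m} {G : SimpleGraph (Fin n)}
  {A : AdjLists G} {pos : Fin n → ℕ}

/-- The memory contains all tables for the enumeration of embeddings. -/
structure CountEnv (A : AdjLists G) (pos : Fin n → ℕ) (H : Pattern (Fin m)) (σ : Fin s → Fin m)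
    (st : RamState) : Prop where
  host : HostTables A pos st
  pattern : PatternTables H σ st
  mulRow : ∀ i < s, st.word rMulRow i = i * (n + 1)
  mul : ∀ i < s, ∀ y ≤ n, st.word rMul (i * (n + 1) + y) = y * (n + 1) ^ i
  fact : ∀ i ≤ n, st.ctr 1 i = (i.factorial : ℚ)
  dict : ∀ y : ℕ → ℕ, (∀ i < s, y i ≤ n) → st.word rDict (digitSum (n + 1) s y) =
    Nat.card {v // LeftMap G pos s y v}

theorem CountEnv.congr {st st' : RamState} (h : CountEnv A pos H σ st)
    (h' : ∀ a ∈ [0, rBase, rAdj, rLeft, rLNbr, rLCnt, rS, rPow, rCap, rBitRow, rBit, rTok, rMulRow,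
      rMul, rDict], st'.word a = st.word a) (hc : st'.ctr 1 = st.ctr 1) : CountEnv A pos H σ st' := by
  refine ⟨h.host.congr fun a ha => h' a ?_, h.pattern.congr fun a ha => h' a ?_, ?_, ?_, ?_, ?_⟩
  · simp only [List.mem_cons, List.not_mem_nil, or_false] at ha ⊢
    omega
  · simp only [List.mem_cons, List.not_mem_nil, or_false] at ha ⊢
    omega
  · rw [h' rMulRow (by simp)]
    exact h.mulRow
  · rw [h' rMul (by simp)]
    exact h.mul
  · rw [hc]
    exact h.fact
  · rw [h' rDict (by simp)]
    exact h.dict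

theorem CountEnv.of_sameOutside {st st' : RamState} {P : RamProgram} (h : CountEnv A pos H σ st)
    (hs : SameOutside P st st')
    (hP : ([0, rBase, rAdj, rLeft, rLNbr, rLCnt, rS, rPow, rCap, rBitRow, rBit, rTok, rMulRow,
      rMul, rDict].all fun a => !P.writesWord a) = true) (hc : P.writesCtr 1 = false) :
    CountEnv A pos H σ st' := by
  refine h.congr (fun a ha => hs.word a ?_) (hs.ctr 1 hc)
  simpa using List.all_eq_true.1 hP a ha

/-- The restriction of `ψ` to a subset of the small side as a sequence of digits. -/
def partialDigits (ψ : Fin s → Fin n) (X i : ℕ) : ℕ :=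
  if h : i < s ∧ X.testBit i = true then ψ ⟨i, h.1⟩ + 1 else 0

theorem partialDigits_le (ψ : Fin s → Fin n) (X i : ℕ) : partialDigits ψ X i ≤ n := by
  unfold partialDigits
  split_ifs
  · exact (ψ _).2
  · omega

/-- The `ψ i` in the left neighbourhood of `v`, as a binary number. -/
noncomputable def leftMask (G : SimpleGraph (Fin n)) (pos : Fin n → ℕ) (ψ : Fin s → Fin n)
    (v : Fin n) : ℕ :=
  bitSum s fun i => ∃ h : i < s, G.Adj v (ψ ⟨i, h⟩) ∧ pos v < pos (ψ ⟨i, h⟩)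

theorem leftMask_lt {ψ : Fin s → Fin n} {v : Fin n} : leftMask G pos ψ v < 2 ^ s := bitSum_lt _ _

/-- Looking up the restriction of `ψ` to `X` counts the vertices whose left mask contains `X`, which
is the starting point `i = 0` of the Möbius inversion. -/
theorem leftMap_partialDigits_iff {ψ : Fin s → Fin n} {X : ℕ} (hX : X < 2 ^ s) {v : Fin n} :
    LeftMap G pos s (partialDigits ψ X) v ↔ SieveRel 0 X (leftMask G pos ψ v) := by
  simp only [LeftMap, SieveRel, Nat.not_lt_zero, false_imp_iff, implies_true, true_and, leftMask,
    testBit_bitSum, partialDigits]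
  constructor
  · intro h j hj
    have hjs : j < s := by
      by_contra hjs
      rw [Nat.testBit_lt_two_pow
        (hX.trans_le (Nat.pow_le_pow_right (by norm_num) (not_lt.1 hjs)))] at hj
      simp at hj
    exact ⟨hjs, hjs, h j hjs _ (by rw [dif_pos ⟨hjs, hj⟩])⟩
  · intro h i hi u hu
    split_ifs at hu with hc
    obtain ⟨_, _, h1⟩ := h i hc.2
    have hu' : ψ ⟨i, hi⟩ = u := Fin.ext (Nat.succ.inj hu)
    rwa [hu'] at h1

/-- This recursion, which removes the top element of a subset, lets the codes of all `2 ^ s`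
restrictions be computed with a bounded number of operations each. -/
theorem digitSum_partialDigits_succ {ψ : Fin s → Fin n} {i Y : ℕ} (hi : i < s) (hY : Y < 2 ^ i) :
    digitSum (n + 1) (i + 1) (partialDigits ψ Y) = digitSum (n + 1) i (partialDigits ψ Y) ∧
    digitSum (n + 1) (i + 1) (partialDigits ψ (2 ^ i + Y)) =
      digitSum (n + 1) i (partialDigits ψ Y) + (ψ ⟨i, hi⟩ + 1) * (n + 1) ^ i := by
  constructor
  · rw [digitSum_succ, partialDigits, dif_neg]
    · simp
    · simp [Nat.testBit_lt_two_pow hY]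
  · have h1 : partialDigits ψ (2 ^ i + Y) i = ψ ⟨i, hi⟩ + 1 := by
      rw [partialDigits, dif_pos ⟨hi, by
        rw [Nat.testBit_two_pow_add_eq, Nat.testBit_lt_two_pow hY]; rfl⟩]
    rw [digitSum_succ, h1]
    congr 1
    refine digitSum_congr fun j hj => ?_
    unfold partialDigits
    simp only [Nat.testBit_two_pow_add_gt hj]

theorem runs_lookupCounts {st : RamState} (h : CountEnv A pos H σ st) {ψ : Fin s → Fin n}
    (hψ : ∀ i : Fin s, st.word rPhi i = ψ i) :
    Runs lookupCounts st ((s + 1) * (2 ^ s * 60 + 60)) (fun st' => ∀ X < 2 ^ s, st'.word rE X =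
      Nat.card {v // SieveRel 0 X (leftMask G pos ψ v)}) := by
  refine Runs.le (Runs.straight_seq rfl (Runs.seq (Runs.forUpto s (2 ^ s * 45 + 20) (fun i st' =>
    ∀ X < 2 ^ i, st'.word rCodes X = digitSum (n + 1) i (partialDigits ψ X)) rfl ?_ ?_ ?_ ?_)
    (fun s₁ hs₁ h₁ => Runs.forUpto (2 ^ s) 10 (fun X st' => ∀ X' < X, st'.word rE X' =
      Nat.card {v // SieveRel 0 X' (leftMask G pos ψ v)}) rfl ?_ ?_ ?_ ?_))) ?_
  · intro s' hs
    rw [WordExpr.eval, WordExpr.eval, hs.word rS rfl]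
    simpa using h.pattern.side
  · intro j x s h
    simpa using h
  · intro X hX
    obtain rfl : X = 0 := by omega
    simp [digitSum]
  · rintro i s' hi hs hii g
    have hE := (h.congr (st' := (RamProgram.setWord rCodes 0 0).run st) (by simp)
      (by simp)).of_sameOutside hs rfl rfl
    have hpow := hE.pattern.pow i hi.le
    have hpow2 : 2 ^ i ≤ 2 ^ s := Nat.pow_le_pow_right (by norm_num) hi.le
    refine Runs.le ((Runs.forUpto (2 ^ i) 30 (fun j st' => ∀ X < 2 ^ i,
      st'.word rCodes X = digitSum (n + 1) (i + 1) (partialDigits ψ X) ∧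
      (X < j → st'.word rCodes (2 ^ i + X) =
        digitSum (n + 1) (i + 1) (partialDigits ψ (2 ^ i + X)))) rfl ?_ ?_ ?_ ?_).mono le_rfl ?_) ?_
    · intro s'' hs'
      rw [WordExpr.eval, WordExpr.eval, WordExpr.eval, hs'.word rPow rfl, hs'.word rI rfl]
      simp [hii, hpow]
    · intro j x s h
      simpa using h
    · intro X hX
      refine ⟨?_, fun h => absurd h (by omega)⟩
      rw [(digitSum_partialDigits_succ hi hX).1, ← g X hX]
    · rintro j s'' hj hs' hjj g'
      have hE' := hE.of_sameOutside hs' rfl rfl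
      have hI : s''.word rI 0 = i := by rw [hs'.word rI rfl]; simpa using hii
      have hP : s''.word rPhi i = ψ ⟨i, hi⟩ := by
        rw [hs'.word rPhi rfl]
        simpa [hs.word rPhi rfl] using hψ ⟨i, hi⟩
      refine Runs.straight rfl (by simp) fun X hX => ⟨?_, fun hXj => ?_⟩
      · have hne : X ≠ 2 ^ i + j := by omega
        simp [hI, hE'.pattern.pow i hi.le, hjj, hne, (g' X hX).1]
      · have h1 := (digitSum_partialDigits_succ (ψ := ψ) hi hj)
        by_cases he : X = j
        · subst he
          simp only [RamProgram.run, RamState.putWord_word_self]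
          simp only [WordExpr.eval_hAdd, WordExpr.eval, hI, hjj, hP,
            hE'.pattern.pow i hi.le, hE'.mulRow i hi, Function.update_self]
          rw [hE'.mul i hi _ (ψ ⟨i, hi⟩).2, (g' X hX).1, h1.1, h1.2]
        · have hne : 2 ^ i + X ≠ 2 ^ i + j := by omega
          simp only [RamProgram.run, RamState.putWord_word_self]
          simp only [WordExpr.eval_hAdd, WordExpr.eval, hI, hjj, hE'.pattern.pow i hi.le]
          rw [Function.update_of_ne hne, (g' X hX).2 (by omega)]
    · intro s'' _ g' X hX
      rcases lt_or_ge X (2 ^ i) with h1 | h1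
      · exact (g' X h1).1
      · obtain ⟨Y, rfl⟩ := Nat.exists_eq_add_of_le h1
        have hY : Y < 2 ^ i := by rw [pow_succ] at hX; omega
        exact (g' Y hY).2 hY
    · simp
      omega
  · intro s' hs
    rw [WordExpr.eval, WordExpr.eval, WordExpr.eval, hs.word rPow rfl, hs.word rS rfl,
      hs₁.word rPow rfl, hs₁.word rS rfl]
    simp [h.pattern.side, h.pattern.pow]
  · intro j x s h
    simpa using h
  · simp
  · rintro X s' hX hs hXX g
    have hE := ((h.congr (st' := (RamProgram.setWord rCodes 0 0).run st) (by simp)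
      (by simp)).of_sameOutside hs₁ rfl rfl).of_sameOutside hs rfl rfl
    have hC : s'.word rCodes = s₁.word rCodes := hs.word rCodes rfl
    refine Runs.straight rfl (by simp) fun X' hX' => ?_
    by_cases he : X' = X
    · subst he
      simp [hXX, hC, h₁ X' hX, hE.dict _ fun i _ => partialDigits_le ψ X' i]
      exact Nat.card_congr (Equiv.subtypeEquivRight fun v => leftMap_partialDigits_iff hX)
    · simp [hXX, he]
      exact g X' (by omega)
  · simp
    have : (s + 1) * (2 ^ s * 60 + 60) = s * (2 ^ s * 45 + 20 + 2 + 10) + s * (2 ^ s * 15 + 28) +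
      (2 ^ s * 60 + 60) := by ring
    omega

end

theorem Runs.cond_set {st : RamState} (b : WordExpr) (a : ℕ) (e : WordExpr) :
    Runs (.cond b (setV a e) .skip) st (b.cost + e.cost + 5) (fun st' =>
      st'.word a 0 = if b.eval st ≠ 0 then e.eval st else st.word a 0) := by
  refine Runs.straight rfl ?_ ?_
  · simp
    omega
  · simp only [RamProgram.run]
    split_ifs <;> simp

/-! ### Möbius inversion, correction to full neighbourhoods, and the product of falling factorials.
-/

section

variable {m s k n : ℕ} {H : Pattern (Fin m)} {σ : Fin s → Fin m} {G : SimpleGraph (Fin n)}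
  {A : AdjLists G} {pos : Fin n → ℕ}

/-- Working in place is safe: when `X` without the digit `i` is treated, the later cell `X + 2 ^ i`
still holds its value for `i`. By `SieveRel.card_succ` the truncated subtraction is exact. -/
theorem runs_sieve {st : RamState} (h : CountEnv A pos H σ st) {α : Type*} [Fintype α] {f : α → ℕ}
    (hf : ∀ a, f a < 2 ^ s)
    (hE : ∀ X < 2 ^ s, st.word rE X = Nat.card {a // SieveRel 0 X (f a)}) :
    Runs sieve st (s * (2 ^ s * 50 + 40) + 20) (fun st' => ∀ X < 2 ^ s, st'.word rE X =
      Nat.card {a // f a = X}) := by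
  classical
  refine Runs.le ((Runs.forUpto s (2 ^ s * 50 + 20) (fun i st' =>
    ∀ X < 2 ^ s, st'.word rE X = Nat.card {a // SieveRel i X (f a)}) rfl ?_ ?_ ?_ ?_).mono le_rfl
    ?_) ?_
  · intro s' hs
    rw [WordExpr.eval, WordExpr.eval, hs.word rS rfl]
    exact h.pattern.side
  · intro j x s h
    simpa using h
  · exact hE
  · rintro i s' hi hs hii g
    have hE' := h.of_sameOutside hs rfl rfl
    refine Runs.le ((Runs.forUpto (2 ^ s) 30 (fun j st' => ∀ X < 2 ^ s, st'.word rE X =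
      if X < j then Nat.card {a // SieveRel (i + 1) X (f a)} else
        Nat.card {a // SieveRel i X (f a)}) rfl ?_ ?_ ?_ ?_).mono le_rfl ?_) ?_
    · intro s'' hs'
      rw [WordExpr.eval, WordExpr.eval, WordExpr.eval, hs'.word rPow rfl, hs'.word rS rfl]
      simp [hE'.pattern.side, hE'.pattern.pow]
    · intro j x s h
      simpa using h
    · simpa using g
    · rintro X s'' hX hs' hXX g'
      have hE'' := hE'.of_sameOutside hs' rfl rfl
      have hI : s''.word rI 0 = i := by rw [hs'.word rI rfl]; exact hii
      have hbit := hE''.pattern.bit X hX i hi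
      have hrow := hE''.pattern.row X hX
      refine Runs.le (Runs.cond (B₁ := 20) (fun hc => ?_) (fun hc => ?_)) (by simp)
      · have hb : X.testBit i = true := by
          by_contra hb
          simp [hXX, hI, hbit, hrow, hb] at hc
        refine Runs.straight rfl (by simp) fun X' hX' => ?_
        simp only [RamProgram.run]
        rw [g' X' hX']
        by_cases he : X' = X
        · subst he
          simp only [lt_irrefl, if_false, Nat.lt_succ_self, if_true]
          exact Nat.card_congr (Equiv.subtypeEquivRight fun a =>
            (SieveRel.succ_iff_of_testBit hb).symm)
        · have : X' < X ↔ X' < X + 1 := by omega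
          simp only [this]
      · have hb : X.testBit i = false := by
          by_contra hb
          simp [hXX, hI, hbit, hrow, hb] at hc
        obtain ⟨hlt, -⟩ := testBit_add_two_pow hX hi hb
        have hcard := SieveRel.card_succ f hX hi hb
        simp only [← Fintype.card_subtype, ← Nat.card_eq_fintype_card] at hcard
        refine Runs.straight rfl (by simp) fun X' hX' => ?_
        by_cases he : X' = X
        · subst he
          have h1 := g' X' hX'
          have h2 := g' (X' + 2 ^ i) hlt
          rw [if_neg (by omega)] at h1
          rw [if_neg (Nat.not_lt.2 (Nat.le_add_right _ _))] at h2
          simp only [RamProgram.run, RamState.putWord_word_self]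
          simp only [WordExpr.eval_hSub, WordExpr.eval, hXX, hI,
            hE''.pattern.pow i hi.le, Function.update_self, Nat.lt_succ_self, if_true, h1, h2]
          omega
        · have : X' < X ↔ X' < X + 1 := by omega
          simp only [RamProgram.run, RamState.putWord_word_self]
          simp only [WordExpr.eval, hXX]
          rw [Function.update_of_ne he, g' X' hX']
          simp only [this]
    · intro s'' _ g' X hX
      rw [g' X hX, if_pos hX]
    · simp
      omega
  · intro s' _ g X hX
    rw [g X hX]
    exact Nat.card_congr (Equiv.subtypeEquivRight fun a => SieveRel.iff_eq (hf a))
  · simp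
    have : s * (2 ^ s * 50 + 40) = s * (2 ^ s * 50 + 20 + 2 + 10) + s * 8 := by ring
    omega

theorem runs_vertexMasks {st : RamState} (h : CountEnv A pos H σ st) {ψ : Fin s → Fin n}
    (hψ : ∀ i : Fin s, st.word rPhi i = ψ i) {v : Fin n} (hv : st.word rVert 0 = v) :
    Runs vertexMasks st (s * 100 + 40) (fun st' => st'.word rXl 0 = leftMask G pos ψ v ∧
      st'.word rXf 0 = hostMask G ψ v ∧ (st'.word rInS 0 = 0 ↔ ∀ i, ψ i ≠ v)) := by
  classical
  refine Runs.straight_seq rfl (B₂ := s * 100 + 30) (Runs.straight_seq rfl (B₂ := s * 100 + 20)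
    (Runs.straight_seq rfl (B₂ := s * 100 + 10) (Runs.le ((Runs.forUpto s 80 (fun i st' =>
      st'.word rXl 0 = bitSum i (fun i => ∃ h : i < s, G.Adj v (ψ ⟨i, h⟩) ∧
        pos v < pos (ψ ⟨i, h⟩)) ∧
      st'.word rXf 0 = bitSum i (fun i => ∃ h : i < s, G.Adj (ψ ⟨i, h⟩) v) ∧
      (st'.word rInS 0 = 0 ↔ ∀ j : Fin s, (j : ℕ) < i → ψ j ≠ v)) rfl ?_ ?_ ?_ ?_).mono le_rfl ?_)
      ?_) (by simp; omega)) (by simp; omega)) (by simp; omega)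
  · intro s' hs
    rw [WordExpr.eval, WordExpr.eval, hs.word rS rfl]
    simpa using h.pattern.side
  · intro j x s h
    simpa using h
  · simp
  · rintro i s' hi hs hii ⟨g1, g2, g3⟩
    have hE := ((((h.congr (st' := (setV rXl 0).run st) (by simp) (by simp)).congr
      (st' := (setV rXf 0).run ((setV rXl 0).run st)) (by simp) (by simp)).congr
      (st' := (setV rInS 0).run ((setV rXf 0).run ((setV rXl 0).run st))) (by simp)
      (by simp))).of_sameOutside hs rfl rfl
    have hV : s'.word rVert 0 = v := by rw [hs.word rVert rfl]; simpa using hv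
    have hP : s'.word rPhi i = ψ ⟨i, hi⟩ := by rw [hs.word rPhi rfl]; simpa using hψ ⟨i, hi⟩
    have hbase := hE.host.base v
    have hleft := hE.host.left v (ψ ⟨i, hi⟩)
    have hadj := hE.host.adj v (ψ ⟨i, hi⟩)
    have hpow := hE.pattern.pow i hi.le
    refine Runs.seq (Runs.cond_set _ _ _) (fun s₁ hs₁ h₁ => Runs.seq (Runs.cond_set _ _ _)
      (fun s₂ hs₂ h₂ => Runs.straight rfl le_rfl ?_)) (by simp)
    have hV₁ : s₁.word rVert 0 = v := by rw [hs₁.word rVert rfl, hV]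
    have hU₁ : s₁.word rU 0 = i := by rw [hs₁.word rU rfl, hii]
    have hP₁ : s₁.word rPhi i = ψ ⟨i, hi⟩ := by rw [hs₁.word rPhi rfl, hP]
    have hV₂ : s₂.word rVert 0 = v := by rw [hs₂.word rVert rfl, hV₁]
    have hU₂ : s₂.word rU 0 = i := by rw [hs₂.word rU rfl, hU₁]
    have hP₂ : s₂.word rPhi i = ψ ⟨i, hi⟩ := by rw [hs₂.word rPhi rfl, hP₁]
    have hS₂ : s₂.word rInS 0 = s'.word rInS 0 := by rw [hs₂.word rInS rfl, hs₁.word rInS rfl]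
    have hl : s₂.word rXl 0 = bitSum (i + 1) (fun i => ∃ h : i < s, G.Adj v (ψ ⟨i, h⟩) ∧
        pos v < pos (ψ ⟨i, h⟩)) := by
      rw [hs₂.word rXl rfl, h₁, bitSum_succ, ← g1]
      simp only [WordExpr.eval, hii, hV, hP, hbase, hleft, hpow, hi,
        exists_true_left]
      split_ifs <;> simp_all
    have hf : s₂.word rXf 0 = bitSum (i + 1) (fun i => ∃ h : i < s, G.Adj (ψ ⟨i, h⟩) v) := by
      rw [h₂, bitSum_succ, hs₁.word rXf rfl, ← g2]
      simp only [WordExpr.eval, hU₁, hV₁, hP₁, hs₁.word rBase rfl, hbase,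
        hs₁.word rAdj rfl, hadj, hs₁.word rPow rfl, hpow, hs₁.word rXf rfl, hi, exists_true_left,
        G.adj_comm (ψ ⟨i, hi⟩) v]
      split_ifs <;> simp_all
    have key : (∀ j : Fin s, (j : ℕ) < i + 1 → ψ j ≠ v) ↔
        (∀ j : Fin s, (j : ℕ) < i → ψ j ≠ v) ∧ ψ ⟨i, hi⟩ ≠ v := by
      refine ⟨fun h => ⟨fun j hj => h j (by omega), h _ (by simp)⟩, fun h j hj => ?_⟩
      rcases lt_or_eq_of_le (Nat.lt_succ_iff.1 hj) with h1 | h1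
      · exact h.1 j h1
      · have : j = ⟨i, hi⟩ := Fin.ext h1
        rw [this]
        exact h.2
    rw [key, ← g3, ← hS₂]
    by_cases he : ψ ⟨i, hi⟩ = v
    · have hc : (distExpr (wv rVert) (.get rPhi (wv rU))).eval s₂ = 0 := by
        simp [hV₂, hU₂, hP₂, he]
      simp only [RamProgram.run, hc]
      simp [hl, hf, he]
    · have hc : (distExpr (wv rVert) (.get rPhi (wv rU))).eval s₂ ≠ 0 := by
        simp only [WordExpr.eval_hSub, WordExpr.eval, hV₂, hU₂, hP₂]
        intro h
        exact he (Fin.ext (by omega))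
      rw [RamProgram.run, if_pos hc]
      simp [hl, hf, he]
  · rintro s' - ⟨g1, g2, g3⟩
    exact ⟨g1, g2, by rw [g3]; exact ⟨fun h j => h j j.2, fun h j _ => h j⟩⟩
  · simp
    omega

open scoped Classical in
/-- The number of vertices with the set `X` of neighbours in the image of `ψ`, where only the vertices
in `P` are treated correctly: otherwise, the left neighbours are considered, and the vertex may belong
to the image. -/
noncomputable def partialCount (G : SimpleGraph (Fin n)) (pos : Fin n → ℕ) (ψ : Fin s → Fin n)
    (P : Finset (Fin n)) (X : ℕ) : ℕ :=
  ∑ v, if v ∈ P then (if (∀ i, ψ i ≠ v) ∧ hostMask G ψ v = X then 1 else 0)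
    else if leftMask G pos ψ v = X then 1 else 0

open scoped Classical in
-- Treating `x` moves a single unit between cells. The common remainder `r` states this with
-- additions only, so the subtraction of 1 in the program is seen to be exact.
theorem partialCount_insert (G : SimpleGraph (Fin n)) (pos : Fin n → ℕ) (ψ : Fin s → Fin n)
    {P : Finset (Fin n)} {x : Fin n} (hx : x ∉ P) : ∃ r : ℕ → ℕ, ∀ X,
    partialCount G pos ψ P X = r X + (if leftMask G pos ψ x = X then 1 else 0) ∧
    partialCount G pos ψ (insert x P) X =
      r X + (if (∀ i, ψ i ≠ x) ∧ hostMask G ψ x = X then 1 else 0) := by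
  refine ⟨fun X => ∑ v ∈ Finset.univ.erase x, if v ∈ P then
    (if (∀ i, ψ i ≠ v) ∧ hostMask G ψ v = X then 1 else 0)
    else if leftMask G pos ψ v = X then 1 else 0, fun X => ⟨?_, ?_⟩⟩
  · rw [partialCount, ← Finset.sum_erase_add _ _ (Finset.mem_univ x), if_neg hx]
  · rw [partialCount, ← Finset.sum_erase_add _ _ (Finset.mem_univ x),
      if_pos (Finset.mem_insert_self _ _)]
    congr 1
    refine Finset.sum_congr rfl fun v hv => ?_
    have : v ∈ insert x P ↔ v ∈ P := by
      rw [Finset.mem_insert]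
      exact or_iff_right (Finset.ne_of_mem_erase hv)
    simp only [this]

open scoped Classical in
theorem partialCount_empty (G : SimpleGraph (Fin n)) (pos : Fin n → ℕ) (ψ : Fin s → Fin n) (X : ℕ) :
    partialCount G pos ψ ∅ X = Nat.card {v // leftMask G pos ψ v = X} := by
  rw [Nat.card_eq_fintype_card, Fintype.card_subtype, Finset.card_filter]
  simp [partialCount]

open scoped Classical in
-- A vertex that is neither in the image nor a left neighbour of it has all its neighbours in the
-- image on its own left side. Its left mask is then its full mask, so the vertices in `P` are the
-- only ones that need a correction.
theorem partialCount_eq_freeCount {ψ : Fin s → Fin n} (hpos : Function.Injective pos)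
    {P : Finset (Fin n)} (hP : ∀ i, ψ i ∈ P ∧ ∀ v, G.Adj (ψ i) v ∧ pos (ψ i) < pos v → v ∈ P) (X : ℕ) :
    partialCount G pos ψ P X = freeCount G ψ X := by
  rw [freeCount, Finset.card_filter]
  refine Finset.sum_congr rfl fun v _ => ?_
  by_cases hv : v ∈ P
  · rw [if_pos hv]
  · rw [if_neg hv]
    have h1 : ∀ i, ψ i ≠ v := fun i h => hv (h ▸ (hP i).1)
    have h2 : leftMask G pos ψ v = hostMask G ψ v := by
      refine bitSum_congr fun i hi => exists_congr fun h => ?_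
      refine ⟨fun h' => h'.1.symm, fun h' => ⟨h'.symm, ?_⟩⟩
      rcases lt_trichotomy (pos v) (pos (ψ ⟨i, h⟩)) with h3 | h3 | h3
      · exact h3
      · exact absurd (hpos h3).symm (h1 _)
      · exact absurd ((hP ⟨i, h⟩).2 v ⟨h', h3⟩) hv
    rw [h2]
    simp [h1]

/-- The state during the correction of the counts: the vertices in `P` are marked and processed. -/
structure CorrectState (G : SimpleGraph (Fin n)) (pos : Fin n → ℕ) (ψ : Fin s → Fin n) (t : ℕ)
    (P : Finset (Fin n)) (st : RamState) : Prop where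
  stamp : st.word rStamp 0 = t
  marked : ∀ u : Fin n, st.word rMark u = t ↔ u ∈ P
  mark_le : ∀ u : Fin n, st.word rMark u ≤ t
  count : ∀ X < 2 ^ s, st.word rE X = partialCount G pos ψ P X

theorem CorrectState.congr {ψ : Fin s → Fin n} {t : ℕ} {P : Finset (Fin n)} {st st' : RamState}
    (h : CorrectState G pos ψ t P st) (h1 : st'.word rStamp = st.word rStamp)
    (h2 : st'.word rMark = st.word rMark) (h3 : st'.word rE = st.word rE) :
    CorrectState G pos ψ t P st' :=
  ⟨by rw [h1, h.stamp], by rw [h2]; exact h.marked, by rw [h2]; exact h.mark_le,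
    by rw [h3]; exact h.count⟩

/-- A vertex may be met several times, as a left neighbour of several vertices of the image. The
mark makes all but the first treatment void, in accordance with `insert v P`. -/
theorem runs_correctVertex {st : RamState} (h : CountEnv A pos H σ st) {ψ : Fin s → Fin n}
    (hψ : ∀ i : Fin s, st.word rPhi i = ψ i) {v : Fin n} (hv : st.word rVert 0 = v) {t : ℕ}
    {P : Finset (Fin n)} (hst : CorrectState G pos ψ t P st) :
    Runs correctVertex st (s * 100 + 90) (CorrectState G pos ψ t (insert v P)) := by
  refine Runs.le (Runs.cond (B₁ := s * 100 + 75) (fun hc => ?_) (fun hc => ?_)) (by simp; omega)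
  · have hvP : v ∉ P := by
      intro hvP
      refine hc ?_
      simp [hv, hst.stamp, (hst.marked v).2 hvP]
    obtain ⟨r, hr⟩ := partialCount_insert G pos ψ hvP
    refine Runs.straight_seq rfl (B₂ := s * 100 + 70) (Runs.seq (runs_vertexMasks (v := v)
      (h.congr (by simp) (by simp)) (by simpa using hψ) (by simpa using hv))
      (fun s₁ hs₁ h₁ => ?_) (B₂ := 30)) (by simp; omega)
    obtain ⟨g1, g2, g3⟩ := h₁
    have hE₁ : s₁.word rE = st.word rE := by rw [hs₁.word rE rfl]; simp
    have hS₁ : s₁.word rStamp 0 = t := by rw [hs₁.word rStamp rfl]; simp [hst.stamp]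
    have hM₁ : s₁.word rMark = Function.update (st.word rMark) v t := by
      rw [hs₁.word rMark rfl]; simp [hv, hst.stamp]
    have hmk : ∀ u : Fin n, s₁.word rMark u = t ↔ u ∈ insert v P := by
      intro u
      rw [hM₁, Finset.mem_insert, ← hst.marked u]
      by_cases he : u = v
      · simp [he]
      · rw [Function.update_of_ne (by simpa [Fin.val_inj] using he)]
        simp [he]
    have hmk' : ∀ u : Fin n, s₁.word rMark u ≤ t := by
      intro u
      rw [hM₁, Function.update_apply]
      split_ifs
      · exact le_rfl
      · exact hst.mark_le u
    have hE₂ : ∀ X < 2 ^ s, ((RamProgram.setWord rE (wv rXl)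
        (.get rE (wv rXl) - 1)).run s₁).word rE X = r X := by
      intro X hX
      have h1 := hst.count X hX
      rw [(hr X).1] at h1
      by_cases he : X = leftMask G pos ψ v
      · subst he
        rw [if_pos rfl] at h1
        simp [g1, hE₁, h1]
      · rw [if_neg (Ne.symm he)] at h1
        simp [g1, hE₁, h1, he]
    refine Runs.straight_seq rfl (B₂ := 20) (Runs.le (Runs.cond (B₁ := 12) (fun hc => ?_)
      (fun hc => ?_)) (by simp)) (by simp)
    · have hfree : ¬ ∀ i, ψ i ≠ v := by
        rw [← g3]
        simpa using hc
      refine Runs.straight rfl (by simp) ⟨?_, ?_, ?_, fun X hX => ?_⟩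
      · simpa using hS₁
      · simpa using hmk
      · simpa using hmk'
      · rw [(hr X).2, if_neg fun h => hfree h.1]
        exact hE₂ X hX
    · have hfree : ∀ i, ψ i ≠ v := by
        rw [← g3]
        simpa using hc
      refine Runs.straight rfl (by simp) ⟨?_, ?_, ?_, fun X hX => ?_⟩
      · simpa using hS₁
      · simpa using hmk
      · simpa using hmk'
      · have h2 := hE₂ X hX
        rw [(hr X).2, ← h2]
        by_cases he : X = hostMask G ψ v
        · subst he
          simp [g2, hfree]
        · rw [if_neg fun h => he h.2.symm]
          simp [g2, he]
  · have hvP : v ∈ P := by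
      rw [← hst.marked, ← hst.stamp]
      simp [hv] at hc
      omega
    refine Runs.straight rfl (by simp) ?_
    rw [Finset.insert_eq_of_mem hvP]
    exact hst

/-- Increasing the stamp invalidates all old marks at once, since these are at most the old stamp;
so the marks need not be cleared between maps, which would take time linear in `n`. For each `i`,
the loop over `j` treats `ψ i` itself for `j = 0` and then its left neighbours. -/
theorem runs_correctCounts {st : RamState} (h : CountEnv A pos H σ st)
    (hpos : RankDegenerate G pos k) {ψ : Fin s → Fin n}
    (hψ : ∀ i : Fin s, st.word rPhi i = ψ i)
    (hmk : ∀ u : Fin n, st.word rMark u ≤ st.word rStamp 0)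
    (hE : ∀ X < 2 ^ s, st.word rE X = Nat.card {v // leftMask G pos ψ v = X}) :
    Runs correctCounts st (s * ((k + 1) * (s * 100 + 150) + 50) + 30) (fun st' =>
      (∀ u : Fin n, st'.word rMark u ≤ st'.word rStamp 0) ∧
      ∀ X < 2 ^ s, st'.word rE X = freeCount G ψ X) := by
  set t := st.word rStamp 0 + 1 with ht
  refine Runs.straight_seq rfl (B₂ := s * ((k + 1) * (s * 100 + 150) + 50) + 20) (Runs.le
    ((Runs.forUpto s ((k + 1) * (s * 100 + 150) + 30) (fun i st' => ∃ P : Finset (Fin n),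
    CorrectState G pos ψ t P st' ∧ ∀ i' : Fin s, (i' : ℕ) < i → ψ i' ∈ P ∧
      ∀ v, G.Adj (ψ i') v ∧ pos (ψ i') < pos v → v ∈ P) rfl ?_ ?_ ?_ ?_).mono le_rfl ?_) ?_)
    (by simp; omega)
  · intro s' hs
    rw [WordExpr.eval, WordExpr.eval, hs.word rS rfl]
    simpa using h.pattern.side
  · rintro j x s ⟨P, h1, h2⟩
    exact ⟨P, h1.congr (by simp) (by simp) (by simp), h2⟩
  · refine ⟨∅, ⟨?_, ?_, ?_, ?_⟩, by simp⟩
    · simp [ht]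
    · intro u
      have := hmk u
      simp
      omega
    · intro u
      have := hmk u
      simp
      omega
    · intro X hX
      rw [partialCount_empty, ← hE X hX]
      simp
  · rintro i s₁ hi hs₁ hii ⟨P, h1, h2⟩
    have hE₁ := (h.congr (st' := (setV rStamp (wv rStamp + 1)).run st) (by simp)
      (by simp)).of_sameOutside hs₁ rfl rfl
    have hψ₁ : ∀ i : Fin s, s₁.word rPhi i = ψ i := by
      rw [hs₁.word rPhi rfl]; simpa using hψ
    set x := ψ ⟨i, hi⟩ with hx
    have hlen := A.length_leftList_le hpos x
    refine Runs.straight_seq rfl (B₂ := (k + 1) * (s * 100 + 150) + 20) (Runs.le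
      ((Runs.forUpto ((A.leftList pos x).length + 1) (s * 100 + 120) (fun j st' =>
        ∃ P' : Finset (Fin n), P ⊆ P' ∧ CorrectState G pos ψ t P' st' ∧ (0 < j → x ∈ P') ∧
        ∀ r (hr : r < (A.leftList pos x).length), r + 1 < j → (A.leftList pos x)[r] ∈ P')
        rfl ?_ ?_ ?_ ?_).mono le_rfl ?_) ?_) (by simp; omega)
    · intro s' hs
      rw [WordExpr.eval_hAdd, WordExpr.eval, WordExpr.eval, WordExpr.eval, hs.word rLCnt rfl,
        hs.word rX rfl]
      simp [hii, hψ₁ ⟨i, hi⟩, hE₁.host.lcnt, hx]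
    · rintro j x s ⟨P', h1, h2, h3⟩
      exact ⟨P', h1, h2.congr (by simp) (by simp) (by simp), h3⟩
    · exact ⟨P, subset_rfl, h1.congr (by simp) (by simp) (by simp), by simp, by simp⟩
    · rintro j s₂ hj hs₂ hjj ⟨P', g1, g2, g3, g4⟩
      have hE₂ := (hE₁.congr (st' := (setV rX (.get rPhi (wv rI))).run s₁) (by simp)
        (by simp)).of_sameOutside hs₂ rfl rfl
      have hψ₂ : ∀ i : Fin s, s₂.word rPhi i = ψ i := by
        rw [hs₂.word rPhi rfl]; simpa using hψ₁
      have hX₂ : s₂.word rX 0 = x := by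
        rw [hs₂.word rX rfl]; simp [hii, hψ₁ ⟨i, hi⟩, hx]
      obtain ⟨v, hv0, hv1⟩ : ∃ v : Fin n, (j = 0 → v = x) ∧ (∀ r, j = r + 1 →
          ∀ hr : r < (A.leftList pos x).length, v = (A.leftList pos x)[r]) := by
        cases j with
        | zero => exact ⟨x, fun _ => rfl, fun r hr => by omega⟩
        | succ r => exact ⟨(A.leftList pos x)[r], fun h => by omega, fun r' hr' _ => by
            obtain rfl : r = r' := by omega
            rfl⟩
      refine Runs.seq (R := fun st' => st'.word rVert 0 = v ∧ CorrectState G pos ψ t P' st')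
        (B₁ := 25) ?_ (fun s₃ hs₃ h₃ => ?_) (B₂ := s * 100 + 90) (by omega)
      · refine Runs.le (Runs.cond (B₁ := 20) (fun hc => ?_) (fun hc => ?_)) (by simp)
        · obtain ⟨r, rfl⟩ : ∃ r, j = r + 1 := by
            refine ⟨j - 1, ?_⟩
            have : j ≠ 0 := by simpa [hjj] using hc
            omega
          have hr : r < (A.leftList pos x).length := by omega
          refine Runs.straight rfl (by simp) ⟨?_, g2.congr (by simp) (by simp) (by simp)⟩
          simp [hX₂, hE₂.host.base, hjj, hE₂.host.lnbr x r hr, hv1 r rfl hr]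
        · have hj0 : j = 0 := by simpa [hjj] using hc
          refine Runs.straight rfl (by simp) ⟨?_, g2.congr (by simp) (by simp) (by simp)⟩
          simp [hX₂, hv0 hj0]
      · refine (runs_correctVertex (hE₂.of_sameOutside hs₃ rfl rfl)
          (by rw [hs₃.word rPhi rfl]; exact hψ₂) h₃.1 h₃.2).mono le_rfl ?_
        intro s₄ _ h₄
        refine ⟨insert v P', g1.trans (Finset.subset_insert _ _), h₄, fun _ => ?_,
          fun r hr hrj => ?_⟩
        · by_cases hj0 : j = 0
          · rw [hv0 hj0]
            exact Finset.mem_insert_self _ _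
          · exact Finset.mem_insert_of_mem (g3 (by omega))
        · rcases lt_or_eq_of_le (Nat.lt_succ_iff.1 hrj) with h5 | h5
          · exact Finset.mem_insert_of_mem (g4 r hr h5)
          · rw [hv1 r h5.symm hr]
            exact Finset.mem_insert_self _ _
    · rintro s₂ - ⟨P', g1, g2, g3, g4⟩
      refine ⟨P', g2, fun i' hi' => ?_⟩
      rcases lt_or_eq_of_le (Nat.lt_succ_iff.1 hi') with h5 | h5
      · exact ⟨g1 (h2 i' h5).1, fun v hv => g1 ((h2 i' h5).2 v hv)⟩
      · obtain rfl : i' = ⟨i, hi⟩ := Fin.ext h5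
        refine ⟨g3 (by omega), fun v hv => ?_⟩
        obtain ⟨r, hr, rfl⟩ := List.mem_iff_getElem.1 (A.mem_leftList.2 hv)
        exact g4 r hr (Nat.succ_lt_succ hr)
    · simp
      have : ((A.leftList pos x).length + 1) * (s * 100 + 120 + 5 + 10) ≤
          (k + 1) * (s * 100 + 150) := Nat.mul_le_mul (by omega) (by omega)
      linarith
  · rintro s' - ⟨P, h1, h2⟩
    refine ⟨fun u => by rw [h1.stamp]; exact h1.mark_le u, fun X hX => ?_⟩
    rw [h1.count X hX, partialCount_eq_freeCount hpos.injective fun i => h2 i i.2]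
  · simp
    have : s * ((k + 1) * (s * 100 + 150) + 50) =
      s * ((k + 1) * (s * 100 + 150) + 30 + 2 + 10) + s * 8 := by ring
    omega

/-- A falling factorial is a quotient of two tabulated factorials. If the multiplicity exceeds the
number of free vertices, the truncated difference would yield a wrong nonzero quotient; the product
is then set to 0 and remains 0. -/
theorem runs_addProduct {st : RamState} (h : CountEnv A pos H σ st) {ψ : Fin s → Fin n}
    (hE : ∀ X < 2 ^ s, st.word rE X = freeCount G ψ X) :
    Runs addProduct st (2 ^ s * 60 + 30) (fun st' =>
      st'.ctr 0 0 = st.ctr 0 0 + (H.extensions σ G ψ : ℚ)) := by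
  classical
  have hle : ∀ X, freeCount G ψ X ≤ n := fun X => by
    simpa [freeCount] using Finset.card_le_univ (Finset.univ.filter fun v =>
      (∀ i, ψ i ≠ v) ∧ hostMask G ψ v = X)
  refine Runs.straight_seq rfl (B₂ := 2 ^ s * 60 + 20) (Runs.seq (Runs.forUpto (2 ^ s) 45
    (fun X st' => st'.ctr 2 0 = ((∏ X' ∈ Finset.range X,
      (freeCount G ψ X').descFactorial (H.cap σ X') : ℕ) : ℚ)) rfl ?_ ?_ ?_ ?_)
    (fun s₁ hs₁ h₁ => Runs.straight rfl le_rfl ?_) ?_) (by simp; omega)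
  · intro s' hs
    rw [WordExpr.eval, WordExpr.eval, WordExpr.eval, hs.word rPow rfl, hs.word rS rfl]
    simp [h.pattern.side, h.pattern.pow]
  · intro j x s h
    simpa using h
  · simp
  · rintro X s₁ hX hs₁ hXX g
    have hE₁ := (h.congr (st' := (RamProgram.setCtr 2 0 (.ofWord 1)).run st) (by simp)
      (by simp)).of_sameOutside hs₁ rfl rfl
    have hX₁ : s₁.word rE X = freeCount G ψ X := by rw [hs₁.word rE rfl]; simpa using hE X hX
    have hcap := hE₁.pattern.cap X
    refine Runs.le (Runs.cond (B₁ := 30) (fun hc => ?_) (fun hc => ?_)) (by simp)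
    · simp [hXX, hX₁, hcap] at hc
      refine Runs.straight rfl (by simp) ?_
      rw [Finset.prod_range_succ, Nat.descFactorial_eq_zero_iff_lt.2 (by omega)]
      simp
    · simp [hXX, hX₁, hcap, Nat.sub_eq_zero_iff_le] at hc
      refine Runs.straight rfl (by simp) ?_
      have h1 := Nat.factorial_mul_descFactorial hc
      have h2 : ((freeCount G ψ X - H.cap σ X).factorial : ℚ) ≠ 0 := by
        exact_mod_cast Nat.factorial_ne_zero _
      rw [Finset.prod_range_succ, Nat.cast_mul, ← g]
      simp [hXX, hX₁, hcap, hE₁.fact _ (hle X),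
        hE₁.fact (freeCount G ψ X - H.cap σ X) ((Nat.sub_le _ _).trans (hle X)), ← h1]
      left
      field_simp
  · have h0 : s₁.ctr 0 = st.ctr 0 := by rw [hs₁.ctr 0 rfl]; simp
    simp only [RamProgram.run, RamState.putCtr_ctr_self]
    simp [h0, h₁, Pattern.extensions]
  · simp
    omega

theorem runs_countExtensions {st : RamState} (h : CountEnv A pos H σ st)
    (hpos : RankDegenerate G pos k) {ψ : Fin s → Fin n}
    (hψ : ∀ i : Fin s, st.word rPhi i = ψ i)
    (hmk : ∀ u : Fin n, st.word rMark u ≤ st.word rStamp 0) :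
    Runs countExtensions st ((s + 1) * (2 ^ s * 200 + (k + 1) * (s * 100 + 150) + 300))
      (fun st' => (∀ u : Fin n, st'.word rMark u ≤ st'.word rStamp 0) ∧
        st'.ctr 0 0 = st.ctr 0 0 + (H.extensions σ G ψ : ℚ)) := by
  refine Runs.le (Runs.seq (runs_lookupCounts h hψ) (fun s₁ hs₁ h₁ => ?_)
    (B₂ := (s * (2 ^ s * 50 + 40) + 20) + ((s * ((k + 1) * (s * 100 + 150) + 50) + 30) +
      (2 ^ s * 60 + 30)))) ?_
  · have hE₁ := h.of_sameOutside hs₁ rfl rfl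
    refine Runs.seq (runs_sieve hE₁ (fun v => leftMask_lt) h₁) (fun s₂ hs₂ h₂ => ?_)
    have hE₂ := hE₁.of_sameOutside hs₂ rfl rfl
    refine Runs.seq (runs_correctCounts hE₂ hpos (ψ := ψ) ?_ ?_ h₂) (fun s₃ hs₃ h₃ => ?_)
    · rw [hs₂.word rPhi rfl, hs₁.word rPhi rfl]
      exact hψ
    · rw [hs₂.word rMark rfl, hs₁.word rMark rfl, hs₂.word rStamp rfl, hs₁.word rStamp rfl]
      exact hmk
    · refine (runs_addProduct (hE₂.of_sameOutside hs₃ rfl rfl) h₃.2).mono le_rfl ?_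
      intro s₄ hs₄ h₄
      rw [hs₄.word rMark rfl, hs₄.word rStamp rfl, h₄, hs₃.ctr 0 rfl, hs₂.ctr 0 rfl, hs₁.ctr 0 rfl]
      exact ⟨h₃.1, rfl⟩
  · have : (s + 1) * (2 ^ s * 200 + (k + 1) * (s * 100 + 150) + 300) =
      (s + 1) * (2 ^ s * 60 + 60) + s * (2 ^ s * 50 + 40) + s * ((k + 1) * (s * 100 + 150) + 50) +
      (s * (2 ^ s * 90 + 150) + 2 ^ s * 140 + (k + 1) * (s * 100 + 150) + 240) := by ring
    omega

end

/-! ## Enumeration of the maps of the small side -/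

notation "rCand" => 72
notation "rCLen" => 73

/-- Is the map of the small side an embedding as an induced subgraph? -/
def checkInduced : RamProgram :=
  setV rBad 0 ;;
  forUpto rI (wv rS)
    (forUpto rJ (wv rS)
      (setV rBad (wv rBad +
        (distExpr (.get rAdj (.get rBase (.get rPhi (wv rI)) + .get rPhi (wv rJ)))
            (tokenBit (wv rI) (wv rJ)) +
          ((1 - distExpr (.get rPhi (wv rI)) (.get rPhi (wv rJ))) -
            (1 - distExpr (wv rI) (wv rJ)))))))

/-- Process the map of the small side that is given by the sequence of indices in array `77`, unless it
has been processed before. -/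
def processMap : RamProgram :=
  forUpto rI (wv rS) (.setWord rPhi (wv rI) (.get rCand (.get 77 (wv rI)))) ;;
  setV rCode 0 ;;
  forUpto rI (wv rS)
    (setV rCode (wv rCode + .get rMul (.get rMulRow (wv rI) + (.get rPhi (wv rI) + 1)))) ;;
  .cond (.get rVis (wv rCode)) .skip
    (.setWord rVis (wv rCode) 1 ;; checkInduced ;; .cond (wv rBad) .skip countExtensions)

/-- List the closed left neighbourhoods of the vertices in array `74`. -/
def listCandidates : RamProgram :=
  setV rCLen 0 ;;
  forUpto rI (wv rC)
    (setV rX (.get 74 (wv rI)) ;;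
      .setWord rCand (wv rCLen) (wv rX) ;;
      setV rCLen (wv rCLen + 1) ;;
      forUpto rJ (.get rLCnt (wv rX))
        (.setWord rCand (wv rCLen) (.get rLNbr (.get rBase (wv rX) + (wv rJ + 1)) - 1) ;;
          setV rCLen (wv rCLen + 1)))

/-- Process all maps of the small side whose image is covered by few closed left neighbourhoods. -/
def enumerateMaps : RamProgram :=
  forTuples 74 75 76 (wv 0) (wv rC)
    (listCandidates ;; forTuples 77 78 79 (wv rCLen) (wv rS) processMap)

section

variable {m s k n : ℕ} {H : Pattern (Fin m)} {σ : Fin s → Fin m} {G : SimpleGraph (Fin n)}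
  {A : AdjLists G} {pos : Fin n → ℕ}

/-- All summands are natural numbers, so the total vanishes exactly if each of them does. The
difference of the two terms `1 - distExpr _ _` is 1 exactly if `ψ i = ψ j` while `i ≠ j`, and 0
otherwise, which tests injectivity. -/
theorem runs_checkInduced {st : RamState} (h : CountEnv A pos H σ st) {ψ : Fin s → Fin n}
    (hψ : ∀ i : Fin s, st.word rPhi i = ψ i) :
    Runs checkInduced st (s * (s * 100 + 30) + 20) (fun st' =>
      st'.word rBad 0 = 0 ↔ H.Induced σ G ψ) := by
  classical
  set R : Fin s → Fin s → Prop := fun i j =>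
    (H.graph.Adj (σ i) (σ j) ↔ G.Adj (ψ i) (ψ j)) ∧ (ψ i = ψ j → i = j) with hR
  refine Runs.straight_seq rfl (B₂ := s * (s * 100 + 30) + 10) (Runs.le ((Runs.forUpto s
    (s * 100 + 10) (fun i st' => st'.word rBad 0 = 0 ↔ ∀ i' j : Fin s, (i' : ℕ) < i → R i' j)
    rfl ?_ ?_ ?_ ?_).mono le_rfl ?_) ?_) (by simp; omega)
  · intro s' hs
    rw [WordExpr.eval, WordExpr.eval, hs.word rS rfl]
    simpa using h.pattern.side
  · intro j x s h
    simpa using h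
  · simp
  · rintro i s₁ hi hs₁ hii g
    have hE₁ := (h.congr (st' := (setV rBad 0).run st) (by simp) (by simp)).of_sameOutside hs₁ rfl rfl
    refine Runs.le ((Runs.forUpto s 80 (fun j st' => st'.word rBad 0 = 0 ↔
      s₁.word rBad 0 = 0 ∧ ∀ j' : Fin s, (j' : ℕ) < j → R ⟨i, hi⟩ j') rfl ?_ ?_ ?_ ?_).mono le_rfl
      ?_) ?_
    · intro s' hs
      rw [WordExpr.eval, WordExpr.eval, hs.word rS rfl]
      exact hE₁.pattern.side
    · intro j x s h
      simpa using h
    · simp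
    · rintro j s₂ hj hs₂ hjj g'
      have hE₂ := hE₁.of_sameOutside hs₂ rfl rfl
      have hP : ∀ i : Fin s, s₂.word rPhi i = ψ i := by
        rw [hs₂.word rPhi rfl, hs₁.word rPhi rfl]; simpa using hψ
      have hI : s₂.word rI 0 = i := by rw [hs₂.word rI rfl]; exact hii
      have hPi := hP ⟨i, hi⟩
      have hPj := hP ⟨j, hj⟩
      have hadj := hE₂.host.adj (ψ ⟨i, hi⟩) (ψ ⟨j, hj⟩)
      have htok := hE₂.pattern.tok ⟨i, hi⟩
      have hlt := H.mask_lt σ (σ ⟨i, hi⟩)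
      have hbit : s₂.word rBit (H.mask σ (σ ⟨i, hi⟩) * s + j) =
          if H.graph.Adj (σ ⟨j, hj⟩) (σ ⟨i, hi⟩) then 1 else 0 := by
        rw [hE₂.pattern.bit _ hlt j hj]
        exact if_congr (H.testBit_mask σ _ ⟨j, hj⟩) rfl rfl
      dsimp only at hPi hPj htok
      have key : (∀ j' : Fin s, (j' : ℕ) < j + 1 → R ⟨i, hi⟩ j') ↔
          (∀ j' : Fin s, (j' : ℕ) < j → R ⟨i, hi⟩ j') ∧ R ⟨i, hi⟩ ⟨j, hj⟩ := by
        refine ⟨fun h => ⟨fun j' hj' => h j' (by omega), h _ (by simp)⟩, fun h j' hj' => ?_⟩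
        rcases lt_or_eq_of_le (Nat.lt_succ_iff.1 hj') with h1 | h1
        · exact h.1 j' h1
        · have : j' = ⟨j, hj⟩ := Fin.ext h1
          rw [this]
          exact h.2
      refine Runs.straight rfl (by simp) ?_
      rw [key, ← and_assoc, ← g']
      simp only [RamProgram.run, RamState.putWord_word_self]
      simp only [WordExpr.eval, WordExpr.eval_hSub,
        Function.update_self, hI, hjj, hPi, hPj, hE₂.host.base, hadj, htok,
        hE₂.pattern.row _ hlt, hbit, Nat.add_eq_zero_iff]
      refine and_congr_right fun _ => ?_
      rw [hR]
      refine and_congr ?_ ?_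
      · rw [H.graph.adj_comm (σ ⟨i, hi⟩)]
        split_ifs with h1 h2 h2 <;> simp [h1, h2]
      · rw [← Fin.val_inj, Fin.mk.injEq]
        omega
    · intro s₂ _ g'
      rw [g', g]
      constructor
      · rintro ⟨h1, h2⟩ i' j hi'
        rcases lt_or_eq_of_le (Nat.lt_succ_iff.1 hi') with h3 | h3
        · exact h1 i' j h3
        · have : i' = ⟨i, hi⟩ := Fin.ext h3
          rw [this]
          exact h2 j j.2
      · exact fun h1 => ⟨fun i' j hi' => h1 i' j (by omega), fun j _ => h1 _ j (by simp)⟩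
    · simp
      omega
  · rintro s' - g
    rw [g]
    exact ⟨fun h => ⟨fun i j hij => (h i j i.2).2 hij, fun i j => (h i j i.2).1⟩,
      fun h i j _ => ⟨h.adj_iff i j, fun hij => h.injective hij⟩⟩
  · simp
    have : s * (s * 100 + 30) = s * (s * 100 + 10 + 2 + 10) + s * 8 := by ring
    omega

/-- The code of a map of the small side. -/
def mapCode (ψ : Fin s → Fin n) : ℕ :=
  digitSum (n + 1) s fun i => if h : i < s then ψ ⟨i, h⟩ + 1 else 0

theorem mapCode_injective : Function.Injective (mapCode : (Fin s → Fin n) → ℕ) := by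
  intro ψ ψ' h
  have hlt : ∀ (ψ : Fin s → Fin n) (i : ℕ), i < s →
      (if h : i < s then (ψ ⟨i, h⟩ : ℕ) + 1 else 0) < n + 1 := by
    intro ψ i hi
    rw [dif_pos hi]
    have := (ψ ⟨i, hi⟩).2
    omega
  funext i
  have := (digitSum_inj (hlt ψ) (hlt ψ')).1 h i i.2
  simp only [Fin.is_lt, dif_pos, Fin.eta] at this
  exact Fin.ext (by omega)

open scoped Classical in
/-- The maps in `F` have been processed. -/
structure Processed (H : Pattern (Fin m)) (σ : Fin s → Fin m) (G : SimpleGraph (Fin n))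
    (F : Finset (Fin s → Fin n)) (st : RamState) : Prop where
  visited : ∀ z, st.word rVis z ≠ 0 ↔ ∃ ψ ∈ F, mapCode ψ = z
  mark_le : ∀ u : Fin n, st.word rMark u ≤ st.word rStamp 0
  total : st.ctr 0 0 = ((∑ ψ ∈ F.filter (H.Induced σ G), H.extensions σ G ψ : ℕ) : ℚ)

theorem Processed.congr {F : Finset (Fin s → Fin n)} {st st' : RamState}
    (h : Processed H σ G F st) (h1 : st'.word rVis = st.word rVis)
    (h2 : st'.word rMark = st.word rMark) (h3 : st'.word rStamp = st.word rStamp)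
    (h4 : st'.ctr 0 = st.ctr 0) : Processed H σ G F st' :=
  ⟨by rw [h1]; exact h.visited, by rw [h2, h3]; exact h.mark_le, by rw [h4]; exact h.total⟩

/-- A bound for the cost of `processMap`. -/
def mapCost (s k : ℕ) : ℕ :=
  (s + 1) * (2 ^ s * 200 + (k + 1) * (s * 100 + 150) + s * 100 + 500)

/-- The code of the map, injective by `mapCode_injective`, is the address of its entry in `rVis`. A
map reached from several tuples of centres or through repeated candidates is therefore counted once.
-/
theorem runs_processMap {st : RamState} (h : CountEnv A pos H σ st)
    (hpos : RankDegenerate G pos k) {ψ : Fin s → Fin n}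
    (hψ : ∀ i : Fin s, st.word rCand (st.word 77 i) = ψ i) {F : Finset (Fin s → Fin n)}
    (hF : Processed H σ G F st) :
    Runs processMap st (mapCost s k) (Processed H σ G (insert ψ F)) := by
  classical
  refine Runs.le (Runs.seq (Runs.forUpto s 10 (fun i st' => ∀ j : Fin s, (j : ℕ) < i →
    st'.word rPhi j = ψ j) rfl ?_ ?_ ?_ ?_) (fun s₁ hs₁ h₁ => ?_)
    (B₂ := s * 60 + 40 + ((s * (s * 100 + 30) + 20) +
      (s + 1) * (2 ^ s * 200 + (k + 1) * (s * 100 + 150) + 300)))) ?_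
  · intro s' hs
    rw [WordExpr.eval, WordExpr.eval, hs.word rS rfl]
    exact h.pattern.side
  · intro j x s h
    simpa using h
  · simp
  · rintro i s' hi hs hii g
    refine Runs.straight rfl (by simp) fun j hj => ?_
    have hD : s'.word 77 = st.word 77 := by rw [hs.word 77 rfl]
    have hC : s'.word rCand = st.word rCand := by rw [hs.word rCand rfl]
    by_cases he : (j : ℕ) = i
    · have := hψ j
      rw [he] at this
      simp [hii, he, hD, hC, this]
    · simp [hii, he, g j (by omega)]
  · have hE₁ := h.of_sameOutside hs₁ rfl rfl
    have hP₁ : ∀ i : Fin s, s₁.word rPhi i = ψ i := fun i => h₁ i i.2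
    refine Runs.straight_seq rfl (B₂ := s * 60 + 30 + ((s * (s * 100 + 30) + 20) +
      (s + 1) * (2 ^ s * 200 + (k + 1) * (s * 100 + 150) + 300))) (Runs.seq
      (Runs.forUpto s 20 (fun i st' => st'.word rCode 0 = digitSum (n + 1) i fun i =>
        if h : i < s then ψ ⟨i, h⟩ + 1 else 0) rfl ?_ ?_ ?_ ?_) (fun s₂ hs₂ h₂ => ?_)
      (B₂ := 20 + ((s * (s * 100 + 30) + 20) +
        (s + 1) * (2 ^ s * 200 + (k + 1) * (s * 100 + 150) + 300))) (by simp; omega))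
      (by simp; omega)
    · intro s' hs
      rw [WordExpr.eval, WordExpr.eval, hs.word rS rfl]
      simpa using hE₁.pattern.side
    · intro j x s h
      simpa using h
    · simp [digitSum]
    · rintro i s' hi hs hii g
      have hE' := (hE₁.congr (st' := (setV rCode 0).run s₁) (by simp) (by simp)).of_sameOutside
        hs rfl rfl
      have hP' : s'.word rPhi i = ψ ⟨i, hi⟩ := by
        rw [hs.word rPhi rfl]; simpa using hP₁ ⟨i, hi⟩
      refine Runs.straight rfl (by simp) ?_
      have h1 := hE'.mul i hi _ (ψ ⟨i, hi⟩).2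
      rw [digitSum_succ, dif_pos hi, ← g]
      simp [hii, hP', hE'.mulRow i hi, -Order.lt_add_one_iff]
      exact h1
    · have hE₂ := (hE₁.congr (st' := (setV rCode 0).run s₁) (by simp) (by simp)).of_sameOutside
        hs₂ rfl rfl
      have hcode : s₂.word rCode 0 = mapCode ψ := h₂
      have hF₂ : Processed H σ G F s₂ := hF.congr
        (by rw [hs₂.word rVis rfl]; simp [hs₁.word rVis rfl])
        (by rw [hs₂.word rMark rfl]; simp [hs₁.word rMark rfl])
        (by rw [hs₂.word rStamp rfl]; simp [hs₁.word rStamp rfl])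
        (by rw [hs₂.ctr 0 rfl]; simp [hs₁.ctr 0 rfl])
      have hP₂ : ∀ i : Fin s, s₂.word rPhi i = ψ i := by
        rw [hs₂.word rPhi rfl]; simpa using hP₁
      have hvis : (WordExpr.get rVis (wv rCode)).eval s₂ ≠ 0 ↔ ψ ∈ F := by
        rw [WordExpr.eval, WordExpr.eval, WordExpr.eval, hcode, hF₂.visited]
        exact ⟨fun ⟨ψ', h1, h2⟩ => mapCode_injective h2 ▸ h1, fun h => ⟨ψ, h, rfl⟩⟩
      refine Runs.le (Runs.cond (B₁ := 8 + ((s * (s * 100 + 30) + 20) +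
        (s + 1) * (2 ^ s * 200 + (k + 1) * (s * 100 + 150) + 300))) (fun hc => ?_)
        (fun hc => ?_)) (by simp; omega)
      · rw [Finset.insert_eq_of_mem (hvis.1 hc)]
        refine Runs.straight rfl ?_ hF₂
        simp only [RamProgram.maxCost]
        omega
      · have hnF : ψ ∉ F := fun h => hvis.2 h hc
        refine Runs.straight_seq rfl (B₂ := 3 + ((s * (s * 100 + 30) + 20) +
          (s + 1) * (2 ^ s * 200 + (k + 1) * (s * 100 + 150) + 300))) (Runs.seq (runs_checkInduced
          (ψ := ψ) (hE₂.congr (by simp) (by simp)) (by simpa using hP₂))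
          (fun s₃ hs₃ h₃ => ?_) (B₂ := 3 +
          (s + 1) * (2 ^ s * 200 + (k + 1) * (s * 100 + 150) + 300)) (by omega)) (by simp; omega)
        have hE₃ := (hE₂.congr (st' := (RamProgram.setWord rVis (wv rCode) 1).run s₂) (by simp)
          (by simp)).of_sameOutside hs₃ rfl rfl
        have hvis₃ : s₃.word rVis = Function.update (s₂.word rVis) (mapCode ψ) 1 := by
          rw [hs₃.word rVis rfl]; simp [hcode]
        have hV : ∀ z, s₃.word rVis z ≠ 0 ↔ ∃ ψ' ∈ insert ψ F, mapCode ψ' = z := by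
          intro z
          rw [hvis₃, Function.update_apply]
          split_ifs with hz
          · simp [hz]
          · rw [hF₂.visited]
            simp [Ne.symm hz]
        have hM : ∀ u : Fin n, s₃.word rMark u ≤ s₃.word rStamp 0 := by
          rw [hs₃.word rMark rfl, hs₃.word rStamp rfl]
          simpa using hF₂.mark_le
        have hT : s₃.ctr 0 0 = ((∑ ψ ∈ F.filter (H.Induced σ G), H.extensions σ G ψ : ℕ) : ℚ) := by
          rw [hs₃.ctr 0 rfl, ← hF₂.total]
          simp
        refine Runs.le (Runs.cond
          (B₁ := (s + 1) * (2 ^ s * 200 + (k + 1) * (s * 100 + 150) + 300)) (fun hc => ?_)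
          (fun hc => ?_)) (by simp)
        · have hind : ¬ H.Induced σ G ψ := by
            rw [← h₃]
            simpa using hc
          refine Runs.straight rfl ?_ ⟨hV, hM, ?_⟩
          · simp only [RamProgram.maxCost]
            exact Nat.succ_le_of_lt (by positivity)
          · rw [Finset.filter_insert, if_neg hind]
            exact hT
        · have hind : H.Induced σ G ψ := by
            rw [← h₃]
            simpa using hc
          refine (runs_countExtensions hE₃ hpos (ψ := ψ) (by
            rw [hs₃.word rPhi rfl]; simpa using hP₂) hM).mono le_rfl ?_
          rintro s₄ hs₄ ⟨h4, h5⟩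
          refine ⟨by rw [hs₄.word rVis rfl]; exact hV, h4, ?_⟩
          rw [h5, hT, Finset.filter_insert, if_pos hind, Finset.sum_insert (by simp [hnF])]
          push_cast
          ring
  · unfold mapCost
    have : (s + 1) * (2 ^ s * 200 + (k + 1) * (s * 100 + 150) + s * 100 + 500) =
      (s + 1) * (2 ^ s * 200 + (k + 1) * (s * 100 + 150) + 300) + s * (s * 100 + 30) +
        s * 270 + 200 := by ring
    simp
    omega

end

theorem digitSum_div_mod {b s : ℕ} {y : ℕ → ℕ} (h : ∀ i < s, y i < b) {i : ℕ} (hi : i < s) :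
    digitSum b s y / b ^ i % b = y i :=
  (digitSum_inj (fun _ hj => Nat.mod_lt _ ((Nat.zero_le _).trans_lt (h _ hj))) h).1
    (digitSum_digits (digitSum_lt h)) i hi

/-! ### Enumeration of all maps with a covered image. -/

section

variable {m s k n : ℕ} {H : Pattern (Fin m)} {σ : Fin s → Fin m} {G : SimpleGraph (Fin n)}
  {A : AdjLists G} {pos : Fin n → ℕ}

/-- The array `rCand` lists at most `l` vertices, among them all vertices that satisfy `R`. -/
structure Listed (n : ℕ) (R : Fin n → Prop) (l : ℕ) (st : RamState) : Prop where
  len_le : st.word rCLen 0 ≤ l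
  vertex : ∀ q < st.word rCLen 0, ∃ u : Fin n, st.word rCand q = u
  mem : ∀ u : Fin n, R u → ∃ q < st.word rCLen 0, st.word rCand q = u

theorem Listed.congr {R : Fin n → Prop} {l : ℕ} {st st' : RamState} (h : Listed n R l st)
    (h1 : st'.word rCLen = st.word rCLen) (h2 : st'.word rCand = st.word rCand) :
    Listed n R l st' :=
  ⟨by rw [h1]; exact h.len_le, by rw [h1, h2]; exact h.vertex, by rw [h1, h2]; exact h.mem⟩

theorem Listed.mono {R R' : Fin n → Prop} {l l' : ℕ} {st : RamState} (h : Listed n R l st)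
    (hR : ∀ u, R' u → R u) (hl : l ≤ l') : Listed n R' l' st :=
  ⟨h.len_le.trans hl, h.vertex, fun u hu => h.mem u (hR u hu)⟩

theorem Listed.push {R : Fin n → Prop} {l : ℕ} {st st' : RamState} (h : Listed n R l st)
    (u : Fin n) (h1 : st'.word rCLen 0 = st.word rCLen 0 + 1)
    (h2 : st'.word rCand = Function.update (st.word rCand) (st.word rCLen 0) u) :
    Listed n (fun v => R v ∨ v = u) (l + 1) st' := by
  refine ⟨by rw [h1]; exact Nat.succ_le_succ h.len_le, fun q hq => ?_, fun v hv => ?_⟩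
  · rw [h2, Function.update_apply]
    split_ifs with he
    · exact ⟨u, rfl⟩
    · exact h.vertex q (by omega)
  · rcases hv with hv | rfl
    · obtain ⟨q, hq, hq'⟩ := h.mem v hv
      exact ⟨q, by omega, by rw [h2, Function.update_of_ne (by omega), hq']⟩
    · exact ⟨st.word rCLen 0, by omega, by rw [h2, Function.update_self]⟩

/-- The vertex `u` lies in the closed left neighbourhood of one of the first `l` vertices of `C`. -/
def CoveredBy (G : SimpleGraph (Fin n)) (pos : Fin n → ℕ) (C : ℕ → Fin n) (l : ℕ) (u : Fin n) :
    Prop := ∃ j < l, u = C j ∨ G.Adj (C j) u ∧ pos (C j) < pos u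

theorem runs_listCandidates {st : RamState} (hT : HostTables A pos st)
    (hpos : RankDegenerate G pos k) {c : ℕ} (hc : st.word rC 0 = c) {C : ℕ → Fin n}
    (hC : ∀ j < c, st.word 74 j = C j) :
    Runs listCandidates st (c * (k * 40 + 60) + 20) (Listed n (CoveredBy G pos C c) (c * (k + 1))) := by
  refine Runs.straight_seq rfl (B₂ := c * (k * 40 + 60) + 10) (Runs.le (Runs.forUpto c
    (k * 40 + 45) (fun i => Listed n (CoveredBy G pos C i) (i * (k + 1))) rfl ?_ ?_ ?_ ?_) ?_)
    (by simp; omega)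
  · intro s' hs
    rw [WordExpr.eval, WordExpr.eval, hs.word rC rfl]
    simpa using hc
  · exact fun j x s h => h.congr (by simp) (by simp)
  · exact ⟨by simp, by simp, fun u ⟨j, hj, _⟩ => absurd hj (Nat.not_lt_zero _)⟩
  · intro i s₁ hi hs₁ hii g
    have hT₁ : HostTables A pos s₁ := hT.congr (by
      intro a ha
      rw [hs₁.word a (by simp at ha; rcases ha with rfl | rfl | rfl | rfl | rfl | rfl <;> rfl)]
      simp at ha
      rcases ha with rfl | rfl | rfl | rfl | rfl | rfl <;> simp)
    have hCi : s₁.word 74 i = C i := by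
      rw [hs₁.word 74 rfl]; simpa using hC i hi
    set v := C i with hv
    have hlen := A.length_leftList_le hpos v
    refine Runs.straight_seq rfl (B₂ := k * 40 + 35) (Runs.straight_seq rfl (B₂ := k * 40 + 30)
      (Runs.straight_seq rfl (B₂ := k * 40 + 20) (Runs.le ((Runs.forUpto
      (A.leftList pos v).length 25 (fun j => Listed n (fun u => CoveredBy G pos C i u ∨ u = v ∨
        ∃ r, ∃ hr : r < (A.leftList pos v).length, r < j ∧ u = (A.leftList pos v)[r])
        (i * (k + 1) + 1 + j)) rfl ?_ ?_ ?_ ?_).mono le_rfl ?_) ?_) (by simp; omega)) (by simp; omega))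
      (by simp; omega)
    · intro s' hs
      rw [WordExpr.eval, WordExpr.eval, WordExpr.eval, hs.word rLCnt rfl, hs.word rX rfl]
      simpa [hii, hCi] using hT₁.lcnt v
    · exact fun j x s h => h.congr (by simp) (by simp)
    · refine (g.push v (st' := RamProgram.run _ (RamProgram.run _ (RamProgram.run _ s₁))) ?_
        ?_).mono ?_ le_rfl
      · simp
      · simp [hii, hCi]
      · rintro u (h | h | ⟨r, _, h, _⟩)
        · exact .inl h
        · exact .inr h
        · exact absurd h (Nat.not_lt_zero _)
    · intro j s₂ hj hs₂ hjj g'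
      have hX : s₂.word rX 0 = v := by
        rw [hs₂.word rX rfl]; simp [hii, hCi]
      have hB : s₂.word rBase v = v * n := by
        rw [hs₂.word rBase rfl]; simpa using hT₁.base v
      have hN : s₂.word rLNbr (v * n + (j + 1)) = (A.leftList pos v)[j] + 1 := by
        rw [hs₂.word rLNbr rfl]; simpa using hT₁.lnbr v j hj
      refine Runs.straight rfl (by simp) ((g'.push ((A.leftList pos v)[j])
        (st' := RamProgram.run _ s₂) ?_ ?_).mono ?_ le_rfl)
      · simp
      · simp [hX, hB, hjj, hN]
      · rintro u (h | h | ⟨r, hr, h, h'⟩)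
        · exact .inl (.inl h)
        · exact .inl (.inr (.inl h))
        · rcases lt_or_eq_of_le (Nat.lt_succ_iff.1 h) with h1 | rfl
          · exact .inl (.inr (.inr ⟨r, hr, h1, h'⟩))
          · exact .inr h'
    · intro s₂ _ g'
      refine g'.mono ?_ (by rw [Nat.succ_mul]; omega)
      rintro u ⟨j, hj, h⟩
      rcases lt_or_eq_of_le (Nat.lt_succ_iff.1 hj) with h1 | rfl
      · exact .inl ⟨j, h1, h⟩
      · rcases h with h | h
        · exact .inr (.inl h)
        · obtain ⟨r, hr, h'⟩ := List.getElem_of_mem ((A.mem_leftList (pos := pos)).2 h)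
          exact .inr (.inr ⟨r, hr, hr, h'.symm⟩)
    · simp
      omega
  · simp
    have : c * (k * 40 + 60) = c * (k * 40 + 45 + 2 + 10) + c * 3 := by ring
    omega

/-- A bound for the cost of `enumerateMaps`. -/
def enumerateCost (s k c n : ℕ) : ℕ :=
  n ^ c * (c * (k * 40 + 110) + (c * (k + 1)) ^ s * (mapCost s k + s * 44 + 17) + s * 17 + 70) +
    c * 17 + 17

open scoped Classical in
-- The candidate list of a tuple may contain repetitions, which does no harm: for a map covered by
-- the tuple, one index in the list is chosen for each `ψ i`, and the number with these digits leads
-- to `ψ`.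
theorem runs_enumerateMaps {st : RamState} (h : CountEnv A pos H σ st)
    (hpos : RankDegenerate G pos k) {c : ℕ} (hc : st.word rC 0 = c) (hc1 : 1 ≤ c) (hn : 1 ≤ n)
    (hz : ∀ a ∈ [rVis, rMark, rStamp], ∀ z, st.word a z = 0) (hctr : st.ctr 0 0 = 0) :
    Runs enumerateMaps st (enumerateCost s k c n) (fun st' =>
      ∃ F : Finset (Fin s → Fin n), Processed H σ G F st' ∧
        ∀ (C : ℕ → Fin n) (ψ : Fin s → Fin n), (∀ i, CoveredBy G pos C c (ψ i)) → ψ ∈ F) := by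
  set tuple : ℕ → ℕ → Fin n := fun x j => ⟨x / n ^ j % n, Nat.mod_lt _ hn⟩ with htuple
  refine Runs.le ((Runs.forTuples n c (c * (k * 40 + 60) + 20 +
    (c * (k + 1)) ^ s * (mapCost s k + s * 44 + 17) + s * 17 + 17)
    (fun x st' => ∃ F : Finset (Fin s → Fin n), Processed H σ G F st' ∧
      ∀ x' < x, ∀ ψ : Fin s → Fin n, (∀ i, CoveredBy G pos (tuple x') c (ψ i)) → ψ ∈ F)
    (by simp) (by simp) (by simp) hn rfl ?_ ?_ ?_ ?_ ?_).mono le_rfl ?_) ?_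
  · intro s' hs
    rw [WordExpr.eval, WordExpr.eval, hs.word 0 rfl]
    exact h.host.size
  · intro s' hs
    rw [WordExpr.eval, WordExpr.eval, hs.word rC rfl]
    exact hc
  · rintro x s s' hw hctr ⟨F, hF, h'⟩
    exact ⟨F, hF.congr (hw _ (by simp) (by simp) (by simp)) (hw _ (by simp) (by simp) (by simp))
      (hw _ (by simp) (by simp) (by simp)) (by rw [hctr]), h'⟩
  · refine ⟨∅, ⟨fun z => ?_, fun u => ?_, ?_⟩, by simp⟩
    · simp [hz rVis (by simp)]
    · simp [hz rMark (by simp)]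
    · simpa using hctr
  · rintro x s₁ hx hs₁ hd ⟨F, hF, hxF⟩
    have hE₁ := h.of_sameOutside hs₁ rfl rfl
    refine Runs.seq (runs_listCandidates hE₁.host hpos (c := c) (C := tuple x)
      (by rw [hs₁.word rC rfl]; exact hc) (fun j hj => hd j hj)) (fun s₂ hs₂ hL => ?_)
      (B₂ := (c * (k + 1)) ^ s * (mapCost s k + s * 44 + 17) + s * 17 + 17) (by omega)
    have hE₂ := hE₁.of_sameOutside hs₂ rfl rfl
    have hF₂ : Processed H σ G F s₂ := hF.congr (hs₂.word _ rfl) (hs₂.word _ rfl) (hs₂.word _ rfl)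
      (hs₂.ctr 0 rfl)
    set b := s₂.word rCLen 0 with hb
    -- As `1 ≤ c`, the first centre is itself a candidate, so the base of the inner enumeration is
    -- positive.
    have hb0 : 0 < b := by
      obtain ⟨q, hq, _⟩ := hL.mem (tuple x 0) ⟨0, hc1, .inl rfl⟩
      omega
    have hmod : ∀ x i, x / b ^ i % b < b := fun x i => Nat.mod_lt _ hb0
    have hbM : b ^ s ≤ (c * (k + 1)) ^ s := Nat.pow_le_pow_left hL.len_le s
    refine Runs.le ((Runs.forTuples b s (mapCost s k) (fun y st' => ∃ F' : Finset (Fin s → Fin n),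
      Processed H σ G F' st' ∧ F ⊆ F' ∧ ∀ y' < y, ∀ ψ : Fin s → Fin n,
        (∀ i : Fin s, s₂.word rCand (y' / b ^ (i : ℕ) % b) = ψ i) → ψ ∈ F')
      (by simp) (by simp) (by simp) hb0 rfl ?_ ?_ ?_ ?_ ?_).mono le_rfl ?_) ?_
    · intro s' hs
      rw [WordExpr.eval, WordExpr.eval, hs.word rCLen rfl]
    · intro s' hs
      rw [WordExpr.eval, WordExpr.eval, hs.word rS rfl]
      exact hE₂.pattern.side
    · rintro x s s' hw hctr ⟨F', hF', h'⟩
      exact ⟨F', hF'.congr (hw _ (by simp) (by simp) (by simp))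
        (hw _ (by simp) (by simp) (by simp)) (hw _ (by simp) (by simp) (by simp)) (by rw [hctr]),
        h'⟩
    · exact ⟨F, hF₂, subset_rfl, by simp⟩
    · rintro y s₃ hy hs₃ hd₃ ⟨F', hF', hsub, hyF⟩
      have hE₃ := hE₂.of_sameOutside hs₃ rfl rfl
      have hcand : s₃.word rCand = s₂.word rCand := hs₃.word _ rfl
      choose ψ hψ using fun i : Fin s => hL.vertex _ (hmod y i)
      refine (runs_processMap hE₃ hpos (ψ := ψ) (fun i => ?_) hF').mono le_rfl
        fun s₄ _ h₄ => ⟨insert ψ F', h₄, hsub.trans (Finset.subset_insert _ _), fun y' hy' ψ' h' => ?_⟩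
      · rw [hcand, hd₃ i i.2, hψ]
      · rcases lt_or_eq_of_le (Nat.lt_succ_iff.1 hy') with h1 | rfl
        · exact Finset.mem_insert_of_mem (hyF y' h1 ψ' h')
        · have : ψ' = ψ := funext fun i => Fin.ext ((h' i).symm.trans (hψ i))
          rw [this]
          exact Finset.mem_insert_self _ _
    · rintro s₃ - ⟨F', hF', hsub, hyF⟩
      refine ⟨F', hF', fun x' hx' ψ hψ => ?_⟩
      rcases lt_or_eq_of_le (Nat.lt_succ_iff.1 hx') with h1 | rfl
      · exact hsub (hxF x' h1 ψ hψ)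
      · choose q hq hq' using fun i => hL.mem _ (hψ i)
        have hlt : ∀ i < s, (fun i => if h : i < s then q ⟨i, h⟩ else 0) i < b := by
          intro i hi
          simp only [dif_pos hi]
          exact hq _
        refine hyF _ (digitSum_lt hlt) ψ fun i => ?_
        rw [digitSum_div_mod hlt i.2]
        simp [hq']
    · have := Nat.mul_le_mul_right (mapCost s k + s * 44 + 17) hbM
      have he : b ^ s * (mapCost s k + s * 44 + 17) =
        b ^ s * (mapCost s k + s * (2 + 2 + 40) + 2 + 15) := by ring
      simp
      omega
  · rintro s' - ⟨F, hF, hxF⟩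
    refine ⟨F, hF, fun C ψ hψ => hxF _ (digitSum_lt (s := c) (y := fun j => C j) fun j _ => (C j).2)
      ψ fun i => ?_⟩
    obtain ⟨j, hj, h'⟩ := hψ i
    have : tuple (digitSum n c fun j => C j) j = C j :=
      Fin.ext (digitSum_div_mod (fun j _ => (C j).2) hj)
    exact ⟨j, hj, by rwa [this]⟩
  · unfold enumerateCost
    generalize (c * (k + 1)) ^ s * (mapCost s k + s * 44 + 17) = Z
    have : n ^ c * (c * (k * 40 + 60) + 20 + Z + s * 17 + 17 + c * (2 + 2 + 40) + 2 + 15) ≤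
        n ^ c * (c * (k * 40 + 110) + Z + s * 17 + 70) :=
      Nat.mul_le_mul_left _ (by
        have : c * (k * 40 + 110) = c * (k * 40 + 60) + c * 44 + c * 6 := by ring
        omega)
    simp
    omega

/-- After all relevant maps have been processed, the counter holds the number of strong embeddings. -/
theorem Processed.strongCount {F : Finset (Fin s → Fin n)} {st : RamState}
    (h : Processed H σ G F st) (hσ : H.Lists σ) (hpos : RankDegenerate G pos k) {c : ℕ}
    (hc : ∀ w : ℕ → ℕ, (∀ p < (H.tokenData σ k).L, w p < (H.tokenData σ k).base) →
      (H.tokenData σ k).Valid ((H.tokenData σ k).extend w) →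
      (H.tokenData σ k).Coverable ((H.tokenData σ k).extend w) c)
    (hF : ∀ (C : ℕ → Fin n) (ψ : Fin s → Fin n), (∀ i, CoveredBy G pos C c (ψ i)) → ψ ∈ F) :
    st.ctr 0 0 = H.strongCount G := by
  classical
  rw [h.total, H.strongCount_eq_sum hσ]
  congr 1
  -- Induced maps that have not been processed have an uncovered image and thus, by
  -- `RankDegenerate.exists_cover`, no extension.
  refine Finset.sum_subset (Finset.filter_subset_filter _ (Finset.subset_univ _)) fun ψ hψ hψ' => ?_
  have hind := (Finset.mem_filter.1 hψ).2
  by_contra hne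
  obtain ⟨C, hC⟩ := hpos.exists_cover hσ hc hind hne
  exact hψ' (Finset.mem_filter.2 ⟨hF C ψ hC, hind⟩)

end

/-! ## The counting algorithm -/

/-- The main part of the algorithm, in which the host graph is a degenerate graph with tables. -/
def countFromTables : RamProgram :=
  patternTables ;; coverBound ;; mulTable ;; factTable ;; dictionary ;; enumerateMaps

/-- Count the strong embeddings of a pattern into a host graph. -/
def countPattern : RamProgram :=
  .cond (.get 0 1 - wv 0) .skip
    (.cond (.get 3 (.get 0 1) - .get 1 (wv 0)) .skip
      (computeDegeneracy ;; hostTables ;; eliminate 3 4 (.get 0 (.const 1)) ;;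
        .cond (.get 0 1 - wv rTail) .skip countFromTables))

/-- A bound for the cost of `coverBound`. -/
def coverCost (s k c : ℕ) : ℕ :=
  ((k + 1) * s + 2 ^ s) * 250 + k * 30 + 300 + (s + 2 ^ s) ^ ((k + 1) * s) *
    (((k + 1) * s + 2 ^ s) * (((k + 1) * s + 2 ^ s) * 150 + s * 40 + 300) + (s + 2 ^ s) * 120 + 150 +
      (c + 1) * (((k + 1) * s + 2 ^ s) ^ c * (s * (c * 40 + 60) + c * 60 + 60) + c * 30 + 60) +
      (k + 1) * s * 50 + 50) + (k + 1) * s * 20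

/-- A bound for the cost of `countFromTables`. -/
def tablesCost (m n s k c : ℕ) : ℕ :=
  ((m + 1) * (s + 1) * 1000 + 2 ^ s * (s + 1) * 150) + coverCost s k c + (s * (n * 40 + 80) + 30) +
    (n * 40 + 20) + (n * ((k + 1) ^ s * (s * 90 + 60) + s * 30 + 50) + 20) + enumerateCost s k c n

section

variable {m s k n : ℕ} {H : Pattern (Fin m)} {G : SimpleGraph (Fin n)}
  {A : AdjLists G} {pos : Fin n → ℕ}

/-- Locatability enters only to show that the search for cover numbers stops at some `c' ≤ c`. The
enumeration that follows relies on the computed `c'` alone. -/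
theorem runs_countFromTables {st : RamState} (B : AdjLists H.graph) (hT : HostTables A pos st)
    (hpos : RankDegenerate G pos k) (hk : st.word rK 0 = k) {c d : ℕ} (hkd : k ≤ d)
    (hH : H.Locatable c d) (hc1 : 1 ≤ c) (hn : 1 ≤ n)
    (hm : st.word 0 1 = m) (hoff : st.word 3 = loadArray B.offsets)
    (hent : st.word 4 = loadArray B.entries)
    (hS : ∀ v : Fin m, st.word 5 v = if v ∈ H.S then 1 else 0)
    (hz : ∀ a ∈ [rMask, rCap, rDict, rVis, rMark, rStamp], ∀ z, st.word a z = 0)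
    (hctr : st.ctr 0 0 = 0) :
    Runs countFromTables st (tablesCost m n H.S.card k c) (fun st' =>
      st'.ctr 0 0 = H.strongCount G) := by
  classical
  refine Runs.seq (runs_patternTables H B hm hoff hent hS fun a ha => hz a ?_)
    (fun s₁ hs₁ ⟨s, σ, hσ, hP₁⟩ => ?_) (B₂ := tablesCost m n H.S.card k c -
      ((m + 1) * (H.S.card + 1) * 1000 + 2 ^ H.S.card * (H.S.card + 1) * 150))
    (by unfold tablesCost; omega)
  · simp only [List.mem_cons, List.not_mem_nil, or_false] at ha ⊢
    tauto
  · have hs : H.S.card = s := hσ.card_eq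
    have hT₁ : HostTables A pos s₁ := hT.congr fun a ha => hs₁.word a (by
      simp only [List.mem_cons, List.not_mem_nil, or_false] at ha
      rcases ha with rfl | rfl | rfl | rfl | rfl | rfl <;> rfl)
    rw [hs]
    refine Runs.seq (Runs.le (runs_coverBound (c := c) (k := k) hP₁ (by rw [hs₁.word rK rfl]; exact hk)
      hc1 fun w hw => hw.coverable hσ hH hkd) (B := coverCost s k c) le_rfl)
      (fun s₂ hs₂ ⟨c', hc', hc'c, hC, hcov⟩ => ?_)
      (B₂ := (s * (n * 40 + 80) + 30) + (n * 40 + 20) +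
        (n * ((k + 1) ^ s * (s * 90 + 60) + s * 30 + 50) + 20) + enumerateCost s k c n)
      (by unfold tablesCost; omega)
    have hT₂ : HostTables A pos s₂ := hT₁.congr fun a ha => hs₂.word a (by
      simp only [List.mem_cons, List.not_mem_nil, or_false] at ha
      rcases ha with rfl | rfl | rfl | rfl | rfl | rfl <;> rfl)
    have hP₂ : PatternTables H σ s₂ := hP₁.congr fun a ha => hs₂.word a (by
      simp only [List.mem_cons, List.not_mem_nil, or_false] at ha
      rcases ha with rfl | rfl | rfl | rfl | rfl | rfl | rfl <;> rfl)
    refine Runs.seq (runs_mulTable hT₂.size hP₂.side) (fun s₃ hs₃ hmul => ?_)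
      (B₂ := (n * 40 + 20) +
        (n * ((k + 1) ^ s * (s * 90 + 60) + s * 30 + 50) + 20) + enumerateCost s k c n)
      (by omega)
    have hT₃ : HostTables A pos s₃ := hT₂.congr fun a ha => hs₃.word a (by
      simp only [List.mem_cons, List.not_mem_nil, or_false] at ha
      rcases ha with rfl | rfl | rfl | rfl | rfl | rfl <;> rfl)
    have hP₃ : PatternTables H σ s₃ := hP₂.congr fun a ha => hs₃.word a (by
      simp only [List.mem_cons, List.not_mem_nil, or_false] at ha
      rcases ha with rfl | rfl | rfl | rfl | rfl | rfl | rfl <;> rfl)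
    refine Runs.seq (runs_factTable hT₃.size) (fun s₄ hs₄ hfact => ?_)
      (B₂ := (n * ((k + 1) ^ s * (s * 90 + 60) + s * 30 + 50) + 20) + enumerateCost s k c n)
      (by omega)
    have hT₄ : HostTables A pos s₄ := hT₃.congr fun a ha => hs₄.word a (by
      simp only [List.mem_cons, List.not_mem_nil, or_false] at ha
      rcases ha with rfl | rfl | rfl | rfl | rfl | rfl <;> rfl)
    have hP₄ : PatternTables H σ s₄ := hP₃.congr fun a ha => hs₄.word a (by
      simp only [List.mem_cons, List.not_mem_nil, or_false] at ha
      rcases ha with rfl | rfl | rfl | rfl | rfl | rfl | rfl <;> rfl)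
    have hmul₄ : ∀ i < s, s₄.word rMulRow i = i * (n + 1) ∧
        ∀ y ≤ n, s₄.word rMul (i * (n + 1) + y) = y * (n + 1) ^ i := by
      rw [hs₄.word rMulRow rfl, hs₄.word rMul rfl]
      exact hmul
    refine Runs.seq (runs_dictionary A hT₄ hpos hP₄.side hmul₄ fun z => ?_)
      (fun s₅ hs₅ hdict => ?_) (B₂ := enumerateCost s k c n) (by omega)
    · rw [hs₄.word rDict rfl, hs₃.word rDict rfl, hs₂.word rDict rfl, hs₁.word rDict rfl]
      exact hz rDict (by simp) z
    · have hE : CountEnv A pos H σ s₅ := by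
        refine ⟨hT₄.congr fun a ha => hs₅.word a (by
            simp only [List.mem_cons, List.not_mem_nil, or_false] at ha
            rcases ha with rfl | rfl | rfl | rfl | rfl | rfl <;> rfl),
          hP₄.congr fun a ha => hs₅.word a (by
            simp only [List.mem_cons, List.not_mem_nil, or_false] at ha
            rcases ha with rfl | rfl | rfl | rfl | rfl | rfl | rfl <;> rfl), ?_, ?_, ?_, ?_⟩
        · rw [hs₅.word rMulRow rfl]
          exact fun i hi => (hmul₄ i hi).1
        · rw [hs₅.word rMul rfl]
          exact fun i hi => (hmul₄ i hi).2
        · rw [hs₅.ctr 1 rfl]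
          exact hfact
        · intro y hy
          rw [hdict y hy, Nat.card_eq_fintype_card, Fintype.card_subtype]
      -- The program runs with `c'`, the bound is stated with `c`; monotonicity of `n ^ c` needs `1
      -- ≤ n`.
      have hcost : enumerateCost s k c' n ≤ enumerateCost s k c n := by
        unfold enumerateCost
        have h1 : n ^ c' ≤ n ^ c := Nat.pow_le_pow_right hn hc'c
        gcongr
      refine (runs_enumerateMaps hE hpos (c := c') ?_ hc' hn ?_ ?_).mono hcost
        fun s₆ _ ⟨F, hF, hF'⟩ => hF.strongCount hσ hpos hcov hF'
      · rw [hs₅.word rC rfl, hs₄.word rC rfl, hs₃.word rC rfl, hC]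
      · intro a ha z
        simp only [List.mem_cons, List.not_mem_nil, or_false] at ha
        rcases ha with rfl | rfl | rfl
        · rw [hs₅.word _ rfl, hs₄.word _ rfl, hs₃.word _ rfl, hs₂.word _ rfl, hs₁.word _ rfl]
          exact hz rVis (by simp) z
        · rw [hs₅.word _ rfl, hs₄.word _ rfl, hs₃.word _ rfl, hs₂.word _ rfl, hs₁.word _ rfl]
          exact hz rMark (by simp) z
        · rw [hs₅.word _ rfl, hs₄.word _ rfl, hs₃.word _ rfl, hs₂.word _ rfl, hs₁.word _ rfl]
          exact hz rStamp (by simp) z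
      · rw [hs₅.ctr 0 rfl, hs₄.ctr 0 rfl, hs₃.ctr 0 rfl, hs₂.ctr 0 rfl, hs₁.ctr 0 rfl]
        exact hctr

end

/-! ### Necessary conditions for an embedding, and the whole algorithm. -/

section

variable {m n k : ℕ} {H : Pattern (Fin m)} {G : SimpleGraph (Fin n)} {φ : Fin m ↪ Fin n}

theorem Pattern.IsStrongEmbedding.adj (hφ : H.IsStrongEmbedding G φ) {u v : Fin m}
    (h : H.graph.Adj u v) : G.Adj (φ u) (φ v) := by
  by_cases hu : u ∈ H.S
  · exact (hφ u hu v).1 h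
  by_cases hv : v ∈ H.S
  · exact ((hφ v hv u).1 h.symm).symm
  exact absurd h (Pattern.not_adj_of_not_mem_S hu hv)

theorem Pattern.IsStrongEmbedding.isDegenerate (hφ : H.IsStrongEmbedding G φ) {pos : Fin n → ℕ}
    (hpos : RankDegenerate G pos k) : IsDegenerate H.graph k := by
  classical
  have h : RankDegenerate H.graph (fun v => pos (φ v)) k := by
    refine ⟨hpos.injective.comp φ.injective, fun v => le_trans ?_ (hpos.card_le (φ v))⟩
    rw [← Finset.card_map φ]
    refine Finset.card_le_card fun w hw => ?_
    simp only [Finset.mem_map, Finset.mem_filter, Finset.mem_univ, true_and] at hw ⊢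
    obtain ⟨u, hu, rfl⟩ := hw
    exact ⟨hφ.adj hu.1, hu.2⟩
  obtain ⟨o, -, ho⟩ := h.isDegenerate
  exact ⟨o, ho⟩

theorem Pattern.IsStrongEmbedding.start_le (hφ : H.IsStrongEmbedding G φ) (A : AdjLists G)
    (B : AdjLists H.graph) : B.start m ≤ A.start n := by
  classical
  rw [A.start_last, B.start_last]
  calc ∑ u, (B.nbrs u).length ≤ ∑ u, (A.nbrs (φ u)).length := by
        refine Finset.sum_le_sum fun u _ => ?_
        rw [A.length_nbrs, B.length_nbrs, ← Finset.card_map φ]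
        refine Finset.card_le_card fun w hw => ?_
        simp only [Finset.mem_map, Finset.mem_filter, Finset.mem_univ, true_and] at hw ⊢
        obtain ⟨v, hv, rfl⟩ := hw
        exact hφ.adj hv
    _ = ∑ v ∈ Finset.univ.map φ, (A.nbrs v).length := by rw [Finset.sum_map]
    _ ≤ ∑ u, (A.nbrs u).length :=
        Finset.sum_le_sum_of_subset (Finset.subset_univ _)

theorem Pattern.strongCount_eq_zero (h : ∀ φ : Fin m ↪ Fin n, ¬ H.IsStrongEmbedding G φ) :
    H.strongCount G = 0 := by
  have : IsEmpty {φ : Fin m ↪ Fin n // H.IsStrongEmbedding G φ} := ⟨fun φ => h φ.1 φ.2⟩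
  exact Nat.card_of_isEmpty

/-- A bound for the cost of `countPattern`. -/
def patternCost (s k c d n : ℕ) : ℕ :=
  (d + 1) * (n * 150 + 2 * (d * n) * 80 + 80) + (n * 80 + 2 * (d * n) * 80) +
    (n * 150 + 2 * (d * n) * 80) + tablesCost n n s k c + 200

/-- The initial tests precede all expensive work. If H has more vertices or more list entries than
G, or is not `k`-degenerate, then the count is 0 and the counter is left untouched. The first two
tests bound the cost of reading H in terms of G. The third bounds `s`: a pattern without any
`d`-degenerate ordering would be locatable for trivial reasons, with an arbitrarily large small
side. -/
theorem runs_countPattern (A : AdjLists G) (B : AdjLists H.graph) {c d : ℕ} (hc : 1 ≤ c)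
    (hG : IsDegenerate G d) (hH : H.Locatable c d) :
    ∃ t, Runs countPattern (inputState A H B) t (fun st' => st'.ctr 0 0 = H.strongCount G) ∧
      (t ≤ 100 ∨ 1 ≤ n ∧ ∃ s k, k ≤ d ∧ s ≤ c * (k + 1) ∧ t = patternCost s k c d n) := by
  have hm1 : 1 ≤ m := by
    obtain ⟨v⟩ := H.connected.nonempty
    exact v.pos
  have hn : (inputState A H B).word 0 0 = n := rfl
  have hm : (inputState A H B).word 0 1 = m := rfl
  have hG' : (inputState A H B).word 1 n = A.start n := A.loadArray_offsets le_rfl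
  have hH' : (inputState A H B).word 3 m = B.start m := B.loadArray_offsets le_rfl
  have hskip : ∀ (st : RamState), st.ctr 0 0 = 0 → (∀ φ : Fin m ↪ Fin n, ¬ H.IsStrongEmbedding G φ) →
      ∀ t, 1 ≤ t → Runs .skip st t (fun st' => st'.ctr 0 0 = H.strongCount G) := by
    intro st h0 h t ht
    refine Runs.straight rfl ht ?_
    rw [H.strongCount_eq_zero h]
    simpa using h0
  by_cases hmn : m ≤ n
  swap
  · refine ⟨20, Runs.le (Runs.cond (B₁ := 1) (fun _ => hskip _ rfl (fun φ _ => hmn ?_) 1 le_rfl)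
      (fun h => ?_)) (by simp), .inl (by norm_num)⟩
    · simpa using Fintype.card_le_of_embedding φ
    · simp [hn, hm] at h
      omega
  by_cases hAB : B.start m ≤ A.start n
  swap
  · refine ⟨30, Runs.le (Runs.cond (B₁ := 20) (fun h => ?_) fun _ => Runs.cond (B₁ := 1)
      (fun _ => hskip _ rfl (fun φ hφ => hAB (hφ.start_le A B)) 1 le_rfl)
      (fun h => ?_) (by simp)) (by simp), .inl (by norm_num)⟩
    · simp [hn, hm] at h
      omega
    · simp [hn, hm, hG', hH'] at h
      omega
  have hsum := hG.sum_degree_le A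
  have hS : ∀ v : Fin m, (inputState A H B).word 5 v = if v ∈ H.S then 1 else 0 := by
    intro v
    simp [inputState, loadArray, List.getD_eq_getElem?_getD]
  obtain ⟨s, k, hkd, hsk, hrun⟩ : ∃ s k, k ≤ d ∧ s ≤ c * (k + 1) ∧ Runs (computeDegeneracy ;;
      hostTables ;; eliminate 3 4 (.get 0 (.const 1)) ;;
      .cond (.get 0 1 - wv rTail) .skip countFromTables) (inputState A H B)
      (patternCost s k c d n - 100) (fun st' => st'.ctr 0 0 = H.strongCount G) := by
    obtain ⟨t₁, s₁, he₁, ht₁, k, hkd, hk, hpos⟩ := runs_computeDegeneracy A hG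
      (s := inputState A H B) rfl rfl hn
    have hs₁ := he₁.sameOutside
    have hT := runs_hostTables (A := A) (s := s₁) (pos := fun v => s₁.word rPos v)
      (by rw [hs₁.word 0 rfl]; rfl) (by rw [hs₁.word 1 rfl]; rfl) (by rw [hs₁.word 2 rfl]; rfl)
      (fun _ => rfl) (fun a ha z => by
        simp only [List.mem_cons, List.not_mem_nil, or_false] at ha
        rcases ha with rfl | rfl | rfl | rfl <;> (rw [hs₁.word _ rfl]; rfl))
    obtain ⟨t₂, s₂, he₂, ht₂, hT⟩ := hT
    have hs₂ := he₂.sameOutside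
    have hw : ∀ a, computeDegeneracy.writesWord a = false → hostTables.writesWord a = false →
        s₂.word a = (inputState A H B).word a := fun a h h' => by rw [hs₂.word a h', hs₁.word a h]
    obtain ⟨t₃, s₃, he₃, ht₃, l, hl, hl₁, hl₂⟩ := runs_eliminate B (o := 3) (e := 4) (k := k)
      (N := .get 0 (.const 1)) (s := s₂) (by norm_num) (by norm_num) (by rw [hw 3 rfl rfl]; rfl)
      (by rw [hw 4 rfl rfl]; rfl)
      (fun s' h => by rw [WordExpr.eval, WordExpr.eval, h, hw 0 rfl rfl]; rfl) rfl
      (by rw [hs₂.word rK rfl]; exact hk)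
    have hs₃ := he₃.sameOutside
    have hw' : ∀ a, computeDegeneracy.writesWord a = false → hostTables.writesWord a = false →
        (eliminate 3 4 (.get 0 (.const 1))).writesWord a = false →
        s₃.word a = (inputState A H B).word a := fun a h h' h'' => by rw [hs₃.word a h'', hw a h h']
    have hctr : s₃.ctr 0 0 = 0 := by
      rw [hs₃.ctr 0 rfl, hs₂.ctr 0 rfl, hs₁.ctr 0 rfl]
      rfl
    have hm₃ : s₃.word 0 1 = m := by rw [hw' 0 rfl rfl rfl]; rfl
    have key : ∀ s, Runs (.cond (.get 0 1 - wv rTail) .skip countFromTables) s₃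
          (tablesCost n n s k c + 10) (fun st' => st'.ctr 0 0 = H.strongCount G) →
        Runs (computeDegeneracy ;; hostTables ;; eliminate 3 4 (.get 0 (.const 1)) ;;
          .cond (.get 0 1 - wv rTail) .skip countFromTables) (inputState A H B)
          (patternCost s k c d n - 100) (fun st' => st'.ctr 0 0 = H.strongCount G) := by
      rintro s ⟨t₄, s₄, he₄, ht₄, h₄⟩
      refine ⟨_, s₄, he₁.seq (he₂.seq (he₃.seq he₄)), ?_, h₄⟩
      have h1 : (d + 1) * (n * 150 + A.start n * 80 + 80) ≤
          (d + 1) * (n * 150 + 2 * (d * n) * 80 + 80) := by gcongr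
      unfold patternCost
      omega
    by_cases hlen : l.length = m
    · have hposH := hl.rankDegenerate hlen hl₁
      obtain ⟨o, -, ho⟩ := hposH.isDegenerate
      refine ⟨H.S.card, k, hkd, hH.card_le ho hkd, key _ (Runs.cond (B₁ := tablesCost n n H.S.card k c)
        (fun h => ?_) (fun _ => ?_) (by simp; omega))⟩
      · simp [hm₃, hl.tail, hlen] at h
      · refine (runs_countFromTables (A := A) B (pos := fun v => s₁.word rPos v) (hT.congr fun a ha =>
          hs₃.word a (by
            simp only [List.mem_cons, List.not_mem_nil, or_false] at ha
            rcases ha with rfl | rfl | rfl | rfl | rfl | rfl <;> rfl)) hpos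
          (by rw [hs₃.word rK rfl, hs₂.word rK rfl, hk]) hkd hH hc (by omega) hm₃
          (by rw [hw' 3 rfl rfl rfl]; rfl) (by rw [hw' 4 rfl rfl rfl]; rfl)
          (by rw [hw' 5 rfl rfl rfl]; exact hS) (fun a ha z => ?_) hctr).le ?_
        · simp only [List.mem_cons, List.not_mem_nil, or_false] at ha
          rcases ha with rfl | rfl | rfl | rfl | rfl | rfl <;> (rw [hw' _ rfl rfl rfl]; rfl)
        · unfold tablesCost
          gcongr
    -- The pattern is not `k`-degenerate and no table is computed for it, so any admissible `s`
    -- serves in the bound; 0 is taken.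
    · refine ⟨0, k, hkd, Nat.zero_le _, key _ (Runs.cond (B₁ := 1) (fun _ => ?_) (fun h => ?_)
        (by simp))⟩
      · exact hskip s₃ hctr (fun φ hφ => hlen ((hφ.isDegenerate hpos).length_eq hl.nodup hl₂)) 1 le_rfl
      · have : l.length ≤ m := by simpa using hl.nodup.length_le_card
        simp [hm₃, hl.tail] at h
        omega
  refine ⟨_, Runs.le (Runs.cond (fun h => ?_) fun _ => Runs.cond (fun h => ?_) fun _ => hrun) ?_,
    .inr ⟨by omega, s, k, hkd, hsk, rfl⟩⟩
  · simp [hn, hm] at h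
    omega
  · simp [hn, hm, hG', hH'] at h
    omega
  · simp [patternCost]
    omega

end

/-! ## The running time -/

/-- The quantity `W` is chosen so that the number of words satisfies `(s + 2 ^ s) ^ ((k + 1) * s) ≤
2 ^ (2 * q * ((d + 1) * q)) = W ^ 2`. The number of positions and the number of tuples of centres
are at most `W ^ 3` each, and `s`, `k`, `c` at most `W`, which makes the total a polynomial of
degree 8 in `W`. -/
theorem coverCost_le {s k c d q W : ℕ} (hk : k ≤ d) (hc : 1 ≤ c) (hq : q = c * (d + 1))
    (hs : s ≤ q) (hW : W = 2 ^ (q * q * (d + 1))) : coverCost s k c ≤ 20000 * W ^ 8 := by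
  have hdq : d + 1 ≤ q := by rw [hq]; exact Nat.le_mul_of_pos_left _ hc
  have hcq : c ≤ q := by rw [hq]; exact Nat.le_mul_of_pos_right _ (by omega)
  have hq1 : 1 ≤ q := by omega
  have hqq : q ≤ q * q := Nat.le_mul_of_pos_left _ hq1
  have hqR : q * q ≤ q * q * (d + 1) := Nat.le_mul_of_pos_right _ (by omega)
  have hW' : ∀ a b, a ≤ b * (q * q * (d + 1)) → 2 ^ a ≤ W ^ b := by
    intro a b h
    rw [hW, ← pow_mul, mul_comm _ b]
    exact Nat.pow_le_pow_right (by norm_num) h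
  have hW1 : 1 ≤ W := by rw [hW]; exact Nat.one_le_two_pow
  have hqW : q ≤ W := (Nat.lt_two_pow_self).le.trans (by simpa using hW' q 1 (by omega))
  have hkW : k ≤ W := by omega
  have hcW : c ≤ W := by omega
  have hsW : s ≤ W := by omega
  have hL : (k + 1) * s ≤ (d + 1) * q := by gcongr
  have hLq : (d + 1) * q ≤ q * q := by gcongr
  have hLW : (k + 1) * s ≤ W := by
    have : q * q ≤ W := (Nat.lt_two_pow_self).le.trans (by simpa using hW' (q * q) 1 (by omega))
    omega
  have hs2 : 2 ^ s ≤ 2 ^ q := Nat.pow_le_pow_right (by norm_num) hs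
  have hlt := (Nat.lt_two_pow_self (n := s)).le
  have hbase : s + 2 ^ s ≤ 2 ^ (2 * q) := by
    calc s + 2 ^ s ≤ 2 ^ (s + 1) := by rw [pow_succ]; omega
      _ ≤ _ := Nat.pow_le_pow_right (by norm_num) (by omega)
  have hbaseW : s + 2 ^ s ≤ W ^ 2 := hbase.trans (hW' _ _ (by omega))
  have hpow : (s + 2 ^ s) ^ ((k + 1) * s) ≤ W ^ 2 := by
    calc (s + 2 ^ s) ^ ((k + 1) * s) ≤ (2 ^ (2 * q)) ^ ((k + 1) * s) := Nat.pow_le_pow_left hbase _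
      _ ≤ (2 ^ (2 * q)) ^ ((d + 1) * q) := Nat.pow_le_pow_right (by positivity) hL
      _ = 2 ^ (2 * (q * q * (d + 1))) := by rw [← pow_mul]; ring_nf
      _ ≤ W ^ 2 := hW' _ _ le_rfl
  have hlen : (k + 1) * s + 2 ^ s ≤ 2 ^ (3 * q) := by
    have h1 : q * q ≤ 2 ^ q * 2 ^ q := Nat.mul_le_mul Nat.lt_two_pow_self.le Nat.lt_two_pow_self.le
    have h2 : 2 ^ q ≤ 2 ^ q * 2 ^ q := Nat.le_mul_of_pos_left _ (by positivity)
    have h3 : 2 ^ q * 2 ^ q * 2 ≤ 2 ^ q * 2 ^ q * 2 ^ q :=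
      Nat.mul_le_mul_left _ (Nat.le_self_pow (by omega) 2)
    have h4 : 2 ^ (3 * q) = 2 ^ q * 2 ^ q * 2 ^ q := by ring
    omega
  have hlenW : (k + 1) * s + 2 ^ s ≤ W ^ 3 := hlen.trans (hW' _ _ (by omega))
  have hlenc : ((k + 1) * s + 2 ^ s) ^ c ≤ W ^ 3 := by
    calc ((k + 1) * s + 2 ^ s) ^ c ≤ (2 ^ (3 * q)) ^ c := Nat.pow_le_pow_left hlen _
      _ = 2 ^ (3 * q * c) := by rw [← pow_mul]
      _ ≤ W ^ 3 := hW' _ _ (by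
        have : q * c ≤ q * q := Nat.mul_le_mul_left _ hcq
        rw [mul_assoc]
        omega)
  unfold coverCost
  calc _ ≤ W ^ 3 * 250 + W * 30 + 300 + W ^ 2 * (W ^ 3 * (W ^ 3 * 150 + W * 40 + 300) +
        W ^ 2 * 120 + 150 + (W + 1) * (W ^ 3 * (W * (W * 40 + 60) + W * 60 + 60) + W * 30 + 60) +
        W * 50 + 50) + W * 20 := by gcongr
    _ ≤ 20000 * W ^ 8 := by
        have h : ∀ i, i ≤ 8 → W ^ i ≤ W ^ 8 := fun i hi => Nat.pow_le_pow_right hW1 hi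
        have h0 := h 0 (by norm_num)
        have h1 := h 1 (by norm_num)
        have h2 := h 2 (by norm_num)
        have h3 := h 3 (by norm_num)
        have h4 := h 4 (by norm_num)
        have h5 := h 5 (by norm_num)
        have h6 := h 6 (by norm_num)
        have h7 := h 7 (by norm_num)
        ring_nf at *
        omega

/-- The factor `q ^ q` bounds both `(c * (k + 1)) ^ s` and `(k + 1) ^ s`, the factor `2 ^ q` is the
work on the subsets of the small side, and `q ^ 3` covers the polynomial factors per map. -/
theorem patternCost_le {s k c d n q : ℕ} (hk : k ≤ d) (hc : 1 ≤ c) (hd : 2 ≤ d) (hn : 1 ≤ n)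
    (hq : q = c * (d + 1)) (hs : s ≤ q) :
    patternCost s k c d n ≤ coverCost s k c + 50000 * (q ^ q * 2 ^ q * q ^ 3) * n ^ c := by
  have hdq : d + 1 ≤ q := by rw [hq]; exact Nat.le_mul_of_pos_left _ hc
  have hcq : c ≤ q := by rw [hq]; exact Nat.le_mul_of_pos_right _ (by omega)
  have hq1 : 1 ≤ q := by omega
  have hnc : n ≤ n ^ c := Nat.le_self_pow (by omega) n
  have hN1 : 1 ≤ n ^ c := Nat.one_le_pow _ _ hn
  have hck : c * (k + 1) ≤ q := by rw [hq]; gcongr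
  have hks : (k + 1) ^ s ≤ q ^ q :=
    (Nat.pow_le_pow_left (by omega) s).trans (Nat.pow_le_pow_right hq1 hs)
  have hcks : (c * (k + 1)) ^ s ≤ q ^ q :=
    (Nat.pow_le_pow_left hck s).trans (Nat.pow_le_pow_right hq1 hs)
  have hs2 : 2 ^ s ≤ 2 ^ q := Nat.pow_le_pow_right (by norm_num) hs
  have hE : 1 ≤ q ^ q := Nat.one_le_pow _ _ hq1
  have hP : 1 ≤ 2 ^ q := Nat.one_le_two_pow
  have hkq : k + 1 ≤ q := by omega
  have hdq' : d ≤ q := by omega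
  have hs1 : s + 1 ≤ 2 * q := by omega
  have hkq' : k ≤ q := by omega
  have hn1 : n + 1 ≤ 2 * n ^ c := by omega
  unfold patternCost tablesCost enumerateCost mapCost
  generalize coverCost s k c = Y
  generalize n ^ c = N at *
  generalize (c * (k + 1)) ^ s = E₁ at *
  generalize (k + 1) ^ s = E₂ at *
  generalize q ^ q = E at *
  generalize 2 ^ s = P₁ at *
  generalize 2 ^ q = P at *
  -- After expansion, every monomial is compared with the leading one, `E * P * q ^ 3 * N`, and the
  -- coefficients are added up.
  have hmon : ∀ x y i w, x ≤ E → y ≤ P → i ≤ 3 → w ≤ N → x * y * q ^ i * w ≤ E * P * q ^ 3 * N := by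
    intro x y i w hx hy hi hw
    have := Nat.pow_le_pow_right hq1 hi
    gcongr
  calc _ ≤ q * (N * 150 + 2 * (q * N) * 80 + 80) + (N * 80 + 2 * (q * N) * 80) +
        (N * 150 + 2 * (q * N) * 80) + (((2 * N) * (2 * q) * 1000 + P * (2 * q) * 150) + Y +
        (q * (N * 40 + 80) + 30) + (N * 40 + 20) + (N * (E * (q * 90 + 60) + q * 30 + 50) + 20) +
        (N * (q * (q * 40 + 110) + E * ((2 * q) * (P * 200 + q * (q * 100 + 150) + q * 100 + 500) +
          q * 44 + 17) + q * 17 + 70) + q * 17 + 17)) + 200 := by gcongr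
    _ ≤ _ := by
        have a1 := hmon 1 1 0 1 hE hP (by norm_num) hN1
        have a2 := hmon 1 1 1 1 hE hP (by norm_num) hN1
        have a3 := hmon 1 1 0 N hE hP (by norm_num) le_rfl
        have a4 := hmon 1 1 1 N hE hP (by norm_num) le_rfl
        have a5 := hmon 1 1 2 N hE hP (by norm_num) le_rfl
        have a6 := hmon 1 P 1 1 hE le_rfl (by norm_num) hN1
        have a7 := hmon E 1 0 N le_rfl hP (by norm_num) le_rfl
        have a8 := hmon E 1 1 N le_rfl hP (by norm_num) le_rfl
        have a9 := hmon E 1 2 N le_rfl hP (by norm_num) le_rfl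
        have a10 := hmon E 1 3 N le_rfl hP (by norm_num) le_rfl
        have a11 := hmon E P 1 N le_rfl le_rfl (by norm_num) le_rfl
        clear hmon
        ring_nf at *
        linarith

/-- The number of maps of the small side to the candidates, in terms of the desired bound. -/
theorem candidates_le {c d q : ℕ} (hc : 1 ≤ c) (hd : 2 ≤ d) (hq : q = c * (d + 1)) :
    q ^ q * 2 ^ q * q ^ 3 ≤ 32 * 54 ^ 54 * (c * d) ^ (2 * c * d + d) := by
  set x := c * d with hx
  have hxq : q = x + c := by rw [hq, hx]; ring
  have h2c : 2 * c ≤ x := by rw [hx, mul_comm]; exact Nat.mul_le_mul_left _ hd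
  -- With `e = x - c` one has `q = 2 * c + e` and `c ≤ e`, as `d ≥ 2`. The target exponent `2 * x +
  -- d` is at least `q + 2 + e`, so beyond `x ^ (q + 2)` a factor `x ^ e` is available to absorb `3
  -- ^ q ≤ 27 ^ e` and one factor `x`.
  obtain ⟨e, he⟩ : ∃ e, x = c + e := ⟨x - c, by omega⟩
  have hx1 : 1 ≤ x := by omega
  have h2q : 2 * q ≤ 3 * x := by omega
  have hq3 : q ^ 3 ≤ 4 * x ^ 3 := by
    have h1 : (2 * q) ^ 3 ≤ (3 * x) ^ 3 := Nat.pow_le_pow_left h2q 3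
    have h2 : (2 * q) ^ 3 = 8 * q ^ 3 := by ring
    have h3 : (3 * x) ^ 3 = 27 * x ^ 3 := by ring
    omega
  have h3e : 3 ^ q ≤ 27 ^ e := by
    calc 3 ^ q ≤ 3 ^ (3 * e) := Nat.pow_le_pow_right (by norm_num) (by omega)
      _ = 27 ^ e := by rw [pow_mul]; norm_num
  have hxe : x ≤ 2 * 2 ^ e := by
    have := (Nat.lt_two_pow_self (n := e)).le
    omega
  -- The number 54 is `27 * 2`, where the 2 stems from `x ≤ 2 * 2 ^ e`. For `x < 54` the exponent
  -- `e` is also below 54, and the constant suffices.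
  have h54 : 54 ^ e ≤ 54 ^ 54 * x ^ e := by
    rcases le_total 54 x with h | h
    · calc 54 ^ e ≤ x ^ e := Nat.pow_le_pow_left h e
        _ ≤ 54 ^ 54 * x ^ e := Nat.le_mul_of_pos_left _ (by positivity)
    · calc 54 ^ e ≤ 54 ^ 54 := Nat.pow_le_pow_right (by norm_num) (by omega)
        _ ≤ 54 ^ 54 * x ^ e := Nat.le_mul_of_pos_right _ (by positivity)
  have h27 : 27 ^ e * x ≤ 2 * (54 ^ 54 * x ^ e) := by
    calc 27 ^ e * x ≤ 27 ^ e * (2 * 2 ^ e) := Nat.mul_le_mul_left _ hxe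
      _ = 2 * 54 ^ e := by
        rw [show (54 : ℕ) = 27 * 2 from rfl, mul_pow]
        ring
      _ ≤ _ := Nat.mul_le_mul_left _ h54
  calc q ^ q * 2 ^ q * q ^ 3 = (2 * q) ^ q * q ^ 3 := by rw [mul_pow]; ring
    _ ≤ (3 * x) ^ q * (4 * x ^ 3) := Nat.mul_le_mul (Nat.pow_le_pow_left h2q q) hq3
    _ = 4 * 3 ^ q * x * x ^ (q + 2) := by rw [mul_pow]; ring
    _ ≤ 4 * 27 ^ e * x * x ^ (q + 2) := by gcongr
    _ = 4 * (27 ^ e * x) * x ^ (q + 2) := by ring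
    _ ≤ 4 * (2 * (54 ^ 54 * x ^ e)) * x ^ (q + 2) := by gcongr
    _ = 8 * 54 ^ 54 * x ^ (e + (q + 2)) := by rw [pow_add x e]; ring
    _ ≤ 32 * 54 ^ 54 * x ^ (2 * c * d + d) := by
        refine Nat.mul_le_mul (Nat.mul_le_mul_right _ (by norm_num))
          (Nat.pow_le_pow_right hx1 ?_)
        rw [mul_assoc, ← hx]
        omega

/-- The exponent is `c ^ 2 * (d + 1) ^ 3`. For `d ≥ 3` it is at most `c ^ d * (2 * d) ^ 3 ≤ 8 * (c *
d) ^ d`; for `d = 2` this reads `27 * c ^ 2 ≤ 32 * c ^ 2`. The factor 64 is `8 * 8`, and the base 2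
is replaced by `c * d ≥ 2`. -/
theorem two_pow_le {c d q : ℕ} (hc : 1 ≤ c) (hd : 2 ≤ d) (hq : q = c * (d + 1)) :
    (2 ^ (q * q * (d + 1))) ^ 8 ≤ (c * d) ^ (64 * (c * d) ^ d) := by
  have h : q * q * (d + 1) ≤ 8 * (c * d) ^ d := by
    rw [hq]
    rcases hd.eq_or_lt with rfl | h3
    · ring_nf
      omega
    · calc c * (d + 1) * (c * (d + 1)) * (d + 1) = c ^ 2 * (d + 1) ^ 3 := by ring
        _ ≤ c ^ d * (2 * d) ^ 3 := Nat.mul_le_mul (Nat.pow_le_pow_right hc hd)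
            (Nat.pow_le_pow_left (by omega) 3)
        _ = 8 * (c ^ d * d ^ 3) := by ring
        _ ≤ 8 * (c ^ d * d ^ d) := by
            gcongr
            · omega
            · omega
        _ = 8 * (c * d) ^ d := by rw [mul_pow]
  have hcd : 2 ≤ c * d := hd.trans (Nat.le_mul_of_pos_left _ hc)
  calc (2 ^ (q * q * (d + 1))) ^ 8 = 2 ^ (q * q * (d + 1) * 8) := (pow_mul _ _ _).symm
    _ ≤ 2 ^ (64 * (c * d) ^ d) := Nat.pow_le_pow_right (by norm_num) (by omega)
    _ ≤ _ := Nat.pow_le_pow_left hcd _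

theorem theorem3 :
    ∃ (P : RamProgram) (K A : ℕ),
      ∀ (c d : ℕ), 1 ≤ c → 2 ≤ d →
      ∀ (n : ℕ) (G : SimpleGraph (Fin n)) (LG : AdjLists G),
      ∀ (m : ℕ) (H : Pattern (Fin m)) (LH : AdjLists H.graph),
        IsDegenerate G d → H.Locatable c d →
        ∃ (t : ℕ) (s : RamState),
          Exec P (inputState LG H LH) t s ∧
          s.ctr 0 0 = (H.strongCount G : ℚ) ∧
          t ≤ K * ((c * d) ^ (A * (c * d) ^ d) + (c * d) ^ (2 * c * d + d) * n ^ c) := by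
  -- The factor 50000 comes from `patternCost_le`, the factor `32 * 54 ^ 54` from `candidates_le`,
  -- and the exponent 64 from `two_pow_le`; the product also dominates the 20000 of `coverCost_le`
  -- and the 100 steps of an early exit.
  refine ⟨countPattern, 50000 * (32 * 54 ^ 54), 64, ?_⟩
  intro c d hc hd n G LG m H LH hG hH
  obtain ⟨T, ⟨t, s', he, ht, hr⟩, hT⟩ := runs_countPattern LG LH hc hG hH
  refine ⟨t, s', he, hr, ht.trans ?_⟩
  have hcd : 1 ≤ c * d := Nat.mul_pos hc (by omega)
  rw [Nat.mul_add]
  rcases hT with hT | ⟨hn, s, k, hk, hs, rfl⟩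
  · have : 1 ≤ (c * d) ^ (64 * (c * d) ^ d) := Nat.one_le_pow _ _ hcd
    have h1 : 50000 * (32 * 54 ^ 54) * 1 ≤
      50000 * (32 * 54 ^ 54) * (c * d) ^ (64 * (c * d) ^ d) := Nat.mul_le_mul_left _ this
    omega
  · have hs' : s ≤ c * (d + 1) := hs.trans (by gcongr)
    refine (patternCost_le hk hc hd hn rfl hs').trans (Nat.add_le_add ?_ ?_)
    · calc coverCost s k c ≤ 20000 * (2 ^ (c * (d + 1) * (c * (d + 1)) * (d + 1))) ^ 8 :=
            coverCost_le hk hc rfl hs' rfl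
        _ ≤ 20000 * (c * d) ^ (64 * (c * d) ^ d) := Nat.mul_le_mul_left _ (two_pow_le hc hd rfl)
        _ ≤ _ := Nat.mul_le_mul_right _ (by norm_num)
    · calc _ ≤ 50000 * (32 * 54 ^ 54 * (c * d) ^ (2 * c * d + d)) * n ^ c :=
            Nat.mul_le_mul_right _ (Nat.mul_le_mul_left _ (candidates_le hc hd rfl))
        _ = _ := by ring
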